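/- Let $X$ be a bounded geometry $\mathrm{CAT}(0)$-cubical space: a connected, simply connected complex of unit Euclidean cubes glued along faces by isometries (each closed cube embedded, two cubes meeting in a common face or not at all), all of whose vertex links are flag complexes, with a uniform bound on the number of edges at a vertex. Let $G$ be a second countable, locally compact group acting continuously on $X$ by automorphisms of the cubical structure (continuity means that the stabilizers of vertices are open). Fix a base vertex $P$, and for each hyperplane $H$ put $w(H)=\operatorname{distance}(P,H)$, the distance in the path metric of $X$. For a cube $C$ let $\operatorname{Mid}(C)$ be the set of hyperplanes that cut through $C$. For $H\in\operatorname{Mid}(C)$ let $x_H\colon C\to[0,1]$ be the affine coordinate that is $0$ on the codimension-one face of $C$ disjoint from $H$ and on the same side of $H$ as $P$, and $1$ on the opposite face; put $\alpha_H=dx_H$ and $y_H=x_H-1$. Let $\operatorname{SAH}(C)$ be the set of hyperplanes $H$ that are disjoint from $C$, cut a cube $D_H$ that has $C$ as a codimension-one face, and separate $C$ from $P$. Let $\Omega^*(C)$ be the space of complex differential forms on $C$ that are smooth up to the boundary, $\Omega_0^*(C)$ the space of those that pull back to zero on every proper face of $C$, and $\Omega^*_{00}(C)$ the space of those with compact support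 in the interior of $C$. Let $\Omega^*(X)$, $\Omega_0^*(X)$, $\Omega_{00}^*(X)$ be the algebraic direct sums of these spaces over all cubes of all dimensions, and let $\Omega^*_{L^2}(X)$ be the Hilbert space direct sum of the spaces of $L^2$-forms on the cubes, graded by the parity of the form degree, on which $G$ acts unitarily by $g\mapsto(g^{-1})^*$. For $\beta\in\Omega^*(C)$ put \[ d_w\beta=d\beta+\sum_{H\in\operatorname{Mid}(C)}w(H)\,dx_H\wedge\beta,\qquad e_w\beta=\sum_{H\in\operatorname{SAH}(C)}w(H)\,e^{w(H)y_H}\,\alpha_H\wedge\pi_H^*\beta , \] where $\pi_H\colon D_H\to C$ is the orthogonal projection and the $H$-th summand of $e_w\beta$ is a form on $D_H$. Regard $d_w$ as an operator with domain $\Omega^*_0(X)$ and $e_w$ as an operator with domain $\Omega^*(X)$. Let $d_w^\diamond$ and $e_w^\diamond$ be the formal adjoints, with domain $\Omega^*(X)$: $\langle d_w\sigma,\tau\rangle=\langle\sigma,d_w^\diamond\tau\rangle$ for $\sigma\in\Omega^*_{00}(X)$, $\tau\in\Omega^*(X)$, and $\langle e_w\sigma,\tau\rangle=\langle\sigma,e_w^\diamond\tau\rangle$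 for $\sigma,\tau\in\Omega^*(X)$. Let \[ D_{\mathrm{dR}}=d_w+e_w+d_w^\diamond+e_w^\diamond \] on $\Omega^*_{L^2}(X)$, with domain $\Omega^*_0(X)$. Then $D_{\mathrm{dR}}$ is essentially self-adjoint, and (its closure, again written $D_{\mathrm{dR}}$) defines an unbounded cycle for $KK_G(\mathbb C,\mathbb C)$. That is: $\Omega^*_{L^2}(X)$ is a separable graded Hilbert space with a strongly continuous, grading-preserving unitary action of $G$; $D_{\mathrm{dR}}$ is odd and self-adjoint and has compact resolvent; and, for every $g\in G$, the action of $g$ preserves the domain of $D_{\mathrm{dR}}$ and $D_{\mathrm{dR}}-g(D_{\mathrm{dR}})$ extends to a bounded operator, which is a strongly continuous, locally bounded, bounded-operator-valued function of $g\in G$. -/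

import Mathlib

open scoped Pointwise ContDiff Topology

noncomputable section

/-! ## Cube complexes -/

/-- A face of the combinatorial cube `{0,1}ⁿ`: some coordinates are fixed, the others are free. -/
def IsCubeFace {n : ℕ} (F : Set (Fin n → Bool)) : Prop :=
  ∃ (S : Set (Fin n)) (a : Fin n → Bool), F = {b | ∀ i ∈ S, b i = a i}

/-- A labelling `ψ` of the vertices of a cube by `{0,1}ⁿ` that matches the cubes of the complex
contained in it with the faces of `{0,1}ⁿ`. -/
def IsCubeChart {V : Type*} (cubes : Set (Set V)) {n : ℕ} (ψ : (Fin n → Bool) → V) : Prop :=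
  Function.Injective ψ ∧
    ∀ A ⊆ Set.range ψ, A ∈ cubes ↔ ∃ F : Set (Fin n → Bool), IsCubeFace F ∧ ψ '' F = A

/-- A cubical complex with vertex set `V`: unit cubes glued by isometries of their faces, so that
each closed cube is embedded and two cubes are disjoint or meet in a common face.
A cube is recorded by its set of vertices. -/
structure CubeComplex (V : Type*) where
  cubes : Set (Set V)
  singleton_mem : ∀ v, {v} ∈ cubes
  exists_chart : ∀ C ∈ cubes, ∃ (n : ℕ) (ψ : (Fin n → Bool) → V),
    IsCubeChart cubes ψ ∧ Set.range ψ = C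
  inter_mem : ∀ C ∈ cubes, ∀ D ∈ cubes, (C ∩ D).Nonempty → C ∩ D ∈ cubes

namespace CubeComplex

variable {V : Type*} (K : CubeComplex V)

/-- The type of all cubes, of all dimensions. -/
abbrev Cube : Type _ := {C : Set V // C ∈ K.cubes}

/-- The 1-skeleton. -/
def graph : SimpleGraph V where
  Adj u v := u ≠ v ∧ {u, v} ∈ K.cubes
  symm := ⟨fun u v h => ⟨h.1.symm, by rw [Set.pair_comm]; exact h.2⟩⟩
  loopless := ⟨fun _ h => h.1 rfl⟩

/-- `a, b, c, d` are the vertices of a 2-cube, in cyclic order. -/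
def IsSquare (a b c d : V) : Prop :=
  K.graph.Adj a b ∧ K.graph.Adj b c ∧ K.graph.Adj c d ∧ K.graph.Adj d a ∧ a ≠ c ∧ b ≠ d ∧
    {a, b, c, d} ∈ K.cubes

/-- Combinatorial homotopy of edge paths with fixed end points: generated by inserting and deleting
backtracks and by pushing a path across a 2-cube. -/
inductive EdgeHomotopic : ∀ {u v : V}, K.graph.Walk u v → K.graph.Walk u v → Prop
  | refl {u v : V} (p : K.graph.Walk u v) : EdgeHomotopic p p
  | symm {u v : V} {p q : K.graph.Walk u v} : EdgeHomotopic p q → EdgeHomotopic q p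
  | trans {u v : V} {p q r : K.graph.Walk u v} :
      EdgeHomotopic p q → EdgeHomotopic q r → EdgeHomotopic p r
  | append {u v w : V} {p p' : K.graph.Walk u v} {q q' : K.graph.Walk v w} :
      EdgeHomotopic p p' → EdgeHomotopic q q' → EdgeHomotopic (p.append q) (p'.append q')
  | backtrack {u v : V} (h : K.graph.Adj u v) :
      EdgeHomotopic (.cons h (.cons h.symm .nil)) .nil
  | square {a b c d : V} (hab : K.graph.Adj a b) (hbc : K.graph.Adj b c)
      (had : K.graph.Adj a d) (hdc : K.graph.Adj d c) (hs : K.IsSquare a b c d) :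
      EdgeHomotopic (.cons hab (.cons hbc .nil)) (.cons had (.cons hdc .nil))

/-- A `CAT(0)` cubical space: a connected and simply connected cubical complex of nonpositive
curvature, that is, all of whose vertex links are flag complexes.  The vertices of the link of `v`
are the neighbours of `v`, and a finite set of neighbours of `v` spans a simplex
of the link when some cube contains it together with `v`. -/
structure IsCAT0 : Prop where
  connected : K.graph.Connected
  simplyConnected : ∀ (v : V) (p : K.graph.Walk v v), K.EdgeHomotopic p .nil
  flag : ∀ (v : V) (S : Set V), S.Finite → (∀ a ∈ S, K.graph.Adj v a) →
    (∀ a ∈ S, ∀ b ∈ S, ∃ C ∈ K.cubes, v ∈ C ∧ a ∈ C ∧ b ∈ C) →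
    ∃ C ∈ K.cubes, v ∈ C ∧ S ⊆ C

/-- There is a uniform bound on the number of edges that contain a given vertex. -/
def BoundedGeometry : Prop :=
  ∃ N : ℕ, ∀ v : V, (K.graph.neighborSet v).encard ≤ N

/-! ## Hyperplanes -/

/-- Two edges are opposite edges of a 2-cube. -/
def OppositeEdges (e e' : K.graph.edgeSet) : Prop :=
  ∃ a b c d : V, K.IsSquare a b c d ∧ e.1 = s(a, b) ∧ e'.1 = s(d, c)

/-- A hyperplane is a class of midplanes; it is recorded by the edges whose midpoints it contains,
which form a class for the equivalence relation generated by `OppositeEdges`. -/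
def Hyperplane : Type _ := Quot K.OppositeEdges

variable {K}

/-- `u` and `v` are the end points of an edge whose midpoint lies on `H`. -/
def Hyperplane.Crosses (H : K.Hyperplane) (u v : V) : Prop :=
  ∃ h : K.graph.Adj u v, Quot.mk K.OppositeEdges ⟨s(u, v), h⟩ = H

/-- The vertices `u` and `v` lie in distinct components of the complement of `H`: every edge path
from `u` to `v` crosses `H`. -/
def Hyperplane.Separates (H : K.Hyperplane) (u v : V) : Prop :=
  ¬ Relation.ReflTransGen (fun a b => K.graph.Adj a b ∧ ¬ H.Crosses a b) u v

variable (K)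

/-- The set of hyperplanes that cut through the cube with vertex set `C`. -/
def midSet (C : Set V) : Set K.Hyperplane := {H | ∃ u ∈ C, ∃ v ∈ C, H.Crosses u v}

variable {K}

theorem midSet_mono {C D : Set V} (h : C ⊆ D) : K.midSet C ⊆ K.midSet D := by
  rintro H ⟨u, hu, v, hv, hc⟩
  exact ⟨u, h hu, v, h hv, hc⟩

theorem Cube.finite (C : K.Cube) : C.1.Finite := by
  obtain ⟨n, ψ, -, h⟩ := K.exists_chart C.1 C.2
  exact h ▸ Set.finite_range ψ

theorem Cube.midSet_finite (C : K.Cube) : (K.midSet C.1).Finite := by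
  have h : K.midSet C.1 ⊆ ⋃ u ∈ C.1, ⋃ v ∈ C.1, {H : K.Hyperplane | H.Crosses u v} := by
    rintro H ⟨u, hu, v, hv, hc⟩
    simp only [Set.mem_iUnion]
    exact ⟨u, hu, v, hv, hc⟩
  refine Set.Finite.subset ?_ h
  refine C.finite.biUnion fun u _ => C.finite.biUnion fun v _ => Set.Subsingleton.finite ?_
  rintro H ⟨_, h1⟩ H' ⟨_, h2⟩
  exact h1.symm.trans h2

/-- `Mid(C)`, the hyperplanes that cut through the cube `C`. -/
abbrev Cube.Mid (C : K.Cube) : Type _ := {H : K.Hyperplane // H ∈ K.midSet C.1}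

instance (C : K.Cube) : Fintype C.Mid := C.midSet_finite.fintype

/-- `C` is a codimension-one face of `D` (a `q`-cube has `2 ^ q` vertices). -/
def Cube.IsFacet (C D : K.Cube) : Prop := C.1 ⊆ D.1 ∧ D.1.ncard = 2 * C.1.ncard

/-- `H` is adjacent to `C`. -/
def Hyperplane.Adjacent (H : K.Hyperplane) (C : K.Cube) : Prop :=
  H ∉ K.midSet C.1 ∧ ∃ D : K.Cube, C.IsFacet D ∧ H ∈ K.midSet D.1

/-- `SAH(C)`: the hyperplanes adjacent to `C` that separate `C` from the base vertex `P`. -/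
def Cube.SAH (P : V) (C : K.Cube) : Set K.Hyperplane :=
  {H | H.Adjacent C ∧ ∀ v ∈ C.1, H.Separates v P}

/-! ## The distance from the base vertex to a hyperplane -/

/-- The point with coordinates `x ∈ [0,1]ⁿ` of the cube with chart `ψ`, as a point of the geometric
realization.  The realization is modelled in `V → ℝ`: a point of a cube is written as the
convex combination of the vertices of the cube with the multilinear weights, which makes
the gluing along faces automatic. -/
def cubePoint {n : ℕ} (ψ : (Fin n → Bool) → V) (x : EuclideanSpace ℝ (Fin n)) : V → ℝ :=
  open Classical in
  ∑ b : Fin n → Bool, (∏ i, if b i then x i else 1 - x i) • Pi.single (ψ b) (1 : ℝ)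

variable (K)

/-- `p` and `q` lie in a common cube, at Euclidean distance `ℓ` in that cube. -/
def SegmentLength (p q : V → ℝ) (ℓ : ℝ) : Prop :=
  ∃ (n : ℕ) (ψ : (Fin n → Bool) → V) (x y : EuclideanSpace ℝ (Fin n)),
    Set.range ψ ∈ K.cubes ∧ IsCubeChart K.cubes ψ ∧
    (∀ i, x i ∈ Set.Icc (0 : ℝ) 1) ∧ (∀ i, y i ∈ Set.Icc (0 : ℝ) 1) ∧
    p = cubePoint ψ x ∧ q = cubePoint ψ y ∧ ℓ = dist x y

/-- There is a piecewise linear path of length `ℓ` from `p` to `q`. -/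
inductive PathLength : (V → ℝ) → (V → ℝ) → ℝ → Prop
  | nil (p : V → ℝ) : PathLength p p 0
  | cons {p q r : V → ℝ} {ℓ m : ℝ} :
      K.SegmentLength p q ℓ → PathLength q r m → PathLength p r (ℓ + m)

variable {K}

/-- The points of the geometric realization that lie on `H`: the union of its midplanes. -/
def Hyperplane.points (H : K.Hyperplane) : Set (V → ℝ) :=
  {p | ∃ (n : ℕ) (ψ : (Fin n → Bool) → V) (x : EuclideanSpace ℝ (Fin n)) (i : Fin n)
    (b : Fin n → Bool), Set.range ψ ∈ K.cubes ∧ IsCubeChart K.cubes ψ ∧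
    (∀ j, x j ∈ Set.Icc (0 : ℝ) 1) ∧
    H.Crosses (ψ b) (ψ (Function.update b i (!b i))) ∧ x i = 1 / 2 ∧ p = cubePoint ψ x}

/-- The distance from the vertex `P` to the hyperplane `H` in the path metric of the cubical space,
whose cubes are Euclidean unit cubes. -/
def distWeight (P : V) (H : K.Hyperplane) : ℝ :=
  open Classical in
  sInf {ℓ | ∃ q ∈ H.points, K.PathLength (Pi.single P 1) q ℓ}

/-! ## Differential forms

The cube `C` is identified with `[0,1] ^ Mid(C)` by the coordinates `x_H`, `H ∈ Mid(C)`, that are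
`0` on the side of `H` containing the base vertex and `1` on the other side.  So the
coordinate forms `α_H = dx_H` are the coordinate projections. -/

/-- The ambient coordinate space of the cube `C`. -/
abbrev Cube.E (C : K.Cube) : Type _ := C.Mid → ℝ

/-- The cube `C` in its coordinates. -/
def Cube.box (C : K.Cube) : Set C.E := Set.Icc 0 1

variable (K)

/-- Families of inhomogeneous complex differential forms, one for each cube; the component
of degree `p` is zero when `p` exceeds the dimension of the cube.  A smooth form on a closed
cube is given by a smooth form on the ambient coordinate space, of which only the restriction to the
cube matters. -/
abbrev Form : Type _ := ∀ (C : K.Cube) (p : ℕ), C.E → C.E [⋀^Fin p]→L[ℝ] ℂ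

/-- `Ω(X)`: the algebraic direct sum of the spaces of smooth forms on the cubes. -/
def Omega : Submodule ℂ K.Form where
  carrier := {σ | (∀ C p, ContDiff ℝ ∞ (σ C p)) ∧ {C | σ C ≠ 0}.Finite}
  add_mem' := by
    rintro σ τ ⟨h1, h2⟩ ⟨h3, h4⟩
    refine ⟨fun C p => (h1 C p).add (h3 C p), (h2.union h4).subset ?_⟩
    intro C hC
    by_contra h
    simp only [Set.mem_union, Set.mem_ofPred_eq, not_or, not_not] at h
    exact hC (by rw [Pi.add_apply, h.1, h.2, add_zero])
  zero_mem' := ⟨fun C p => contDiff_const, by simp⟩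
  smul_mem' := by
    rintro c σ ⟨h1, h2⟩
    refine ⟨fun C p => (h1 C p).const_smul c, h2.subset ?_⟩
    intro C hC h
    exact hC (by funext p x; ext v; simp [h])

/-- `Ω₀(X)`: the smooth forms that pull back to zero on each proper face of each cube (it is enough
to say this for the faces `x_H = 0` and `x_H = 1`). -/
def Omega0 : Submodule ℂ K.Form where
  carrier := {σ | σ ∈ K.Omega ∧ ∀ (C : K.Cube) (p : ℕ) (H : C.Mid), ∀ x ∈ C.box,
    (x H = 0 ∨ x H = 1) → ∀ v : Fin p → C.E, (∀ k, v k H = 0) → σ C p x v = 0}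
  add_mem' := by
    rintro σ τ ⟨h1, h2⟩ ⟨h3, h4⟩
    refine ⟨add_mem h1 h3, fun C p H x hx hH v hv => ?_⟩
    simp [h2 C p H x hx hH v hv, h4 C p H x hx hH v hv]
  zero_mem' := ⟨zero_mem _, by simp⟩
  smul_mem' := by
    rintro c σ ⟨h1, h2⟩
    refine ⟨Submodule.smul_mem _ c h1, fun C p H x hx hH v hv => ?_⟩
    simp [h2 C p H x hx hH v hv]

/-- `Ω₀₀(X)`: the smooth forms that are compactly supported in the interiors of the cubes. -/
def Omega00 : Submodule ℂ K.Form where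
  carrier := {σ | σ ∈ K.Omega ∧ ∀ (C : K.Cube) (p : ℕ), tsupport (σ C p) ⊆ interior C.box}
  add_mem' := by
    rintro σ τ ⟨h1, h2⟩ ⟨h3, h4⟩
    exact ⟨add_mem h1 h3, fun C p => (tsupport_add _ _).trans (Set.union_subset (h2 C p) (h4 C p))⟩
  zero_mem' := ⟨zero_mem _, by
    intro C p
    have : tsupport ((0 : K.Form) C p) = ∅ := tsupport_eq_empty_iff.2 rfl
    rw [this]; exact Set.empty_subset _⟩
  smul_mem' := by
    rintro c σ ⟨h1, h2⟩
    refine ⟨Submodule.smul_mem _ c h1, fun C p => Set.Subset.trans ?_ (h2 C p)⟩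
    exact closure_mono (Function.support_const_smul_subset c (σ C p))

/-! ## The Hilbert space of square-integrable forms -/

/-- An auxiliary total order on the hyperplanes, used to write forms as `∑_I f_I dx_I`
with increasing multi-indices `I`. -/
instance : LinearOrder K.Hyperplane :=
  open Classical in linearOrderOfSTO WellOrderingRel

/-- Pairs of a cube `C` and a multi-index `I ⊆ Mid(C)`. -/
abbrev FormIndex : Type _ := Σ C : K.Cube, Finset C.Mid

/-- Lebesgue measure on the cube `C`. -/
def Cube.measure {K : CubeComplex V} (C : K.Cube) : MeasureTheory.Measure C.E :=
  MeasureTheory.volume.restrict C.box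

/-- `Ω_{L²}(X)`: the Hilbert space direct sum over all the cubes of the spaces of `L²` forms, where
an `L²` form `∑_I f_I dx_I` on a cube is recorded by its coefficients `f_I`. -/
abbrev OmegaL2 : Type _ := lp (fun i : K.FormIndex => MeasureTheory.Lp ℂ 2 i.1.measure) 2

variable {K}

/-- The coefficient `f_I` of `dx_I` in `σ`, for `I = {H₁ < ⋯ < H_p}`: the value of `σ` on the
corresponding coordinate vectors. -/
def coeff (σ : K.Form) (i : K.FormIndex) (x : i.1.E) : ℂ :=
  σ i.1 i.2.card x fun k => Pi.single (i.2.orderEmbOfFin rfl k) 1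

/-- The form `σ` defines the element `ξ` of `Ω_{L²}(X)`. -/
def Represents (σ : K.Form) (ξ : K.OmegaL2) : Prop :=
  ∀ i : K.FormIndex, (ξ i : i.1.E → ℂ) =ᵐ[i.1.measure] coeff σ i

theorem Represents.add {σ τ : K.Form} {ξ η : K.OmegaL2} (h : Represents σ ξ)
    (h' : Represents τ η) : Represents (σ + τ) (ξ + η) := by
  intro i
  rw [lp.coeFn_add, Pi.add_apply]
  filter_upwards [MeasureTheory.Lp.coeFn_add (ξ i) (η i), h i, h' i] with x hx h1 h2
  rw [hx, Pi.add_apply, h1, h2]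
  rfl

theorem Represents.smul {σ : K.Form} {ξ : K.OmegaL2} (c : ℂ) (h : Represents σ ξ) :
    Represents (c • σ) (c • ξ) := by
  intro i
  rw [lp.coeFn_smul, Pi.smul_apply]
  filter_upwards [MeasureTheory.Lp.coeFn_smul c (ξ i), h i] with x hx h1
  rw [hx, Pi.smul_apply, h1]
  rfl

theorem represents_zero : Represents (0 : K.Form) 0 := by
  intro i
  rw [lp.coeFn_zero, Pi.zero_apply]
  filter_upwards [MeasureTheory.Lp.coeFn_zero ℂ 2 i.1.measure] with x hx
  rw [hx]
  rfl

/-- The subspace of `Ω_{L²}(X)` of the elements defined by the forms in `S`. -/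
def l2Subspace (S : Submodule ℂ K.Form) : Submodule ℂ K.OmegaL2 where
  carrier := {ξ | ∃ σ ∈ S, Represents σ ξ}
  add_mem' := by
    rintro ξ η ⟨σ, hσ, h⟩ ⟨τ, hτ, h'⟩
    exact ⟨σ + τ, add_mem hσ hτ, h.add h'⟩
  zero_mem' := ⟨0, zero_mem _, represents_zero⟩
  smul_mem' := by
    rintro c ξ ⟨σ, hσ, h⟩
    exact ⟨c • σ, S.smul_mem c hσ, h.smul c⟩

/-- The unbounded operator on `Ω_{L²}(X)` with domain `S` that is given by the linear operator `T`
on forms. -/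
def l2Operator (S : Submodule ℂ K.Form) (T : S →ₗ[ℂ] K.Form) : K.OmegaL2 →ₗ.[ℂ] K.OmegaL2 :=
  Submodule.toLinearPMap
    { carrier := {x | ∃ σ : S, Represents σ.1 x.1 ∧ Represents (T σ) x.2}
      add_mem' := by
        rintro x y ⟨σ, h1, h2⟩ ⟨τ, h3, h4⟩
        exact ⟨σ + τ, h1.add h3, by rw [map_add]; exact h2.add h4⟩
      zero_mem' := ⟨0, represents_zero, by rw [map_zero]; exact represents_zero⟩
      smul_mem' := by
        rintro c x ⟨σ, h1, h2⟩
        exact ⟨c • σ, h1.smul c, by rw [map_smul]; exact h2.smul c⟩ }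

/-! ## The differentials -/

/-- The coordinate one-form `α_H = dx_H` on the cube `C`. -/
def alpha {C : K.Cube} (H : C.Mid) : C.E →L[ℝ] ℝ := ContinuousLinearMap.proj H

/-- Exterior multiplication `β ↦ α ∧ β` by a one-form:
`(α ∧ β)(v₀, …, v_p) = ∑ᵢ (-1)ⁱ α(vᵢ) β(v₀, …, v̂ᵢ, …, v_p)`. -/
def wedge {F : Type*} [NormedAddCommGroup F] [NormedSpace ℝ F] {p : ℕ} (α : F →L[ℝ] ℝ)
    (β : F [⋀^Fin p]→L[ℝ] ℂ) : F [⋀^Fin (p + 1)]→L[ℝ] ℂ :=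
  ContinuousAlternatingMap.alternatizeUncurryFin (α.smulRight β)

/-- The Witten-type differential `d_w β = dβ + ∑_{H ∈ Mid(C)} w(H) dx_H ∧ β` on each cube. -/
def dForm (w : K.Hyperplane → ℝ) (σ : K.Form) : K.Form
  | _, 0, _ => 0
  | C, p + 1, x => extDeriv (σ C p) x + ∑ H : C.Mid, w H.1 • wedge (alpha H) (σ C p x)

/-- The orthogonal projection from a cube `D` onto its face `C`, in coordinates. -/
def faceProj {C D : K.Cube} (h : C.1 ⊆ D.1) : D.E →L[ℝ] C.E :=
  ContinuousLinearMap.pi fun H => ContinuousLinearMap.proj ⟨H.1, midSet_mono h H.2⟩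

instance (D : K.Cube) : Finite {C : K.Cube // C.1 ⊆ D.1} := by
  have : Finite {A : Set V | A ⊆ D.1} := D.finite.finite_subsets
  refine Finite.of_injective
    (fun C : {C : K.Cube // C.1 ⊆ D.1} => (⟨C.1.1, C.2⟩ : {A : Set V | A ⊆ D.1})) ?_
  intro C C' h
  have h' : C.1.1 = C'.1.1 := congrArg (fun A : {A : Set V | A ⊆ D.1} => A.1) h
  exact Subtype.ext (Subtype.ext h')

instance (D : K.Cube) : Fintype {C : K.Cube // C.1 ⊆ D.1} := Fintype.ofFinite _

open Classical in
/-- The operator `e_w`, which sends a form `β` on `C` to the sum over `H ∈ SAH(C)` of the forms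
`w(H) e^{w(H) y_H} α_H ∧ π^* β`, `y_H = x_H - 1`, on the cubes `D_H` that are cut by `H` and
contain `C` as a codimension-one face.  The component on `D` thus collects the contributions
of the faces `C` of `D`. -/
def eForm (P : V) (w : K.Hyperplane → ℝ) (σ : K.Form) : K.Form
  | _, 0, _ => 0
  | D, p + 1, x => ∑ C : {C : K.Cube // C.1 ⊆ D.1}, ∑ H : D.Mid,
      if C.1.IsFacet D ∧ H.1 ∈ C.1.SAH P then
        (w H.1 * Real.exp (w H.1 * (x H - 1))) •
          wedge (alpha H) ((σ C.1 p (faceProj C.2 x)).compContinuousLinearMap (faceProj C.2))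
      else 0

theorem wedge_add {F : Type*} [NormedAddCommGroup F] [NormedSpace ℝ F] {p : ℕ} (α : F →L[ℝ] ℝ)
    (β γ : F [⋀^Fin p]→L[ℝ] ℂ) : wedge α (β + γ) = wedge α β + wedge α γ := by
  ext v
  simp [wedge, ContinuousAlternatingMap.alternatizeUncurryFin_apply, Finset.sum_add_distrib]

theorem wedge_smul {F : Type*} [NormedAddCommGroup F] [NormedSpace ℝ F] {p : ℕ} (α : F →L[ℝ] ℝ)
    (c : ℂ) (β : F [⋀^Fin p]→L[ℝ] ℂ) : wedge α (c • β) = c • wedge α β := by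
  ext v
  simp only [wedge, ContinuousAlternatingMap.alternatizeUncurryFin_apply,
    ContinuousLinearMap.smulRight_apply, ContinuousAlternatingMap.smul_apply, Finset.smul_sum]
  refine Finset.sum_congr rfl fun i _ => ?_
  simp only [smul_comm c]

/-- `d_w` on a space `S` of smooth forms. -/
def dLin (S : Submodule ℂ K.Form) (hS : S ≤ K.Omega) (w : K.Hyperplane → ℝ) :
    S →ₗ[ℂ] K.Form where
  toFun σ := dForm w σ
  map_add' σ τ := by
    funext C p x
    cases p with
    | zero => simp [dForm]
    | succ p =>
      have h1 := ((hS σ.2).1 C p).differentiable (by simp) x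
      have h2 := ((hS τ.2).1 C p).differentiable (by simp) x
      have h3 := extDeriv_add h1 h2
      simp only [dForm, Submodule.coe_add, Pi.add_apply, wedge_add, smul_add,
        Finset.sum_add_distrib, h3]
      abel
  map_smul' c σ := by
    funext C p x
    cases p with
    | zero => ext v; simp [dForm]
    | succ p =>
      have h1 := ((hS σ.2).1 C p).differentiable (by simp) x
      have h3 : extDeriv (c • σ.1 C p) x = c • extDeriv (σ.1 C p) x := by
        ext v
        simp only [extDeriv, fderiv_const_smul h1,
          ContinuousAlternatingMap.alternatizeUncurryFin_apply, ContinuousAlternatingMap.smul_apply,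
          Finset.smul_sum, smul_comm c]
        rfl
      simp only [dForm, Submodule.coe_smul, Pi.smul_apply, wedge_smul, h3, smul_add,
        Finset.smul_sum, RingHom.id_apply, smul_comm c]

/-- `e_w` on a space `S` of forms. -/
def eLin (S : Submodule ℂ K.Form) (P : V) (w : K.Hyperplane → ℝ) : S →ₗ[ℂ] K.Form where
  toFun σ := eForm P w σ
  map_add' σ τ := by
    funext D p x
    cases p with
    | zero => simp [eForm]
    | succ p =>
      simp only [eForm, Submodule.coe_add, Pi.add_apply, ← Finset.sum_add_distrib]
      refine Finset.sum_congr rfl fun C _ => Finset.sum_congr rfl fun H _ => ?_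
      split_ifs with h
      · refine Eq.trans ?_ (smul_add _ _ _)
        rw [← wedge_add]; rfl
      · simp
  map_smul' c σ := by
    funext D p x
    cases p with
    | zero => ext v; simp [eForm]
    | succ p =>
      simp only [eForm, Submodule.coe_smul, Pi.smul_apply, Finset.smul_sum, RingHom.id_apply]
      refine Finset.sum_congr rfl fun C _ => Finset.sum_congr rfl fun H _ => ?_
      split_ifs with h
      · rw [smul_comm c, ← wedge_smul]; rfl
      · simp

/-! ## The de Rham operator -/

/-- The differential `d_w`, as an unbounded operator with domain `Ω₀(X)`. -/
def dOp (w : K.Hyperplane → ℝ) : K.OmegaL2 →ₗ.[ℂ] K.OmegaL2 :=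
  l2Operator K.Omega0 (dLin K.Omega0 (fun _ h => h.1) w)

/-- The formal adjoint of `d_w`, with domain `Ω(X)`: it is characterized by
`⟨d_w σ, τ⟩ = ⟨σ, d_w^⋄ τ⟩` for all `σ ∈ Ω₀₀(X)` and `τ ∈ Ω(X)`. -/
def dDiamondOp (w : K.Hyperplane → ℝ) : K.OmegaL2 →ₗ.[ℂ] K.OmegaL2 :=
  (LinearPMap.adjoint (l2Operator K.Omega00 (dLin K.Omega00 (fun _ h => h.1) w))).domRestrict
    (l2Subspace K.Omega)

/-- The operator `e_w`, with domain `Ω(X)`. -/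
def eOp (P : V) (w : K.Hyperplane → ℝ) : K.OmegaL2 →ₗ.[ℂ] K.OmegaL2 :=
  l2Operator K.Omega (eLin K.Omega P w)

/-- The formal adjoint of `e_w`, with domain `Ω(X)`. -/
def eDiamondOp (P : V) (w : K.Hyperplane → ℝ) : K.OmegaL2 →ₗ.[ℂ] K.OmegaL2 :=
  (LinearPMap.adjoint (eOp P w)).domRestrict (l2Subspace K.Omega)

/-- The de Rham operator `D_dR = d_w + e_w + d_w^⋄ + e_w^⋄`, defined on the intersection of the
domains of the four summands. -/
def deRhamOp (P : V) (w : K.Hyperplane → ℝ) : K.OmegaL2 →ₗ.[ℂ] K.OmegaL2 :=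
  dOp w + eOp P w + dDiamondOp w + eDiamondOp P w

/-! ## Group actions -/

/-- The group `G`, acting on the vertices, acts by automorphisms of the cubical complex. -/
class CubicalAction (K : CubeComplex V) (G : Type*) [Group G] [MulAction G V] : Prop where
  smul_mem : ∀ (g : G), ∀ C ∈ K.cubes, g • C ∈ K.cubes

section Action

variable {G : Type*} [Group G] [MulAction G V] [K.CubicalAction G]

theorem smul_adj (g : G) {u v : V} (h : K.graph.Adj u v) : K.graph.Adj (g • u) (g • v) := by
  refine ⟨fun e => h.1 (MulAction.injective g e), ?_⟩
  have := CubicalAction.smul_mem (K := K) g _ h.2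
  rwa [← Set.image_smul, Set.image_pair] at this

theorem smul_isSquare (g : G) {a b c d : V} (h : K.IsSquare a b c d) :
    K.IsSquare (g • a) (g • b) (g • c) (g • d) := by
  obtain ⟨h1, h2, h3, h4, h5, h6, h7⟩ := h
  refine ⟨smul_adj g h1, smul_adj g h2, smul_adj g h3, smul_adj g h4,
    fun e => h5 (MulAction.injective g e), fun e => h6 (MulAction.injective g e), ?_⟩
  have := CubicalAction.smul_mem (K := K) g _ h7
  simpa only [← Set.image_smul, Set.image_insert_eq, Set.image_singleton] using this

/-- The translate of an edge. -/
def smulEdge (g : G) (e : K.graph.edgeSet) : K.graph.edgeSet :=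
  ⟨e.1.map (g • ·), by
    obtain ⟨e, he⟩ := e
    induction e using Sym2.ind with
    | _ u v => exact smul_adj g he⟩

/-- The translate `gH` of a hyperplane. -/
def Hyperplane.translate (g : G) : K.Hyperplane → K.Hyperplane :=
  Quot.map (smulEdge g) (by
    rintro e e' ⟨a, b, c, d, hs, h1, h2⟩
    exact ⟨g • a, g • b, g • c, g • d, smul_isSquare g hs, by simp [smulEdge, h1],
      by simp [smulEdge, h2]⟩)

/-- The translate `gC` of a cube. -/
def Cube.translate (g : G) (C : K.Cube) : K.Cube := ⟨g • C.1, CubicalAction.smul_mem g C.1 C.2⟩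

theorem Cube.translate_mid (g : G) (C : K.Cube) (H : (C.translate g⁻¹).Mid) :
    H.1.translate g ∈ K.midSet C.1 := by
  obtain ⟨H, u, hu, v, hv, h, rfl⟩ := H
  refine ⟨g • u, Set.mem_inv_smul_set_iff.1 hu, g • v, Set.mem_inv_smul_set_iff.1 hv,
    smul_adj g h, rfl⟩

open Classical in
/-- The linear part of the isometry `g⁻¹ : C → g⁻¹C` in coordinates.  Since `x_H(g⁻¹z)` is the
coordinate of `z` for the hyperplane `gH` relative to the base vertex `gP`, it is `x_{gH}(z)`
if `P` and `gP` are on the same side of `gH`, and `1 - x_{gH}(z)` otherwise. -/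
def moveLin (P : V) (g : G) (C : K.Cube) : C.E →L[ℝ] (C.translate g⁻¹).E :=
  ContinuousLinearMap.pi fun H =>
    (if (H.1.translate g).Separates P (g • P) then (-1 : ℝ) else 1) •
      ContinuousLinearMap.proj ⟨H.1.translate g, C.translate_mid g H⟩

open Classical in
/-- The isometry `g⁻¹ : C → g⁻¹C` in coordinates. -/
def move (P : V) (g : G) (C : K.Cube) (x : C.E) : (C.translate g⁻¹).E := fun H =>
  (if (H.1.translate g).Separates P (g • P) then 1 else 0) + moveLin P g C x H

/-- The action of `g` on forms: the pullback along `g⁻¹`. -/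
def smulForm (P : V) (g : G) (σ : K.Form) : K.Form := fun C p x =>
  (σ (C.translate g⁻¹) p (move P g C x)).compContinuousLinearMap (moveLin P g C)

end Action

/-- The grading operator of `Ω_{L²}(X)`, equal to `(-1)^p` on the forms of degree `p`. -/
def IsDegreeGrading (γ : K.OmegaL2 →L[ℂ] K.OmegaL2) : Prop :=
  ∀ (ξ : K.OmegaL2) (i : K.FormIndex), γ ξ i = (-1 : ℂ) ^ i.2.card • ξ i

end CubeComplex

/-! ## Unbounded cycles -/

/-- The operator `D` is essentially self-adjoint. -/
def IsEssentiallySelfAdjoint {H : Type*} [NormedAddCommGroup H] [InnerProductSpace ℂ H]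
    [CompleteSpace H] (D : H →ₗ.[ℂ] H) : Prop :=
  Dense (D.domain : Set H) ∧ D.IsClosable ∧ IsSelfAdjoint D.closure

/-- The operator `D` has compact resolvent: for each non-real `z`, the operator `D - z` has an
everywhere defined two-sided inverse that is compact. -/
def HasCompactResolvent {H : Type*} [NormedAddCommGroup H] [InnerProductSpace ℂ H]
    (D : H →ₗ.[ℂ] H) : Prop :=
  ∀ z : ℂ, z.im ≠ 0 → ∃ R : H →L[ℂ] H, IsCompactOperator R ∧
    (∀ ξ : H, ∃ h : R ξ ∈ D.domain, D ⟨R ξ, h⟩ - z • R ξ = ξ) ∧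
    (∀ ξ : D.domain, R (D ξ - z • (ξ : H)) = ξ)

/-- `(H, D)` is an unbounded cycle for `KK_G(ℂ, ℂ)`, where `γ` is the grading operator of the graded
Hilbert space `H` and `u` is the representation of `G` on `H`. -/
structure IsUnboundedCycle {G : Type*} [Group G] [TopologicalSpace G] {H : Type*}
    [NormedAddCommGroup H] [InnerProductSpace ℂ H] [CompleteSpace H]
    (γ : H →L[ℂ] H) (u : G →* (H ≃ₗᵢ[ℂ] H)) (D : H →ₗ.[ℂ] H) : Prop where
  separable : TopologicalSpace.SeparableSpace H
  grading_selfAdjoint : IsSelfAdjoint γ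
  grading_sq : γ * γ = 1
  rep_even : ∀ (g : G) (ξ : H), u g (γ ξ) = γ (u g ξ)
  rep_continuous : ∀ ξ : H, Continuous fun g => u g ξ
  selfAdjoint : IsSelfAdjoint D
  odd : ∀ ξ : D.domain, ∃ h : γ ξ ∈ D.domain, D ⟨γ ξ, h⟩ = -γ (D ξ)
  compactResolvent : HasCompactResolvent D
  domain_invariant : ∀ (g : G), ∀ ξ ∈ D.domain, u g ξ ∈ D.domain
  bounded_difference : ∃ B : G → H →L[ℂ] H,
    (∀ (g : G) (ξ : D.domain), B g ξ =
      D ξ - u g (D ⟨u g⁻¹ ξ, domain_invariant g⁻¹ ξ ξ.2⟩)) ∧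
    (∀ ξ : H, Continuous fun g => B g ξ) ∧
    (∀ g₀ : G, ∃ U ∈ 𝓝 g₀, ∃ M : ℝ, ∀ g ∈ U, ‖B g‖ ≤ M)

end

noncomputable section

/-! ## Charts, squares and the 1-skeleton -/

/-! The operator can be diagonalized by hand. A cube is determined by its vertex v farthest from P
together with its hyperplanes, and these can be any finite set of hyperplanes cutting edges from v
towards P (`exists_cube_top_eq`, `Cube.ext_top`). The operators d_w and d_w^⋄ stay in a cube, while
e_w and e_w^⋄ add or remove one hyperplane without changing v. In a single coordinate, d/dx + w maps
the Dirichlet modes sin(mπx) to the functions `cosMode w m`, and the orthogonal complement of its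
image is spanned by e^{w(x-1)}, which is exactly the function that e_w inserts.

Fix v and mode numbers m(H) ≥ 0. The forms `modeVec` with these data are indexed by finite sets I of
hyperplanes, and D_dR sends the I-th form to a signed combination of those for I ∆ {H}, where H runs
over `downSet P v` (`mem_graph_modeVec`). The signs are those of a Koszul complex, so the mixed
terms of the square cancel and D_dR² is a scalar (`koszul_sq`): a sum over H in `downSet P v` of w²
+ m²π² if m(H) ≠ 0, and of w² ∫ e^{2w(x-1)} dx if m(H) = 0.

The modes span a dense subspace (`span_modeVec`). Only finitely many nonzero modes have eigenvalue
below a given bound (`finite_modes`), because the weights w(H) tend to infinity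
(`finite_distWeight_le`) and v is determined by `downSet P v` (`downSet_injective`). As D_dR is
symmetric by integration by parts (`isFormalAdjoint_deRhamOp`), the abstract criterion
`essentiallySelfAdjoint_of_sq` gives essential self-adjointness and compact resolvent.

The geometry is derived from the combinatorial definition of a CAT(0) cubical space. Edge paths are
considered up to pushing them across squares; the flag condition yields a diamond property for these
pushes (`SwapEq.diamond`), and simple connectivity then makes reduced paths between two vertices
unique up to pushes. So reduced paths are geodesics, the 1-skeleton is bipartite and satisfies the
quadrangle condition, and each hyperplane has exactly two sides (`separates_iff_dist`).

For equivariance, conjugating by g replaces P by gP. The weights change by a bounded amount, and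
orientations or faces change only at the finitely many hyperplanes separating P from gP, so the
commutators of g with d_w and e_w are bounded (`exists_dForm_commutator`,
`exists_eForm_commutator`). Elements fixing P commute with D_dR, so D_dR - g(D_dR) depends only on
the coset of g modulo an open subgroup and is locally constant. -/

/-- The vertex of `{0,1}ⁿ` that differs from `b` exactly in the coordinate `i`. -/
def flipAt {n : ℕ} (i : Fin n) (b : Fin n → Bool) : Fin n → Bool := Function.update b i (!b i)

theorem flipAt_same {n : ℕ} (i : Fin n) (b : Fin n → Bool) : flipAt i b i = !b i := by
  simp [flipAt]

theorem flipAt_of_ne {n : ℕ} {i j : Fin n} (h : j ≠ i) (b : Fin n → Bool) :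
    flipAt i b j = b j := by
  simp [flipAt, h]

theorem flipAt_ne {n : ℕ} (i : Fin n) (b : Fin n → Bool) : flipAt i b ≠ b := by
  intro h
  have := congrFun h i
  rw [flipAt_same] at this
  cases hb : b i <;> simp [hb] at this

theorem flipAt_flipAt {n : ℕ} (i : Fin n) (b : Fin n → Bool) : flipAt i (flipAt i b) = b := by
  funext j
  by_cases h : j = i
  · subst h; simp [flipAt_same]
  · simp [flipAt_of_ne h]

theorem flipAt_comm {n : ℕ} (i j : Fin n) (b : Fin n → Bool) :
    flipAt i (flipAt j b) = flipAt j (flipAt i b) := by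
  by_cases hij : i = j
  · rw [hij]
  funext k
  by_cases h : k = i
  · subst h; rw [flipAt_same, flipAt_of_ne hij, flipAt_of_ne hij, flipAt_same]
  · by_cases h' : k = j
    · subst h'; rw [flipAt_of_ne h, flipAt_same, flipAt_same, flipAt_of_ne h]
    · simp [flipAt_of_ne h, flipAt_of_ne h']

theorem flipAt_injective {n : ℕ} {i j : Fin n} {b : Fin n → Bool} (h : flipAt i b = flipAt j b) :
    i = j := by
  by_contra hij
  have := congrFun h i
  rw [flipAt_same, flipAt_of_ne hij] at this
  cases hb : b i <;> simp [hb] at this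

/-- Induction on `{0,1}ⁿ` along edges. -/
theorem flipAt_induction {n : ℕ} {p : (Fin n → Bool) → Prop} (b₀ : Fin n → Bool) (h₀ : p b₀)
    (h : ∀ b i, p b → p (flipAt i b)) (b : Fin n → Bool) : p b := by
  classical
  suffices H : ∀ s : Finset (Fin n), ∀ b, (∀ i ∉ s, b i = b₀ i) → p b from
    H Finset.univ b (by simp)
  intro s
  induction s using Finset.induction_on with
  | empty => intro b hb; rwa [show b = b₀ from funext fun i => hb i (by simp)]
  | insert i s _ ih =>
    intro b hb
    by_cases hi : b i = b₀ i
    · refine ih b fun j hj => ?_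
      by_cases hji : j = i
      · rw [hji, hi]
      · exact hb j (by simp [hji, hj])
    · rw [← flipAt_flipAt i b]
      refine h _ _ (ih _ fun j hj => ?_)
      by_cases hji : j = i
      · subst hji
        rw [flipAt_same]
        cases h1 : b j <;> cases h2 : b₀ j <;> simp_all
      · rw [flipAt_of_ne hji]
        exact hb j (by simp [hji, hj])

namespace CubeComplex

variable {V : Type*} {K : CubeComplex V}

/-- An edge is a cube inside the chart, hence the image of a face. A coordinate in which the two
vertices differ must be free in this face, and flipping it gives a point of a set with only two
elements. -/
theorem _root_.IsCubeChart.adj_iff {n : ℕ} {ψ : (Fin n → Bool) → V} (hψ : IsCubeChart K.cubes ψ)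
    {b b' : Fin n → Bool} : K.graph.Adj (ψ b) (ψ b') ↔ ∃ i, b' = flipAt i b := by
  have hsub : ({ψ b, ψ b'} : Set V) ⊆ Set.range ψ := by
    rintro x (rfl | rfl)
    exacts [⟨_, rfl⟩, ⟨_, rfl⟩]
  constructor
  · rintro ⟨hne, hc⟩
    obtain ⟨F, ⟨S, a, rfl⟩, hF⟩ := (hψ.2 _ hsub).1 hc
    have hF' : {c | ∀ i ∈ S, c i = a i} = ({b, b'} : Set (Fin n → Bool)) :=
      hψ.1.image_injective (by rw [hF, Set.image_pair])
    have hbb : b ≠ b' := fun h => hne (by rw [h])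
    obtain ⟨i, hi⟩ := Function.ne_iff.1 hbb
    have hb : b ∈ {c | ∀ i ∈ S, c i = a i} := by rw [hF']; simp
    have hb' : b' ∈ {c | ∀ i ∈ S, c i = a i} := by rw [hF']; simp
    have hiS : i ∉ S := fun h => hi ((hb i h).trans (hb' i h).symm)
    have : flipAt i b ∈ {c | ∀ i ∈ S, c i = a i} := by
      intro j hj
      rw [flipAt_of_ne (fun h : j = i => hiS (h ▸ hj))]
      exact hb j hj
    rw [hF'] at this
    rcases this with h | h
    · exact absurd h (flipAt_ne i b)
    · exact ⟨i, h.symm⟩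
  · rintro ⟨i, rfl⟩
    refine ⟨fun h => flipAt_ne i b (hψ.1 h).symm, (hψ.2 _ hsub).2 ?_⟩
    refine ⟨{c | ∀ j ∈ ({i}ᶜ : Set (Fin n)), c j = b j}, ⟨_, _, rfl⟩, ?_⟩
    rw [← Set.image_pair]
    congr 1
    ext c
    simp only [Set.mem_compl_iff, Set.mem_singleton_iff, Set.mem_ofPred_eq, Set.mem_insert_iff]
    constructor
    · intro h
      by_cases hc : c i = b i
      · left; funext j; by_cases hj : j = i
        · rw [hj, hc]
        · exact h j hj
      · right; funext j; by_cases hj : j = i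
        · subst hj; rw [flipAt_same]; cases h1 : c j <;> cases h2 : b j <;> simp_all
        · rw [flipAt_of_ne hj, h j hj]
    · rintro (rfl | rfl) j hj
      · rfl
      · rw [flipAt_of_ne hj]

/-- The four vertices form the face in which exactly the coordinates i and j are free; a point of
that face is identified by its values at i and j. -/
theorem _root_.IsCubeChart.isSquare {n : ℕ} {ψ : (Fin n → Bool) → V} (hψ : IsCubeChart K.cubes ψ)
    (b : Fin n → Bool) {i j : Fin n} (hij : i ≠ j) :
    K.IsSquare (ψ b) (ψ (flipAt i b)) (ψ (flipAt j (flipAt i b))) (ψ (flipAt j b)) := by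
  refine ⟨hψ.adj_iff.2 ⟨i, rfl⟩, hψ.adj_iff.2 ⟨j, rfl⟩,
    hψ.adj_iff.2 ⟨i, by rw [flipAt_comm j i, flipAt_flipAt]⟩,
    hψ.adj_iff.2 ⟨j, by rw [flipAt_flipAt]⟩, ?_, ?_, ?_⟩
  · intro h
    have := congrFun (hψ.1 h) j
    rw [flipAt_same, flipAt_of_ne hij.symm] at this
    cases hb : b j <;> simp [hb] at this
  · intro h
    exact hij (flipAt_injective (hψ.1 h))
  · refine (hψ.2 _ ?_).2 ⟨{c | ∀ k ∈ ({i, j}ᶜ : Set (Fin n)), c k = b k}, ⟨_, _, rfl⟩, ?_⟩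
    · rintro x (rfl | rfl | rfl | rfl) <;> exact ⟨_, rfl⟩
    · have : ({ψ b, ψ (flipAt i b), ψ (flipAt j (flipAt i b)), ψ (flipAt j b)} : Set V) =
          ψ '' {b, flipAt i b, flipAt j (flipAt i b), flipAt j b} := by
        simp [Set.image_insert_eq]
      rw [this]
      congr 1
      ext c
      simp only [Set.mem_compl_iff, Set.mem_singleton_iff, Set.mem_ofPred_eq, Set.mem_insert_iff,
        not_or]
      constructor
      · intro h
        have key : ∀ d : Fin n → Bool, (∀ k, k ≠ i → k ≠ j → d k = b k) → d i = c i → d j = c j →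
            c = d := by
          intro d hd hi hj
          funext k
          by_cases h1 : k = i
          · rw [h1, hi]
          by_cases h2 : k = j
          · rw [h2, hj]
          rw [hd k h1 h2, h k ⟨h1, h2⟩]
        have e1 : ∀ k, k ≠ i → k ≠ j → flipAt i b k = b k := fun k h1 _ => flipAt_of_ne h1 _
        have e2 : ∀ k, k ≠ i → k ≠ j → flipAt j b k = b k := fun k _ h1 => flipAt_of_ne h1 _
        have e3 : ∀ k, k ≠ i → k ≠ j → flipAt j (flipAt i b) k = b k := fun k h1 h2 => by
          rw [flipAt_of_ne h2, flipAt_of_ne h1]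
        by_cases hi : c i = b i <;> by_cases hj : c j = b j
        · exact Or.inl (key b (fun _ _ _ => rfl) hi.symm hj.symm)
        · refine Or.inr (Or.inr (Or.inr (key _ e2 ?_ ?_)))
          · rw [flipAt_of_ne hij, hi]
          · rw [flipAt_same]; cases h1 : c j <;> cases h2 : b j <;> simp_all
        · refine Or.inr (Or.inl (key _ e1 ?_ ?_))
          · rw [flipAt_same]; cases h1 : c i <;> cases h2 : b i <;> simp_all
          · rw [flipAt_of_ne hij.symm, hj]
        · refine Or.inr (Or.inr (Or.inl (key _ e3 ?_ ?_)))
          · rw [flipAt_of_ne hij, flipAt_same]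
            cases h1 : c i <;> cases h2 : b i <;> simp_all
          · rw [flipAt_same, flipAt_of_ne hij.symm]
            cases h1 : c j <;> cases h2 : b j <;> simp_all
      · rintro (rfl | rfl | rfl | rfl) k ⟨h1, h2⟩ <;> simp [flipAt_of_ne h1, flipAt_of_ne h2]

theorem _root_.IsCubeChart.ncard_range {n : ℕ} {ψ : (Fin n → Bool) → V} (hψ : IsCubeChart K.cubes ψ) :
    (Set.range ψ).ncard = 2 ^ n := by
  rw [← Set.image_univ, Set.ncard_image_of_injective _ hψ.1, Set.ncard_univ]
  simp

theorem IsSquare.swap {a b c d : V} (h : K.IsSquare a b c d) : K.IsSquare a d c b := by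
  obtain ⟨h1, h2, h3, h4, h5, h6, h7⟩ := h
  refine ⟨h4.symm, h3.symm, h2.symm, h1.symm, h5, h6.symm, ?_⟩
  convert h7 using 1
  ext x; simp only [Set.mem_insert_iff, Set.mem_singleton_iff]; tauto

theorem IsSquare.rotate {a b c d : V} (h : K.IsSquare a b c d) : K.IsSquare b c d a := by
  obtain ⟨h1, h2, h3, h4, h5, h6, h7⟩ := h
  refine ⟨h2, h3, h4, h1, h6, h5.symm, ?_⟩
  convert h7 using 1
  ext x; simp only [Set.mem_insert_iff, Set.mem_singleton_iff]; tauto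

/-- A 2-cube is determined by three of its vertices. -/
theorem IsSquare.unique {v a d d' b : V} (h : K.IsSquare v a d b) (h' : K.IsSquare v a d' b) :
    d = d' := by
  obtain ⟨h1, h2, h3, h4, h5, h6, h7⟩ := h
  -- The intersection is itself a cube and so has 2 ^ n vertices. It contains the three common
  -- vertices and has at most four, which forces n = 2 and makes the two squares equal.
  have hI := K.inter_mem _ h7 _ h'.2.2.2.2.2.2 ⟨v, by simp, by simp⟩
  obtain ⟨n, ψ, hψ, hr⟩ := K.exists_chart _ hI
  have hc := hψ.ncard_range
  rw [hr] at hc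
  have h3' : ({v, a, b} : Set V) ⊆ {v, a, d, b} ∩ {v, a, d', b} := by
    rintro x (rfl | rfl | rfl) <;> simp
  have hva := h1.ne
  have hvb := h4.ne'
  have e3 : ({v, a, b} : Set V).ncard = 3 := Set.ncard_eq_three.2 ⟨v, a, b, hva, hvb, h6, rfl⟩
  have hfin : ({v, a, d, b} : Set V).Finite := by simp
  have le3 := Set.ncard_le_ncard h3' (hfin.subset Set.inter_subset_left)
  have e4 : ({v, a, d, b} : Set V).ncard ≤ 4 := by
    refine (Set.ncard_insert_le _ _).trans ?_
    refine Nat.succ_le_succ ((Set.ncard_insert_le _ _).trans ?_)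
    exact Nat.succ_le_succ ((Set.ncard_insert_le _ _).trans (by simp))
  have le4 := Set.ncard_le_ncard (Set.inter_subset_left (s := {v, a, d, b}) (t := {v, a, d', b}))
    hfin
  rw [hc] at le3 le4
  have hn : n = 2 := by
    rcases n with _ | _ | _ | n
    · omega
    · omega
    · rfl
    · have : 2 ^ (n + 3) = 8 * 2 ^ n := by ring
      have := Nat.one_le_two_pow (n := n)
      omega
  subst hn
  have heq : ({v, a, d, b} ∩ {v, a, d', b} : Set V) = {v, a, d, b} :=
    Set.eq_of_subset_of_ncard_le Set.inter_subset_left (by rw [hc]; exact e4) hfin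
  have hd : d ∈ ({v, a, d', b} : Set V) := (heq ▸ (by simp : d ∈ ({v, a, d, b} : Set V))).2
  rcases hd with rfl | rfl | rfl | rfl
  · exact absurd rfl h5
  · exact absurd rfl h2.ne
  · rfl
  · exact absurd rfl h3.ne

/-- Three pairwise adjacent squares at `b` are completed to a 3-cube. -/
theorem IsCAT0.exists_cube_corner (hK : K.IsCAT0) {v a b c d₁ d₂ e : V}
    (h₁ : K.IsSquare v a d₁ b) (h₂ : K.IsSquare v b d₂ c) (h₃ : K.IsSquare b d₁ e d₂) :
    a ≠ c ∧ ∃ y, K.IsSquare a d₁ e y ∧ K.IsSquare c d₂ e y ∧ K.IsSquare v a y c := by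
  have hS : ∀ x ∈ ({v, d₁, d₂} : Set V), K.graph.Adj b x := by
    rintro x (rfl | rfl | rfl)
    exacts [h₁.2.2.2.1, h₁.2.2.1.symm, h₂.2.1]
  -- The neighbours v, d₁, d₂ of b lie pairwise in squares through b, so flagness puts them in one
  -- cube with b. Uniqueness of squares then places a, c and e in a chart of this cube, and y is the
  -- vertex opposite to b in the 3-cube spanned by the three directions.
  obtain ⟨C, hC, hbC, hSC⟩ := hK.flag b {v, d₁, d₂} (by simp) hS (by
    have k₁ := h₁.2.2.2.2.2.2
    have k₂ := h₂.2.2.2.2.2.2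
    have k₃ := h₃.2.2.2.2.2.2
    have kv := h₁.2.2.2.1.symm.2
    rintro x (rfl | rfl | rfl) y (rfl | rfl | rfl)
    all_goals first
      | (refine ⟨_, k₁, ?_, ?_, ?_⟩ <;> simp <;> done)
      | (refine ⟨_, k₂, ?_, ?_, ?_⟩ <;> simp <;> done)
      | (refine ⟨_, k₃, ?_, ?_, ?_⟩ <;> simp))
  obtain ⟨n, ψ, hψ, rfl⟩ := K.exists_chart C hC
  obtain ⟨β, rfl⟩ := hbC
  obtain ⟨β₁, rfl⟩ := hSC (show v ∈ _ by simp)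
  obtain ⟨β₂, rfl⟩ := hSC (show d₁ ∈ _ by simp)
  obtain ⟨β₃, rfl⟩ := hSC (show d₂ ∈ _ by simp)
  obtain ⟨i, rfl⟩ := hψ.adj_iff.1 (hS (ψ β₁) (by simp))
  obtain ⟨j, rfl⟩ := hψ.adj_iff.1 (hS (ψ β₂) (by simp))
  obtain ⟨k, rfl⟩ := hψ.adj_iff.1 (hS (ψ β₃) (by simp))
  have hij : i ≠ j := fun h => h₁.2.2.2.2.1 (by rw [h])
  have hik : i ≠ k := fun h => h₂.2.2.2.2.1 (by rw [h])
  have hjk : j ≠ k := fun h => h₃.2.2.2.2.2.1 (by rw [h])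
  have ea : a = ψ (flipAt j (flipAt i β)) :=
    h₁.rotate.rotate.rotate.unique (hψ.isSquare β hij)
  have ec : c = ψ (flipAt k (flipAt i β)) :=
    h₂.rotate.swap.unique (hψ.isSquare β hik)
  have ee : e = ψ (flipAt k (flipAt j β)) := h₃.unique (hψ.isSquare β hjk)
  subst ea ec ee
  refine ⟨fun h => hjk (flipAt_injective (hψ.1 h)), ψ (flipAt k (flipAt j (flipAt i β))), ?_, ?_, ?_⟩
  · have := hψ.isSquare (flipAt j (flipAt i β)) hik
    rwa [flipAt_comm j i, flipAt_flipAt, flipAt_comm i j] at this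
  · have := hψ.isSquare (flipAt k (flipAt i β)) hij
    rwa [flipAt_comm k i, flipAt_flipAt, flipAt_comm j k, flipAt_comm i k,
      flipAt_comm j k (flipAt i β)] at this
  · exact hψ.isSquare (flipAt i β) hjk

end CubeComplex
end

noncomputable section
namespace CubeComplex
variable {V : Type*} {K : CubeComplex V}

/-! ## Edge paths up to pushing across squares

Edge paths that end at the base vertex are recorded as lists of vertices. -/

variable (K) in
/-- One push of an edge path across a 2-cube. -/
inductive Swap : List V → List V → Prop
  | square {v a d b : V} (h : K.IsSquare v a d b) (l : List V) : Swap (v :: a :: d :: l) (v :: b :: d :: l)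
  | cons (x : V) {l l' : List V} : Swap l l' → Swap (x :: l) (x :: l')

variable (K) in
/-- Equality of edge paths up to pushing across 2-cubes. -/
def SwapEq : List V → List V → Prop := Relation.ReflTransGen K.Swap

theorem Swap.symm {l l' : List V} (h : K.Swap l l') : K.Swap l' l := by
  induction h with
  | square h l => exact .square h.swap l
  | cons x _ ih => exact .cons x ih

theorem Swap.length_eq {l l' : List V} (h : K.Swap l l') : l.length = l'.length := by
  induction h with
  | square h l => rfl
  | cons x _ ih => simp [ih]

theorem Swap.head_eq {v v' : V} {l l' : List V} (h : K.Swap (v :: l) (v' :: l')) : v = v' := by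
  cases h <;> rfl

theorem SwapEq.refl (l : List V) : K.SwapEq l l := Relation.ReflTransGen.refl

theorem SwapEq.trans {l l' l'' : List V} (h : K.SwapEq l l') (h' : K.SwapEq l' l'') :
    K.SwapEq l l'' := Relation.ReflTransGen.trans h h'

theorem SwapEq.symm {l l' : List V} (h : K.SwapEq l l') : K.SwapEq l' l := by
  induction h with
  | refl => exact .refl _
  | tail _ h ih => exact Relation.ReflTransGen.head h.symm ih

theorem SwapEq.cons (x : V) {l l' : List V} (h : K.SwapEq l l') :
    K.SwapEq (x :: l) (x :: l') := by
  induction h with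
  | refl => exact .refl _
  | tail _ h ih => exact ih.tail (.cons x h)

theorem SwapEq.square {v a d b : V} (h : K.IsSquare v a d b) (l : List V) :
    K.SwapEq (v :: a :: d :: l) (v :: b :: d :: l) := Relation.ReflTransGen.single (.square h l)

theorem SwapEq.length_eq {l l' : List V} (h : K.SwapEq l l') : l.length = l'.length := by
  induction h with
  | refl => rfl
  | tail _ h ih => rw [ih, h.length_eq]

theorem SwapEq.head?_eq {l l' : List V} (h : K.SwapEq l l') : l.head? = l'.head? := by
  induction h with
  | refl => rfl
  | tail _ h ih => rw [ih]; cases h <;> rfl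

theorem SwapEq.head_eq {v v' : V} {l l' : List V} (h : K.SwapEq (v :: l) (v' :: l')) :
    v = v' := by simpa using h.head?_eq

/-- Two equivalent edge paths start with the same edge, or their first edges
span a square across which both can be pushed. -/
theorem SwapEq.diamond (hK : K.IsCAT0) {v a b : V} {p q : List V}
    (h : K.SwapEq (v :: a :: p) (v :: b :: q)) :
    (a = b ∧ K.SwapEq (a :: p) (b :: q)) ∨
      (a ≠ b ∧ ∃ d r, K.IsSquare v a d b ∧ K.SwapEq (a :: p) (a :: d :: r) ∧
        K.SwapEq (b :: q) (b :: d :: r)) := by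
  obtain ⟨n, hn⟩ : ∃ n, p.length = n := ⟨_, rfl⟩
  -- Strong induction on the length of the path, and inside it an induction on the number of pushes.
  induction n using Nat.strong_induction_on generalizing v a b p q with
  | _ n IH =>
  obtain ⟨l', hl'⟩ : ∃ l', l' = v :: b :: q := ⟨_, rfl⟩
  rw [← hl'] at h
  induction h generalizing b q with
  | refl =>
    obtain ⟨rfl, rfl⟩ : a = b ∧ p = q := by simpa using hl'
    exact Or.inl ⟨rfl, .refl _⟩
  | @tail m _ h1 h2 ih =>
    subst hl'
    obtain ⟨b', q', rfl⟩ : ∃ b' q', m = v :: b' :: q' := by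
      have e := h2.length_eq
      rcases m with _ | ⟨v', _ | ⟨b', q'⟩⟩
      · simp at e
      · simp at e
      · exact ⟨b', q', by rw [h2.head_eq]⟩
    have hlen : (b' :: q').length = (a :: p).length := by
      have := SwapEq.length_eq h1
      simpa using this.symm
    -- The last push either moves the first edge across a square at v, or leaves the first edge
    -- alone and acts on the tail.
    have step : (b' = b ∧ K.SwapEq (b' :: q') (b :: q)) ∨
        ∃ d r, K.IsSquare v b' d b ∧ K.SwapEq (b' :: q') (b' :: d :: r) ∧
          K.SwapEq (b :: q) (b :: d :: r) := by
      cases h2 with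
      | square hs l => exact Or.inr ⟨_, _, hs, .refl _, .refl _⟩
      | cons _ h => exact Or.inl ⟨h.head_eq, Relation.ReflTransGen.single h⟩
    rcases ih rfl with ⟨rfl, h3⟩ | ⟨hab, d₁, r, hs₁, h3, h4⟩
    · rcases step with ⟨rfl, h5⟩ | ⟨d, r, hs, h5, h6⟩
      · exact Or.inl ⟨rfl, h3.trans h5⟩
      · exact Or.inr ⟨hs.2.2.2.2.2.1, d, r, hs, h3.trans h5, h6⟩
    · rcases step with ⟨rfl, h5⟩ | ⟨d₂, t, hs₂, h5, h6⟩
      · exact Or.inr ⟨hab, d₁, r, hs₁, h3, h5.symm.trans h4⟩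
      -- The squares on (a, b') and (b', b) give two equivalent paths from b' through d₁ and d₂,
      -- short enough for the induction hypothesis. If d₁ = d₂ the two squares share three vertices
      -- and a = b. Otherwise there is a third square at b', and the cube corner supplies the square
      -- on (a, b).
      · have hr : r.length < n := by
          have := h3.length_eq
          simp only [List.length_cons] at this
          omega
        rcases IH _ hr (h4.symm.trans h5) rfl with ⟨rfl, h7⟩ | ⟨_, e, m, hs₃, h7, h8⟩
        · have hac : a = b :=
            hs₁.rotate.rotate.rotate.unique hs₂.rotate.swap
          subst hac
          exact Or.inl ⟨rfl, h3.trans ((h7.cons _).trans h6.symm)⟩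
        · obtain ⟨hac, y, k₁, k₂, k₃⟩ := hK.exists_cube_corner hs₁ hs₂ hs₃
          exact Or.inr ⟨hac, y, e :: m, k₃, h3.trans ((h7.cons _).trans (.square k₁ m)),
            h6.trans ((h8.cons _).trans (.square k₂ m))⟩

theorem SwapEq.cancel (hK : K.IsCAT0) {v a : V} {p q : List V}
    (h : K.SwapEq (v :: a :: p) (v :: a :: q)) : K.SwapEq (a :: p) (a :: q) := by
  rcases h.diamond hK with ⟨_, h⟩ | ⟨h, _⟩
  exacts [h, absurd rfl h]

/-! ### Reduced edge paths and their development along walks -/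

variable (K) in
/-- Edge paths to `P` that cannot be shortened by deleting a backtrack, even after pushing them
across squares. -/
inductive Red (P : V) : List V → Prop
  | nil : Red P [P]
  | cons {v a : V} {l : List V} (h : K.graph.Adj v a) (hl : Red P (a :: l))
      (hn : ∀ r, ¬ K.SwapEq (a :: l) (a :: v :: r)) : Red P (v :: a :: l)

theorem Red.tail {P v a : V} {l : List V} (h : K.Red P (v :: a :: l)) : K.Red P (a :: l) := by
  cases h; assumption

theorem Red.adj {P v a : V} {l : List V} (h : K.Red P (v :: a :: l)) : K.graph.Adj v a := by
  cases h; assumption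

theorem Red.not_swapEq {P v a : V} {l : List V} (h : K.Red P (v :: a :: l)) (r : List V) :
    ¬ K.SwapEq (a :: l) (a :: v :: r) := by
  cases h; tauto

/-- The only real case is a push at the first edge. A backtrack appearing after it is turned, by
pushing back or by `SwapEq.diamond` and uniqueness of squares, into a backtrack of the original
path. -/
theorem Red.swap (hK : K.IsCAT0) {P : V} {l l' : List V} (h : K.Red P l) (hs : K.Swap l l') :
    K.Red P l' := by
  induction hs with
  | cons x hs ih =>
    rename_i m m'
    rcases m with _ | ⟨a, m⟩
    · cases hs
    rcases m' with _ | ⟨a', m'⟩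
    · cases hs
    obtain rfl := hs.head_eq
    refine .cons h.adj (ih h.tail) fun r hr => ?_
    exact h.not_swapEq r ((Relation.ReflTransGen.single hs).trans hr)
  | square hs l =>
    rename_i v a d b
    have hd := h.tail.tail
    refine .cons hs.2.2.2.1.symm (.cons hs.2.2.1.symm hd fun r hr => ?_) fun r hr => ?_
    · refine h.not_swapEq (b :: r) ?_
      exact (hr.cons a).trans (.square hs.rotate r)
    · rcases hr.diamond hK with ⟨rfl, _⟩ | ⟨_, x, m, hx, h1, h2⟩
      · exact hs.2.2.2.2.1 rfl
      · have : x = a := hx.unique hs.rotate.rotate.rotate.swap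
        subst this
        exact h.tail.not_swapEq m h1

theorem Red.swapEq (hK : K.IsCAT0) {P : V} {l l' : List V} (h : K.Red P l) (hs : K.SwapEq l l') :
    K.Red P l' := by
  induction hs with
  | refl => exact h
  | tail _ hs ih => exact ih.swap hK hs

open Classical in
variable (K) in
/-- Prolong the reduced edge path `l` by an edge to `x`, and reduce. -/
def prolong (x : V) (l : List V) : List V :=
  if h : ∃ v r, K.SwapEq l (v :: x :: r) then x :: h.choose_spec.choose else x :: l

/-- The tail chosen in `prolong` does not matter up to pushes: two choices start with the same edge,
which `SwapEq.cancel` removes. -/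
theorem prolong_of_swapEq (hK : K.IsCAT0) {x v : V} {l r : List V}
    (h : K.SwapEq l (v :: x :: r)) : K.SwapEq (K.prolong x l) (x :: r) := by
  have h' : ∃ v r, K.SwapEq l (v :: x :: r) := ⟨v, r, h⟩
  rw [prolong, dif_pos h']
  have h2 := h'.choose_spec.choose_spec
  have h3 := h2.symm.trans h
  have e := h3.head_eq
  revert h3
  generalize h'.choose_spec.choose = r'
  rw [e]
  exact fun h3 => h3.cancel hK

theorem prolong_of_not {x : V} {l : List V} (h : ∀ v r, ¬ K.SwapEq l (v :: x :: r)) :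
    K.prolong x l = x :: l := by
  rw [prolong, dif_neg]
  rintro ⟨v, r, hr⟩
  exact h v r hr

theorem prolong_congr (hK : K.IsCAT0) (x : V) {l l' : List V} (h : K.SwapEq l l') :
    K.SwapEq (K.prolong x l) (K.prolong x l') := by
  by_cases hx : ∃ v r, K.SwapEq l' (v :: x :: r)
  · obtain ⟨v, r, hr⟩ := hx
    exact (prolong_of_swapEq hK (h.trans hr)).trans (prolong_of_swapEq hK hr).symm
  · push Not at hx
    rw [prolong_of_not hx, prolong_of_not fun v r hr => hx v r (h.symm.trans hr)]
    exact h.cons x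

theorem Red.prolong (hK : K.IsCAT0) {P x v : V} {l : List V} (hl : K.Red P (v :: l))
    (hx : K.graph.Adj v x) : K.Red P (K.prolong x (v :: l)) := by
  by_cases h : ∃ v' r, K.SwapEq (v :: l) (v' :: x :: r)
  · obtain ⟨v', r, hr⟩ := h
    exact (hl.swapEq hK hr).tail.swapEq hK (prolong_of_swapEq hK hr).symm
  · push Not at h
    rw [prolong_of_not h]
    exact .cons hx.symm hl (h v)

theorem exists_prolong_eq (hK : K.IsCAT0) (x : V) (l : List V) :
    ∃ r, K.SwapEq (K.prolong x l) (x :: r) := by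
  by_cases h : ∃ v' r, K.SwapEq l (v' :: x :: r)
  · obtain ⟨v', r, hr⟩ := h
    exact ⟨_, prolong_of_swapEq hK hr⟩
  · push Not at h
    rw [prolong_of_not h]
    exact ⟨_, .refl _⟩

/-- Invariance of the development under backtracks. If the first prolongation shortens the path,
reducedness of the original prevents the second from shortening it again. -/
theorem prolong_prolong (hK : K.IsCAT0) {P x v : V} {l : List V} (hl : K.Red P (v :: l)) :
    K.SwapEq (K.prolong v (K.prolong x (v :: l))) (v :: l) := by
  by_cases h : ∃ v' r, K.SwapEq (v :: l) (v' :: x :: r)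
  · obtain ⟨v', r, hr⟩ := h
    obtain rfl := hr.head_eq
    have h1 := prolong_congr hK v (prolong_of_swapEq hK hr)
    refine h1.trans ?_
    rw [prolong_of_not]
    · exact hr.symm
    · intro v' s hs
      obtain rfl := hs.head_eq
      exact (hl.swapEq hK hr).not_swapEq s hs
  · push Not at h
    rw [prolong_of_not h]
    exact prolong_of_swapEq hK (.refl _)

/-- The mixed case of invariance under squares: going to b shortens the path and going to d does
not. Both routes end in the path from c through b. -/
theorem prolong_square_aux (hK : K.IsCAT0) {a b c d : V} {l : List V}
    (hs : K.IsSquare a b c d) (hb : ∃ r, K.SwapEq (a :: l) (a :: b :: r))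
    (hd : ∀ r, ¬ K.SwapEq (a :: l) (a :: d :: r)) :
    K.SwapEq (K.prolong c (K.prolong b (a :: l))) (K.prolong c (K.prolong d (a :: l))) := by
  obtain ⟨p, hp⟩ := hb
  have h1 : K.SwapEq (K.prolong c (K.prolong b (a :: l))) (c :: b :: p) := by
    refine (prolong_congr hK c (prolong_of_swapEq hK hp)).trans ?_
    rw [prolong_of_not]
    · exact .refl _
    · intro v s h
      obtain rfl := h.head_eq
      exact hd (c :: s) (hp.trans ((h.cons a).trans (.square hs s)))
  refine h1.trans (SwapEq.symm ?_)
  rw [prolong_of_not (x := d) (l := a :: l) (fun v r h => by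
    obtain rfl := h.head_eq
    exact hd r h)]
  refine prolong_of_swapEq hK (v := d) ?_
  exact (hp.cons d).trans (.square hs.rotate.rotate.rotate p)

/-- Invariance of the development under squares, by cases on which of the two edges at a shortens
the path. If both do, the diamond property makes the path pass through c after pushes. -/
theorem prolong_square (hK : K.IsCAT0) {a b c d : V} {l : List V}
    (hs : K.IsSquare a b c d) :
    K.SwapEq (K.prolong c (K.prolong b (a :: l))) (K.prolong c (K.prolong d (a :: l))) := by
  by_cases hb : ∃ r, K.SwapEq (a :: l) (a :: b :: r) <;>
    by_cases hd : ∃ r, K.SwapEq (a :: l) (a :: d :: r)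
  · obtain ⟨r, hr⟩ := hb
    obtain ⟨t, ht⟩ := hd
    rcases (hr.symm.trans ht).diamond hK with ⟨h, _⟩ | ⟨_, c', m, hs', h1, h2⟩
    · exact absurd h hs.2.2.2.2.2.1
    · obtain rfl := hs.unique hs'
      have e1 : K.SwapEq (K.prolong c (K.prolong b (a :: l))) (c :: m) :=
        (prolong_congr hK c (prolong_of_swapEq hK hr)).trans (prolong_of_swapEq hK h1)
      have e2 : K.SwapEq (K.prolong c (K.prolong d (a :: l))) (c :: m) :=
        (prolong_congr hK c (prolong_of_swapEq hK ht)).trans (prolong_of_swapEq hK h2)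
      exact e1.trans e2.symm
  · push Not at hd
    exact prolong_square_aux hK hs hb hd
  · push Not at hb
    exact (prolong_square_aux hK hs.swap hd hb).symm
  · push Not at hb hd
    -- If neither edge at a shortens the path, the second step does not shorten it either: the
    -- diamond property at b would let the path from a begin with the edge to d. So both routes
    -- lengthen the path twice and differ by one push.
    have key : ∀ {b d : V}, K.IsSquare a b c d → (∀ r, ¬ K.SwapEq (a :: l) (a :: b :: r)) →
        (∀ r, ¬ K.SwapEq (a :: l) (a :: d :: r)) →
        K.prolong c (K.prolong b (a :: l)) = c :: b :: a :: l := by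
      intro b d hs hb hd
      rw [prolong_of_not (x := b) (fun v r h => by
        obtain rfl := h.head_eq
        exact hb r h), prolong_of_not]
      intro v r h
      obtain rfl := h.head_eq
      rcases h.diamond hK with ⟨h, _⟩ | ⟨_, d', m, hs', h1, h2⟩
      · exact hs.2.2.2.2.1 h
      · have : d' = d := hs'.unique hs.rotate.swap
        subst this
        exact hd m h1
    rw [key hs hb hd, key hs.swap hd hb]
    exact .square hs.rotate.rotate.swap l

variable (K) in
/-- Prolong by all the edges of a walk. -/
def prolongWalk : ∀ {u v : V}, K.graph.Walk u v → List V → List V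
  | _, _, .nil, l => l
  | _, _, .cons (v := x) _ p, l => prolongWalk p (K.prolong x l)

theorem prolongWalk_congr (hK : K.IsCAT0) {u v : V} (p : K.graph.Walk u v) {l l' : List V}
    (h : K.SwapEq l l') : K.SwapEq (K.prolongWalk p l) (K.prolongWalk p l') := by
  induction p generalizing l l' with
  | nil => exact h
  | cons _ _ ih => exact ih (prolong_congr hK _ h)

theorem prolongWalk_append {u v w : V} (p : K.graph.Walk u v) (q : K.graph.Walk v w)
    (l : List V) : K.prolongWalk (p.append q) l = K.prolongWalk q (K.prolongWalk p l) := by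
  induction p generalizing l with
  | nil => rfl
  | cons _ _ ih => exact ih _ _

/-- The reduced edge paths to `P` that start at `v`. -/
def RedAt (K : CubeComplex V) (P v : V) (l : List V) : Prop := K.Red P l ∧ l.head? = some v

theorem RedAt.prolong (hK : K.IsCAT0) {P x v : V} {l : List V} (hl : K.RedAt P v l)
    (hx : K.graph.Adj v x) : K.RedAt P x (K.prolong x l) := by
  obtain ⟨hl, hv⟩ := hl
  rcases l with _ | ⟨w, l⟩
  · simp at hv
  obtain rfl : w = v := by simpa using hv
  refine ⟨hl.prolong hK hx, ?_⟩
  obtain ⟨r, hr⟩ := exists_prolong_eq hK x (w :: l)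
  rw [hr.head?_eq]; rfl

theorem RedAt.prolongWalk (hK : K.IsCAT0) {P u v : V} {l : List V} (hl : K.RedAt P u l)
    (p : K.graph.Walk u v) : K.RedAt P v (K.prolongWalk p l) := by
  induction p generalizing l with
  | nil => exact hl
  | cons h _ ih => exact ih (hl.prolong hK h)

/-- In effect, classes of reduced paths form a covering of the complex, and `prolongWalk` is path
lifting, which depends only on the homotopy class of the walk. -/
theorem prolongWalk_homotopic (hK : K.IsCAT0) {P u v : V} {p q : K.graph.Walk u v}
    (h : K.EdgeHomotopic p q) {l : List V} (hl : K.RedAt P u l) :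
    K.SwapEq (K.prolongWalk p l) (K.prolongWalk q l) := by
  induction h generalizing l with
  | refl => exact .refl _
  | symm _ ih => exact (ih hl).symm
  | trans _ _ ih ih' => exact (ih hl).trans (ih' hl)
  | append _ _ ih ih' =>
    rw [prolongWalk_append, prolongWalk_append]
    exact (ih' (hl.prolongWalk hK _)).trans (prolongWalk_congr hK _ (ih hl))
  | backtrack h =>
    obtain ⟨hl, hv⟩ := hl
    rcases l with _ | ⟨w, l⟩
    · simp at hv
    obtain rfl : w = _ := by simpa using hv
    exact prolong_prolong hK hl
  | square _ _ _ _ hs =>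
    obtain ⟨hl, hv⟩ := hl
    rcases l with _ | ⟨w, l⟩
    · simp at hv
    obtain rfl : w = _ := by simpa using hv
    exact prolong_square hK hs

/-- The walk p q⁻¹ q is homotopic to p because q⁻¹ q is a loop, and to q because p q⁻¹ is one. -/
theorem IsCAT0.edgeHomotopic (hK : K.IsCAT0) {u v : V} (p q : K.graph.Walk u v) :
    K.EdgeHomotopic p q := by
  have h1 : K.EdgeHomotopic (p.append (q.reverse.append q)) (p.append .nil) :=
    .append (.refl _) (hK.simplyConnected _ _)
  have h2 : K.EdgeHomotopic ((p.append q.reverse).append q) (.append .nil q) :=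
    .append (hK.simplyConnected _ _) (.refl _)
  rw [SimpleGraph.Walk.append_nil] at h1
  rw [SimpleGraph.Walk.nil_append, ← SimpleGraph.Walk.append_assoc] at h2
  exact h1.symm.trans h2

theorem redAt_nil (P : V) : K.RedAt P P [P] := ⟨.nil, rfl⟩

/-- A reduced path is the development of the trivial path along itself, read from P outwards;
reducedness says that no step of this development cancels. -/
theorem Red.exists_walk (hK : K.IsCAT0) {P v : V} {l : List V} (hl : K.Red P (v :: l)) :
    ∃ p : K.graph.Walk P v, p.length = l.length ∧ K.SwapEq (K.prolongWalk p [P]) (v :: l) := by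
  induction l generalizing v with
  | nil =>
    cases hl
    exact ⟨.nil, rfl, .refl _⟩
  | cons a l ih =>
    obtain ⟨p, hp, h⟩ := ih hl.tail
    refine ⟨p.append (.cons hl.adj.symm .nil), by simp [hp], ?_⟩
    rw [prolongWalk_append]
    refine (prolong_congr hK v h).trans ?_
    rw [prolong_of_not]
    · exact .refl _
    · intro w r hr
      obtain rfl := hr.head_eq
      exact hl.not_swapEq r hr

/-- Reduced edge paths with the same end points are equal up to pushing across squares. -/
theorem Red.unique (hK : K.IsCAT0) {P v : V} {l l' : List V} (h : K.Red P (v :: l))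
    (h' : K.Red P (v :: l')) : K.SwapEq (v :: l) (v :: l') := by
  obtain ⟨p, -, hp⟩ := h.exists_walk hK
  obtain ⟨q, -, hq⟩ := h'.exists_walk hK
  exact hp.symm.trans
    ((prolongWalk_homotopic hK (hK.edgeHomotopic p q) (redAt_nil P)).trans hq)

/-! ### Reduced paths as geodesics; bipartiteness and the quadrangle condition -/

theorem length_prolong_le (hK : K.IsCAT0) (x : V) (l : List V) :
    (K.prolong x l).length ≤ l.length + 1 := by
  by_cases h : ∃ v' r, K.SwapEq l (v' :: x :: r)
  · obtain ⟨v', r, hr⟩ := h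
    rw [(prolong_of_swapEq hK hr).length_eq, hr.length_eq]
    simp only [List.length_cons]; omega
  · push Not at h
    rw [prolong_of_not h]; simp

theorem length_prolongWalk_le (hK : K.IsCAT0) {u v : V} (p : K.graph.Walk u v) (l : List V) :
    (K.prolongWalk p l).length ≤ l.length + p.length := by
  induction p generalizing l with
  | nil => exact le_rfl
  | @cons _ x _ h p ih =>
    refine (ih (K.prolong x l)).trans ?_
    have := length_prolong_le hK x l
    rw [SimpleGraph.Walk.length_cons]
    exact (Nat.add_le_add_right this _).trans (by omega)

/-- Developing a geodesic from P gives a reduced path that is not longer, and a reduced path is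
itself a walk, so its length is the distance. -/
theorem exists_red (hK : K.IsCAT0) (P v : V) :
    ∃ l, K.Red P (v :: l) ∧ l.length = K.graph.dist P v := by
  obtain ⟨p, hp⟩ := hK.connected.exists_walk_length_eq_dist P v
  obtain ⟨h1, h2⟩ := (redAt_nil (K := K) P).prolongWalk hK p
  have h3 := length_prolongWalk_le hK p [P]
  rcases hl : K.prolongWalk p [P] with _ | ⟨w, l⟩
  · simp [hl] at h2
  obtain rfl : w = v := by simpa [hl] using h2
  rw [hl] at h1 h3
  refine ⟨l, h1, le_antisymm ?_ ?_⟩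
  · simp at h3; omega
  · obtain ⟨q, hq, -⟩ := h1.exists_walk hK
    rw [← hq]
    exact SimpleGraph.dist_le q

theorem Red.length_eq (hK : K.IsCAT0) {P v : V} {l : List V} (h : K.Red P (v :: l)) :
    l.length = K.graph.dist P v := by
  obtain ⟨l', h1, h2⟩ := exists_red hK P v
  have := (h.unique hK h1).length_eq
  simp at this
  omega

/-- The 1-skeleton is bipartite. -/
theorem IsCAT0.dist_adj (hK : K.IsCAT0) (P : V) {v a : V} (h : K.graph.Adj v a) :
    K.graph.dist P v = K.graph.dist P a + 1 ∨ K.graph.dist P a = K.graph.dist P v + 1 := by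
  obtain ⟨l, hl, hlen⟩ := exists_red hK P v
  -- If a geodesic from v to P can be pushed to start with the edge to a, then a is one step nearer
  -- to P. If not, prefixing a gives a reduced path, so a is one step farther.
  by_cases hd : ∃ r, K.SwapEq (v :: l) (v :: a :: r)
  · obtain ⟨r, hr⟩ := hd
    have h1 := (hl.swapEq hK hr)
    have h2 := h1.length_eq hK
    have h3 := h1.tail.length_eq hK
    simp at h2
    omega
  · push Not at hd
    have h1 : K.Red P (a :: v :: l) := .cons h.symm hl hd
    have h2 := h1.length_eq hK
    simp at h2
    omega

/-- The quadrangle condition. -/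
theorem IsCAT0.quadrangle (hK : K.IsCAT0) (P : V) {v a b : V} (ha : K.graph.Adj v a)
    (hb : K.graph.Adj v b) (hab : a ≠ b) (hPa : K.graph.dist P v = K.graph.dist P a + 1)
    (hPb : K.graph.dist P v = K.graph.dist P b + 1) :
    ∃ d, K.IsSquare v a d b ∧ K.graph.dist P v = K.graph.dist P d + 2 := by
  have key : ∀ {a : V}, K.graph.Adj v a → K.graph.dist P v = K.graph.dist P a + 1 →
      ∃ l, K.Red P (v :: a :: l) := by
    intro a ha hPa
    obtain ⟨l, hl, hlen⟩ := exists_red hK P a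
    refine ⟨l, .cons ha hl fun r hr => ?_⟩
    have h1 := (hl.swapEq hK hr).tail.length_eq hK
    have h2 := hr.length_eq
    simp at h2
    omega
  obtain ⟨l, hl⟩ := key ha hPa
  obtain ⟨m, hm⟩ := key hb hPb
  -- The two reduced paths from v, through a and through b, are equivalent by uniqueness; the
  -- diamond property produces the square.
  rcases (hl.unique hK hm).diamond hK with ⟨h, _⟩ | ⟨_, d, r, hs, h1, h2⟩
  · exact absurd h hab
  · refine ⟨d, hs, ?_⟩
    have h3 := hl.tail.swapEq hK h1
    have h4 := h3.length_eq hK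
    have h5 := h3.tail.length_eq hK
    simp at h4
    omega

end CubeComplex
end

noncomputable section
namespace CubeComplex
variable {V : Type*} {K : CubeComplex V}

/-! ## The two sides of a hyperplane -/

theorem Hyperplane.Crosses.symm {H : K.Hyperplane} {u v : V} (h : H.Crosses u v) :
    H.Crosses v u := by
  obtain ⟨h, rfl⟩ := h
  refine ⟨h.symm, ?_⟩
  congr 2
  exact Sym2.eq_swap

theorem Hyperplane.Crosses.adj {H : K.Hyperplane} {u v : V} (h : H.Crosses u v) :
    K.graph.Adj u v := h.1

theorem Hyperplane.Crosses.eq {H H' : K.Hyperplane} {u v : V} (h : H.Crosses u v)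
    (h' : H'.Crosses u v) : H = H' := h.2.symm.trans h'.2

theorem exists_crosses_of_adj {u v : V} (h : K.graph.Adj u v) :
    ∃ H : K.Hyperplane, H.Crosses u v := ⟨_, h, rfl⟩

theorem Hyperplane.exists_crosses (H : K.Hyperplane) : ∃ u v, H.Crosses u v := by
  induction H using Quot.ind with
  | _ e =>
    obtain ⟨e, he⟩ := e
    induction e using Sym2.ind with
    | _ u v => exact ⟨u, v, he, rfl⟩

theorem IsSquare.crosses {a b c d : V} (h : K.IsSquare a b c d) {H : K.Hyperplane}
    (hH : H.Crosses a b) : H.Crosses d c := by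
  obtain ⟨h', rfl⟩ := hH
  exact ⟨h.2.2.1.symm, (Quot.sound ⟨a, b, c, d, h, rfl, rfl⟩).symm⟩

theorem IsCAT0.dist_lt_or_gt (hK : K.IsCAT0) (x : V) {a b : V} (h : K.graph.Adj a b) :
    K.graph.dist x a < K.graph.dist x b ∨ K.graph.dist x b < K.graph.dist x a := by
  rcases hK.dist_adj x h with h | h <;> omega

/-- Otherwise b and d would both be one step farther from x than a and c. The quadrangle condition
at b gives a square on a, b, c whose fourth vertex is nearer to x than a, and by uniqueness of
squares this vertex is d. -/
theorem IsCAT0.dist_lt_of_square (hK : K.IsCAT0) (x : V) {a b c d : V} (h : K.IsSquare a b c d)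
    (hx : K.graph.dist x a < K.graph.dist x b) : K.graph.dist x d < K.graph.dist x c := by
  have h1 := hK.dist_adj x h.1
  have h2 := hK.dist_adj x h.2.1
  have h3 := hK.dist_adj x h.2.2.1
  have h4 := hK.dist_adj x h.2.2.2.1
  by_contra hcon
  obtain ⟨m, hm, hm'⟩ := hK.quadrangle x (v := b) (a := a) (b := c) h.1.symm h.2.1
    h.2.2.2.2.1 (by omega) (by omega)
  have : m = d := hm.unique h.rotate.swap
  subst this
  omega

/-- `x` and `y` are on different sides of the edge `e`. -/
def DiffSide (e : K.graph.edgeSet) (x y : V) : Prop :=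
  ∃ a b, e.1 = s(a, b) ∧ K.graph.dist x a < K.graph.dist x b ∧ K.graph.dist y b < K.graph.dist y a

theorem diffSide_of_opposite (hK : K.IsCAT0) {e e' : K.graph.edgeSet} (h : K.OppositeEdges e e')
    {x y : V} (hd : DiffSide e x y) : DiffSide e' x y := by
  obtain ⟨a, b, c, d, hs, he, he'⟩ := h
  obtain ⟨a', b', h1, h2, h3⟩ := hd
  rw [he, Sym2.eq_iff] at h1
  rcases h1 with ⟨rfl, rfl⟩ | ⟨rfl, rfl⟩
  · exact ⟨d, c, he', hK.dist_lt_of_square x hs h2,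
      hK.dist_lt_of_square y hs.rotate.swap h3⟩
  · exact ⟨c, d, by rw [he', Sym2.eq_swap], hK.dist_lt_of_square x hs.rotate.swap h2,
      hK.dist_lt_of_square y hs h3⟩

theorem oppositeEdges_symm {e e' : K.graph.edgeSet} (h : K.OppositeEdges e e') :
    K.OppositeEdges e' e := by
  obtain ⟨a, b, c, d, hs, he, he'⟩ := h
  exact ⟨d, c, b, a, hs.swap.rotate, he', he⟩

/-- Transport along a chain of opposite edges; it makes the two distance half-spaces of an edge an
invariant of its hyperplane. -/
theorem diffSide_of_mk_eq (hK : K.IsCAT0) {e e' : K.graph.edgeSet}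
    (h : Quot.mk K.OppositeEdges e = Quot.mk K.OppositeEdges e') (x y : V) :
    DiffSide e x y ↔ DiffSide e' x y := by
  have h' := Quot.eqvGen_exact h
  clear h
  induction h' with
  | rel _ _ h => exact ⟨diffSide_of_opposite hK h, diffSide_of_opposite hK (oppositeEdges_symm h)⟩
  | refl => exact Iff.rfl
  | symm _ _ _ ih => exact ih.symm
  | trans _ _ _ _ _ ih ih' => exact ih.trans ih'

/-- Induction on the distance from a to u. If u' is a neighbour of u one step nearer to a, then u'
and v are both nearer to b than u, and the quadrangle condition based at b gives a square on u', u,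
v. Its edge opposite to (u, v) again joins the two sides, closer to a, and the hyperplane is carried
across the square. -/
theorem crosses_of_dist (hK : K.IsCAT0) {H : K.Hyperplane} {a b u v : V} (hab : H.Crosses a b)
    (huv : K.graph.Adj u v) (hu : K.graph.dist u a < K.graph.dist u b)
    (hv : K.graph.dist v b < K.graph.dist v a) : H.Crosses u v := by
  obtain ⟨k, hk⟩ : ∃ k, K.graph.dist a u = k := ⟨_, rfl⟩
  induction k generalizing u v with
  | zero =>
    obtain rfl := hK.connected.dist_eq_zero_iff.1 hk
    have h1 : K.graph.dist a b = 1 := SimpleGraph.dist_eq_one_iff_adj.2 hab.adj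
    have h2 := hK.dist_adj v huv
    rw [SimpleGraph.dist_self] at h2
    have h3 : K.graph.dist v a = 1 := SimpleGraph.dist_eq_one_iff_adj.2 huv.symm
    obtain rfl := hK.connected.dist_eq_zero_iff.1 (by omega : K.graph.dist v b = 0)
    exact hab
  | succ k ih =>
    have c : ∀ x y, K.graph.dist x y = K.graph.dist y x := fun _ _ => SimpleGraph.dist_comm
    rw [c u a, c u b] at hu
    rw [c v a, c v b] at hv
    obtain ⟨u', hu', hd⟩ : ∃ u', K.graph.Adj u u' ∧ K.graph.dist a u' = k := by
      obtain ⟨p, hp⟩ := hK.connected.exists_walk_length_eq_dist u a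
      cases p with
      | nil => rw [SimpleGraph.dist_self] at hk; omega
      | cons h p =>
        rename_i u'
        refine ⟨u', h, ?_⟩
        have h1 := SimpleGraph.dist_le p
        rw [SimpleGraph.Walk.length_cons, c u a] at hp
        have h2 := hK.dist_adj a h
        rw [c u' a] at h1
        omega
    have e1 := hK.dist_adj a huv
    have e2 := hK.dist_adj b huv
    have e3 := hK.dist_adj b hu'
    have e4 := hK.dist_adj u hab.adj
    have e5 := hK.dist_adj v hab.adj
    have e6 := hK.dist_adj u' hab.adj
    rw [c u a, c u b] at e4
    rw [c v a, c v b] at e5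
    rw [c u' a, c u' b] at e6
    obtain ⟨v', hs, hv'⟩ := hK.quadrangle b hu' huv (fun h => by subst h; omega)
      (by omega) (by omega)
    have e7 := hK.dist_adj a hs.2.2.1
    have e8 := hK.dist_adj v' hab.adj
    rw [c v' a, c v' b] at e8
    have := ih hs.2.1 (by rw [c u' a, c u' b]; omega) (by rw [c v' a, c v' b]; omega) hd
    exact (hs.rotate.crosses this)

/-- The components of the complement of H are the two distance half-spaces of any edge crossing H.
By `crosses_of_dist` a path avoiding H stays in its half-space; conversely, a geodesic towards a or
b inside its half-space does not cross H. -/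
theorem separates_iff_dist (hK : K.IsCAT0) {H : K.Hyperplane} {a b : V} (hab : H.Crosses a b)
    (x y : V) : H.Separates x y ↔
      ¬ (K.graph.dist x a < K.graph.dist x b ↔ K.graph.dist y a < K.graph.dist y b) := by
  have key : ∀ u v, K.graph.Adj u v ∧ ¬ H.Crosses u v → K.graph.dist u a < K.graph.dist u b →
      K.graph.dist v a < K.graph.dist v b := by
    rintro u v ⟨h1, h2⟩ h3
    by_contra h4
    have := hK.dist_lt_or_gt v hab.adj
    exact h2 (crosses_of_dist hK hab h1 h3 (by omega))
  have key' : ∀ u v, K.graph.Adj u v ∧ ¬ H.Crosses u v →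
      (K.graph.dist u a < K.graph.dist u b ↔ K.graph.dist v a < K.graph.dist v b) :=
    fun u v h => ⟨key u v h, key v u ⟨h.1.symm, fun h' => h.2 h'.symm⟩⟩
  -- An edge that crosses H has its ends on different sides of itself, hence on different sides of
  -- the edge (a, b) of the same hyperplane.
  have diff : ∀ {u v}, H.Crosses u v →
      ¬ (K.graph.dist u a < K.graph.dist u b ↔ K.graph.dist v a < K.graph.dist v b) := by
    intro u v huv
    have h1 : DiffSide ⟨s(u, v), huv.adj⟩ u v := by
      refine ⟨u, v, rfl, ?_, ?_⟩ <;> rw [SimpleGraph.dist_self]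
      · exact hK.connected.pos_dist_of_ne huv.adj.ne
      · exact hK.connected.pos_dist_of_ne huv.adj.ne'
    have h2 : DiffSide ⟨s(a, b), hab.adj⟩ u v :=
      (diffSide_of_mk_eq hK (huv.2.trans hab.2.symm) u v).1 h1
    obtain ⟨a', b', h3, h4, h5⟩ := h2
    rcases Sym2.eq_iff.1 h3 with ⟨rfl, rfl⟩ | ⟨rfl, rfl⟩ <;> omega
  rw [Hyperplane.Separates, not_iff_not]
  constructor
  · intro h
    induction h with
    | refl => exact Iff.rfl
    | tail _ h ih => exact ih.trans (key' _ _ h)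
  · -- each side is connected
    have conn : ∀ {a b : V}, H.Crosses a b → ∀ x, K.graph.dist x a < K.graph.dist x b →
        (∀ {u v}, H.Crosses u v →
          ¬ (K.graph.dist u a < K.graph.dist u b ↔ K.graph.dist v a < K.graph.dist v b)) →
        Relation.ReflTransGen (fun a b => K.graph.Adj a b ∧ ¬ H.Crosses a b) x a := by
      intro a b hab x hx diff
      obtain ⟨k, hk⟩ : ∃ k, K.graph.dist x a = k := ⟨_, rfl⟩
      induction k generalizing x with
      | zero => rw [hK.connected.dist_eq_zero_iff.1 hk]
      | succ k ih =>
        obtain ⟨p, hp⟩ := hK.connected.exists_walk_length_eq_dist x a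
        cases p with
        | nil => simp at hk
        | cons h p =>
          rename_i x'
          have h1 := SimpleGraph.dist_le p
          rw [SimpleGraph.Walk.length_cons] at hp
          have h2 := hK.dist_adj a h
          have h3 := hK.dist_adj b h
          rw [SimpleGraph.dist_comm (u := a), SimpleGraph.dist_comm (u := a)] at h2
          rw [SimpleGraph.dist_comm (u := b), SimpleGraph.dist_comm (u := b)] at h3
          have h4 : K.graph.dist x' a < K.graph.dist x' b := by omega
          refine Relation.ReflTransGen.head ⟨h, fun hc => ?_⟩ (ih x' h4 (by omega))
          exact diff hc ⟨fun _ => h4, fun _ => hx⟩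
    have symm : ∀ {x y}, Relation.ReflTransGen (fun a b => K.graph.Adj a b ∧ ¬ H.Crosses a b) x y →
        Relation.ReflTransGen (fun a b => K.graph.Adj a b ∧ ¬ H.Crosses a b) y x := by
      intro x y h
      induction h with
      | refl => exact .refl
      | tail _ h ih => exact .head ⟨h.1.symm, fun h' => h.2 h'.symm⟩ ih
    intro h
    rcases hK.dist_lt_or_gt x hab.adj with hx | hx
    · exact (conn hab x hx diff).trans (symm (conn hab y (h.1 hx) diff))
    · have hy : K.graph.dist y b < K.graph.dist y a := by
        rcases hK.dist_lt_or_gt y hab.adj with hy | hy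
        · have := h.2 hy; omega
        · exact hy
      have diff' : ∀ {u v}, H.Crosses u v →
          ¬ (K.graph.dist u b < K.graph.dist u a ↔ K.graph.dist v b < K.graph.dist v a) := by
        intro u v huv
        have h1 := diff huv
        have h2 := hK.dist_lt_or_gt u hab.adj
        have h3 := hK.dist_lt_or_gt v hab.adj
        omega
      exact (conn hab.symm x hx diff').trans (symm (conn hab.symm y hy diff'))

/-- Since H has exactly two sides, separation is an exclusive or; most later arguments about sides
are reduced to this identity. -/
theorem separates_trans_iff (hK : K.IsCAT0) (H : K.Hyperplane) (x y z : V) :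
    H.Separates x z ↔ ¬ (H.Separates x y ↔ H.Separates y z) := by
  obtain ⟨a, b, hab⟩ := H.exists_crosses
  rw [separates_iff_dist hK hab, separates_iff_dist hK hab, separates_iff_dist hK hab]
  tauto

theorem not_separates_self (H : K.Hyperplane) (x : V) : ¬ H.Separates x x :=
  fun h => h .refl

theorem separates_comm (hK : K.IsCAT0) (H : K.Hyperplane) (x y : V) :
    H.Separates x y ↔ H.Separates y x := by
  have := separates_trans_iff hK H x y x
  have := not_separates_self H x
  tauto

theorem Hyperplane.Crosses.separates_iff (hK : K.IsCAT0) {H : K.Hyperplane} {a b : V}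
    (hab : H.Crosses a b) (y : V) : H.Separates a y ↔ K.graph.dist y b < K.graph.dist y a := by
  rw [separates_iff_dist hK hab, SimpleGraph.dist_self]
  have h1 := hK.connected.pos_dist_of_ne hab.adj.ne
  have h2 := hK.dist_lt_or_gt y hab.adj
  omega

theorem Hyperplane.Crosses.separates (hK : K.IsCAT0) {H : K.Hyperplane} {a b : V}
    (hab : H.Crosses a b) : H.Separates a b := by
  rw [hab.separates_iff hK, SimpleGraph.dist_self]
  exact hK.connected.pos_dist_of_ne hab.adj.ne'

theorem Hyperplane.Separates.crosses {H : K.Hyperplane} {a b : V}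
    (h : H.Separates a b) (hab : K.graph.Adj a b) : H.Crosses a b := by
  by_contra hc
  exact h (.single ⟨hab, hc⟩)

/-- At each vertex there is at most one edge that crosses a given hyperplane. -/
theorem Hyperplane.Crosses.unique (hK : K.IsCAT0) {H : K.Hyperplane} {v a b : V}
    (ha : H.Crosses v a) (hb : H.Crosses v b) : a = b := by
  by_contra hab
  -- By bipartiteness b is farther from a than from v, so H separates a from b. But H separates v
  -- from both of them, which three sides would require.
  have h1 : H.Separates a b := by
    rw [ha.symm.separates_iff hK, SimpleGraph.dist_eq_one_iff_adj.2 hb.adj.symm]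
    have h1 := hK.dist_adj b ha.adj
    have h2 := hK.connected.pos_dist_of_ne (Ne.symm hab)
    have h3 := SimpleGraph.dist_eq_one_iff_adj.2 hb.adj.symm
    omega
  have h2 := ha.separates hK
  have h3 := hb.separates hK
  have h4 := separates_trans_iff hK H v a b
  tauto

theorem finite_separates (hK : K.IsCAT0) (x y : V) : {H : K.Hyperplane | H.Separates x y}.Finite := by
  obtain ⟨p⟩ := hK.connected x y
  induction p with
  | nil =>
    convert Set.finite_empty
    ext H
    simpa using not_separates_self H _
  | @cons u v w h p ih =>
    have h1 : {H : K.Hyperplane | H.Crosses u v}.Subsingleton := fun H h H' h' => h.eq h'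
    refine (h1.finite.union ih).subset fun H hH => ?_
    have h2 := (separates_trans_iff hK H u v w).1 hH
    by_cases h3 : H.Separates u v
    · exact Or.inl (h3.crosses h)
    · exact Or.inr (by simp only [Set.mem_ofPred_eq]; tauto)

/-! ## The hyperplanes of a cube -/

theorem _root_.IsCubeChart.crosses_iff {n : ℕ} {ψ : (Fin n → Bool) → V}
    (hψ : IsCubeChart K.cubes ψ) (H : K.Hyperplane) (i : Fin n) (b b' : Fin n → Bool) :
    H.Crosses (ψ b) (ψ (flipAt i b)) ↔ H.Crosses (ψ b') (ψ (flipAt i b')) := by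
  refine flipAt_induction (p := fun b => H.Crosses (ψ b) (ψ (flipAt i b)) ↔
    H.Crosses (ψ b') (ψ (flipAt i b'))) b' Iff.rfl (fun b j hb => ?_) b
  rw [← hb]
  by_cases hij : i = j
  · subst hij
    rw [flipAt_flipAt]
    exact ⟨fun h => h.symm, fun h => h.symm⟩
  · have hs := hψ.isSquare b hij
    rw [flipAt_comm i j]
    exact ⟨fun h => (hs.rotate.rotate.crosses h.symm).symm, fun h => hs.crosses h⟩

/-- The hyperplanes dual to the coordinate directions of a cube. -/
theorem _root_.IsCubeChart.exists_hyperplane (hK : K.IsCAT0) {n : ℕ} {ψ : (Fin n → Bool) → V}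
    (hψ : IsCubeChart K.cubes ψ) : ∃ h : Fin n → K.Hyperplane, Function.Injective h ∧
      (∀ i b, (h i).Crosses (ψ b) (ψ (flipAt i b))) ∧ K.midSet (Set.range ψ) = Set.range h ∧
      ∀ i b b', (h i).Separates (ψ b) (ψ b') ↔ b i ≠ b' i := by
  have h1 : ∀ i : Fin n, ∃ H : K.Hyperplane, ∀ b, H.Crosses (ψ b) (ψ (flipAt i b)) := by
    intro i
    obtain ⟨H, hH⟩ := exists_crosses_of_adj
      (hψ.adj_iff.2 ⟨i, rfl⟩ : K.graph.Adj (ψ fun _ => false) (ψ (flipAt i fun _ => false)))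
    exact ⟨H, fun b => (hψ.crosses_iff H i _ _).1 hH⟩
  choose h hh using h1
  have hinj : Function.Injective h := by
    intro i j hij
    have h1 := hh i fun _ => false
    have h2 := hh j fun _ => false
    rw [← hij] at h2
    exact flipAt_injective (hψ.1 (h1.unique hK h2))
  refine ⟨h, hinj, hh, ?_, ?_⟩
  · ext H
    constructor
    · rintro ⟨_, ⟨b, rfl⟩, _, ⟨b', rfl⟩, hc⟩
      obtain ⟨i, rfl⟩ := hψ.adj_iff.1 hc.adj
      exact ⟨i, (hh i b).eq hc⟩
    · rintro ⟨i, rfl⟩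
      exact ⟨_, ⟨_, rfl⟩, _, ⟨_, rfl⟩, hh i fun _ => false⟩
  · intro i b b'
    refine flipAt_induction (p := fun b => (h i).Separates (ψ b) (ψ b') ↔ b i ≠ b' i) b'
      (by simpa using not_separates_self _ _) (fun b j hb => ?_) b
    have h2 := separates_trans_iff hK (h i) (ψ (flipAt j b)) (ψ b) (ψ b')
    by_cases hij : i = j
    · subst hij
      have h3 := (hh i b).symm.separates hK
      rw [flipAt_same]
      cases h4 : b i <;> cases h5 : b' i <;> simp_all
    · have h3 : ¬ (h i).Separates (ψ (flipAt j b)) (ψ b) := fun h' =>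
        hij (hinj ((h'.crosses (hh j b).adj.symm).eq (hh j b).symm))
      rw [flipAt_of_ne hij]
      tauto

theorem Cube.exists_crosses (hK : K.IsCAT0) {C : Set V} (hC : C ∈ K.cubes) {H : K.Hyperplane}
    (hH : H ∈ K.midSet C) {v : V} (hv : v ∈ C) : ∃ a ∈ C, H.Crosses v a := by
  obtain ⟨n, ψ, hψ, rfl⟩ := K.exists_chart C hC
  obtain ⟨h, h1, h2, h3, h4⟩ := hψ.exists_hyperplane hK
  rw [h3] at hH
  obtain ⟨i, rfl⟩ := hH
  obtain ⟨b, rfl⟩ := hv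
  exact ⟨_, ⟨_, rfl⟩, h2 i b⟩

theorem Cube.not_separates (hK : K.IsCAT0) {C : Set V} (hC : C ∈ K.cubes) {H : K.Hyperplane}
    (hH : H ∉ K.midSet C) {u v : V} (hu : u ∈ C) (hv : v ∈ C) : ¬ H.Separates u v := by
  obtain ⟨n, ψ, hψ, rfl⟩ := K.exists_chart C hC
  obtain ⟨b, rfl⟩ := hu
  obtain ⟨b', rfl⟩ := hv
  refine flipAt_induction (p := fun b => ¬ H.Separates (ψ b) (ψ b')) b' (not_separates_self _ _)
    (fun b i hb h => ?_) b
  have h1 : ¬ H.Separates (ψ (flipAt i b)) (ψ b) := fun h' =>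
    hH ⟨_, ⟨_, rfl⟩, _, ⟨_, rfl⟩, h'.crosses (hψ.adj_iff.2 ⟨i, rfl⟩).symm⟩
  have h2 := separates_trans_iff hK H (ψ (flipAt i b)) (ψ b) (ψ b')
  tauto

theorem Cube.eq_of_not_separates (hK : K.IsCAT0) {C : Set V} (hC : C ∈ K.cubes) {u v : V}
    (hu : u ∈ C) (hv : v ∈ C) (h : ∀ H ∈ K.midSet C, ¬ H.Separates u v) : u = v := by
  obtain ⟨n, ψ, hψ, rfl⟩ := K.exists_chart C hC
  obtain ⟨hh, h1, h2, h3, h4⟩ := hψ.exists_hyperplane hK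
  obtain ⟨b, rfl⟩ := hu
  obtain ⟨b', rfl⟩ := hv
  congr 1
  funext i
  by_contra hi
  exact h (hh i) (by rw [h3]; exact ⟨i, rfl⟩) ((h4 i b b').2 hi)

theorem Cube.ncard_eq (hK : K.IsCAT0) {C : Set V} (hC : C ∈ K.cubes) :
    C.ncard = 2 ^ (K.midSet C).ncard := by
  obtain ⟨n, ψ, hψ, rfl⟩ := K.exists_chart C hC
  obtain ⟨hh, h1, h2, h3, h4⟩ := hψ.exists_hyperplane hK
  rw [hψ.ncard_range, h3, ← Set.image_univ, Set.ncard_image_of_injective _ h1, Set.ncard_univ]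
  simp

/-- A cube is determined by one of its vertices and its hyperplanes. -/
theorem Cube.subset_of_midSet_subset (hK : K.IsCAT0) {C C' : Set V} (hC : C ∈ K.cubes)
    (hC' : C' ∈ K.cubes) {v : V} (hv : v ∈ C) (hv' : v ∈ C') (h : K.midSet C ⊆ K.midSet C') :
    C ⊆ C' := by
  have hI := K.inter_mem C hC C' hC' ⟨v, hv, hv'⟩
  obtain ⟨n, ψ, hψ, rfl⟩ := K.exists_chart C hC
  obtain ⟨hh, h1, h2, h3, h4⟩ := hψ.exists_hyperplane hK
  obtain ⟨F, ⟨S, a, rfl⟩, hF⟩ := (hψ.2 _ Set.inter_subset_left).1 hI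
  obtain ⟨β, rfl⟩ := hv
  have hβ : ∀ i ∈ S, β i = a i := by
    have : ψ β ∈ ψ '' {b | ∀ i ∈ S, b i = a i} := by rw [hF]; exact ⟨⟨_, rfl⟩, hv'⟩
    obtain ⟨β', hβ', e⟩ := this
    rwa [hψ.1 e] at hβ'
  -- The intersection is a face of C. A fixed coordinate i would exclude the neighbour of v across
  -- the i-th hyperplane, but C' is cut by that hyperplane too and so contains this neighbour.
  have hS : S = ∅ := by
    rw [Set.eq_empty_iff_forall_notMem]
    intro i hi
    obtain ⟨w, hw, hc⟩ := Cube.exists_crosses hK hC' (h (by rw [h3]; exact ⟨i, rfl⟩) :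
      hh i ∈ K.midSet C') hv'
    have e := hc.unique hK (h2 i β)
    have : ψ (flipAt i β) ∈ ψ '' {b | ∀ i ∈ S, b i = a i} := by
      rw [hF]; exact ⟨⟨_, rfl⟩, e ▸ hw⟩
    obtain ⟨β', hβ', e⟩ := this
    rw [hψ.1 e] at hβ'
    have h5 := hβ' i hi
    rw [← hβ i hi, flipAt_same] at h5
    cases h6 : β i <;> simp [h6] at h5
  subst hS
  rw [show {b : Fin n → Bool | ∀ i ∈ (∅ : Set (Fin n)), b i = a i} = Set.univ by ext; simp,
    Set.image_univ] at hF
  rw [hF]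
  exact Set.inter_subset_right

theorem Cube.eq_of_midSet_eq (hK : K.IsCAT0) {C C' : Set V} (hC : C ∈ K.cubes)
    (hC' : C' ∈ K.cubes) {v : V} (hv : v ∈ C) (hv' : v ∈ C') (h : K.midSet C = K.midSet C') :
    C = C' :=
  (subset_of_midSet_subset hK hC hC' hv hv' h.le).antisymm
    (subset_of_midSet_subset hK hC' hC hv' hv h.ge)

/-! ## The vertex of a cube farthest from the base vertex -/

/-- In a chart, the side of each hyperplane of C can be prescribed independently of the others. -/
theorem Cube.exists_top (hK : K.IsCAT0) (P : V) (C : K.Cube) :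
    ∃ v ∈ C.1, ∀ H ∈ K.midSet C.1, H.Separates v P := by
  classical
  obtain ⟨C, hC⟩ := C
  obtain ⟨n, ψ, hψ, rfl⟩ := K.exists_chart C hC
  obtain ⟨h, h1, h2, h3, h4⟩ := hψ.exists_hyperplane hK
  let β : Fin n → Bool := fun i => if (h i).Separates (ψ fun _ => false) P then false else true
  refine ⟨ψ β, ⟨_, rfl⟩, ?_⟩
  simp only [h3]
  rintro _ ⟨i, rfl⟩
  have h5 := separates_trans_iff hK (h i) (ψ β) (ψ fun _ => false) P
  have h6 := h4 i β fun _ => false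
  by_cases h7 : (h i).Separates (ψ fun _ => false) P
  · have : β i = false := by simp [β, h7]
    simp only [this] at h6
    tauto
  · have : β i = true := by simp [β, h7]
    simp only [this] at h6
    have : (h i).Separates (ψ β) (ψ fun _ => false) := h6.2 (by simp)
    tauto

/-- The vertex of `C` farthest from `P`. -/
def Cube.top (hK : K.IsCAT0) (P : V) (C : K.Cube) : V := (C.exists_top hK P).choose

theorem Cube.top_mem (hK : K.IsCAT0) (P : V) (C : K.Cube) : C.top hK P ∈ C.1 :=
  (C.exists_top hK P).choose_spec.1

theorem Cube.separates_top (hK : K.IsCAT0) (P : V) (C : K.Cube) {H : K.Hyperplane}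
    (hH : H ∈ K.midSet C.1) : H.Separates (C.top hK P) P :=
  (C.exists_top hK P).choose_spec.2 H hH

theorem Cube.eq_top (hK : K.IsCAT0) {P : V} {C : K.Cube} {v : V} (hv : v ∈ C.1)
    (h : ∀ H ∈ K.midSet C.1, H.Separates v P) : C.top hK P = v := by
  refine Cube.eq_of_not_separates hK C.2 (C.top_mem hK P) hv fun H hH => ?_
  have h1 := separates_trans_iff hK H (C.top hK P) P v
  have h2 := C.separates_top hK P hH
  have h3 := (separates_comm hK H v P).1 (h H hH)
  tauto

/-- The hyperplanes that cut the edges from `v` towards `P`. -/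
def downSet (K : CubeComplex V) (P v : V) : Set K.Hyperplane :=
  {H | H.Separates v P ∧ ∃ a, H.Crosses v a}

theorem Cube.midSet_subset_downSet (hK : K.IsCAT0) (P : V) (C : K.Cube) :
    K.midSet C.1 ⊆ K.downSet P (C.top hK P) := fun H hH =>
  ⟨C.separates_top hK P hH, by
    obtain ⟨a, -, ha⟩ := Cube.exists_crosses hK C.2 hH (C.top_mem hK P)
    exact ⟨a, ha⟩⟩

theorem BoundedGeometry.finite_neighborSet (hb : K.BoundedGeometry) (v : V) :
    (K.graph.neighborSet v).Finite := by
  obtain ⟨N, hN⟩ := hb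
  exact Set.finite_of_encard_le_coe (hN v)

/-- Distinct hyperplanes cut distinct edges at v. The bound is uniform in P and v and controls the
sparsity of the operators below. -/
theorem BoundedGeometry.exists_encard_downSet_le (hb : K.BoundedGeometry) :
    ∃ N : ℕ, ∀ P v : V, (K.downSet P v).encard ≤ N := by
  obtain ⟨N, hN⟩ := hb
  refine ⟨N, fun P v => (le_trans ?_ (hN v))⟩
  have h : ∀ H ∈ K.downSet P v, ∃ a, H.Crosses v a := fun H hH => hH.2
  have : Nonempty V := ⟨v⟩
  choose! f hf using h
  refine Set.encard_le_encard_of_injOn (f := f) (fun H hH => (hf H hH).adj) ?_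
  intro H hH H' hH' e
  exact (hf H hH).eq (e ▸ hf H' hH')

theorem BoundedGeometry.finite_downSet (hb : K.BoundedGeometry) (P v : V) :
    (K.downSet P v).Finite := by
  obtain ⟨N, hN⟩ := hb.exists_encard_downSet_le
  exact Set.finite_of_encard_le_coe (hN P v)

/-- Any two edges from v towards P span a square by the quadrangle condition, so by flagness
finitely many of them lie in one cube. The face of that cube through v whose free directions are
those of S has exactly the hyperplanes S. -/
theorem exists_cube_of_subset_downSet (hK : K.IsCAT0) {P v : V} {S : Set K.Hyperplane}
    (hfin : S.Finite) (hS : S ⊆ K.downSet P v) : ∃ C : K.Cube, v ∈ C.1 ∧ K.midSet C.1 = S := by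
  classical
  have hN : {a | ∃ H ∈ S, H.Crosses v a}.Finite := by
    have : {a | ∃ H ∈ S, H.Crosses v a} = ⋃ H ∈ S, {a | H.Crosses v a} := by
      ext; simp
    rw [this]
    exact hfin.biUnion fun H _ => Set.Subsingleton.finite fun a ha b hb => ha.unique hK hb
  obtain ⟨D, hD, hvD, hND⟩ := hK.flag v {a | ∃ H ∈ S, H.Crosses v a} hN
    (by rintro a ⟨H, -, ha⟩; exact ha.adj) (by
      rintro a ⟨H, hH, ha⟩ b ⟨H', hH', hb⟩
      by_cases hab : a = b
      · subst hab
        exact ⟨_, ha.adj.2, by simp, by simp, by simp⟩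
      · have e1 := (ha.separates_iff hK P).1 (hS hH).1
        have e2 := (hb.separates_iff hK P).1 (hS hH').1
        have e3 := hK.dist_adj P ha.adj
        have e4 := hK.dist_adj P hb.adj
        obtain ⟨d, hs, -⟩ := hK.quadrangle P ha.adj hb.adj hab (by omega) (by omega)
        exact ⟨_, hs.2.2.2.2.2.2, by simp, by simp, by simp⟩)
  obtain ⟨n, ψ, hψ, rfl⟩ := K.exists_chart D hD
  obtain ⟨β, rfl⟩ := hvD
  obtain ⟨h, h1, h2, h3, h4⟩ := hψ.exists_hyperplane hK
  refine ⟨⟨ψ '' {b | ∀ i ∈ {i | h i ∉ S}, b i = β i}, (hψ.2 _ (Set.image_subset_range _ _)).2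
    ⟨_, ⟨_, _, rfl⟩, rfl⟩⟩, ⟨β, fun _ _ => rfl, rfl⟩, ?_⟩
  ext H
  constructor
  · rintro ⟨_, ⟨b, hb, rfl⟩, _, ⟨b', hb', rfl⟩, hc⟩
    obtain ⟨i, rfl⟩ := hψ.adj_iff.1 hc.adj
    obtain rfl := hc.eq (h2 i b)
    by_contra hi
    have e1 := hb i hi
    have e2 := hb' i hi
    rw [flipAt_same, ← e1] at e2
    cases h6 : b i <;> simp [h6] at e2
  · intro hH
    obtain ⟨a, ha⟩ := (hS hH).2
    obtain ⟨b, rfl⟩ := hND ⟨H, hH, ha⟩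
    obtain ⟨i, rfl⟩ := hψ.adj_iff.1 ha.adj
    obtain rfl := ha.eq (h2 i β)
    refine ⟨_, ⟨β, fun _ _ => rfl, rfl⟩, _, ⟨flipAt i β, fun j hj => ?_, rfl⟩, ha⟩
    rw [flipAt_of_ne]
    rintro rfl
    exact hj hH

theorem exists_cube_top_eq (hK : K.IsCAT0) {P v : V} {S : Set K.Hyperplane}
    (hfin : S.Finite) (hS : S ⊆ K.downSet P v) :
    ∃ C : K.Cube, C.top hK P = v ∧ K.midSet C.1 = S := by
  obtain ⟨C, hv, rfl⟩ := exists_cube_of_subset_downSet hK hfin hS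
  exact ⟨C, Cube.eq_top hK hv fun H hH => (hS hH).1, rfl⟩

theorem Cube.ext_top (hK : K.IsCAT0) {P : V} {C C' : K.Cube} (h : C.top hK P = C'.top hK P)
    (hmid : K.midSet C.1 = K.midSet C'.1) : C = C' :=
  Subtype.ext (Cube.eq_of_midSet_eq hK C.2 C'.2 (C.top_mem hK P) (h ▸ C'.top_mem hK P) hmid)

/-- The facets of `D` that contribute to `e_w` are those opposite to `P`. -/
theorem facet_iff (hK : K.IsCAT0) {P : V} {C D : K.Cube} {H : K.Hyperplane} :
    (C.IsFacet D ∧ H ∈ C.SAH P ∧ H ∈ K.midSet D.1) ↔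
      C.top hK P = D.top hK P ∧ H ∉ K.midSet C.1 ∧ K.midSet D.1 = insert H (K.midSet C.1) := by
  have hfin := D.midSet_finite
  constructor
  · rintro ⟨⟨h1, h2⟩, ⟨⟨h3, -⟩, h4⟩, h5⟩
    have hM : K.midSet D.1 = insert H (K.midSet C.1) := by
      symm
      refine Set.eq_of_subset_of_ncard_le (Set.insert_subset h5 (midSet_mono h1)) ?_ hfin
      rw [Set.ncard_insert_of_notMem h3 C.midSet_finite]
      rw [Cube.ncard_eq hK D.2, Cube.ncard_eq hK C.2, ← pow_succ'] at h2
      exact (Nat.pow_right_injective le_rfl h2).le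
    refine ⟨(Cube.eq_top hK (h1 (C.top_mem hK P)) ?_).symm, h3, hM⟩
    rw [hM]
    rintro H' (rfl | hH')
    · exact h4 _ (C.top_mem hK P)
    · exact C.separates_top hK P hH'
  · rintro ⟨h1, h2, h3⟩
    have hsub : C.1 ⊆ D.1 := Cube.subset_of_midSet_subset hK C.2 D.2 (C.top_mem hK P)
      (h1 ▸ D.top_mem hK P) (by rw [h3]; exact Set.subset_insert _ _)
    have hH : H ∈ K.midSet D.1 := by rw [h3]; exact Set.mem_insert _ _
    have hf : C.IsFacet D := by
      refine ⟨hsub, ?_⟩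
      rw [Cube.ncard_eq hK D.2, Cube.ncard_eq hK C.2, h3,
        Set.ncard_insert_of_notMem h2 C.midSet_finite, pow_succ']
    refine ⟨hf, ⟨⟨h2, D, hf, hH⟩, fun v hv => ?_⟩, hH⟩
    have e1 := D.separates_top hK P hH
    rw [← h1] at e1
    have e2 := Cube.not_separates hK C.2 h2 hv (C.top_mem hK P)
    have e3 := separates_trans_iff hK H v (C.top hK P) P
    tauto

/-! ## The hyperplanes towards the base vertex determine a vertex -/

theorem IsCAT0.exists_adj_dist (hK : K.IsCAT0) {v x : V} (h : v ≠ x) :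
    ∃ a, K.graph.Adj x a ∧ K.graph.dist v x = K.graph.dist v a + 1 := by
  obtain ⟨p, hp⟩ := hK.connected.exists_walk_length_eq_dist x v
  cases p with
  | nil => exact absurd rfl h
  | @cons _ a _ hadj p =>
    refine ⟨a, hadj, ?_⟩
    have h1 := SimpleGraph.dist_le p
    rw [SimpleGraph.Walk.length_cons, SimpleGraph.dist_comm] at hp
    rw [SimpleGraph.dist_comm] at h1
    have h2 := hK.dist_adj v hadj
    omega

/-- The hypothesis says that no edge from v towards P starts a geodesic to x; then the distance from
P grows along every geodesic from v to x. If it first dropped between z' and z, the two neighbours z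
and z'' of z' would be nearer to P. The fourth vertex of their square lies on a geodesic from v to x
at the same distance from v as z', but is two steps nearer to P, against the induction hypothesis.
-/
theorem dist_eq_add_of_no_common (hK : K.IsCAT0) {P v x : V}
    (h : ∀ a, K.graph.Adj v a → K.graph.dist P a < K.graph.dist P v →
      K.graph.dist x v < K.graph.dist x a) (z : V)
    (hz : K.graph.dist v z + K.graph.dist z x = K.graph.dist v x) :
    K.graph.dist P z = K.graph.dist P v + K.graph.dist v z := by
  have c : ∀ x y, K.graph.dist x y = K.graph.dist y x := fun _ _ => SimpleGraph.dist_comm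
  obtain ⟨k, hk⟩ : ∃ k, K.graph.dist v z = k := ⟨_, rfl⟩
  induction k using Nat.strong_induction_on generalizing z with
  | _ k ih =>
  by_cases hvz : v = z
  · subst hvz; rw [SimpleGraph.dist_self, add_zero]
  obtain ⟨z', hz', hd⟩ := hK.exists_adj_dist hvz
  have t1 := hK.connected.dist_triangle (u := v) (v := z') (w := x)
  have t2 := hK.dist_adj x hz'
  rw [c x z, c x z'] at t2
  have i1 := ih _ (by omega) z' (by omega) rfl
  rcases hK.dist_adj P hz' with h1 | h1
  · omega
  · exfalso
    by_cases hvz' : v = z'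
    · subst hvz'
      have := h z hz'.symm (by omega)
      rw [c x v, c x z] at this
      rw [SimpleGraph.dist_self] at *
      omega
    obtain ⟨z'', hz'', hd'⟩ := hK.exists_adj_dist hvz'
    have t3 := hK.dist_adj x hz''
    rw [c x z'', c x z'] at t3
    have t4 := hK.connected.dist_triangle (u := v) (v := z'') (w := x)
    have i2 := ih _ (by omega) z'' (by omega) rfl
    obtain ⟨y, hs, hy⟩ := hK.quadrangle P hz'.symm hz'' (fun e => by subst e; omega)
      (by omega) (by omega)
    have t5 := hK.dist_adj v hs.2.1
    have t6 := hK.dist_adj v hs.2.2.1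
    have t7 := hK.dist_adj x hs.2.1
    rw [c x y, c x z] at t7
    have t8 := hK.connected.dist_triangle (u := v) (v := y) (w := x)
    have i3 := ih _ (by omega) y (by omega) rfl
    omega

/-- If the sets at v and x agree, none of their members separates v from x, so d(P, x) = d(P, v) +
d(v, x). By symmetry d(v, x) = 0. This is what bounds the multiplicities of the eigenvalues. -/
theorem downSet_injective (hK : K.IsCAT0) (P : V) : Function.Injective (K.downSet P) := by
  have key : ∀ v x, K.downSet P v = K.downSet P x →
      K.graph.dist P x = K.graph.dist P v + K.graph.dist v x := by
    intro v x hvx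
    refine dist_eq_add_of_no_common hK (x := x) (fun a ha hlt => ?_) x (by simp)
    obtain ⟨H, hH⟩ := exists_crosses_of_adj ha
    have h1 : H.Separates v P := (hH.separates_iff hK P).2 hlt
    have h2 : H ∈ K.downSet P x := hvx ▸ ⟨h1, a, hH⟩
    by_contra hcon
    have h3 : K.graph.dist x a < K.graph.dist x v := by
      have := hK.dist_lt_or_gt x ha
      omega
    have h4 := (hH.separates_iff hK x).2 h3
    have h5 := separates_trans_iff hK H v x P
    have h6 := h2.1
    tauto
  intro v x hvx
  have h1 := key v x hvx
  have h2 := key x v hvx.symm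
  exact hK.connected.dist_eq_zero_iff.1 (by omega)

end CubeComplex
end

noncomputable section
namespace CubeComplex
variable {V : Type*} {K : CubeComplex V}

/-! ## The distances from the base vertex to the hyperplanes -/

/-- The vertex `b` of the cube, as a point of Euclidean space. -/
def vertexPoint {n : ℕ} (b : Fin n → Bool) : EuclideanSpace ℝ (Fin n) :=
  WithLp.toLp 2 fun i => if b i then 1 else 0

theorem vertexPoint_mem {n : ℕ} (b : Fin n → Bool) (i : Fin n) :
    vertexPoint b i ∈ Set.Icc (0 : ℝ) 1 := by
  simp only [vertexPoint]
  split_ifs <;> simp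

/-- The multilinear weight of the vertex `b` at the point `x`. -/
def vertexWeight {n : ℕ} (x : EuclideanSpace ℝ (Fin n)) (b : Fin n → Bool) : ℝ :=
  ∏ i, if b i then x i else 1 - x i

theorem vertexWeight_vertexPoint {n : ℕ} (b b' : Fin n → Bool) :
    vertexWeight (vertexPoint b) b' = if b' = b then 1 else 0 := by
  split_ifs with h
  · subst h
    refine Finset.prod_eq_one fun i _ => ?_
    cases hb : b' i <;> simp [vertexPoint, hb]
  · obtain ⟨i, hi⟩ := Function.ne_iff.1 h
    refine Finset.prod_eq_zero (Finset.mem_univ i) ?_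
    cases hb : b i <;> cases hb' : b' i <;> simp_all [vertexPoint]

theorem sum_vertexWeight {n : ℕ} (x : EuclideanSpace ℝ (Fin n)) :
    ∑ b : Fin n → Bool, vertexWeight x b = 1 := by
  have := Finset.prod_univ_sum (R := ℝ) (fun _ : Fin n => (Finset.univ : Finset Bool))
    (fun i c => if c then x i else 1 - x i)
  simp only [Fintype.univ_bool, Finset.mem_singleton, Bool.true_eq_false, not_false_eq_true,
    Finset.sum_insert, if_true, Finset.sum_singleton, Bool.false_eq_true, if_false,
    add_sub_cancel, Finset.prod_const_one] at this
  rw [this]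
  refine Finset.sum_congr ?_ fun _ _ => rfl
  ext b
  simp

theorem vertexWeight_nonneg {n : ℕ} {x : EuclideanSpace ℝ (Fin n)}
    (hx : ∀ i, x i ∈ Set.Icc (0 : ℝ) 1) (b : Fin n → Bool) : 0 ≤ vertexWeight x b := by
  refine Finset.prod_nonneg fun i _ => ?_
  have := hx i
  split_ifs
  · exact this.1
  · linarith [this.2]

theorem abs_prod_sub_prod_le {ι : Type*} (s : Finset ι) (f g : ι → ℝ)
    (hf : ∀ i ∈ s, f i ∈ Set.Icc (0 : ℝ) 1) (hg : ∀ i ∈ s, g i ∈ Set.Icc (0 : ℝ) 1) :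
    |∏ i ∈ s, f i - ∏ i ∈ s, g i| ≤ ∑ i ∈ s, |f i - g i| := by
  classical
  induction s using Finset.induction_on with
  | empty => simp
  | insert i s hi ih =>
    rw [Finset.prod_insert hi, Finset.prod_insert hi, Finset.sum_insert hi]
    have h1 := ih (fun j hj => hf j (Finset.mem_insert_of_mem hj))
      fun j hj => hg j (Finset.mem_insert_of_mem hj)
    have h2 := hf i (Finset.mem_insert_self _ _)
    have h3 : |∏ j ∈ s, g j| ≤ 1 := by
      rw [abs_of_nonneg (Finset.prod_nonneg fun j hj => (hg j (Finset.mem_insert_of_mem hj)).1)]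
      exact Finset.prod_le_one (fun j hj => (hg j (Finset.mem_insert_of_mem hj)).1)
        fun j hj => (hg j (Finset.mem_insert_of_mem hj)).2
    have e : f i * ∏ j ∈ s, f j - g i * ∏ j ∈ s, g j =
      f i * (∏ j ∈ s, f j - ∏ j ∈ s, g j) + (f i - g i) * ∏ j ∈ s, g j := by ring
    rw [e]
    refine (abs_add_le _ _).trans ?_
    rw [abs_mul, abs_mul, add_comm]
    refine add_le_add ?_ ?_
    · exact mul_le_of_le_one_right (abs_nonneg _) h3
    · refine le_trans (mul_le_of_le_one_left (abs_nonneg _) ?_) h1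
      rw [abs_of_nonneg h2.1]; exact h2.2

theorem abs_vertexWeight_sub_le {n : ℕ} {x y : EuclideanSpace ℝ (Fin n)}
    (hx : ∀ i, x i ∈ Set.Icc (0 : ℝ) 1) (hy : ∀ i, y i ∈ Set.Icc (0 : ℝ) 1) (b : Fin n → Bool) :
    |vertexWeight x b - vertexWeight y b| ≤ n * dist x y := by
  have key : ∀ x : EuclideanSpace ℝ (Fin n), (∀ i, x i ∈ Set.Icc (0 : ℝ) 1) →
      ∀ i ∈ Finset.univ, (if b i then x i else 1 - x i) ∈ Set.Icc (0 : ℝ) 1 := by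
    intro x hx i _
    have := hx i
    split_ifs
    · exact this
    · exact ⟨by linarith [this.2], by linarith [this.1]⟩
  refine (abs_prod_sub_prod_le _ _ _ (key x hx) (key y hy)).trans ?_
  have : ∀ i ∈ (Finset.univ : Finset (Fin n)),
      |(if b i then x i else 1 - x i) - (if b i then y i else 1 - y i)| ≤ dist x y := by
    intro i _
    have h1 : |x i - y i| ≤ dist x y := by
      rw [dist_eq_norm]
      exact PiLp.norm_apply_le (x - y) i
    split_ifs
    · exact h1
    · rw [show 1 - x i - (1 - y i) = -(x i - y i) by ring, abs_neg]; exact h1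
  refine (Finset.sum_le_sum this).trans ?_
  simp

theorem cubePoint_apply {n : ℕ} {ψ : (Fin n → Bool) → V} (hψ : Function.Injective ψ)
    (x : EuclideanSpace ℝ (Fin n)) (b : Fin n → Bool) : cubePoint ψ x (ψ b) = vertexWeight x b := by
  classical
  rw [cubePoint, Finset.sum_apply, Finset.sum_eq_single b]
  · simp [vertexWeight]
  · intro b' _ hb
    have : ψ b ≠ ψ b' := fun h => hb (hψ h).symm
    simp [this]
  · simp

theorem cubePoint_apply_of_notMem {n : ℕ} {ψ : (Fin n → Bool) → V}
    (x : EuclideanSpace ℝ (Fin n)) {v : V} (hv : v ∉ Set.range ψ) : cubePoint ψ x v = 0 := by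
  classical
  rw [cubePoint, Finset.sum_apply]
  refine Finset.sum_eq_zero fun b _ => ?_
  have : v ≠ ψ b := fun h => hv ⟨b, h.symm⟩
  simp [this]

open Classical in
theorem cubePoint_vertexPoint {n : ℕ} {ψ : (Fin n → Bool) → V} (hψ : Function.Injective ψ)
    (b : Fin n → Bool) : cubePoint ψ (vertexPoint b) = Pi.single (ψ b) 1 := by
  funext v
  by_cases hv : v ∈ Set.range ψ
  · obtain ⟨b', rfl⟩ := hv
    rw [cubePoint_apply hψ, vertexWeight_vertexPoint]
    by_cases h : b' = b
    · simp [h]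
    · have : ψ b' ≠ ψ b := fun e => h (hψ e)
      simp [h, this]
  · rw [cubePoint_apply_of_notMem _ hv, Pi.single_eq_of_ne]
    rintro rfl
    exact hv ⟨_, rfl⟩

theorem dist_vertexPoint_flipAt {n : ℕ} (b : Fin n → Bool) (i : Fin n) :
    dist (vertexPoint b) (vertexPoint (flipAt i b)) = 1 := by
  rw [EuclideanSpace.dist_eq, Finset.sum_eq_single i]
  · simp only [vertexPoint, flipAt_same]
    cases b i <;> simp
  · intro j _ hj
    simp [vertexPoint, flipAt_of_ne hj]
  · simp

open Classical in
theorem segmentLength_of_adj {u v : V} (h : K.graph.Adj u v) :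
    K.SegmentLength (Pi.single u 1) (Pi.single v 1) 1 := by
  obtain ⟨n, ψ, hψ, hr⟩ := K.exists_chart _ h.2
  obtain ⟨b, rfl⟩ : u ∈ Set.range ψ := by rw [hr]; simp
  obtain ⟨b', rfl⟩ : v ∈ Set.range ψ := by rw [hr]; simp
  obtain ⟨i, rfl⟩ := hψ.adj_iff.1 h
  exact ⟨n, ψ, vertexPoint b, vertexPoint (flipAt i b), hr ▸ h.2, hψ, vertexPoint_mem _,
    vertexPoint_mem _, (cubePoint_vertexPoint hψ.1 _).symm, (cubePoint_vertexPoint hψ.1 _).symm,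
    (dist_vertexPoint_flipAt b i).symm⟩

open Classical in
theorem exists_segmentLength_of_crosses {H : K.Hyperplane} {u v : V} (h : H.Crosses u v) :
    ∃ q ∈ H.points, ∃ ℓ, K.SegmentLength (Pi.single u 1) q ℓ := by
  obtain ⟨n, ψ, hψ, hr⟩ := K.exists_chart _ h.adj.2
  obtain ⟨b, rfl⟩ : u ∈ Set.range ψ := by rw [hr]; simp
  obtain ⟨b', rfl⟩ : v ∈ Set.range ψ := by rw [hr]; simp
  obtain ⟨i, rfl⟩ := hψ.adj_iff.1 h.adj
  let x : EuclideanSpace ℝ (Fin n) :=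
    WithLp.toLp 2 (Function.update (fun i => if b i then 1 else 0) i (1 / 2))
  have hx : ∀ j, x j ∈ Set.Icc (0 : ℝ) 1 := by
    intro j
    by_cases hj : j = i
    · subst hj; simp only [x, Function.update_self]; norm_num
    · simp only [x, Function.update_of_ne hj]
      split_ifs <;> simp
  exact ⟨cubePoint ψ x, ⟨n, ψ, x, i, b, hr ▸ h.adj.2, hψ, hx, h, by simp [x], rfl⟩, _,
    n, ψ, vertexPoint b, x, hr ▸ h.adj.2, hψ, vertexPoint_mem _, hx,
    (cubePoint_vertexPoint hψ.1 _).symm, rfl, rfl⟩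

theorem SegmentLength.nonneg {p q : V → ℝ} {ℓ : ℝ} (h : K.SegmentLength p q ℓ) : 0 ≤ ℓ := by
  obtain ⟨n, ψ, x, y, -, -, -, -, -, -, rfl⟩ := h
  exact dist_nonneg

theorem PathLength.nonneg {p q : V → ℝ} {ℓ : ℝ} (h : K.PathLength p q ℓ) : 0 ≤ ℓ := by
  induction h with
  | nil => exact le_rfl
  | cons h _ ih => exact add_nonneg h.nonneg ih

open Classical in
/-- The lengths of the paths from `P` to `H`. -/
def pathLengths (P : V) (H : K.Hyperplane) : Set ℝ :=
  {ℓ | ∃ q ∈ H.points, K.PathLength (Pi.single P 1) q ℓ}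

theorem bddBelow_pathLengths (P : V) (H : K.Hyperplane) : BddBelow (pathLengths P H) :=
  ⟨0, by rintro ℓ ⟨q, -, h⟩; exact h.nonneg⟩

theorem distWeight_nonneg (P : V) (H : K.Hyperplane) : 0 ≤ distWeight P H :=
  Real.sInf_nonneg (by rintro ℓ ⟨q, -, h⟩; exact h.nonneg)

theorem pathLengths_of_adj {P Q : V} (h : K.graph.Adj P Q) {H : K.Hyperplane} {ℓ : ℝ}
    (hℓ : ℓ ∈ pathLengths Q H) : 1 + ℓ ∈ pathLengths P H := by
  obtain ⟨q, hq, hp⟩ := hℓ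
  exact ⟨q, hq, .cons (segmentLength_of_adj h) hp⟩

theorem pathLengths_nonempty (hK : K.IsCAT0) (P : V) (H : K.Hyperplane) :
    (pathLengths P H).Nonempty := by
  obtain ⟨u, v, huv⟩ := H.exists_crosses
  obtain ⟨p⟩ := hK.connected P u
  induction p with
  | nil =>
    obtain ⟨q, hq, ℓ, h⟩ := exists_segmentLength_of_crosses huv
    exact ⟨_, q, hq, .cons h (.nil _)⟩
  | cons h _ ih =>
    obtain ⟨ℓ, hℓ⟩ := ih huv
    exact ⟨_, pathLengths_of_adj h hℓ⟩

theorem distWeight_le_of_walk (hK : K.IsCAT0) {P Q : V} (p : K.graph.Walk P Q)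
    (H : K.Hyperplane) : distWeight P H ≤ p.length + distWeight Q H := by
  induction p with
  | nil => simp
  | @cons u v w h p ih =>
    have h1 : distWeight u H ≤ 1 + distWeight v H := by
      rw [← sub_le_iff_le_add']
      refine le_csInf (pathLengths_nonempty hK v H) fun ℓ hℓ => ?_
      rw [sub_le_iff_le_add']
      exact csInf_le (bddBelow_pathLengths u H) (pathLengths_of_adj h hℓ)
    rw [SimpleGraph.Walk.length_cons]
    push_cast
    linarith

/-- A path from Q to H is prolonged by a fixed edge path from P to Q. The bound is uniform in H,
which is what makes the commutators with the group bounded. -/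
theorem exists_abs_distWeight_sub_le (hK : K.IsCAT0) (P Q : V) :
    ∃ M : ℝ, ∀ H : K.Hyperplane, |distWeight P H - distWeight Q H| ≤ M := by
  obtain ⟨p⟩ := hK.connected P Q
  refine ⟨p.length, fun H => abs_sub_le_iff.2 ⟨?_, ?_⟩⟩
  · linarith [distWeight_le_of_walk hK p H]
  · have := distWeight_le_of_walk hK p.reverse H
    rw [SimpleGraph.Walk.length_reverse] at this
    linarith

theorem dist_chart_le (hK : K.IsCAT0) {n : ℕ} {ψ : (Fin n → Bool) → V}
    (hψ : IsCubeChart K.cubes ψ) (b b' : Fin n → Bool) : K.graph.dist (ψ b) (ψ b') ≤ n := by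
  classical
  suffices H : ∀ s : Finset (Fin n), ∀ b', (∀ i ∉ s, b i = b' i) →
      K.graph.dist (ψ b) (ψ b') ≤ s.card by
    simpa using H Finset.univ b' (by simp)
  intro s
  induction s using Finset.induction_on with
  | empty =>
    intro b' h
    rw [show b = b' from funext fun i => h i (by simp)]
    simp
  | insert i s hi ih =>
    intro b' h
    rw [Finset.card_insert_of_notMem hi]
    by_cases hb : b i = b' i
    · refine (ih b' fun j hj => ?_).trans (Nat.le_succ _)
      by_cases hji : j = i
      · rw [hji, hb]
      · exact h j (by simp [hji, hj])
    · have h1 := ih (flipAt i b') fun j hj => by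
        by_cases hji : j = i
        · subst hji
          rw [flipAt_same]
          cases h1 : b j <;> cases h2 : b' j <;> simp_all
        · rw [flipAt_of_ne hji]; exact h j (by simp [hji, hj])
      have h2 : K.graph.dist (ψ (flipAt i b')) (ψ b') = 1 :=
        SimpleGraph.dist_eq_one_iff_adj.2 (hψ.adj_iff.2 ⟨i, (flipAt_flipAt i b').symm⟩)
      have h3 := hK.connected.dist_triangle (u := ψ b) (v := ψ (flipAt i b')) (w := ψ b')
      omega

theorem BoundedGeometry.exists_dim_le (hb : K.BoundedGeometry) :
    ∃ N : ℕ, ∀ (n : ℕ) (ψ : (Fin n → Bool) → V), IsCubeChart K.cubes ψ → n ≤ N := by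
  obtain ⟨N, hN⟩ := hb
  refine ⟨N, fun n ψ hψ => ?_⟩
  have h1 : (Set.range fun i => ψ (flipAt i fun _ => false)).encard = n := by
    rw [← Set.image_univ, Function.Injective.encard_image]
    · simp
    · exact fun i j h => flipAt_injective (hψ.1 h)
  have h2 : (Set.range fun i => ψ (flipAt i fun _ => false)) ⊆
      K.graph.neighborSet (ψ fun _ => false) := by
    rintro _ ⟨i, rfl⟩
    exact hψ.adj_iff.2 ⟨i, rfl⟩
  have h3 := (Set.encard_le_encard h2).trans (hN _)
  rw [h1] at h3
  exact_mod_cast h3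

/-- The multilinear extension of the distance from `P` in the 1-skeleton. -/
def distExt (K : CubeComplex V) (P : V) (p : V → ℝ) : ℝ := ∑ᶠ v, p v * K.graph.dist P v

theorem distExt_cubePoint (P : V) {n : ℕ} {ψ : (Fin n → Bool) → V} (hψ : Function.Injective ψ)
    (x : EuclideanSpace ℝ (Fin n)) :
    K.distExt P (cubePoint ψ x) = ∑ b, vertexWeight x b * K.graph.dist P (ψ b) := by
  classical
  rw [distExt, finsum_eq_sum_of_support_subset (s := Finset.univ.image ψ)]
  · rw [Finset.sum_image fun a _ b _ h => hψ h]
    exact Finset.sum_congr rfl fun b _ => by rw [cubePoint_apply hψ]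
  · intro v hv
    by_contra h
    refine hv ?_
    change cubePoint ψ x v * _ = 0
    rw [cubePoint_apply_of_notMem, zero_mul]
    simpa using h

/-- A crude Lipschitz estimate that compares the path metric of the complex with the distance in the
1-skeleton, without using geodesics of the former. -/
theorem distExt_sub_le (hK : K.IsCAT0) {N : ℕ}
    (hN : ∀ (n : ℕ) (ψ : (Fin n → Bool) → V), IsCubeChart K.cubes ψ → n ≤ N)
    (P : V) {p q : V → ℝ} {ℓ : ℝ} (h : K.SegmentLength p q ℓ) :
    K.distExt P q ≤ K.distExt P p + 2 ^ N * (N * N) * ℓ := by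
  obtain ⟨n, ψ, x, y, -, hψ, hx, hy, rfl, rfl, rfl⟩ := h
  rw [distExt_cubePoint P hψ.1, distExt_cubePoint P hψ.1, ← sub_le_iff_le_add']
  let b₀ : Fin n → Bool := fun _ => false
  -- The weights sum to 1 at both points, so the value at a reference vertex may be subtracted. Each
  -- of the at most 2 ^ N terms is then a weight difference of size at most N ℓ times a distance
  -- difference of size at most N.
  have e : ∑ b, vertexWeight y b * (K.graph.dist P (ψ b) : ℝ) -
      ∑ b, vertexWeight x b * (K.graph.dist P (ψ b) : ℝ) =
      ∑ b, (vertexWeight y b - vertexWeight x b) *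
        ((K.graph.dist P (ψ b) : ℝ) - K.graph.dist P (ψ b₀)) := by
    simp only [mul_sub, sub_mul, Finset.sum_sub_distrib, ← Finset.sum_mul, sum_vertexWeight]
    ring
  rw [e]
  have hnN : (n : ℝ) ≤ N := by exact_mod_cast hN n ψ hψ
  have key : ∀ b ∈ (Finset.univ : Finset (Fin n → Bool)),
      (vertexWeight y b - vertexWeight x b) *
        ((K.graph.dist P (ψ b) : ℝ) - K.graph.dist P (ψ b₀)) ≤ N * dist x y * N := by
    intro b _
    refine (le_abs_self _).trans ?_
    rw [abs_mul]
    refine mul_le_mul ?_ ?_ (abs_nonneg _) (by positivity)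
    · rw [abs_sub_comm]
      exact (abs_vertexWeight_sub_le hx hy b).trans (by gcongr)
    · refine le_trans ?_ hnN
      have h1 := dist_chart_le hK hψ b b₀
      have h2 := hK.connected.dist_triangle (u := P) (v := ψ b₀) (w := ψ b)
      have h3 := hK.connected.dist_triangle (u := P) (v := ψ b) (w := ψ b₀)
      rw [SimpleGraph.dist_comm (u := ψ b₀)] at h2
      rw [abs_sub_le_iff]
      constructor
      · rw [sub_le_iff_le_add]; norm_cast; omega
      · rw [sub_le_iff_le_add]; norm_cast; omega
  refine (Finset.sum_le_sum key).trans ?_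
  rw [Finset.sum_const, nsmul_eq_mul, Finset.card_univ]
  have hcard : ((Fintype.card (Fin n → Bool) : ℕ) : ℝ) ≤ 2 ^ N := by
    simp only [Fintype.card_pi, Fintype.card_bool, Finset.prod_const, Finset.card_univ,
      Fintype.card_fin]
    exact_mod_cast Nat.pow_le_pow_right (by norm_num) (hN n ψ hψ)
  calc _ ≤ 2 ^ N * (N * dist x y * N) := by gcongr
    _ = _ := by ring

theorem BoundedGeometry.finite_ball (hb : K.BoundedGeometry) (hK : K.IsCAT0) (P : V) (r : ℕ) :
    {v | K.graph.dist P v ≤ r}.Finite := by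
  induction r with
  | zero =>
    refine (Set.finite_singleton P).subset fun v hv => ?_
    exact (hK.connected.dist_eq_zero_iff.1 (Nat.le_zero.1 hv)).symm
  | succ r ih =>
    refine ((Set.finite_singleton P).union
      (ih.biUnion fun v _ => hb.finite_neighborSet v)).subset fun v hv => ?_
    by_cases h : P = v
    · exact Or.inl h.symm
    · obtain ⟨a, ha, hd⟩ := hK.exists_adj_dist h
      refine Or.inr (Set.mem_biUnion (x := a) ?_ ha.symm)
      have : K.graph.dist P v ≤ r + 1 := hv
      change K.graph.dist P a ≤ r
      omega

/-- Only finitely many hyperplanes lie within a given distance of the base vertex. -/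
theorem finite_distWeight_le (hK : K.IsCAT0) (hb : K.BoundedGeometry) (P : V) (R : ℝ) :
    {H : K.Hyperplane | distWeight P H ≤ R}.Finite := by
  classical
  obtain ⟨N, hN⟩ := hb.exists_dim_le
  set L : ℝ := 2 ^ N * (N * N) with hL
  have hL0 : 0 ≤ L := by positivity
  have hF : {H : K.Hyperplane | ∃ v ∈ {v | K.graph.dist P v ≤ ⌈L * (R + 1)⌉₊},
      ∃ a, H.Crosses v a}.Finite := by
    have : {H : K.Hyperplane | ∃ v ∈ {v | K.graph.dist P v ≤ ⌈L * (R + 1)⌉₊},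
        ∃ a, H.Crosses v a} ⊆ ⋃ v ∈ {v | K.graph.dist P v ≤ ⌈L * (R + 1)⌉₊},
          ⋃ a ∈ K.graph.neighborSet v, {H : K.Hyperplane | H.Crosses v a} := by
      rintro H ⟨v, hv, a, ha⟩
      simp only [Set.mem_iUnion]
      exact ⟨v, hv, a, ha.adj, ha⟩
    refine Set.Finite.subset ?_ this
    exact (hb.finite_ball hK P _).biUnion fun v _ => (hb.finite_neighborSet v).biUnion
      fun a _ => Set.Subsingleton.finite fun H h H' h' => h.eq h'
  -- It remains to find, for a hyperplane within distance R, an edge that crosses it at a vertex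
  -- within edge distance L (R + 1) of P.
  refine hF.subset fun H hH => ?_
  obtain ⟨ℓ, ⟨q, hq, hp⟩, hℓ⟩ := exists_lt_of_csInf_lt (pathLengths_nonempty hK P H)
    (show sInf (pathLengths P H) < R + 1 from lt_of_le_of_lt hH (by linarith))
  have h1 : ∀ {p q : V → ℝ} {ℓ : ℝ}, K.PathLength p q ℓ →
      K.distExt P q ≤ K.distExt P p + L * ℓ := by
    intro p q ℓ h
    induction h with
    | nil => simp
    | cons h _ ih =>
      have := distExt_sub_le hK hN P h
      rw [← hL] at this
      linarith
  have h2 : K.distExt P (Pi.single P 1) = 0 := by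
    rw [distExt, finsum_eq_zero_of_forall_eq_zero]
    intro v
    by_cases h : v = P
    · subst h; simp
    · simp [h]
  have h3 := h1 hp
  rw [h2, zero_add] at h3
  have h4 : K.distExt P q ≤ L * (R + 1) := h3.trans (mul_le_mul_of_nonneg_left hℓ.le hL0)
  obtain ⟨n, ψ, x, i, b, hC, hψ, hx, hc, -, rfl⟩ := hq
  rw [distExt_cubePoint P hψ.1] at h4
  -- The value of `distExt` at the end point is a weighted mean of its values at the vertices of the
  -- cube, so some vertex is not farther than this mean.
  obtain ⟨b', hb'⟩ : ∃ b', (K.graph.dist P (ψ b') : ℝ) ≤ L * (R + 1) := by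
    by_contra hcon
    push Not at hcon
    have h5 : L * (R + 1) = ∑ b, vertexWeight x b * (L * (R + 1)) := by
      rw [← Finset.sum_mul, sum_vertexWeight, one_mul]
    obtain ⟨b₁, hb₁⟩ : ∃ b, 0 < vertexWeight x b := by
      by_contra hneg
      push Not at hneg
      have := Finset.sum_nonpos fun b (_ : b ∈ Finset.univ) => hneg b
      rw [sum_vertexWeight] at this
      linarith
    have h6 : ∑ b, vertexWeight x b * (L * (R + 1)) <
        ∑ b, vertexWeight x b * (K.graph.dist P (ψ b) : ℝ) :=
      Finset.sum_lt_sum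
        (fun b _ => mul_le_mul_of_nonneg_left (hcon b).le (vertexWeight_nonneg hx b))
        ⟨b₁, Finset.mem_univ _, mul_lt_mul_of_pos_left (hcon b₁) hb₁⟩
    linarith
  refine ⟨ψ b', ?_, ?_⟩
  · exact_mod_cast hb'.trans (Nat.le_ceil _)
  · obtain ⟨a, -, ha⟩ := Cube.exists_crosses hK hC
      ⟨_, ⟨_, rfl⟩, _, ⟨_, rfl⟩, hc⟩ (⟨b', rfl⟩ : ψ b' ∈ Set.range ψ)
    exact ⟨a, ha⟩

/-! ## Translates of hyperplanes -/

section Action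

variable {G : Type*} [Group G] [MulAction G V] [K.CubicalAction G]

theorem Hyperplane.Crosses.translate (g : G) {H : K.Hyperplane} {u v : V} (h : H.Crosses u v) :
    (H.translate g).Crosses (g • u) (g • v) := by
  obtain ⟨h, rfl⟩ := h
  exact ⟨smul_adj g h, rfl⟩

theorem Hyperplane.translate_mul (g h : G) (H : K.Hyperplane) :
    H.translate (g * h) = (H.translate h).translate g := by
  obtain ⟨u, v, huv⟩ := H.exists_crosses
  have h1 := huv.translate (g * h)
  rw [mul_smul, mul_smul] at h1
  exact h1.eq ((huv.translate h).translate g)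

theorem Hyperplane.translate_one (H : K.Hyperplane) : H.translate (1 : G) = H := by
  obtain ⟨u, v, huv⟩ := H.exists_crosses
  have h1 := huv.translate (1 : G)
  rw [one_smul, one_smul] at h1
  exact h1.eq huv

theorem Hyperplane.translate_inv_translate (g : G) (H : K.Hyperplane) :
    (H.translate g).translate g⁻¹ = H := by
  rw [← Hyperplane.translate_mul, inv_mul_cancel, Hyperplane.translate_one]

theorem Hyperplane.translate_translate_inv (g : G) (H : K.Hyperplane) :
    (H.translate g⁻¹).translate g = H := by
  rw [← Hyperplane.translate_mul, mul_inv_cancel, Hyperplane.translate_one]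

theorem Hyperplane.translate_separates (g : G) (H : K.Hyperplane) (u v : V) :
    (H.translate g).Separates (g • u) (g • v) ↔ H.Separates u v := by
  have key : ∀ (g : G) (H : K.Hyperplane) {u v : V},
      Relation.ReflTransGen (fun a b => K.graph.Adj a b ∧ ¬ H.Crosses a b) u v →
      Relation.ReflTransGen (fun a b => K.graph.Adj a b ∧ ¬ (H.translate g).Crosses a b)
        (g • u) (g • v) := by
    intro g H u v h
    induction h with
    | refl => exact .refl
    | tail _ h ih =>
      refine ih.tail ⟨smul_adj g h.1, fun hc => h.2 ?_⟩
      have := hc.translate g⁻¹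
      rwa [Hyperplane.translate_inv_translate, inv_smul_smul, inv_smul_smul] at this
  rw [Hyperplane.Separates, Hyperplane.Separates, not_iff_not]
  refine ⟨fun h => ?_, key g H⟩
  have := key g⁻¹ _ h
  rwa [Hyperplane.translate_inv_translate, inv_smul_smul, inv_smul_smul] at this

theorem mem_midSet_smul (g : G) (C : Set V) (H : K.Hyperplane) :
    H ∈ K.midSet (g • C) ↔ H.translate g⁻¹ ∈ K.midSet C := by
  constructor
  · rintro ⟨u, hu, v, hv, h⟩
    exact ⟨_, Set.mem_smul_set_iff_inv_smul_mem.1 hu, _, Set.mem_smul_set_iff_inv_smul_mem.1 hv,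
      h.translate g⁻¹⟩
  · rintro ⟨u, hu, v, hv, h⟩
    refine ⟨g • u, Set.smul_mem_smul_set hu, g • v, Set.smul_mem_smul_set hv, ?_⟩
    have := h.translate g
    rwa [Hyperplane.translate_translate_inv] at this

theorem smul_mem_cubes_iff (g : G) (C : Set V) : g • C ∈ K.cubes ↔ C ∈ K.cubes := by
  refine ⟨fun h => ?_, fun h => CubicalAction.smul_mem g C h⟩
  have := CubicalAction.smul_mem (K := K) g⁻¹ _ h
  rwa [inv_smul_smul] at this

theorem _root_.IsCubeChart.smul (g : G) {n : ℕ} {ψ : (Fin n → Bool) → V}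
    (hψ : IsCubeChart K.cubes ψ) : IsCubeChart K.cubes fun b => g • ψ b := by
  refine ⟨fun b b' h => hψ.1 (MulAction.injective g h), fun A hA => ?_⟩
  have hr : g⁻¹ • A ⊆ Set.range ψ := by
    rintro _ ⟨a, ha, rfl⟩
    obtain ⟨b, rfl⟩ := hA ha
    exact ⟨b, by simp⟩
  rw [← smul_mem_cubes_iff g⁻¹, hψ.2 _ hr]
  refine exists_congr fun F => and_congr_right fun _ => ?_
  rw [show (fun b => g • ψ b) '' F = g • (ψ '' F) by
    rw [← Set.image_smul, Set.image_image]]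
  exact ⟨fun h => by rw [h, smul_inv_smul], fun h => by rw [← h, inv_smul_smul]⟩

theorem cubePoint_smul (g : G) {n : ℕ} {ψ : (Fin n → Bool) → V} (hψ : Function.Injective ψ)
    (x : EuclideanSpace ℝ (Fin n)) :
    cubePoint (fun b => g • ψ b) x = fun v => cubePoint ψ x (g⁻¹ • v) := by
  funext v
  by_cases hv : g⁻¹ • v ∈ Set.range ψ
  · obtain ⟨b, hb⟩ := hv
    rw [← hb, cubePoint_apply hψ, show v = g • ψ b by rw [hb, smul_inv_smul]]
    exact cubePoint_apply (ψ := fun b => g • ψ b) (fun b b' h => hψ (MulAction.injective g h)) x b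
  · rw [cubePoint_apply_of_notMem x hv, cubePoint_apply_of_notMem]
    rintro ⟨b, rfl⟩
    exact hv ⟨b, by simp⟩

theorem pathLengths_translate (g : G) (P : V) (H : K.Hyperplane) :
    pathLengths P H ⊆ pathLengths (g • P) (H.translate g) := by
  have hr : ∀ {n : ℕ} {ψ : (Fin n → Bool) → V}, Set.range ψ ∈ K.cubes →
      Set.range (fun b => g • ψ b) ∈ K.cubes := by
    intro n ψ h
    rw [show (Set.range fun b => g • ψ b) = g • Set.range ψ by
      rw [← Set.image_smul, ← Set.range_comp]; rfl]
    exact CubicalAction.smul_mem g _ h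
  rintro ℓ ⟨q, ⟨n, ψ, x, i, b, h1, h2, h3, h4, h5, rfl⟩, hp⟩
  refine ⟨fun v => cubePoint ψ x (g⁻¹ • v), ⟨n, fun b => g • ψ b, x, i, b, hr h1, h2.smul g, h3,
    h4.translate g, h5, (cubePoint_smul g h2.1 x).symm⟩, ?_⟩
  have key : ∀ {p q : V → ℝ} {ℓ : ℝ}, K.PathLength p q ℓ →
      K.PathLength (fun v => p (g⁻¹ • v)) (fun v => q (g⁻¹ • v)) ℓ := by
    intro p q ℓ h
    induction h with
    | nil => exact .nil _
    | cons h _ ih =>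
      refine .cons ?_ ih
      obtain ⟨n, ψ, x, y, h1, h2, h3, h4, rfl, rfl, h5⟩ := h
      exact ⟨n, fun b => g • ψ b, x, y, hr h1, h2.smul g, h3, h4,
        (cubePoint_smul g h2.1 x).symm, (cubePoint_smul g h2.1 y).symm, h5⟩
  have h6 := key hp
  convert h6 using 1
  classical
  funext v
  by_cases h : v = g • P
  · subst h; simp
  · have : g⁻¹ • v ≠ P := fun e => h (by rw [← e, smul_inv_smul])
    simp [h, this]

theorem distWeight_translate (g : G) (P : V) (H : K.Hyperplane) :
    distWeight (g • P) (H.translate g) = distWeight P H := by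
  refine congrArg sInf (Set.Subset.antisymm ?_ (pathLengths_translate g P H))
  have := pathLengths_translate g⁻¹ (g • P) (H.translate g)
  rwa [inv_smul_smul, Hyperplane.translate_inv_translate] at this

theorem distWeight_translate_inv (g : G) (P : V) (H : K.Hyperplane) :
    distWeight P (H.translate g⁻¹) = distWeight (g • P) H := by
  rw [← distWeight_translate g, Hyperplane.translate_translate_inv]

theorem Cube.isFacet_translate (g : G) {C D : K.Cube} :
    (C.translate g).IsFacet (D.translate g) ↔ C.IsFacet D := by
  have h : ∀ A : Set V, (g • A).ncard = A.ncard := fun A => by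
    rw [← Set.image_smul, Set.ncard_image_of_injective _ (MulAction.injective g)]
  simp only [Cube.IsFacet, Cube.translate, h, Set.smul_set_subset_smul_set_iff]

theorem Cube.translate_inv_translate (g : G) (C : K.Cube) : (C.translate g).translate g⁻¹ = C :=
  Subtype.ext (inv_smul_smul g C.1)

theorem Cube.translate_translate_inv (g : G) (C : K.Cube) : (C.translate g⁻¹).translate g = C :=
  Subtype.ext (smul_inv_smul g C.1)

theorem Cube.mem_SAH_translate (g : G) (P : V) {C : K.Cube} {H : K.Hyperplane} :
    H.translate g ∈ (C.translate g).SAH (g • P) ↔ H ∈ C.SAH P := by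
  have h1 : ∀ C : K.Cube, H.translate g ∈ K.midSet (C.translate g).1 ↔ H ∈ K.midSet C.1 := by
    intro C
    rw [Cube.translate, mem_midSet_smul, Hyperplane.translate_inv_translate]
  have h2 : (H.translate g).Adjacent (C.translate g) ↔ H.Adjacent C := by
    refine and_congr (not_congr (h1 C)) ⟨?_, ?_⟩
    · rintro ⟨D, hD, hH⟩
      obtain ⟨D, rfl⟩ : ∃ D' : K.Cube, D = D'.translate g :=
        ⟨_, (Cube.translate_translate_inv g D).symm⟩
      exact ⟨D, (Cube.isFacet_translate g).1 hD, (h1 D).1 hH⟩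
    · rintro ⟨D, hD, hH⟩
      exact ⟨D.translate g, (Cube.isFacet_translate g).2 hD, (h1 D).2 hH⟩
  refine and_congr h2 ⟨fun h v hv => ?_, fun h v hv => ?_⟩
  · exact (H.translate_separates g v P).1 (h _ (Set.smul_mem_smul_set hv))
  · have h3 := h _ (Set.mem_smul_set_iff_inv_smul_mem.1 hv)
    rw [← H.translate_separates g, smul_inv_smul] at h3
    exact h3

end Action

end CubeComplex
end

noncomputable section

/-! ## Unbounded symmetric operators with a complete system of eigenvectors -/

section LpMap

variable {ι : Type*} {E : ι → Type*} [∀ i, NormedAddCommGroup (E i)]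

theorem memℓp_two_of_norm_le {F : ι → Type*} [∀ i, NormedAddCommGroup (F i)] (f : lp F 2)
    {M : ℝ} {g : ∀ i, E i} (h : ∀ i, ‖g i‖ ≤ M * ‖f i‖) : Memℓp g 2 := by
  rw [memℓp_gen_iff (by norm_num)]
  have h1 := (memℓp_gen_iff (p := 2) (by norm_num)).1 (lp.memℓp f)
  refine Summable.of_nonneg_of_le (fun i => by positivity) (fun i => ?_) (h1.mul_left (M ^ 2))
  have := h i
  simp only [ENNReal.toReal_ofNat, Real.rpow_ofNat] at *
  calc ‖g i‖ ^ 2 ≤ (M * ‖f i‖) ^ 2 := by gcongr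
    _ = _ := by ring

theorem lp_norm_le_of_norm_le {F : ι → Type*} [∀ i, NormedAddCommGroup (F i)] (f : lp F 2)
    {M : ℝ} (hM : 0 ≤ M) (g : lp E 2) (h : ∀ i, ‖g i‖ ≤ M * ‖f i‖) : ‖g‖ ≤ M * ‖f‖ := by
  have h2 : (0 : ℝ) < (2 : ENNReal).toReal := by norm_num
  rw [← Real.rpow_le_rpow_iff (norm_nonneg _) (by positivity) h2,
    lp.norm_rpow_eq_tsum h2, Real.mul_rpow hM (norm_nonneg _), lp.norm_rpow_eq_tsum h2 f,
    ← tsum_mul_left]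
  refine Summable.tsum_le_tsum (fun i => ?_) ((memℓp_gen_iff h2).1 (lp.memℓp g))
    (((memℓp_gen_iff h2).1 (lp.memℓp f)).mul_left _)
  rw [← Real.mul_rpow hM (norm_nonneg _)]
  exact Real.rpow_le_rpow (norm_nonneg _) (h i) h2.le

/-- The diagonal operator on `lp E 2` given by uniformly bounded operators. -/
def lpDiag [∀ i, NormedSpace ℂ (E i)] (T : ∀ i, E i →L[ℂ] E i) (M : ℝ) (hM : ∀ i, ‖T i‖ ≤ M)
    (h0 : 0 ≤ M) : lp E 2 →L[ℂ] lp E 2 :=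
  LinearMap.mkContinuous
    { toFun := fun f => ⟨fun i => T i (f i), memℓp_two_of_norm_le f (M := M) fun i =>
        ((T i).le_opNorm _).trans (mul_le_mul_of_nonneg_right (hM i) (norm_nonneg _))⟩
      map_add' := fun f g => by ext i : 2; exact map_add (T i) _ _
      map_smul' := fun c f => by ext i : 2; exact map_smul (T i) _ _ } M
    fun f => lp_norm_le_of_norm_le f h0 _ fun i =>
      ((T i).le_opNorm _).trans (mul_le_mul_of_nonneg_right (hM i) (norm_nonneg _))

theorem lpDiag_apply [∀ i, NormedSpace ℂ (E i)] (T : ∀ i, E i →L[ℂ] E i) (M : ℝ)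
    (hM : ∀ i, ‖T i‖ ≤ M) (h : 0 ≤ M) (f : lp E 2) (i : ι) :
    lpDiag T M hM h f i = T i (f i) := rfl

theorem norm_lpDiag_le [∀ i, NormedSpace ℂ (E i)] (T : ∀ i, E i →L[ℂ] E i) (M : ℝ)
    (hM : ∀ i, ‖T i‖ ≤ M) (h : 0 ≤ M) : ‖lpDiag T M hM h‖ ≤ M := LinearMap.mkContinuous_norm_le _ h _

end LpMap

variable {H : Type*} [NormedAddCommGroup H] [InnerProductSpace ℂ H]

section HilbertBasis

variable {ι : Type*} (b : HilbertBasis ι ℂ H)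

/-- The diagonal operator in a Hilbert basis with the bounded diagonal entries `a`. -/
def HilbertBasis.diag (a : ι → ℂ) (M : ℝ) (hM : ∀ i, ‖a i‖ ≤ M) (h : 0 ≤ M) : H →L[ℂ] H :=
  (b.repr.symm.toContinuousLinearEquiv : lp (fun _ : ι => ℂ) 2 →L[ℂ] H) ∘L
    lpDiag (fun i => a i • ContinuousLinearMap.id ℂ ℂ) M
      (fun i => by rw [norm_smul]; simpa using hM i) h ∘L
    (b.repr.toContinuousLinearEquiv : H →L[ℂ] lp (fun _ : ι => ℂ) 2)

theorem HilbertBasis.inner_diag (a : ι → ℂ) (M : ℝ) (hM : ∀ i, ‖a i‖ ≤ M) (h : 0 ≤ M) (x : H)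
    (i : ι) : (inner ℂ (b i) (b.diag a M hM h x)) = a i * (inner ℂ (b i) x) := by
  rw [← b.repr_apply_apply, ← b.repr_apply_apply]
  simp [HilbertBasis.diag, lpDiag_apply]

theorem HilbertBasis.norm_diag_le (a : ι → ℂ) (M : ℝ) (hM : ∀ i, ‖a i‖ ≤ M) (h : 0 ≤ M) :
    ‖b.diag a M hM h‖ ≤ M := by
  refine ContinuousLinearMap.opNorm_le_bound _ h fun x => ?_
  have hM' : ∀ i, ‖a i • ContinuousLinearMap.id ℂ ℂ‖ ≤ M := fun i => by
    rw [norm_smul]; simpa using hM i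
  refine (b.repr.symm.norm_map _).le.trans ?_
  change ‖lpDiag (E := fun _ => ℂ) (fun i => a i • ContinuousLinearMap.id ℂ ℂ) M hM' h (b.repr x)‖ ≤ _
  refine (ContinuousLinearMap.le_opNorm _ (b.repr x)).trans ?_
  exact mul_le_mul (norm_lpDiag_le _ _ _ h) (b.repr.norm_map _).le (norm_nonneg _) h

theorem HilbertBasis.ext_inner {x y : H} (h : ∀ i, (inner ℂ (b i) x) = (inner ℂ (b i) y)) : x = y := by
  refine b.repr.injective ?_
  ext i
  rw [b.repr_apply_apply, b.repr_apply_apply, h]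

/-- Truncating to the finitely many entries of modulus at least 1/(n+1) gives finite rank operators
that converge in norm. -/
theorem HilbertBasis.isCompactOperator_diag [CompleteSpace H] (a : ι → ℂ) (M : ℝ)
    (hM : ∀ i, ‖a i‖ ≤ M) (h : 0 ≤ M) (ha : ∀ ε > 0, {i | ε ≤ ‖a i‖}.Finite) :
    IsCompactOperator (b.diag a M hM h) := by
  classical
  have hfin : ∀ s : Finset ι, IsCompactOperator
      (∑ i ∈ s, (a i • (innerSL ℂ (b i)).smulRight (b i)) : H →L[ℂ] H) := by
    intro s
    induction s using Finset.induction_on with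
    | empty => simpa using! isCompactOperator_zero
    | insert i s hi ih =>
      rw [Finset.sum_insert hi]
      refine IsCompactOperator.add ?_ ih
      refine IsCompactOperator.smul ?_ _
      have h1 : IsCompactOperator (innerSL ℂ (b i) : H →L[ℂ] ℂ) :=
        isCompactOperator_of_locallyCompactSpace_dom (innerSL ℂ (b i))
      exact h1.clm_comp (ContinuousLinearMap.smulRight (1 : ℂ →L[ℂ] ℂ) (b i))
  choose! s hs using fun n : ℕ => (ha (1 / ((n : ℝ) + 1)) (by positivity)).exists_finset_coe
  refine isCompactOperator_of_tendsto (l := Filter.atTop)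
    (F := fun n : ℕ => (∑ i ∈ s n, (a i • (innerSL ℂ (b i)).smulRight (b i)) : H →L[ℂ] H)) ?_
    (Filter.Eventually.of_forall fun n => hfin (s n))
  rw [tendsto_iff_norm_sub_tendsto_zero]
  refine squeeze_zero (fun _ => norm_nonneg _) (fun n => ?_) tendsto_one_div_add_atTop_nhds_zero_nat
  have hM' : ∀ i, ‖(if i ∈ s n then 0 else -a i : ℂ)‖ ≤ 1 / ((n : ℝ) + 1) := by
    intro i
    split_ifs with hi
    · simp only [norm_zero]; positivity
    · rw [norm_neg]
      by_contra h
      exact hi (by rw [← Finset.mem_coe, hs]; exact (not_le.1 h).le)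
  have e : (∑ i ∈ s n, (a i • (innerSL ℂ (b i)).smulRight (b i)) : H →L[ℂ] H) - b.diag a M hM h =
      b.diag (fun i => if i ∈ s n then 0 else -a i) _ hM' (by positivity) := by
    ext x
    refine b.ext_inner fun i => ?_
    rw [b.inner_diag]
    simp only [sub_apply, sum_apply, smul_apply, ContinuousLinearMap.smulRight_apply, innerSL_apply_apply,
      inner_sub_right, inner_sum, inner_smul_right, b.inner_diag]
    have := orthonormal_iff_ite.1 b.orthonormal
    simp only [this, mul_ite, mul_one, mul_zero, Finset.sum_ite_eq]
    split_ifs <;> ring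
  rw [e]
  exact b.norm_diag_le _ _ _ (by positivity)

end HilbertBasis

theorem LinearPMap.mem_graph_sum {ι : Type*} {D : H →ₗ.[ℂ] H} (s : Finset ι) (c : ι → ℂ)
    {x y : ι → H} (h : ∀ i ∈ s, (x i, y i) ∈ D.graph) :
    (∑ i ∈ s, c i • x i, ∑ i ∈ s, c i • y i) ∈ D.graph := by
  have : (∑ i ∈ s, c i • x i, ∑ i ∈ s, c i • y i) = ∑ i ∈ s, c i • (x i, y i) := by
    rw [← prod_mk_sum]
    rfl
  rw [this]
  exact Submodule.sum_mem _ fun i hi => Submodule.smul_mem _ _ (h i hi)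

/-- The graph of the closure is stable under continuous maps that preserve the graph. -/
theorem LinearPMap.closure_graph_of_graph {D : H →ₗ.[ℂ] H} (hD : D.IsClosable) (T : H →L[ℂ] H)
    (S : H × H →L[ℂ] H) (h : ∀ x y, (x, y) ∈ D.graph → (T x, S (x, y)) ∈ D.graph) {x y : H}
    (hxy : (x, y) ∈ D.closure.graph) : (T x, S (x, y)) ∈ D.closure.graph := by
  rw [← hD.graph_closure_eq_closure_graph] at hxy ⊢
  exact map_mem_closure (f := fun p : H × H => (T p.1, S p)) (by fun_prop) hxy
    fun p hp => h p.1 p.2 hp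

variable [CompleteSpace H]

/-- A symmetric operator that is diagonal in a Hilbert basis, with eigenvalues going to infinity,
is essentially self-adjoint with compact resolvent. -/
theorem essentiallySelfAdjoint_of_hilbertBasis {ι : Type*} (b : HilbertBasis ι ℂ H) (μ : ι → ℝ)
    (D : H →ₗ.[ℂ] H) (hsym : D.IsFormalAdjoint D) (hb : ∀ i, (b i, (μ i : ℂ) • b i) ∈ D.graph)
    (hfin : ∀ R : ℝ, {i | |μ i| ≤ R}.Finite) :
    IsEssentiallySelfAdjoint D ∧ HasCompactResolvent D.closure := by
  have hdense : Dense (D.domain : Set H) := by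
    rw [Submodule.dense_iff_topologicalClosure_eq_top, eq_top_iff, ← b.dense_span]
    refine Submodule.topologicalClosure_mono (Submodule.span_le.2 ?_)
    rintro _ ⟨i, rfl⟩
    exact LinearPMap.mem_domain_of_mem_graph (hb i)
  have hle : D ≤ D.adjoint := hsym.le_adjoint hdense
  have hclos : D.IsClosable := (LinearPMap.adjoint_isClosed hdense).isClosable.leIsClosable hle
  -- Pairing with the eigenvectors shows that the adjoint acts diagonally on coefficients; below,
  -- the closure contains everything that does.
  have hadj : ∀ x y : H, (x, y) ∈ D.adjoint.graph → ∀ i, (inner ℂ (b i) y) = μ i * (inner ℂ (b i) x) := by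
    intro x y hxy i
    rw [LinearPMap.adjoint_graph_eq_graph_adjoint hdense, Submodule.mem_adjoint_iff] at hxy
    have := hxy _ _ (hb i)
    rw [inner_smul_left, Complex.conj_ofReal] at this
    exact (sub_eq_zero.1 this).symm
  have hcg := hclos.graph_closure_eq_closure_graph
  -- approximation by partial sums
  have happ : ∀ x y : H, (∀ i, (inner ℂ (b i) y) = μ i * (inner ℂ (b i) x)) → (x, y) ∈ D.closure.graph := by
    intro x y hxy
    rw [← hcg]
    have h1 := b.hasSum_repr x
    have h2 := b.hasSum_repr y
    refine mem_closure_of_tendsto (h1.prodMk_nhds h2) (Filter.Eventually.of_forall fun s => ?_)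
    have := LinearPMap.mem_graph_sum s (fun i => b.repr x i) (x := b)
      (y := fun i => (μ i : ℂ) • b i) fun i _ => hb i
    have e : ∑ i ∈ s, b.repr y i • b i = ∑ i ∈ s, b.repr x i • (μ i : ℂ) • b i := by
      refine Finset.sum_congr rfl fun i _ => ?_
      rw [b.repr_apply_apply, b.repr_apply_apply, hxy, smul_smul, mul_comm]
    rw [← e] at this
    exact this
  -- Both are therefore the maximal diagonal operator with the entries μ.
  have heq : D.closure = D.adjoint := by
    refine LinearPMap.eq_of_eq_graph (le_antisymm ?_ ?_)
    · rw [← hcg]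
      exact Submodule.topologicalClosure_minimal _ (LinearPMap.le_graph_of_le hle)
        (LinearPMap.adjoint_isClosed hdense)
    · rintro ⟨x, y⟩ hxy
      exact happ x y (hadj x y hxy)
  have hdense' : Dense (D.closure.domain : Set H) := hdense.mono D.le_closure.1
  have hsa : IsSelfAdjoint D.closure := by
    rw [LinearPMap.isSelfAdjoint_def]
    refine LinearPMap.eq_of_eq_graph ?_
    rw [LinearPMap.adjoint_graph_eq_graph_adjoint hdense']
    conv_rhs => rw [heq, LinearPMap.adjoint_graph_eq_graph_adjoint hdense]
    refine le_antisymm ?_ ?_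
    · intro x hx
      rw [Submodule.mem_adjoint_iff] at hx ⊢
      exact fun a c h => hx a c (LinearPMap.le_graph_of_le D.le_closure h)
    · intro x hx
      rw [Submodule.mem_adjoint_iff] at hx ⊢
      rw [← hcg]
      intro a c h
      have hcl : IsClosed {p : H × H | (inner ℂ p.2 x.1) - (inner ℂ p.1 x.2) = 0} :=
        isClosed_eq (by fun_prop) continuous_const
      exact closure_minimal (s := (D.graph : Set (H × H))) (fun p hp => hx p.1 p.2 hp) hcl h
  refine ⟨⟨hdense, hclos, hsa⟩, fun z hz => ?_⟩
  have hzi : ∀ i, |z.im| ≤ ‖(μ i : ℂ) - z‖ := fun i => by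
    have := Complex.abs_im_le_norm ((μ i : ℂ) - z)
    simpa using this
  have hz0 : 0 < |z.im| := abs_pos.2 hz
  have hne : ∀ i, (μ i : ℂ) - z ≠ 0 := fun i => norm_pos_iff.1 (hz0.trans_le (hzi i))
  have hM : ∀ i, ‖((μ i : ℂ) - z)⁻¹‖ ≤ |z.im|⁻¹ := fun i => by
    rw [norm_inv]
    exact inv_anti₀ hz0 (hzi i)
  refine ⟨b.diag (fun i => ((μ i : ℂ) - z)⁻¹) _ hM (by positivity), b.isCompactOperator_diag _ _ _ _ ?_, ?_, ?_⟩
  · intro ε hε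
    refine (hfin (ε⁻¹ + ‖z‖)).subset fun i hi => ?_
    have h1 : ε ≤ ‖((μ i : ℂ) - z)⁻¹‖ := hi
    rw [norm_inv] at h1
    have h2 : ‖(μ i : ℂ) - z‖ ≤ ε⁻¹ := by
      rw [← inv_inv ‖(μ i : ℂ) - z‖]
      exact inv_anti₀ hε h1
    have h3 := norm_le_norm_sub_add (μ i : ℂ) z
    rw [Complex.norm_real, Real.norm_eq_abs] at h3
    exact h3.trans (by linarith)
  · intro ξ
    set R := b.diag (fun i => ((μ i : ℂ) - z)⁻¹) _ hM (by positivity) with hR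
    have h1 : (R ξ, ξ + z • R ξ) ∈ D.closure.graph := by
      refine happ _ _ fun i => ?_
      rw [inner_add_right, inner_smul_right, hR, b.inner_diag]
      field_simp [hne i]
      ring
    refine ⟨LinearPMap.mem_domain_of_mem_graph h1, ?_⟩
    rw [sub_eq_iff_eq_add]
    obtain ⟨y, hy⟩ := (LinearPMap.mem_graph_iff D.closure).1 h1
    have : y = ⟨R ξ, LinearPMap.mem_domain_of_mem_graph h1⟩ := Subtype.ext hy.1
    rw [← this]; exact hy.2
  · intro ξ
    have h1 : ((ξ : H), D.closure ξ) ∈ D.adjoint.graph := by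
      rw [← heq]
      exact LinearPMap.mem_graph _ ξ
    refine b.ext_inner fun i => ?_
    rw [b.inner_diag, inner_sub_right, inner_smul_right, hadj _ _ h1 i, ← sub_mul,
      inv_mul_cancel_left₀ (hne i)]

/-- A symmetric operator whose square has a complete system of eigenvectors, with finitely many
eigenvalues below each bound, is essentially self-adjoint with compact resolvent. -/
theorem essentiallySelfAdjoint_of_sq {ι : Type*} (D : H →ₗ.[ℂ] H) (hsym : D.IsFormalAdjoint D)
    (φ ψ : ι → H) (lam : ι → ℝ) (h0 : ∀ i, 0 ≤ lam i) (hφ : ∀ i, (φ i, ψ i) ∈ D.graph)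
    (hψ : ∀ i, (ψ i, (lam i : ℂ) • φ i) ∈ D.graph)
    (hd : (Submodule.span ℂ (Set.range φ)).topologicalClosure = ⊤)
    (hfin : ∀ R : ℝ, {i | lam i ≤ R ∧ φ i ≠ 0}.Finite) :
    IsEssentiallySelfAdjoint D ∧ HasCompactResolvent D.closure := by
  have hs : ∀ {x y x' y' : H}, (x, y) ∈ D.graph → (x', y') ∈ D.graph → (inner ℂ y (x')) = (inner ℂ x (y')) := by
    intro x y x' y' h h'
    obtain ⟨a, ha, ha'⟩ := (LinearPMap.mem_graph_iff D).1 h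
    obtain ⟨c, hc, hc'⟩ := (LinearPMap.mem_graph_iff D).1 h'
    simp only at ha ha' hc hc'
    rw [← ha, ← ha', ← hc, ← hc']
    exact hsym a c
  -- The vectors φ i are eigenvectors of the square of D; by symmetry they are orthogonal for
  -- different eigenvalues.
  have hgg : ∀ {i j}, lam i ≠ lam j → (inner ℂ (φ i) (φ j)) = 0 := by
    intro i j hij
    have h1 := hs (hψ i) (hφ j)
    have h2 := hs (hφ i) (hψ j)
    rw [inner_smul_left, Complex.conj_ofReal] at h1
    rw [inner_smul_right] at h2
    have h3 : ((lam i : ℂ) - lam j) * (inner ℂ (φ i) (φ j)) = 0 := by rw [sub_mul, h1, h2, sub_self]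
    rcases mul_eq_zero.1 h3 with h | h
    · exact absurd (by exact_mod_cast sub_eq_zero.1 h) hij
    · exact h
  -- Eigenspaces of D itself; an orthonormal basis is assembled from bases of these.
  let E : ℝ → Submodule ℂ H := fun μ =>
    D.graph.comap (LinearMap.prod LinearMap.id ((μ : ℂ) • LinearMap.id))
  have hE : ∀ {μ : ℝ} {x : H}, x ∈ E μ ↔ (x, (μ : ℂ) • x) ∈ D.graph := Iff.rfl
  have hEφ : ∀ {μ : ℝ} {x : H}, x ∈ E μ → ∀ i, lam i ≠ μ ^ 2 → (inner ℂ (φ i) x) = 0 := by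
    intro μ x hx i hi
    have h1 := hs (hφ i) (hE.1 hx)
    have h2 := hs (hψ i) (hE.1 hx)
    rw [inner_smul_left, Complex.conj_ofReal, inner_smul_right] at h2
    rw [inner_smul_right] at h1
    rw [h1, ← mul_assoc] at h2
    have h3 : ((lam i : ℂ) - μ * μ) * (inner ℂ (φ i) x) = 0 := by rw [sub_mul, h2, sub_self]
    rcases mul_eq_zero.1 h3 with h | h
    · refine absurd ?_ hi
      have := sub_eq_zero.1 h
      rw [pow_two]; exact_mod_cast this
    · exact h
  let W : ℝ → Submodule ℂ H := fun μ =>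
    Submodule.span ℂ (φ '' {i | lam i = μ ^ 2 ∧ φ i ≠ 0})
  have hWfin : ∀ μ, FiniteDimensional ℂ (W μ) := fun μ =>
    FiniteDimensional.span_of_finite ℂ
      (((hfin (μ ^ 2)).subset fun i hi => ⟨hi.1.le, hi.2⟩).image φ)
  -- An eigenvector of D for μ is orthogonal to every φ i with eigenvalue other than μ². Its
  -- component orthogonal to W μ is thus orthogonal to all φ i and vanishes, so E μ is finite
  -- dimensional.
  have hEW : ∀ μ, E μ ≤ W μ := by
    intro μ x hx
    have := hWfin μ
    have h1 : x - (W μ).starProjection x = 0 := by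
      have hdd : Dense ((Submodule.span ℂ (Set.range φ) : Submodule ℂ H) : Set H) :=
        Submodule.dense_iff_topologicalClosure_eq_top.2 hd
      refine hdd.eq_zero_of_inner_left ℂ fun v hv => ?_
      induction hv using Submodule.span_induction with
      | mem v hv =>
        obtain ⟨i, rfl⟩ := hv
        rw [← inner_conj_symm, map_eq_zero]
        by_cases hi : lam i = μ ^ 2
        · by_cases h0 : φ i = 0
          · rw [h0, inner_zero_left]
          · have hm : φ i ∈ W μ := Submodule.subset_span ⟨i, ⟨hi, h0⟩, rfl⟩
            exact Submodule.inner_right_of_mem_orthogonal hm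
              (Submodule.sub_starProjection_mem_orthogonal x)
        · rw [inner_sub_right, hEφ hx i hi, zero_sub, neg_eq_zero]
          have hm : (W μ).starProjection x ∈ W μ := Submodule.starProjection_apply_mem _ x
          generalize (W μ).starProjection x = y at hm
          induction hm using Submodule.span_induction with
          | mem v hv =>
            obtain ⟨j, ⟨hj, -⟩, rfl⟩ := hv
            exact hgg (by rw [hj]; exact hi)
          | zero => simp
          | add x y _ _ hx hy => rw [inner_add_right, hx, hy, add_zero]
          | smul c x _ hx => rw [inner_smul_right, hx, mul_zero]
      | zero => simp
      | add x y _ _ hx hy => rw [inner_add_right, hx, hy, add_zero]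
      | smul c x _ hx => rw [inner_smul_right, hx, mul_zero]
    rw [sub_eq_zero.1 h1]
    exact Submodule.starProjection_apply_mem _ x
  have hEfin : ∀ μ, FiniteDimensional ℂ (E μ) := fun μ => by
    have := hWfin μ
    exact Submodule.finiteDimensional_of_le (hEW μ)
  have horth : OrthogonalFamily ℂ (fun μ => E μ) fun μ => (E μ).subtypeₗᵢ := by
    intro μ ν hμν x y
    have h1 := hs (hE.1 x.2) (hE.1 y.2)
    rw [inner_smul_left, Complex.conj_ofReal, inner_smul_right] at h1
    have h3 : ((μ : ℂ) - ν) * (inner ℂ (x : H) (y : H)) = 0 := by rw [sub_mul, h1, sub_self]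
    rcases mul_eq_zero.1 h3 with h | h
    · exact absurd (by exact_mod_cast sub_eq_zero.1 h) hμν
    · exact h
  let v : (Σ μ : ℝ, Fin (Module.finrank ℂ (E μ))) → H := fun a =>
    (stdOrthonormalBasis ℂ (E a.1) a.2 : H)
  have hv : Orthonormal ℂ v :=
    horth.orthonormal_sigma_orthonormal fun μ => (stdOrthonormalBasis ℂ (E μ)).orthonormal
  have hEv : ∀ μ, E μ ≤ Submodule.span ℂ (Set.range v) := by
    intro μ x hx
    have h1 := (stdOrthonormalBasis ℂ (E μ)).sum_repr ⟨x, hx⟩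
    have h2 : x = ∑ i, (stdOrthonormalBasis ℂ (E μ)).repr ⟨x, hx⟩ i • v ⟨μ, i⟩ := by
      have := congrArg (Subtype.val) h1
      simpa [v] using this.symm
    rw [h2]
    exact Submodule.sum_mem _ fun i _ => Submodule.smul_mem _ _ (Submodule.subset_span ⟨_, rfl⟩)
  have hdense : ⊤ ≤ (Submodule.span ℂ (Set.range v)).topologicalClosure := by
    rw [← hd]
    refine Submodule.topologicalClosure_mono (Submodule.span_le.2 ?_)
    rintro _ ⟨i, rfl⟩
    -- With s² = lam i, the vectors ψ i ± s φ i are eigenvectors of D for ±s, and φ i is a multiple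
    -- of their difference when s ≠ 0. When s = 0, symmetry gives ‖ψ i‖² = 0, so φ i is in the
    -- kernel of D.
    set s := Real.sqrt (lam i) with hsdef
    have hss : (s : ℂ) * s = lam i := by exact_mod_cast Real.mul_self_sqrt (h0 i)
    by_cases hz : lam i = 0
    · have h1 : ψ i = 0 := by
        have := hs (hφ i) (hψ i)
        rw [hz, Complex.ofReal_zero, zero_smul, inner_zero_right] at this
        exact inner_self_eq_zero.1 this
      refine hEv 0 (hE.2 ?_)
      have := hφ i
      rw [h1] at this
      simpa using this
    · have hs0 : (s : ℂ) ≠ 0 := fun h => hz (by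
        have : (lam i : ℂ) = 0 := by rw [← hss, h, zero_mul]
        exact_mod_cast this)
      have h1 : ψ i + (s : ℂ) • φ i ∈ E s := by
        have := add_mem (hψ i) (D.graph.smul_mem (s : ℂ) (hφ i))
        rw [Prod.smul_mk, Prod.mk_add_mk] at this
        rwa [hE, smul_add, smul_smul, hss, add_comm ((s : ℂ) • ψ i)]
      have h2 : ψ i - (s : ℂ) • φ i ∈ E (-s) := by
        have := sub_mem (hψ i) (D.graph.smul_mem (s : ℂ) (hφ i))
        rw [Prod.smul_mk, Prod.mk_sub_mk] at this
        rwa [hE, Complex.ofReal_neg, neg_smul, smul_sub, smul_smul, hss, neg_sub]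
      have h3 : φ i = (2 * (s : ℂ))⁻¹ •
          ((ψ i + (s : ℂ) • φ i) - (ψ i - (s : ℂ) • φ i)) := by
        rw [add_sub_sub_cancel, ← add_smul, smul_smul, ← two_mul, inv_mul_cancel₀
          (mul_ne_zero two_ne_zero hs0), one_smul]
      rw [SetLike.mem_coe, h3]
      exact Submodule.smul_mem _ _ (sub_mem (hEv _ h1) (hEv _ h2))
  refine essentiallySelfAdjoint_of_hilbertBasis (HilbertBasis.mk hv hdense) (fun a => a.1) D hsym
    ?_ ?_
  · intro a
    rw [HilbertBasis.coe_mk]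
    exact hE.1 (stdOrthonormalBasis ℂ (E a.1) a.2).2
  · intro R
    -- A nonzero eigenspace of D for μ requires some φ i ≠ 0 with lam i = μ², so only finitely many
    -- μ with |μ| ≤ R occur.
    have h1 : ((fun i => Real.sqrt (lam i)) '' {i | lam i ≤ R ^ 2 ∧ φ i ≠ 0} ∪
        (fun i => -Real.sqrt (lam i)) '' {i | lam i ≤ R ^ 2 ∧ φ i ≠ 0}).Finite :=
      ((hfin _).image _).union ((hfin _).image _)
    refine Set.Finite.subset (Set.Finite.preimage' h1 (f := Sigma.fst) fun μ _ => ?_) (t := ?_)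
      (s := Sigma.fst ⁻¹' _) ?_
    · refine (Set.finite_range fun k : Fin (Module.finrank ℂ (E μ)) =>
        (⟨μ, k⟩ : Σ μ : ℝ, Fin (Module.finrank ℂ (E μ)))).subset ?_
      rintro ⟨ν, k⟩ rfl
      exact ⟨k, rfl⟩
    rintro ⟨μ, k⟩ hμ
    rw [Set.mem_preimage]
    simp only [Set.mem_ofPred_eq] at hμ
    have h2 : ∃ i, lam i = μ ^ 2 ∧ φ i ≠ 0 := by
      by_contra hcon
      have hemp : {i | lam i = μ ^ 2 ∧ φ i ≠ 0} = ∅ :=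
        Set.eq_empty_iff_forall_notMem.2 fun i hi => hcon ⟨i, hi⟩
      have hbot : W μ = ⊥ := by simp only [W, hemp, Set.image_empty, Submodule.span_empty]
      have hE0 : E μ = ⊥ := by rw [eq_bot_iff, ← hbot]; exact hEW μ
      have : Module.finrank ℂ (E μ) = 0 := by rw [hE0]; simp
      exact (Fin.cast this k).elim0
    obtain ⟨i, hi, hi0⟩ := h2
    have hle : lam i ≤ R ^ 2 := by
      rw [hi, ← sq_abs μ]
      exact pow_le_pow_left₀ (abs_nonneg _) hμ 2
    have hsq : Real.sqrt (lam i) = |μ| := by rw [hi, Real.sqrt_sq_eq_abs]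
    rcases abs_choice μ with h | h
    · exact Or.inl ⟨i, ⟨hle, hi0⟩, by simp only [hsq, h]⟩
    · exact Or.inr ⟨i, ⟨hle, hi0⟩, by simp only [hsq, h, neg_neg]⟩

/-! ### The Koszul sign rule -/

/-- The Koszul sign and coefficient of the step from `I` to `I ∆ {k}`. -/
def koszulCoeff {α : Type*} [LinearOrder α] (a b : α → ℝ) (k : α) (I : Finset α) : ℝ :=
  (-1) ^ (I.filter (· < k)).card * if k ∈ I then b k else a k

/-- Toggling h changes the number of elements below k by one if h < k and not otherwise. Of the two
orders of toggling h and k, exactly one therefore picks up a sign. -/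
theorem koszulCoeff_symmDiff {α : Type*} [LinearOrder α] (a b : α → ℝ) {h k : α} (hk : h ≠ k)
    (I : Finset α) : koszulCoeff a b k (symmDiff I {h}) =
      (if h < k then -1 else 1) * koszulCoeff a b k I := by
  have h1 : k ∈ symmDiff I {h} ↔ k ∈ I := by
    simp [Finset.mem_symmDiff, hk.symm]
  simp only [koszulCoeff, h1]
  rw [← mul_assoc]
  congr 1
  split_ifs with hlt
  · by_cases hI : h ∈ I
    · have e : I.filter (· < k) = insert h ((symmDiff I {h}).filter (· < k)) := by
        ext x
        simp only [Finset.mem_filter, Finset.mem_insert, Finset.mem_symmDiff, Finset.mem_singleton]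
        constructor
        · intro hx
          by_cases hxh : x = h
          · exact Or.inl hxh
          · exact Or.inr ⟨Or.inl ⟨hx.1, hxh⟩, hx.2⟩
        · rintro (rfl | hx)
          · exact ⟨hI, hlt⟩
          · refine ⟨?_, hx.2⟩
            rcases hx.1 with h | h
            exacts [h.1, h.1 ▸ hI]
      rw [e, Finset.card_insert_of_notMem (by simp [Finset.mem_symmDiff, hI]), pow_succ]
      ring
    · have e : (symmDiff I {h}).filter (· < k) = insert h (I.filter (· < k)) := by
        ext x
        simp only [Finset.mem_filter, Finset.mem_insert, Finset.mem_symmDiff, Finset.mem_singleton]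
        constructor
        · intro hx
          tauto
        · rintro (rfl | hx)
          · exact ⟨Or.inr ⟨rfl, hI⟩, hlt⟩
          · exact ⟨Or.inl ⟨hx.1, fun e => hI (e ▸ hx.1)⟩, hx.2⟩
      rw [e, Finset.card_insert_of_notMem (by simp [hI]), pow_succ]
      ring
  · rw [one_mul]
    congr 2
    ext x
    simp only [Finset.mem_filter, Finset.mem_symmDiff, Finset.mem_singleton]
    constructor
    · rintro ⟨hx, hxk⟩
      refine ⟨?_, hxk⟩
      rcases hx with hx | hx
      · exact hx.1
      · exact absurd (hx.1 ▸ hxk) hlt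
    · rintro ⟨hx, hxk⟩
      exact ⟨Or.inl ⟨hx, fun e => hlt (e ▸ hxk)⟩, hxk⟩

theorem koszulCoeff_mul_self {α : Type*} [LinearOrder α] (a b : α → ℝ) (k : α) (I : Finset α) :
    koszulCoeff a b k I * koszulCoeff a b k (symmDiff I {k}) = a k * b k := by
  have h1 : k ∈ symmDiff I {k} ↔ k ∉ I := by simp [Finset.mem_symmDiff]
  have e : (symmDiff I {k}).filter (· < k) = I.filter (· < k) := by
    ext x
    simp only [Finset.mem_filter, Finset.mem_symmDiff, Finset.mem_singleton]
    constructor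
    · rintro ⟨hx, hxk⟩
      have := hxk.ne
      tauto
    · rintro ⟨hx, hxk⟩
      exact ⟨Or.inl ⟨hx, hxk.ne⟩, hxk⟩
  simp only [koszulCoeff, h1, e]
  have hp : ((-1 : ℝ) ^ (I.filter (· < k)).card) * (-1) ^ (I.filter (· < k)).card = 1 := by
    rw [← mul_pow]; norm_num
  by_cases hk : k ∈ I
  · simp only [hk, if_true, not_true, if_false]
    linear_combination a k * b k * hp
  · simp only [hk, if_true, if_false, not_false_iff]
    linear_combination a k * b k * hp

/-- The square of a Koszul-type operator is scalar. -/
theorem koszul_sq {α : Type*} [LinearOrder α] {M : Type*} [AddCommGroup M] [Module ℂ M]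
    (a b : α → ℝ) (Q : Finset α) (X : Finset α → M) (I : Finset α) :
    ∑ k ∈ Q, (koszulCoeff a b k I : ℂ) • ∑ h ∈ Q, (koszulCoeff a b h (symmDiff I {k}) : ℂ) •
      X (symmDiff (symmDiff I {k}) {h}) = ((∑ k ∈ Q, a k * b k : ℝ) : ℂ) • X I := by
  let t : α → α → M := fun k h => (koszulCoeff a b k I : ℂ) •
    (koszulCoeff a b h (symmDiff I {k}) : ℂ) • X (symmDiff (symmDiff I {k}) {h})
  -- The terms for (k, h) and (h, k) lead to the same set with opposite signs, so only the diagonal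
  -- terms survive.
  have ht : ∀ k h, k ≠ h → t k h = -t h k := by
    intro k h hkh
    simp only [t]
    rw [koszulCoeff_symmDiff a b hkh, koszulCoeff_symmDiff a b hkh.symm, symmDiff_right_comm,
      smul_smul, smul_smul, ← neg_smul]
    congr 1
    rcases lt_or_gt_of_ne hkh with hlt | hlt
    · simp only [hlt, if_true, not_lt_of_gt hlt, if_false]
      push_cast; ring
    · simp only [hlt, if_true, not_lt_of_gt hlt, if_false]
      push_cast; ring
  have hd : ∀ k, t k k = ((a k * b k : ℝ) : ℂ) • X I := by
    intro k
    simp only [t]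
    rw [smul_smul, symmDiff_assoc, symmDiff_self, symmDiff_bot, ← Complex.ofReal_mul,
      koszulCoeff_mul_self]
  have h1 : ∑ k ∈ Q, (koszulCoeff a b k I : ℂ) • ∑ h ∈ Q,
      (koszulCoeff a b h (symmDiff I {k}) : ℂ) • X (symmDiff (symmDiff I {k}) {h}) =
      ∑ k ∈ Q, ∑ h ∈ Q, t k h := by
    simp only [Finset.smul_sum, t]
  rw [h1]
  have h2 : ∑ k ∈ Q, ∑ h ∈ Q, (t k h - if k = h then t k k else 0) = 0 := by
    set S := ∑ k ∈ Q, ∑ h ∈ Q, (t k h - if k = h then t k k else 0) with hS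
    have h3 : S = -S := by
      conv_lhs => rw [hS, Finset.sum_comm]
      rw [hS, ← Finset.sum_neg_distrib]
      refine Finset.sum_congr rfl fun k _ => ?_
      rw [← Finset.sum_neg_distrib]
      refine Finset.sum_congr rfl fun h _ => ?_
      by_cases hkh : k = h
      · subst hkh; simp
      · rw [if_neg hkh, if_neg (Ne.symm hkh), sub_zero, sub_zero, ht h k (Ne.symm hkh)]
    have h4 : (2 : ℂ) • S = 0 := by
      rw [two_smul]
      nth_rewrite 1 [h3]
      exact neg_add_cancel S
    exact (smul_eq_zero.1 h4).resolve_left two_ne_zero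
  simp only [Finset.sum_sub_distrib, sub_eq_zero] at h2
  rw [h2]
  push_cast
  rw [Finset.sum_smul]
  refine Finset.sum_congr rfl fun k hk => ?_
  rw [Finset.sum_ite_eq, if_pos hk, hd, Complex.ofReal_mul]

end

noncomputable section

/-! ## Analysis on boxes -/

open MeasureTheory

section Box

variable {ι κ : Type*} [Fintype ι] [Fintype κ]

theorem restrict_box_eq_pi : (volume : Measure (ι → ℝ)).restrict (Set.Icc 0 1) =
    Measure.pi fun _ : ι => (volume : Measure ℝ).restrict (Set.Icc 0 1) := by
  rw [← Measure.restrict_pi_pi, Set.pi_univ_Icc]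
  rfl

instance : IsProbabilityMeasure ((volume : Measure ℝ).restrict (Set.Icc 0 1)) :=
  ⟨by simp⟩

instance : IsProbabilityMeasure ((volume : Measure (ι → ℝ)).restrict (Set.Icc 0 1)) := by
  rw [restrict_box_eq_pi]; infer_instance

/-- The splitting of the last coordinate of a box. -/
def splitBox {ι κ : Type*} (e : Option κ ≃ ι) : (ι → ℝ) ≃ᵐ (κ → ℝ) × ℝ :=
  (MeasurableEquiv.piCongrLeft (fun _ => ℝ) e).symm.trans (MeasurableEquiv.piOptionEquivProd _)

theorem splitBox_apply {ι κ : Type*} (e : Option κ ≃ ι) (x : ι → ℝ) :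
    splitBox e x = (fun k => x (e (some k)), x (e none)) := rfl

theorem measurePreserving_splitBox (e : Option κ ≃ ι) :
    MeasurePreserving (splitBox e) (volume.restrict (Set.Icc 0 1))
      (((volume : Measure (κ → ℝ)).restrict (Set.Icc 0 1)).prod
        ((volume : Measure ℝ).restrict (Set.Icc 0 1))) := by
  simp only [restrict_box_eq_pi]
  have h1 := measurePreserving_piCongrLeft (fun _ : ι => (volume : Measure ℝ).restrict (Set.Icc 0 1)) e
  have h2 : MeasurePreserving (MeasurableEquiv.piOptionEquivProd fun _ : Option κ => ℝ).symm
      ((Measure.pi fun _ : κ => (volume : Measure ℝ).restrict (Set.Icc 0 1)).prod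
        ((volume : Measure ℝ).restrict (Set.Icc 0 1)))
      (Measure.pi fun _ : Option κ => (volume : Measure ℝ).restrict (Set.Icc 0 1)) :=
    ⟨MeasurableEquiv.measurable _,
      Measure.pi_map_piOptionEquivProd fun _ : Option κ => (volume : Measure ℝ).restrict (Set.Icc 0 1)⟩
  exact (h2.symm _).comp (h1.symm _)

theorem measurePreserving_comp_some (e : Option κ ≃ ι) :
    MeasurePreserving (fun (x : ι → ℝ) k => x (e (some k))) (volume.restrict (Set.Icc 0 1))
      ((volume : Measure (κ → ℝ)).restrict (Set.Icc 0 1)) :=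
  measurePreserving_fst.comp (measurePreserving_splitBox e)

theorem integral_box_mul (e : Option κ ≃ ι) (f : (κ → ℝ) → ℂ) (g : ℝ → ℂ) :
    ∫ x in Set.Icc (0 : ι → ℝ) 1, f (fun k => x (e (some k))) * g (x (e none)) =
      (∫ y in Set.Icc (0 : κ → ℝ) 1, f y) * ∫ t in Set.Icc (0 : ℝ) 1, g t := by
  rw [← integral_prod_mul]
  exact (measurePreserving_splitBox e).integral_comp' (g := fun z => f z.1 * g z.2)

theorem measurePreserving_one_sub :
    MeasurePreserving (fun t : ℝ => 1 - t) (volume.restrict (Set.Icc 0 1))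
      (volume.restrict (Set.Icc 0 1)) := by
  have h := (Measure.measurePreserving_sub_left (volume : Measure ℝ) 1).restrict_preimage
    (s := Set.Icc (0 : ℝ) 1) measurableSet_Icc
  have e : (fun t : ℝ => 1 - t) ⁻¹' Set.Icc 0 1 = Set.Icc 0 1 := by
    ext t; simp only [Set.mem_preimage, Set.mem_Icc]; constructor <;> rintro ⟨h1, h2⟩ <;> constructor <;> linarith
  rwa [e] at h

/-- Coordinate permutations composed with coordinate reflections preserve the box. -/
theorem measurePreserving_box_signed (e : κ ≃ ι) (s : κ → Prop) [DecidablePred s] :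
    MeasurePreserving (fun (x : ι → ℝ) k => if s k then 1 - x (e k) else x (e k))
      (volume.restrict (Set.Icc 0 1)) ((volume : Measure (κ → ℝ)).restrict (Set.Icc 0 1)) := by
  simp only [restrict_box_eq_pi]
  have h1 := (measurePreserving_piCongrLeft
    (fun _ : ι => (volume : Measure ℝ).restrict (Set.Icc 0 1)) e).symm
  have h2 := measurePreserving_pi (fun _ : κ => (volume : Measure ℝ).restrict (Set.Icc 0 1))
    (fun _ : κ => (volume : Measure ℝ).restrict (Set.Icc 0 1))
    (f := fun k t => if s k then 1 - t else t) fun k => by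
      by_cases h : s k
      · simpa only [h, if_true] using measurePreserving_one_sub
      · simpa only [h, if_false] using! MeasurePreserving.id _
  exact h2.comp h1

/-- Integration of a partial derivative over a box. -/
theorem integral_box_fderiv_eq_zero [DecidableEq ι] (i : ι) {F : (ι → ℝ) → ℂ} (hF : ContDiff ℝ 1 F)
    (h0 : ∀ x ∈ Set.Icc (0 : ι → ℝ) 1, x i = 0 ∨ x i = 1 → F x = 0) :
    ∫ x in Set.Icc (0 : ι → ℝ) 1, fderiv ℝ F x (Pi.single i 1) = 0 := by
  let e : Option {j // j ≠ i} ≃ ι := Equiv.optionSubtypeNe i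
  have hcont : Continuous fun x => fderiv ℝ F x (Pi.single i 1) :=
    (hF.continuous_fderiv one_ne_zero).clm_apply continuous_const
  have hint : Integrable (fun x => fderiv ℝ F x (Pi.single i 1))
      (volume.restrict (Set.Icc (0 : ι → ℝ) 1)) :=
    hcont.continuousOn.integrableOn_compact isCompact_Icc
  have hp := measurePreserving_splitBox e
  -- Fubini isolates the i-th coordinate; the fundamental theorem of calculus then leaves the values
  -- of F on the two faces, which vanish.
  have h1 : ∫ x in Set.Icc (0 : ι → ℝ) 1, fderiv ℝ F x (Pi.single i 1) =
      ∫ z, fderiv ℝ F ((splitBox e).symm z) (Pi.single i 1)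
        ∂(((volume : Measure ({j // j ≠ i} → ℝ)).restrict (Set.Icc 0 1)).prod
        ((volume : Measure ℝ).restrict (Set.Icc 0 1))) :=
    ((hp.symm _).integral_comp' (g := fun x => fderiv ℝ F x (Pi.single i 1))).symm
  rw [h1, integral_prod]
  swap
  · exact (hp.symm _).integrable_comp_of_integrable hint
  refine setIntegral_eq_zero_of_forall_eq_zero fun y hy => ?_
  have happ : ∀ t j, (splitBox e).symm (y, t) j = if h : j = i then t else y ⟨j, h⟩ := by
    intro t j
    have h2 : splitBox e (fun j => if h : j = i then t else y ⟨j, h⟩) = (y, t) := by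
      rw [splitBox_apply]
      refine Prod.ext (funext fun k => ?_) ?_
      · simp [e, k.2]
      · simp [e]
    rw [← h2, MeasurableEquiv.symm_apply_apply]
  have hd : ∀ t, HasDerivAt (fun t => (splitBox e).symm (y, t)) (Pi.single i 1) t := by
    intro t
    rw [hasDerivAt_pi]
    intro j
    simp only [happ]
    by_cases h : j = i
    · subst h; simpa using hasDerivAt_id' t
    · simpa [h] using hasDerivAt_const t (y ⟨j, h⟩)
  have hd' : ∀ t, HasDerivAt (fun t => F ((splitBox e).symm (y, t)))
      (fderiv ℝ F ((splitBox e).symm (y, t)) (Pi.single i 1)) t := fun t =>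
    ((hF.differentiable one_ne_zero _).hasFDerivAt).comp_hasDerivAt t (hd t)
  have hc : Continuous fun t => (splitBox e).symm (y, t) :=
    continuous_iff_continuousAt.2 fun t => (hd t).continuousAt
  rw [integral_Icc_eq_integral_Ioc, ← intervalIntegral.integral_of_le zero_le_one,
    intervalIntegral.integral_eq_sub_of_hasDerivAt (fun t _ => hd' t)
      ((hcont.comp hc).intervalIntegrable _ _)]
  have hmem : ∀ t ∈ Set.Icc (0 : ℝ) 1, (splitBox e).symm (y, t) ∈ Set.Icc (0 : ι → ℝ) 1 := by
    intro t ht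
    refine ⟨fun j => ?_, fun j => ?_⟩ <;> rw [happ] <;> split_ifs with h
    exacts [ht.1, hy.1 _, ht.2, hy.2 _]
  rw [h0 _ (hmem 1 (by simp)) (Or.inr (by simp [happ])),
    h0 _ (hmem 0 (by simp)) (Or.inl (by simp [happ])), sub_zero]


/-! ### Approximation by trigonometric modes -/

/-- The substitution c = cos(πx) identifies [0,1] with [-1,1], where the Weierstrass theorem
applies. -/
theorem exists_cos_polynomial_near (q : ℝ → ℝ) (hq : Continuous q) {ε : ℝ} (hε : 0 < ε) :
    ∃ p : Polynomial ℝ, ∀ x ∈ Set.Icc (0 : ℝ) 1, |p.eval (Real.cos (Real.pi * x)) - q x| ≤ ε := by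
  obtain ⟨p, hp⟩ := exists_polynomial_near_of_continuousOn (-1) 1
    (fun c => q (Real.arccos c / Real.pi))
    ((hq.comp (Real.continuous_arccos.div_const _)).continuousOn) ε hε
  refine ⟨p, fun x hx => ?_⟩
  have := hp (Real.cos (Real.pi * x)) ⟨Real.neg_one_le_cos _, Real.cos_le_one _⟩
  rw [Real.arccos_cos (by have := Real.pi_pos; nlinarith [hx.1]) (by have := Real.pi_pos; nlinarith [hx.2]),
    mul_div_cancel_left₀ _ Real.pi_ne_zero] at this
  exact this.le

/-- The Dirichlet modes on the unit interval. -/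
def sinMode (m : ℕ) (x : ℝ) : ℝ := Real.sin (m * Real.pi * x)

/-- The modes on the unit interval of `(d/dx + w)` applied to functions with Dirichlet boundary
conditions, together with the solution of the adjoint equation. -/
def cosMode (w : ℝ) (m : ℕ) (x : ℝ) : ℝ :=
  if m = 0 then Real.exp (w * (x - 1))
  else m * Real.pi * Real.cos (m * Real.pi * x) + w * Real.sin (m * Real.pi * x)

theorem contDiff_sinMode (m : ℕ) {n : WithTop ℕ∞} : ContDiff ℝ n (sinMode m) := by
  unfold sinMode; fun_prop

theorem contDiff_cosMode (w : ℝ) (m : ℕ) {n : WithTop ℕ∞} : ContDiff ℝ n (cosMode w m) := by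
  unfold cosMode
  split_ifs <;> fun_prop

/-- By the product-to-sum formula, multiplication by cos(πx) preserves the span of the cosines. -/
theorem cos_polynomial_mem_span (p : Polynomial ℝ) :
    (fun x => p.eval (Real.cos (Real.pi * x))) ∈
      Submodule.span ℝ (Set.range fun (m : ℕ) (x : ℝ) => Real.cos (m * Real.pi * x)) := by
  set S := Submodule.span ℝ (Set.range fun (m : ℕ) (x : ℝ) => Real.cos (m * Real.pi * x))
  have hmul : ∀ f ∈ S, (fun x => f x * Real.cos (Real.pi * x)) ∈ S := by
    intro f hf
    induction hf using Submodule.span_induction with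
    | mem f hf =>
      obtain ⟨m, rfl⟩ := hf
      cases m with
      | zero =>
        refine Submodule.subset_span ⟨1, ?_⟩
        funext x; simp
      | succ m =>
        have h1 : (fun x : ℝ => Real.cos ((m + 2 : ℕ) * Real.pi * x)) ∈ S :=
          Submodule.subset_span ⟨m + 2, rfl⟩
        have h2 : (fun x : ℝ => Real.cos ((m : ℕ) * Real.pi * x)) ∈ S :=
          Submodule.subset_span ⟨m, rfl⟩
        convert S.smul_mem (1 / 2 : ℝ) (add_mem h1 h2) using 1
        funext x
        simp only [Pi.smul_apply, Pi.add_apply, smul_eq_mul]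
        have e1 : ((m + 2 : ℕ) : ℝ) * Real.pi * x = (m + 1 : ℕ) * Real.pi * x + Real.pi * x := by
          push_cast; ring
        have e2 : (m : ℝ) * Real.pi * x = (m + 1 : ℕ) * Real.pi * x - Real.pi * x := by
          push_cast; ring
        rw [e1, e2, Real.cos_add, Real.cos_sub]
        ring
    | zero => convert S.zero_mem using 1; funext x; simp
    | add f g _ _ hf hg => convert add_mem hf hg using 1; funext x; simp [add_mul]
    | smul c f _ hf => convert S.smul_mem c hf using 1; funext x; simp [mul_assoc]
  have hpow : ∀ n : ℕ, (fun x => Real.cos (Real.pi * x) ^ n) ∈ S := by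
    intro n
    induction n with
    | zero => exact Submodule.subset_span ⟨0, by funext x; simp⟩
    | succ n ih => simpa only [pow_succ] using hmul _ ih
  induction p using Polynomial.induction_on' with
  | add p q hp hq => simpa only [Polynomial.eval_add] using! add_mem hp hq
  | monomial n a => simpa only [Polynomial.eval_monomial] using! S.smul_mem a (hpow n)

/-- Again product-to-sum: sin(πx) cos(mπx) is half the difference of two neighbouring sine modes. -/
theorem sin_mul_mem_span {f : ℝ → ℝ}
    (hf : f ∈ Submodule.span ℝ (Set.range fun (m : ℕ) (x : ℝ) => Real.cos (m * Real.pi * x))) :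
    (fun x => Real.sin (Real.pi * x) * f x) ∈ Submodule.span ℝ (Set.range sinMode) := by
  set S := Submodule.span ℝ (Set.range sinMode)
  induction hf using Submodule.span_induction with
  | mem f hf =>
    obtain ⟨m, rfl⟩ := hf
    cases m with
    | zero =>
      refine Submodule.subset_span ⟨1, ?_⟩
      funext x; simp [sinMode]
    | succ m =>
      have h1 : sinMode (m + 2) ∈ S := Submodule.subset_span ⟨m + 2, rfl⟩
      have h2 : sinMode m ∈ S := Submodule.subset_span ⟨m, rfl⟩
      convert S.smul_mem (1 / 2 : ℝ) (sub_mem h1 h2) using 1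
      funext x
      simp only [Pi.smul_apply, Pi.sub_apply, smul_eq_mul, sinMode]
      have e1 : ((m + 2 : ℕ) : ℝ) * Real.pi * x = (m + 1 : ℕ) * Real.pi * x + Real.pi * x := by
        push_cast; ring
      have e2 : (m : ℝ) * Real.pi * x = (m + 1 : ℕ) * Real.pi * x - Real.pi * x := by
        push_cast; ring
      rw [e1, e2, Real.sin_add, Real.sin_sub]
      ring
  | zero => convert S.zero_mem using 1; funext x; simp
  | add f g _ _ hf hg => convert add_mem hf hg using 1; funext x; simp [mul_add]
  | smul c f _ hf => convert S.smul_mem c hf using 1; funext x; simp; ring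

/-- The functions that vanish at the end points are approximated by the sine modes. -/
theorem exists_sinMode_near (q : ℝ → ℝ) (hq : Continuous q) {ε : ℝ} (hε : 0 < ε) :
    ∃ h ∈ Submodule.span ℝ (Set.range sinMode),
      ∀ x ∈ Set.Icc (0 : ℝ) 1, |h x - Real.sin (Real.pi * x) * q x| ≤ ε := by
  obtain ⟨p, hp⟩ := exists_cos_polynomial_near q hq hε
  refine ⟨_, sin_mul_mem_span (cos_polynomial_mem_span p), fun x hx => ?_⟩
  rw [← mul_sub, abs_mul]
  calc _ ≤ 1 * ε := mul_le_mul (Real.abs_sin_le_one _) (hp x hx) (abs_nonneg _) zero_le_one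
    _ = ε := one_mul ε

/-- A combination of cosines is, up to its mean value, the derivative of a combination of sines. -/
theorem exists_primitive_of_mem_span (w : ℝ) {f : ℝ → ℝ}
    (hf : f ∈ Submodule.span ℝ (Set.range fun (m : ℕ) (x : ℝ) => Real.cos (m * Real.pi * x))) :
    ∃ (a : ℝ) (F : ℝ → ℝ), F 0 = 0 ∧ F 1 = 0 ∧ (∀ x, HasDerivAt F (f x - a) x) ∧
      (fun x => f x - a + w * F x) ∈ Submodule.span ℝ (Set.range (cosMode w)) := by
  set S := Submodule.span ℝ (Set.range (cosMode w))
  induction hf using Submodule.span_induction with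
  | mem f hf =>
    obtain ⟨m, rfl⟩ := hf
    by_cases hm : m = 0
    · subst hm
      refine ⟨1, 0, rfl, rfl, fun x => by simp, ?_⟩
      convert S.zero_mem using 1
      funext x; simp
    · have hm' : (m : ℝ) * Real.pi ≠ 0 := mul_ne_zero (by exact_mod_cast hm) Real.pi_ne_zero
      refine ⟨0, fun x => (m * Real.pi)⁻¹ * Real.sin (m * Real.pi * x), by simp, ?_, fun x => ?_, ?_⟩
      · simp [Real.sin_nat_mul_pi]
      · have h1 := ((hasDerivAt_id' x).const_mul (m * Real.pi)).sin.const_mul (m * Real.pi)⁻¹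
        refine h1.congr_deriv ?_
        field_simp
        ring
      · have h1 : cosMode w m ∈ S := Submodule.subset_span ⟨m, rfl⟩
        convert S.smul_mem (m * Real.pi)⁻¹ h1 using 1
        funext x
        simp only [cosMode, hm, if_false, Pi.smul_apply, smul_eq_mul]
        field_simp
        ring
  | zero => exact ⟨0, 0, rfl, rfl, fun x => by simp, by
      convert S.zero_mem using 1; funext x; simp⟩
  | add f g _ _ hf hg =>
    obtain ⟨a, F, h0, h1, h2, h3⟩ := hf
    obtain ⟨b, G, k0, k1, k2, k3⟩ := hg
    refine ⟨a + b, F + G, by simp [h0, k0], by simp [h1, k1], fun x => ?_, ?_⟩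
    · refine ((h2 x).add (k2 x)).congr_deriv ?_
      rw [Pi.add_apply]; ring
    · convert add_mem h3 k3 using 1
      funext x; simp; ring
  | smul c f _ hf =>
    obtain ⟨a, F, h0, h1, h2, h3⟩ := hf
    refine ⟨c * a, c • F, by simp [h0], by simp [h1], fun x => ?_, ?_⟩
    · refine ((h2 x).const_mul c).congr_deriv ?_
      rw [Pi.smul_apply, smul_eq_mul]; ring
    · convert S.smul_mem c h3 using 1
      funext x; simp; ring

/-- Continuous functions are approximated by the cosine modes. -/
theorem exists_cosMode_near (w : ℝ) (q : ℝ → ℝ) (hq : Continuous q) {ε : ℝ} (hε : 0 < ε) :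
    ∃ h ∈ Submodule.span ℝ (Set.range (cosMode w)), ∀ x ∈ Set.Icc (0 : ℝ) 1, |h x - q x| ≤ ε := by
  set S := Submodule.span ℝ (Set.range (cosMode w))
  have hz0 : 0 < ∫ t in (0 : ℝ)..1, Real.exp (2 * w * t) :=
    intervalIntegral.intervalIntegral_pos_of_pos
      ((by fun_prop : Continuous fun t : ℝ => Real.exp (2 * w * t)).intervalIntegrable _ _)
      (fun _ => Real.exp_pos _) zero_lt_one
  set z := ∫ t in (0 : ℝ)..1, Real.exp (2 * w * t) with hz
  -- The function q is split as κ e^{wx} + (F' + w F) with F(0) = F(1) = 0. Solving the equation for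
  -- F with integrating factor e^{wx} shows that this value of κ is the one for which F(1) = 0.
  set κ : ℝ := (∫ t in (0 : ℝ)..1, Real.exp (w * t) * q t) / z with hκ
  let r : ℝ → ℝ := fun t => Real.exp (w * t) * q t - κ * Real.exp (2 * w * t)
  have hr : Continuous r := by fun_prop
  let R : ℝ → ℝ := fun x => ∫ t in (0 : ℝ)..x, r t
  have hR : ∀ x, HasDerivAt R (r x) x := fun x =>
    intervalIntegral.integral_hasDerivAt_right (hr.intervalIntegrable _ _)
      (hr.stronglyMeasurableAtFilter _ _) hr.continuousAt
  have hR1 : R 1 = 0 := by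
    simp only [R, r]
    rw [intervalIntegral.integral_sub, intervalIntegral.integral_const_mul, ← hz, hκ,
      div_mul_cancel₀ _ hz0.ne', sub_self]
    · exact (by fun_prop : Continuous fun t => Real.exp (w * t) * q t).intervalIntegrable _ _
    · exact (by fun_prop : Continuous fun t => κ * Real.exp (2 * w * t)).intervalIntegrable _ _
  let F : ℝ → ℝ := fun x => Real.exp (-(w * x)) * R x
  let F' : ℝ → ℝ := fun x => q x - κ * Real.exp (w * x) - w * F x
  have hRc : Continuous R := continuous_iff_continuousAt.2 fun x => (hR x).continuousAt
  have hF : ∀ x, HasDerivAt F (F' x) x := by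
    intro x
    have h1 := (((hasDerivAt_id' x).const_mul w).neg.exp).mul (hR x)
    refine h1.congr_deriv ?_
    simp only [F', F, r]
    have e1 : Real.exp (2 * w * x) = Real.exp (w * x) * Real.exp (w * x) := by
      rw [← Real.exp_add]; ring_nf
    have e2 : Real.exp (-(w * x)) * Real.exp (w * x) = 1 := by rw [← Real.exp_add]; simp
    rw [e1]
    change Real.exp (-(w * x)) * -(w * 1) * R x + Real.exp (-(w * x)) * _ = _
    linear_combination (q x - κ * Real.exp (w * x)) * e2
  have hFc : Continuous F := by fun_prop
  have hF'c : Continuous F' := by fun_prop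
  -- The errors of F' and of F will each be at most 2δ, so F' + w F is approximated up to 2δ(1 +
  -- |w|) = ε.
  set δ := ε / (2 * (1 + |w|)) with hδ
  have hw : 0 < 1 + |w| := by positivity
  have hδ0 : 0 < δ := by positivity
  obtain ⟨p, hp⟩ := exists_cos_polynomial_near F' hF'c hδ0
  obtain ⟨a, Φ, hΦ0, hΦ1, hΦ, hmem⟩ := exists_primitive_of_mem_span w (cos_polynomial_mem_span p)
  set f : ℝ → ℝ := fun x => p.eval (Real.cos (Real.pi * x)) with hf
  have hfc : Continuous f := by fun_prop
  have hsub : ∀ x, (f x - a) - F' x = (f x - F' x) - a := fun x => by ring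
  have hint : ∀ x ∈ Set.Icc (0 : ℝ) 1, ∀ y, ∀ b : ℝ, (∀ t ∈ Set.Icc (0 : ℝ) 1, |f t - F' t - b| ≤ y) →
      |(Φ x - F x) - (b - a) * x| ≤ y := by
    intro x hx y b hy
    have h1 : ∀ t, HasDerivAt (fun t => (Φ t - F t) - (b - a) * t) (f t - F' t - b) t := by
      intro t
      refine (((hΦ t).sub (hF t)).sub ((hasDerivAt_id' t).const_mul (b - a))).congr_deriv ?_
      ring
    have h2 : (Φ x - F x) - (b - a) * x = ∫ t in (0 : ℝ)..x, (f t - F' t - b) := by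
      rw [intervalIntegral.integral_eq_sub_of_hasDerivAt (fun t _ => h1 t)
        ((by fun_prop : Continuous fun t => f t - F' t - b).intervalIntegrable _ _)]
      simp [hΦ0, F, R]
    rw [h2]
    have h3 := intervalIntegral.norm_integral_le_of_norm_le_const (a := 0) (b := x) (C := y)
      (f := fun t => f t - F' t - b) fun t ht => by
        rw [Set.uIoc_of_le hx.1] at ht
        exact hy t ⟨ht.1.le, ht.2.trans hx.2⟩
    rw [Real.norm_eq_abs, sub_zero, abs_of_nonneg hx.1] at h3
    have hy0 : 0 ≤ y := (abs_nonneg _).trans (hy 0 (by simp))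
    exact h3.trans (mul_le_of_le_one_right hy0 hx.2)
  -- The approximation f of F' has mean value a, while F' has mean value zero since F vanishes at
  -- both ends; so a is at most the uniform error.
  have ha : |a| ≤ δ := by
    have := hint 1 (by simp) δ 0 fun t ht => by rw [sub_zero]; exact hp t ht
    simpa [hΦ1, F, hR1] using this
  have hd : ∀ t ∈ Set.Icc (0 : ℝ) 1, |f t - a - F' t| ≤ 2 * δ := by
    intro t ht
    rw [hsub]
    exact (abs_sub _ _).trans (by linarith [hp t ht])
  have hd' : ∀ t ∈ Set.Icc (0 : ℝ) 1, |Φ t - F t| ≤ 2 * δ := by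
    intro t ht
    have := hint t ht (2 * δ) a fun s hs => by rw [← hsub]; exact hd s hs
    simpa using this
  have h0 : cosMode w 0 ∈ S := Submodule.subset_span ⟨0, rfl⟩
  refine ⟨_, add_mem hmem (S.smul_mem (κ * Real.exp w) h0), fun x hx => ?_⟩
  have e : (fun x => f x - a + w * Φ x) x + ((κ * Real.exp w) • cosMode w 0) x - q x =
      (f x - a - F' x) + w * (Φ x - F x) := by
    simp only [Pi.smul_apply, smul_eq_mul, cosMode, if_true, F']
    have : Real.exp w * Real.exp (w * (x - 1)) = Real.exp (w * x) := by
      rw [← Real.exp_add]; ring_nf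
    linear_combination κ * this
  rw [Pi.add_apply, e]
  calc _ ≤ |f x - a - F' x| + |w| * |Φ x - F x| := by rw [← abs_mul]; exact abs_add_le _ _
    _ ≤ 2 * δ + |w| * (2 * δ) := by
      gcongr
      exacts [hd x hx, hd' x hx]
    _ = ε := by rw [hδ]; field_simp

/-! ### Completeness of products of modes -/

theorem ae_box_mem_Ioo : ∀ᵐ x ∂((volume : Measure (ι → ℝ)).restrict (Set.Icc 0 1)),
    ∀ i, x i ∈ Set.Ioo (0 : ℝ) 1 := by
  rw [ae_all_iff]
  intro i
  rw [restrict_box_eq_pi]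
  have h1 : ∀ᵐ t ∂((volume : Measure ℝ).restrict (Set.Icc 0 1)), t ∈ Set.Ioo (0 : ℝ) 1 := by
    rw [← restrict_Ioo_eq_restrict_Icc]
    exact ae_restrict_mem measurableSet_Ioo
  exact (measurePreserving_eval (fun _ : ι => (volume : Measure ℝ).restrict (Set.Icc 0 1))
    i).quasiMeasurePreserving.ae h1

theorem integrable_box_smul {F : (ι → ℝ) → ℂ} (hF : IntegrableOn F (Set.Icc 0 1))
    {g : (ι → ℝ) → ℝ} (hg : Continuous g) : IntegrableOn (fun x => g x • F x) (Set.Icc 0 1) :=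
  hF.continuousOn_smul hg.continuousOn isCompact_Icc

theorem eq_zero_of_forall_norm_le {a : ℂ} {C : ℝ} (h : ∀ ε > 0, ‖a‖ ≤ ε * C) : a = 0 := by
  by_contra ha
  have h0 : 0 < ‖a‖ := norm_pos_iff.2 ha
  have hC : 0 < C := by
    by_contra hC
    have := h 1 one_pos
    linarith
  have := h (‖a‖ / (2 * C)) (by positivity)
  have e : ‖a‖ / (2 * C) * C = ‖a‖ / 2 := by field_simp
  linarith

theorem integral_box_smul_eq_zero_of_approx {Z : (ι → ℝ) → ℂ} (hZ : IntegrableOn Z (Set.Icc 0 1))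
    {q : (ι → ℝ) → ℝ} (hq : Continuous q)
    (h : ∀ ε > 0, ∃ g : (ι → ℝ) → ℝ, Continuous g ∧ (∀ x ∈ Set.Icc (0 : ι → ℝ) 1, |g x - q x| ≤ ε) ∧
      ∫ x in Set.Icc (0 : ι → ℝ) 1, g x • Z x = 0) :
    ∫ x in Set.Icc (0 : ι → ℝ) 1, q x • Z x = 0 := by
  refine eq_zero_of_forall_norm_le (C := ∫ x in Set.Icc (0 : ι → ℝ) 1, ‖Z x‖) fun ε hε => ?_
  obtain ⟨g, hg, hgq, hg0⟩ := h ε hε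
  rw [← sub_zero (∫ x in Set.Icc (0 : ι → ℝ) 1, q x • Z x), ← hg0,
    ← integral_sub (integrable_box_smul hZ hq) (integrable_box_smul hZ hg), ← integral_const_mul]
  refine norm_integral_le_of_norm_le (hZ.norm.const_mul ε) ?_
  refine (ae_restrict_iff' measurableSet_Icc).2 (Filter.Eventually.of_forall fun x hx => ?_)
  rw [← sub_smul, norm_smul, Real.norm_eq_abs, abs_sub_comm]
  exact mul_le_mul_of_nonneg_right (hgq x hx) (norm_nonneg _)

/-- Factors from S are exchanged for factors from T one coordinate at a time: the integral is linear
in each factor and continuous under uniform approximation of it. -/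
theorem integral_box_smul_prod_eq_zero (F : (ι → ℝ) → ℂ) (hF : IntegrableOn F (Set.Icc 0 1))
    (S : ι → Set (ℝ → ℝ)) (hS : ∀ i, ∀ h ∈ S i, Continuous h) (T : ι → Set (ℝ → ℝ))
    (hT : ∀ i, ∀ h ∈ T i, Continuous h)
    (happ : ∀ i, ∀ q ∈ T i, ∀ ε > 0, ∃ h ∈ Submodule.span ℝ (S i),
      ∀ x ∈ Set.Icc (0 : ℝ) 1, |h x - q x| ≤ ε)
    (h0 : ∀ h : ι → ℝ → ℝ, (∀ i, h i ∈ S i) →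
      ∫ x in Set.Icc (0 : ι → ℝ) 1, (∏ i, h i (x i)) • F x = 0)
    (q : ι → ℝ → ℝ) (hq : ∀ i, q i ∈ T i) :
    ∫ x in Set.Icc (0 : ι → ℝ) 1, (∏ i, q i (x i)) • F x = 0 := by
  classical
  have main : ∀ (s : Finset ι) (h : ι → ℝ → ℝ), (∀ i ∈ s, h i ∈ T i) → (∀ i ∉ s, h i ∈ S i) →
      ∫ x in Set.Icc (0 : ι → ℝ) 1, (∏ i, h i (x i)) • F x = 0 := by
    intro s
    induction s using Finset.induction_on with
    | empty => exact fun h _ h2 => h0 h fun i => h2 i (Finset.notMem_empty i)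
    | insert i s hi ih =>
      intro h h1 h2
      have hc : ∀ j, Continuous (h j) := fun j => by
        by_cases hj : j ∈ insert i s
        exacts [hT j _ (h1 j hj), hS j _ (h2 j hj)]
      have hsplit : ∀ (g : ℝ → ℝ) (x : ι → ℝ), (∏ j, Function.update h i g j (x j)) • F x =
          g (x i) • (∏ j ∈ Finset.univ.erase i, h j (x j)) • F x := by
        intro g x
        rw [← Finset.mul_prod_erase _ _ (Finset.mem_univ i), mul_smul, Function.update_self]
        congr 2
        refine Finset.prod_congr rfl fun j hj => ?_
        rw [Function.update_of_ne (Finset.ne_of_mem_erase hj)]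
      have hZ : IntegrableOn (fun x => (∏ j ∈ Finset.univ.erase i, h j (x j)) • F x)
          (Set.Icc (0 : ι → ℝ) 1) :=
        integrable_box_smul hF (continuous_finsetProd _ fun j _ => (hc j).comp (continuous_apply j))
      have hspan : ∀ g ∈ Submodule.span ℝ (S i), Continuous g ∧
          ∫ x in Set.Icc (0 : ι → ℝ) 1,
            g (x i) • (∏ j ∈ Finset.univ.erase i, h j (x j)) • F x = 0 := by
        intro g hg
        induction hg using Submodule.span_induction with
        | mem g hg =>
          refine ⟨hS i g hg, ?_⟩
          simp only [← hsplit]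
          refine ih _ (fun j hj => ?_) fun j hj => ?_
          · rw [Function.update_of_ne (ne_of_mem_of_not_mem hj hi)]
            exact h1 j (Finset.mem_insert_of_mem hj)
          · by_cases hji : j = i
            · subst hji; rwa [Function.update_self]
            · rw [Function.update_of_ne hji]
              exact h2 j (by simp [hji, hj])
        | zero => exact ⟨continuous_const, by simp⟩
        | add f g _ _ hf hg =>
          refine ⟨hf.1.add hg.1, ?_⟩
          simp only [Pi.add_apply, add_smul]
          have k1 := integrable_box_smul hZ (hf.1.comp (continuous_apply i))
          have k2 := integrable_box_smul hZ (hg.1.comp (continuous_apply i))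
          simp only [Function.comp_apply] at k1 k2
          rw [integral_add k1 k2, hf.2, hg.2, add_zero]
        | smul c g _ hg =>
          refine ⟨hg.1.const_smul c, ?_⟩
          simp only [Pi.smul_apply, smul_assoc, integral_smul, hg.2, smul_zero]
      have e := hsplit (h i)
      rw [Function.update_eq_self] at e
      simp only [e]
      refine integral_box_smul_eq_zero_of_approx hZ ((hc i).comp (continuous_apply i))
        fun ε hε => ?_
      obtain ⟨g, hg, hgε⟩ := happ i (h i) (h1 i (Finset.mem_insert_self i s)) ε hε
      exact ⟨fun x => g (x i), (hspan g hg).1.comp (continuous_apply i),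
        fun x hx => hgε _ ⟨hx.1 i, hx.2 i⟩, (hspan g hg).2⟩
  exact main Finset.univ q (fun i _ => hq i) fun i hi => absurd (Finset.mem_univ i) hi

/-- A function on the box that is orthogonal to all monomials vanishes. -/
theorem ae_eq_zero_of_integral_monomial_smul_eq_zero (F : (ι → ℝ) → ℂ)
    (hF : IntegrableOn F (Set.Icc 0 1))
    (h0 : ∀ a : ι →₀ ℕ, ∫ x in Set.Icc (0 : ι → ℝ) 1, (∏ i, x i ^ a i) • F x = 0) :
    F =ᵐ[volume.restrict (Set.Icc 0 1)] 0 := by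
  have hpoly : ∀ p : MvPolynomial ι ℝ,
      ∫ x in Set.Icc (0 : ι → ℝ) 1, MvPolynomial.eval x p • F x = 0 := by
    intro p
    induction p using MvPolynomial.induction_on' with
    | monomial a c =>
      have := h0 a
      simp only [MvPolynomial.eval_monomial, mul_smul, integral_smul, Finsupp.prod_pow, this,
        smul_zero]
    | add p q hp hq =>
      simp only [map_add, add_smul]
      rw [integral_add (integrable_box_smul hF (MvPolynomial.continuous_eval p))
        (integrable_box_smul hF (MvPolynomial.continuous_eval q)), hp, hq, add_zero]
  have hloc : LocallyIntegrable F (volume.restrict (Set.Icc (0 : ι → ℝ) 1)) :=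
    hF.locallyIntegrable
  refine ae_eq_zero_of_integral_contDiff_smul_eq_zero hloc fun g hg _ => ?_
  refine integral_box_smul_eq_zero_of_approx hF hg.continuous fun ε hε => ?_
  -- Polynomials separate the points of the box, so by Stone–Weierstrass they approximate the
  -- continuous test function g uniformly.
  let A : Subalgebra ℝ C(Set.Icc (0 : ι → ℝ) 1, ℝ) :=
    (MvPolynomial.aeval fun i : ι =>
      (⟨fun x => x.1 i, (continuous_apply i).comp continuous_subtype_val⟩ : C(Set.Icc (0 : ι → ℝ) 1, ℝ))).range
  have hA : A.SeparatesPoints := by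
    intro x y hxy
    obtain ⟨i, hi⟩ : ∃ i, x.1 i ≠ y.1 i := by
      by_contra hcon
      push Not at hcon
      exact hxy (Subtype.ext (funext hcon))
    exact ⟨_, ⟨_, ⟨MvPolynomial.X i, rfl⟩, rfl⟩, by simpa using hi⟩
  obtain ⟨⟨f, p, rfl⟩, hfp⟩ :=
    ContinuousMap.exists_mem_subalgebra_near_continuous_of_separatesPoints A hA
      (fun x => g x.1) (hg.continuous.comp continuous_subtype_val) ε hε
  refine ⟨fun x => MvPolynomial.eval x p, MvPolynomial.continuous_eval p, fun x hx => ?_, hpoly p⟩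
  have h1 := (hfp ⟨x, hx⟩).le
  have h2 : ∀ p : MvPolynomial ι ℝ, (MvPolynomial.aeval fun i : ι =>
      (⟨fun x => x.1 i, (continuous_apply i).comp continuous_subtype_val⟩ : C(Set.Icc (0 : ι → ℝ) 1, ℝ))) p ⟨x, hx⟩ =
      MvPolynomial.eval x p := by
    intro p
    induction p using MvPolynomial.induction_on with
    | C a => simp
    | add p q hp hq => simp [hp, hq]
    | mul_X p i hp => simp [hp]
  rw [Real.norm_eq_abs] at h1
  simpa [h2] using h1

/-- Completeness of the products of sine and cosine modes. -/
theorem ae_eq_zero_of_integral_modes (w : ι → ℝ) (J : ι → Prop) [DecidablePred J]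
    (F : (ι → ℝ) → ℂ) (hF : IntegrableOn F (Set.Icc 0 1))
    (h0 : ∀ m : ι → ℕ, ∫ x in Set.Icc (0 : ι → ℝ) 1,
      (∏ i, if J i then cosMode (w i) (m i) (x i) else sinMode (m i) (x i)) • F x = 0) :
    F =ᵐ[volume.restrict (Set.Icc 0 1)] 0 := by
  -- Sine modes only approximate functions vanishing at the end points, so the factor sin(πx) is
  -- carried along in the sine coordinates. It does not vanish in the interior and is divided out at
  -- the end.
  let u : ι → ℝ → ℝ := fun i t => if J i then 1 else Real.sin (Real.pi * t)
  have hu : ∀ i, Continuous (u i) := fun i => by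
    by_cases h : J i
    · simp only [u, h, if_true]; fun_prop
    · simp only [u, h, if_false]; fun_prop
  have h1 := integral_box_smul_prod_eq_zero F hF
    (fun i => Set.range fun m t => if J i then cosMode (w i) m t else sinMode m t)
    (by
      rintro i _ ⟨m, rfl⟩
      by_cases h : J i
      · simpa only [h, if_true] using (contDiff_cosMode (w i) m (n := 0)).continuous
      · simpa only [h, if_false] using (contDiff_sinMode m (n := 0)).continuous)
    (fun i => {f | ∃ q : ℝ → ℝ, Continuous q ∧ f = fun t => u i t * q t})
    (by
      rintro i _ ⟨q, hq, rfl⟩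
      exact (hu i).mul hq)
    (by
      rintro i _ ⟨q, hq, rfl⟩ ε hε
      by_cases h : J i
      · simpa only [u, h, if_true, one_mul] using exists_cosMode_near (w i) q hq hε
      · simpa only [u, h, if_false] using exists_sinMode_near q hq hε)
    (by
      intro h hh
      choose m hm using hh
      have := h0 m
      simpa only [← hm] using this)
  have h2 := ae_eq_zero_of_integral_monomial_smul_eq_zero (fun x => (∏ i, u i (x i)) • F x)
    (integrable_box_smul hF (continuous_finsetProd _ fun j _ => (hu j).comp (continuous_apply j)))
    fun a => by
      have := h1 (fun i t => u i t * t ^ a i) fun i => ⟨fun t => t ^ a i, by fun_prop, rfl⟩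
      simpa only [Finset.prod_mul_distrib, smul_smul, mul_comm] using this
  filter_upwards [h2, ae_box_mem_Ioo] with x hx hx'
  refine (smul_eq_zero.1 hx).resolve_left (Finset.prod_ne_zero_iff.2 fun i _ => ?_)
  by_cases h : J i
  · simp [u, h]
  · simp only [u, h, if_false]
    have := hx' i
    refine (Real.sin_pos_of_pos_of_lt_pi (mul_pos Real.pi_pos this.1) ?_).ne'
    have := Real.pi_pos
    nlinarith [(hx' i).2]

end Box

end

noncomputable section

/-! ## Coefficients of alternating forms -/

/-- The sign `(-1) ^ #{h ∈ I | h < k}`. -/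
def wedgeSign {α : Type*} [LinearOrder α] (I : Finset α) (k : α) : ℝ :=
  (-1) ^ (I.filter (· < k)).card

theorem abs_wedgeSign {α : Type*} [LinearOrder α] (I : Finset α) (k : α) : |wedgeSign I k| = 1 := by
  simp [wedgeSign]

section AltCoeff

variable {ι : Type*} [LinearOrder ι] {p : ℕ}

theorem orderEmbOfFin_succAbove {I : Finset ι} (h : I.card = p + 1) (k : Fin (p + 1))
    (h' : (I.erase (I.orderEmbOfFin h k)).card = p) :
    (fun i => I.orderEmbOfFin h (k.succAbove i)) =
      (I.erase (I.orderEmbOfFin h k)).orderEmbOfFin h' := by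
  refine Finset.orderEmbOfFin_unique h' (fun i => ?_) ?_
  · refine Finset.mem_erase.2 ⟨fun e => ?_, Finset.orderEmbOfFin_mem _ _ _⟩
    exact Fin.succAbove_ne k i ((I.orderEmbOfFin h).injective e)
  · exact (I.orderEmbOfFin h).strictMono.comp (Fin.strictMono_succAbove k)

theorem wedgeSign_orderEmbOfFin {I : Finset ι} (h : I.card = p) (k : Fin p) :
    wedgeSign I (I.orderEmbOfFin h k) = (-1) ^ (k : ℕ) := by
  have e : I.filter (· < I.orderEmbOfFin h k) =
      (Finset.Iio k).map (I.orderEmbOfFin h).toEmbedding := by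
    ext x
    simp only [Finset.mem_filter, Finset.mem_map, Finset.mem_Iio]
    constructor
    · rintro ⟨hx, hlt⟩
      have : x ∈ Set.range (I.orderEmbOfFin h) := by
        rw [Finset.range_orderEmbOfFin]; exact hx
      obtain ⟨j, rfl⟩ := this
      exact ⟨j, (I.orderEmbOfFin h).lt_iff_lt.1 hlt, rfl⟩
    · rintro ⟨j, hj, rfl⟩
      exact ⟨Finset.orderEmbOfFin_mem _ _ _, (I.orderEmbOfFin h).lt_iff_lt.2 hj⟩
  rw [wedgeSign, e, Finset.card_map, Fin.card_Iio]

/-- The coefficient of `dx_I` in an alternating form. -/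
def altCoeff (ψ : (ι → ℝ) [⋀^Fin p]→L[ℝ] ℂ) (I : Finset ι) : ℂ :=
  if h : I.card = p then ψ fun k => Pi.single (I.orderEmbOfFin h k) 1 else 0

/-- `altCoeff` as a continuous linear map. -/
def altCoeffL (I : Finset ι) : ((ι → ℝ) [⋀^Fin p]→L[ℝ] ℂ) →L[ℝ] ℂ :=
  if h : I.card = p then
    ContinuousAlternatingMap.apply ℝ (ι → ℝ) ℂ fun k => Pi.single (I.orderEmbOfFin h k) 1 else 0

theorem altCoeffL_apply (ψ : (ι → ℝ) [⋀^Fin p]→L[ℝ] ℂ) (I : Finset ι) :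
    altCoeffL I ψ = altCoeff ψ I := by
  unfold altCoeffL altCoeff
  split_ifs <;> rfl

theorem altCoeff_add (ψ φ : (ι → ℝ) [⋀^Fin p]→L[ℝ] ℂ) (I : Finset ι) :
    altCoeff (ψ + φ) I = altCoeff ψ I + altCoeff φ I := by
  simp only [← altCoeffL_apply, map_add]

theorem altCoeff_smul (c : ℝ) (ψ : (ι → ℝ) [⋀^Fin p]→L[ℝ] ℂ) (I : Finset ι) :
    altCoeff (c • ψ) I = c • altCoeff ψ I := by
  simp only [← altCoeffL_apply, map_smul]

theorem altCoeff_sum {κ : Type*} (s : Finset κ) (ψ : κ → (ι → ℝ) [⋀^Fin p]→L[ℝ] ℂ)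
    (I : Finset ι) : altCoeff (∑ k ∈ s, ψ k) I = ∑ k ∈ s, altCoeff (ψ k) I := by
  simp only [← altCoeffL_apply, map_sum]

theorem altCoeff_zero (I : Finset ι) :
    altCoeff (0 : (ι → ℝ) [⋀^Fin p]→L[ℝ] ℂ) I = 0 := by
  simp only [← altCoeffL_apply, map_zero]

/-- The k-th smallest element of I has exactly k elements below it, counting from k = 0, so the sign
(-1)^k of the alternating sum is `wedgeSign`. -/
theorem altCoeff_alternatizeUncurryFin [Fintype ι] (φ : (ι → ℝ) →L[ℝ] (ι → ℝ) [⋀^Fin p]→L[ℝ] ℂ)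
    {I : Finset ι} (h : I.card = p + 1) :
    altCoeff (ContinuousAlternatingMap.alternatizeUncurryFin φ) I =
      ∑ i ∈ I, wedgeSign I i • altCoeff (φ (Pi.single i 1)) (I.erase i) := by
  rw [altCoeff, dif_pos h, ContinuousAlternatingMap.alternatizeUncurryFin_apply]
  conv_rhs => rw [← Finset.map_orderEmbOfFin_univ I h, Finset.sum_map]
  rw [Finset.map_orderEmbOfFin_univ]
  refine Finset.sum_congr rfl fun k _ => ?_
  have hc : (I.erase (I.orderEmbOfFin h k)).card = p := by
    rw [Finset.card_erase_of_mem (Finset.orderEmbOfFin_mem _ _ _), h]; rfl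
  simp only [RelEmbedding.coe_toEmbedding]
  rw [wedgeSign_orderEmbOfFin, altCoeff, dif_pos hc, ← orderEmbOfFin_succAbove h k hc]
  simp only [Int.reduceNeg, zsmul_eq_mul, Int.cast_pow, Int.cast_neg, Int.cast_one,
    Complex.real_smul, Complex.ofReal_pow, Complex.ofReal_neg, Complex.ofReal_one]
  rfl

theorem altCoeff_wedge [Fintype ι] (i : ι) (β : (ι → ℝ) [⋀^Fin p]→L[ℝ] ℂ) {I : Finset ι}
    (h : I.card = p + 1) :
    altCoeff (CubeComplex.wedge (ContinuousLinearMap.proj i) β) I =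
      if i ∈ I then wedgeSign I i • altCoeff β (I.erase i) else 0 := by
  rw [CubeComplex.wedge, altCoeff_alternatizeUncurryFin _ h]
  simp only [ContinuousLinearMap.smulRight_apply, ContinuousLinearMap.proj_apply]
  have : ∀ j, wedgeSign I j • altCoeff (((Pi.single j 1 : ι → ℝ) i) • β) (I.erase j) =
      if j = i then wedgeSign I j • altCoeff β (I.erase j) else 0 := by
    intro j
    split_ifs with hj
    · subst hj; simp
    · rw [altCoeff_smul, Pi.single_eq_of_ne (Ne.symm hj), zero_smul, smul_zero]
  simp only [this, Finset.sum_ite_eq']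

/-- The values of an alternating form on a family of distinct coordinate vectors. -/
theorem exists_sign_altCoeff {f : Fin p → ι} (hf : Function.Injective f) {I : Finset ι}
    (hI : ∀ i, i ∈ I ↔ ∃ k, f k = i) :
    ∃ ε : ℝ, |ε| = 1 ∧ ∀ ψ : (ι → ℝ) [⋀^Fin p]→L[ℝ] ℂ,
      ψ (fun k => Pi.single (f k) 1) = ε • altCoeff ψ I := by
  have hc : I.card = p := by
    have : I = Finset.univ.image f := by ext i; simp [hI]
    rw [this, Finset.card_image_of_injective _ hf, Finset.card_fin]
  have hr : Set.range f = Set.range (I.orderEmbOfFin hc) := by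
    rw [Finset.range_orderEmbOfFin]; ext i; simp [hI]
  choose τ hτ using fun k => (hr ▸ Set.mem_range_self k : f k ∈ Set.range (I.orderEmbOfFin hc))
  have hinj : Function.Injective τ := fun a b h => hf (by rw [← hτ, ← hτ, h])
  let e : Equiv.Perm (Fin p) := Equiv.ofBijective τ (Finite.injective_iff_bijective.1 hinj)
  refine ⟨(Equiv.Perm.sign e : ℤ), ?_, fun ψ => ?_⟩
  · rcases Int.units_eq_one_or (Equiv.Perm.sign e) with h | h <;> simp [h]
  · have := ψ.toAlternatingMap.map_perm (fun k => Pi.single (I.orderEmbOfFin hc k) 1) e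
    have e1 : (fun k => (Pi.single (f k) 1 : ι → ℝ)) =
        (fun k => Pi.single (I.orderEmbOfFin hc k) 1) ∘ e := by
      funext k
      simp only [Function.comp_apply, e, Equiv.ofBijective_apply, hτ]
    rw [e1, altCoeff, dif_pos hc]
    refine Eq.trans this ?_
    rw [Units.smul_def, zsmul_eq_mul, Complex.real_smul]
    push_cast
    rfl

/-- The form `dx_I`. -/
def coordForm (p : ℕ) (I : Finset ι) : (ι → ℝ) [⋀^Fin p]→L[ℝ] ℂ :=
  if h : I.card = p then
    Complex.ofRealCLM.compContinuousAlternatingMap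
      { (Matrix.detRowAlternating (R := ℝ) (n := Fin p)).compLinearMap
          (LinearMap.pi fun l => LinearMap.proj (I.orderEmbOfFin h l)) with
        cont := by
          refine Continuous.matrix_det (A := fun v : Fin p → ι → ℝ => Matrix.of fun k l =>
            v k (I.orderEmbOfFin h l)) ?_
          exact continuous_matrix fun k l =>
            (continuous_apply (I.orderEmbOfFin h l)).comp (continuous_apply k) }
  else 0

theorem coordForm_apply {I : Finset ι} (h : I.card = p) (v : Fin p → ι → ℝ) :
    coordForm p I v = ((Matrix.of fun k l => v k (I.orderEmbOfFin h l)).det : ℝ) := by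
  rw [coordForm, dif_pos h]
  rfl

theorem coordForm_eq_zero {I : Finset ι} {i : ι} (hi : i ∈ I) {v : Fin p → ι → ℝ}
    (hv : ∀ k, v k i = 0) : coordForm p I v = 0 := by
  by_cases h : I.card = p
  · rw [coordForm_apply h, Complex.ofReal_eq_zero]
    have : i ∈ Set.range (I.orderEmbOfFin h) := by rw [Finset.range_orderEmbOfFin]; exact hi
    obtain ⟨l, rfl⟩ := this
    exact Matrix.det_eq_zero_of_column_eq_zero l hv
  · rw [coordForm, dif_neg h]; rfl

theorem altCoeff_coordForm (I J : Finset ι) (h : J.card = p) :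
    altCoeff (coordForm p I) J = if J = I then 1 else 0 := by
  split_ifs with e
  · subst e
    rw [altCoeff, dif_pos h, coordForm_apply h]
    have : (Matrix.of fun k l : Fin p =>
        (Pi.single (J.orderEmbOfFin h k) 1 : ι → ℝ) (J.orderEmbOfFin h l)) = 1 := by
      ext k l
      rw [Matrix.of_apply, Pi.single_apply, Matrix.one_apply]
      simp only [EmbeddingLike.apply_eq_iff_eq, eq_comm]
    rw [this, Matrix.det_one, Complex.ofReal_one]
  · by_cases hI : I.card = p
    · obtain ⟨i, hi, hiJ⟩ : ∃ i ∈ I, i ∉ J := by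
        by_contra hcon
        push Not at hcon
        exact e (Finset.eq_of_subset_of_card_le hcon (by rw [hI, h])).symm
      rw [altCoeff, dif_pos h]
      refine coordForm_eq_zero hi fun k => Pi.single_eq_of_ne ?_ 1
      exact fun e => hiJ (e ▸ Finset.orderEmbOfFin_mem _ _ _)
    · rw [coordForm, dif_neg hI, altCoeff_zero]

end AltCoeff

namespace CubeComplex

variable {V : Type*} {K : CubeComplex V}

theorem coeff_eq_altCoeff (σ : K.Form) (C : K.Cube) {p : ℕ} {I : Finset C.Mid} (h : I.card = p)
    (x : C.E) : coeff σ ⟨C, I⟩ x = altCoeff (σ C p x) I := by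
  subst h
  rw [altCoeff, dif_pos rfl]
  rfl

theorem contDiff_coeff {σ : K.Form} (hσ : σ ∈ K.Omega) (i : K.FormIndex) :
    ContDiff ℝ ∞ (coeff σ i) := by
  have : coeff σ i = fun x => altCoeffL i.2 (σ i.1 i.2.card x) := by
    funext x
    rw [altCoeffL_apply]
    exact coeff_eq_altCoeff σ i.1 rfl x
  rw [this]
  exact (altCoeffL i.2).contDiff.comp (hσ.1 i.1 i.2.card)

theorem coeff_eq_zero {σ : K.Form} {i : K.FormIndex} (h : σ i.1 = 0) : coeff σ i = 0 := by
  funext x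
  simp [coeff, h]

/-- The form with the given coefficients. -/
def ofCoeff (c : ∀ i : K.FormIndex, i.1.E → ℂ) : K.Form := fun C p x =>
  ∑ I : Finset C.Mid, c ⟨C, I⟩ x • coordForm p I

theorem altCoeff_complex_smul {ι : Type*} [LinearOrder ι] {p : ℕ} (c : ℂ)
    (ψ : (ι → ℝ) [⋀^Fin p]→L[ℝ] ℂ) (I : Finset ι) :
    altCoeff (c • ψ) I = c * altCoeff ψ I := by
  unfold altCoeff
  split_ifs <;> simp

theorem coeff_ofCoeff (c : ∀ i : K.FormIndex, i.1.E → ℂ) : coeff (ofCoeff c) = c := by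
  funext ⟨C, J⟩ x
  rw [coeff_eq_altCoeff _ C rfl, ofCoeff, altCoeff_sum]
  simp only [altCoeff_complex_smul, altCoeff_coordForm _ _ rfl, mul_ite, mul_one, mul_zero]
  rw [Finset.sum_ite_eq, if_pos (Finset.mem_univ _)]

theorem ofCoeff_mem_Omega {c : ∀ i : K.FormIndex, i.1.E → ℂ} (hc : ∀ i, ContDiff ℝ ∞ (c i))
    (hfin : {i | c i ≠ 0}.Finite) : ofCoeff c ∈ K.Omega := by
  refine ⟨fun C p => ?_, (hfin.image Sigma.fst).subset fun C hC => ?_⟩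
  · refine ContDiff.sum fun I _ => ?_
    have e : (fun x => c ⟨C, I⟩ x • coordForm (ι := C.Mid) p I) = fun x =>
        (ContinuousLinearMap.smulRight (1 : ℂ →L[ℂ] ℂ) (coordForm (ι := C.Mid) p I)).restrictScalars ℝ
          (c ⟨C, I⟩ x) := by
      funext x; simp
    rw [e]
    exact (ContinuousLinearMap.contDiff _).comp (hc ⟨C, I⟩)
  · by_contra hcon
    refine hC ?_
    funext p x
    refine Finset.sum_eq_zero fun I _ => ?_
    have : c ⟨C, I⟩ = 0 := by
      by_contra h
      exact hcon ⟨⟨C, I⟩, h, rfl⟩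
    ext v
    simp [this]

/-- The pullback of dx_I to a face x_H = const vanishes when H ∈ I, so the boundary condition only
concerns the coefficients with H ∉ I. -/
theorem ofCoeff_mem_Omega0 {c : ∀ i : K.FormIndex, i.1.E → ℂ} (hc : ∀ i, ContDiff ℝ ∞ (c i))
    (hfin : {i | c i ≠ 0}.Finite)
    (h0 : ∀ (i : K.FormIndex) (H : i.1.Mid), H ∉ i.2 → ∀ x : i.1.E, (x H = 0 ∨ x H = 1) → c i x = 0) :
    ofCoeff c ∈ K.Omega0 := by
  refine ⟨ofCoeff_mem_Omega hc hfin, fun C p H x _ hxH v hv => ?_⟩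
  simp only [ofCoeff]
  rw [ContinuousAlternatingMap.sum_apply]
  refine Finset.sum_eq_zero fun I _ => ?_
  rw [ContinuousAlternatingMap.smul_apply]
  by_cases hI : H ∈ I
  · rw [coordForm_eq_zero hI hv, smul_zero]
  · rw [h0 ⟨C, I⟩ H hI x hxH, zero_smul]

theorem ofCoeff_mem_Omega00 {c : ∀ i : K.FormIndex, i.1.E → ℂ} (hc : ∀ i, ContDiff ℝ ∞ (c i))
    (hfin : {i | c i ≠ 0}.Finite) (h0 : ∀ i, tsupport (c i) ⊆ interior i.1.box) :
    ofCoeff c ∈ K.Omega00 := by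
  refine ⟨ofCoeff_mem_Omega hc hfin, fun C p => ?_⟩
  have h1 : tsupport (ofCoeff c C p) ⊆ ⋃ I : Finset C.Mid, tsupport (c ⟨C, I⟩) := by
    refine closure_minimal (fun x hx => ?_) (isClosed_iUnion_of_finite fun I => isClosed_tsupport _)
    by_contra hcon
    simp only [Set.mem_iUnion, not_exists] at hcon
    refine hx (Finset.sum_eq_zero fun I _ => ?_)
    ext v
    simp [image_eq_zero_of_notMem_tsupport (hcon I)]
  exact h1.trans (Set.iUnion_subset fun I => h0 ⟨C, I⟩)

theorem coeff_dForm (w : K.Hyperplane → ℝ) {σ : K.Form} (hσ : σ ∈ K.Omega) (C : K.Cube)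
    (I : Finset C.Mid) (x : C.E) :
    coeff (dForm w σ) ⟨C, I⟩ x = ∑ H ∈ I, wedgeSign I H •
      (fderiv ℝ (coeff σ ⟨C, I.erase H⟩) x (Pi.single H 1) +
        w H.1 • coeff σ ⟨C, I.erase H⟩ x) := by
  rcases hp : I.card with _ | p
  · rw [coeff_eq_altCoeff _ C hp]
    rw [Finset.card_eq_zero] at hp
    subst hp
    simp [dForm, altCoeff_zero]
  · have hcard : ∀ H ∈ I, (I.erase H).card = p := fun H hH => by
      rw [Finset.card_erase_of_mem hH, hp]; rfl
    rw [coeff_eq_altCoeff _ C hp]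
    simp only [dForm]
    rw [altCoeff_add, altCoeff_sum, extDeriv, altCoeff_alternatizeUncurryFin _ hp]
    simp only [altCoeff_smul, alpha, altCoeff_wedge _ _ hp, smul_ite, smul_zero]
    rw [Finset.sum_ite_mem, Finset.univ_inter, ← Finset.sum_add_distrib]
    refine Finset.sum_congr rfl fun H hH => ?_
    rw [smul_add, smul_comm (w H.1)]
    have e : coeff σ ⟨C, I.erase H⟩ = fun x => altCoeffL (I.erase H) (σ C p x) := by
      funext x
      rw [altCoeffL_apply, coeff_eq_altCoeff σ C (hcard H hH)]
    congr 2
    · have h1 := ((altCoeffL (I.erase H)).hasFDerivAt.comp x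
        ((hσ.1 C p).differentiable (by simp) x).hasFDerivAt).fderiv
      rw [e]
      refine Eq.trans ?_ (congrArg (fun L : C.E →L[ℝ] ℂ => L (Pi.single H 1)) h1).symm
      exact (altCoeffL_apply _ _).symm
    · rw [coeff_eq_altCoeff σ C (hcard H hH)]
      rfl

/-! ## The operators `e` in coefficients -/

/-- The multi-index of hyperplanes underlying a multi-index of a cube. -/
def hyp {C : K.Cube} (I : Finset C.Mid) : Finset K.Hyperplane := I.map (Function.Embedding.subtype _)

open Classical in
/-- The multi-index of a cube given by a set of hyperplanes. -/
def idx (C : K.Cube) (S : Finset K.Hyperplane) : Finset C.Mid := S.subtype (· ∈ K.midSet C.1)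

theorem mem_hyp {C : K.Cube} {I : Finset C.Mid} {H : K.Hyperplane} :
    H ∈ hyp I ↔ ∃ h : H ∈ K.midSet C.1, (⟨H, h⟩ : C.Mid) ∈ I := by
  simp [hyp]

theorem val_mem_hyp {C : K.Cube} {I : Finset C.Mid} {H : C.Mid} : H.1 ∈ hyp I ↔ H ∈ I := by
  simp [hyp]

theorem mem_idx {C : K.Cube} {S : Finset K.Hyperplane} {H : C.Mid} : H ∈ idx C S ↔ H.1 ∈ S := by
  simp [idx]

theorem idx_hyp {C : K.Cube} (I : Finset C.Mid) : idx C (hyp I) = I := by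
  ext H; rw [mem_idx, val_mem_hyp]

theorem hyp_idx {C : K.Cube} {S : Finset K.Hyperplane} (h : ∀ H ∈ S, H ∈ K.midSet C.1) :
    hyp (idx C S) = S := by
  ext H
  rw [mem_hyp]
  simp only [mem_idx]
  exact ⟨fun h => h.2, fun h' => ⟨h H h', h'⟩⟩

theorem hyp_injective {C : K.Cube} : Function.Injective (hyp : Finset C.Mid → _) := fun I J h => by
  rw [← idx_hyp I, h, idx_hyp]

theorem hyp_erase {C : K.Cube} (I : Finset C.Mid) (H : C.Mid) :
    hyp (I.erase H) = (hyp I).erase H.1 := by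
  ext H'
  simp only [Finset.mem_erase, mem_hyp]
  constructor
  · rintro ⟨h, h1, h2⟩
    exact ⟨fun e => h1 (Subtype.ext e), h, h2⟩
  · rintro ⟨h1, h, h2⟩
    exact ⟨h, fun e => h1 (congrArg Subtype.val e), h2⟩

theorem wedgeSign_hyp {C : K.Cube} (I : Finset C.Mid) (H : C.Mid) :
    wedgeSign (hyp I) H.1 = wedgeSign I H := by
  have : (hyp I).filter (· < H.1) = hyp (I.filter (· < H)) := by
    ext H'
    simp only [Finset.mem_filter, mem_hyp]
    exact ⟨fun ⟨⟨h, h1⟩, h2⟩ => ⟨h, h1, h2⟩, fun ⟨h, h1, h2⟩ => ⟨⟨h, h1⟩, h2⟩⟩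
  rw [wedgeSign, wedgeSign, this, hyp, Finset.card_map]

theorem Cube.exists_face (hK : K.IsCAT0) (Q : V) (D : K.Cube) (H : K.Hyperplane) :
    ∃ C : K.Cube, C.top hK Q = D.top hK Q ∧ K.midSet C.1 = K.midSet D.1 \ {H} :=
  exists_cube_top_eq hK (D.midSet_finite.subset Set.sdiff_subset)
    (Set.sdiff_subset.trans (D.midSet_subset_downSet hK Q))

/-- The codimension-one face of `D` on the side of `H` that does not contain `Q`. -/
def Cube.face (hK : K.IsCAT0) (Q : V) (D : K.Cube) (H : K.Hyperplane) : K.Cube :=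
  (D.exists_face hK Q H).choose

theorem Cube.top_face (hK : K.IsCAT0) (Q : V) (D : K.Cube) (H : K.Hyperplane) :
    (D.face hK Q H).top hK Q = D.top hK Q := (D.exists_face hK Q H).choose_spec.1

theorem Cube.midSet_face (hK : K.IsCAT0) (Q : V) (D : K.Cube) (H : K.Hyperplane) :
    K.midSet (D.face hK Q H).1 = K.midSet D.1 \ {H} := (D.exists_face hK Q H).choose_spec.2

theorem Cube.face_subset (hK : K.IsCAT0) (Q : V) (D : K.Cube) (H : K.Hyperplane) :
    (D.face hK Q H).1 ⊆ D.1 :=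
  Cube.subset_of_midSet_subset hK (D.face hK Q H).2 D.2 ((D.face hK Q H).top_mem hK Q)
    (D.top_face hK Q H ▸ D.top_mem hK Q) (by rw [D.midSet_face hK Q H]; exact Set.sdiff_subset)

/-- For each hyperplane of D exactly one codimension-one face contributes to e_w, namely the one on
the side away from Q. This collapses the double sum in `eForm` to a sum over the multi-index. -/
theorem Cube.facet_iff_eq_face (hK : K.IsCAT0) {Q : V} {C D : K.Cube} (H : D.Mid) :
    (C.IsFacet D ∧ H.1 ∈ C.SAH Q) ↔ C = D.face hK Q H.1 := by
  have h1 := facet_iff hK (P := Q) (C := C) (D := D) (H := H.1)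
  have h2 : (C.IsFacet D ∧ H.1 ∈ C.SAH Q) ↔
      (C.IsFacet D ∧ H.1 ∈ C.SAH Q ∧ H.1 ∈ K.midSet D.1) := by
    simp [H.2]
  rw [h2, h1]
  constructor
  · rintro ⟨e1, e2, e3⟩
    refine Cube.ext_top hK (P := Q) (by rw [D.top_face, e1]) ?_
    refine (D.midSet_face hK Q H.1).symm ▸ ?_
    generalize H.1 = H' at e2 e3
    rw [e3, Set.insert_sdiff_self_of_notMem e2]
  · rintro rfl
    refine ⟨D.top_face hK Q H.1, by rw [D.midSet_face]; simp, ?_⟩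
    rw [D.midSet_face, Set.insert_sdiff_singleton, Set.insert_eq_of_mem H.2]

theorem faceProj_single {C D : K.Cube} [DecidableEq C.Mid] [DecidableEq D.Mid] (h : C.1 ⊆ D.1) {H : D.Mid} (hH : H.1 ∈ K.midSet C.1) :
    faceProj h (Pi.single H 1) = Pi.single (⟨H.1, hH⟩ : C.Mid) 1 := by
  funext H'
  simp only [faceProj, ContinuousLinearMap.coe_pi', ContinuousLinearMap.proj_apply, Pi.single_apply,
    Subtype.ext_iff]

/-- The order of the hyperplanes of C is the restriction of that of D, so no sign appears. -/
theorem altCoeff_comp_faceProj {C D : K.Cube} (h : C.1 ⊆ D.1) {p : ℕ}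
    (β : C.E [⋀^Fin p]→L[ℝ] ℂ) {J : Finset D.Mid} (hJ : ∀ H ∈ J, H.1 ∈ K.midSet C.1) :
    altCoeff (β.compContinuousLinearMap (faceProj h)) J = altCoeff β (idx C (hyp J)) := by
  have hc : (idx C (hyp J)).card = J.card := by
    have h1 : hyp (idx C (hyp J)) = hyp J := hyp_idx fun H hH => by
      obtain ⟨h, hH⟩ := mem_hyp.1 hH
      exact hJ _ hH
    have h2 := congrArg Finset.card h1
    rwa [hyp, hyp, Finset.card_map, Finset.card_map] at h2
  unfold altCoeff
  by_cases hp : J.card = p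
  · rw [dif_pos hp, dif_pos (hc.trans hp)]
    have h1 := Finset.orderEmbOfFin_unique (hc.trans hp)
      (f := fun k => ⟨(J.orderEmbOfFin hp k).1, hJ _ (Finset.orderEmbOfFin_mem _ _ _)⟩)
      (fun k => mem_idx.2 (val_mem_hyp.2 (Finset.orderEmbOfFin_mem _ _ _)))
      (fun a b hab => (J.orderEmbOfFin hp).strictMono hab)
    rw [ContinuousAlternatingMap.compContinuousLinearMap_apply]
    refine congrArg β (funext fun k => ?_)
    rw [Function.comp_apply, ← h1]
    exact faceProj_single h (hJ _ (Finset.orderEmbOfFin_mem J hp k))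
  · rw [dif_neg hp, dif_neg (hc ▸ hp)]

open Classical in
/-- The operators of the type of `e_w`, with arbitrary coefficient functions. -/
def eGen (Q : V) (a : ∀ D : K.Cube, D.Mid → D.E → ℝ) (σ : K.Form) : K.Form
  | _, 0, _ => 0
  | D, p + 1, x => ∑ C : {C : K.Cube // C.1 ⊆ D.1}, ∑ H : D.Mid,
      if C.1.IsFacet D ∧ H.1 ∈ C.1.SAH Q then
        a D H x •
          wedge (alpha H) ((σ C.1 p (faceProj C.2 x)).compContinuousLinearMap (faceProj C.2))
      else 0

/-- The coefficient functions of `e_w`. -/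
def eWeight (w : K.Hyperplane → ℝ) (D : K.Cube) (H : D.Mid) (x : D.E) : ℝ :=
  w H.1 * Real.exp (w H.1 * (x H - 1))

theorem eForm_eq_eGen (P : V) (w : K.Hyperplane → ℝ) (σ : K.Form) :
    eForm P w σ = eGen P (eWeight w) σ := by
  funext D p x
  cases p <;> rfl

/-- The index of the coefficient of a form on a face that contributes to the `I`-th coefficient of
the image under `e`. -/
def faceIndex (hK : K.IsCAT0) (Q : V) (i : K.FormIndex) (H : i.1.Mid) : K.FormIndex :=
  ⟨i.1.face hK Q H.1, idx _ (hyp (i.2.erase H))⟩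

theorem coeff_eGen (hK : K.IsCAT0) (Q : V) (a : ∀ D : K.Cube, D.Mid → D.E → ℝ) (σ : K.Form)
    (i : K.FormIndex) (x : i.1.E) :
    coeff (eGen Q a σ) i x = ∑ H ∈ i.2, wedgeSign i.2 H •
      a i.1 H x • coeff σ (faceIndex hK Q i H) (faceProj (i.1.face_subset hK Q H.1) x) := by
  obtain ⟨D, I⟩ := i
  rcases hp : I.card with _ | p
  · rw [coeff_eq_altCoeff _ D hp]
    rw [Finset.card_eq_zero] at hp
    subst hp
    simp [eGen, altCoeff_zero]
  · rw [coeff_eq_altCoeff _ D hp]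
    simp only [eGen]
    rw [Finset.sum_comm, altCoeff_sum]
    rw [← Finset.sum_subset (Finset.subset_univ I)]
    · refine Finset.sum_congr rfl fun H hH => ?_
      rw [altCoeff_sum, Finset.sum_eq_single ⟨D.face hK Q H.1, D.face_subset hK Q H.1⟩]
      · rw [if_pos ((Cube.facet_iff_eq_face hK H).2 rfl), altCoeff_smul]
        rw [alpha, altCoeff_wedge _ _ hp, if_pos hH, smul_comm, altCoeff_comp_faceProj]
        · have hc : (idx (D.face hK Q H.1) (hyp (I.erase H))).card = p := by
            have h1 : hyp (idx (D.face hK Q H.1) (hyp (I.erase H))) = hyp (I.erase H) :=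
              hyp_idx fun H' hH' => by
                rw [D.midSet_face]
                rw [hyp_erase, Finset.mem_erase] at hH'
                exact ⟨(mem_hyp.1 hH'.2).1, hH'.1⟩
            have h2 := congrArg Finset.card h1
            rw [hyp, hyp, Finset.card_map, Finset.card_map, Finset.card_erase_of_mem hH, hp] at h2
            exact h2
          exact congrArg _ (congrArg _ (coeff_eq_altCoeff _ _ hc _).symm)
        · intro H' hH'
          rw [D.midSet_face]
          exact ⟨H'.2, fun e => (Finset.mem_erase.1 hH').1 (Subtype.ext e)⟩
      · intro C _ hC
        rw [if_neg, altCoeff_zero]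
        intro h
        exact hC (Subtype.ext ((Cube.facet_iff_eq_face hK H).1 h))
      · exact fun h => absurd (Finset.mem_univ _) h
    · intro H _ hH
      rw [altCoeff_sum]
      refine Finset.sum_eq_zero fun C _ => ?_
      split_ifs
      · rw [altCoeff_smul, alpha, altCoeff_wedge _ _ hp, if_neg hH, smul_zero]
      · exact altCoeff_zero _

end CubeComplex

end

noncomputable section

open MeasureTheory

/-! ## Sparse operators between direct sums -/

section Sparse

variable {ι : Type*} {E : ι → Type*} [∀ i, NormedAddCommGroup (E i)]

theorem lp_two_norm_sq (f : lp E 2) : ‖f‖ ^ 2 = ∑' i, ‖f i‖ ^ 2 := by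
  have h := lp.norm_rpow_eq_tsum (p := 2) (by norm_num) f
  simpa only [ENNReal.toReal_ofNat, Real.rpow_ofNat] using h

theorem memℓp_two_iff {f : ∀ i, E i} : Memℓp f 2 ↔ Summable fun i => ‖f i‖ ^ 2 := by
  rw [memℓp_gen_iff (by norm_num)]
  simp only [ENNReal.toReal_ofNat, Real.rpow_ofNat]

/-- A Schur-type test: a block matrix with blocks of norm at most M and at most n blocks in each row
and each column is bounded by n M. -/
theorem exists_sparse_operator [∀ i, NormedSpace ℂ (E i)] {A : ι → Type*} [∀ i, Fintype (A i)]
    (src : ∀ i, A i → ι) (T : ∀ i (a : A i), E (src i a) →L[ℂ] E i) {M : ℝ} (hM0 : 0 ≤ M)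
    (hM : ∀ i a, ‖T i a‖ ≤ M) {n : ℕ} (hrow : ∀ i, Fintype.card (A i) ≤ n)
    (hcol : ∀ j, {a : Σ i, A i | src a.1 a.2 = j}.encard ≤ n) :
    ∃ S : lp E 2 →L[ℂ] lp E 2, ‖S‖ ≤ n * M ∧ ∀ f i, S f i = ∑ a, T i a (f (src i a)) := by
  classical
  -- The column bound: each component of f is used at most n times.
  have hq : ∀ f : lp E 2, ∀ s : Finset (Σ i, A i),
      ∑ a ∈ s, ‖f (src a.1 a.2)‖ ^ 2 ≤ n * ‖f‖ ^ 2 := by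
    intro f s
    have hs := memℓp_two_iff.1 (lp.memℓp f)
    rw [Finset.sum_comp (fun j => ‖f j‖ ^ 2) fun a : Σ i, A i => src a.1 a.2, lp_two_norm_sq]
    calc _ ≤ ∑ j ∈ s.image fun a : Σ i, A i => src a.1 a.2, (n : ℝ) * ‖f j‖ ^ 2 := by
          refine Finset.sum_le_sum fun j _ => ?_
          rw [nsmul_eq_mul]
          refine mul_le_mul_of_nonneg_right ?_ (by positivity)
          have h1 : ((s.filter fun a => src a.1 a.2 = j : Finset (Σ i, A i)) : Set (Σ i, A i)).encard ≤ n :=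
            (Set.encard_le_encard fun a ha => (Finset.mem_filter.1 ha).2).trans (hcol j)
          rw [Set.encard_coe_eq_coe_finsetCard] at h1
          exact_mod_cast h1
      _ ≤ _ := by
          rw [← Finset.mul_sum]
          exact mul_le_mul_of_nonneg_left (hs.sum_le_tsum _ fun _ _ => by positivity)
            (Nat.cast_nonneg n)
  -- The row bound, by Cauchy–Schwarz for at most n summands.
  have hrow' : ∀ (f : lp E 2) i, ‖∑ a, T i a (f (src i a))‖ ^ 2 ≤
      n * M ^ 2 * ∑' a, ‖f (src i a)‖ ^ 2 := by
    intro f i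
    rw [tsum_fintype]
    calc _ ≤ (∑ a, M * ‖f (src i a)‖) ^ 2 := by
          gcongr
          refine (norm_sum_le _ _).trans (Finset.sum_le_sum fun a _ => ?_)
          exact ((T i a).le_opNorm _).trans (mul_le_mul_of_nonneg_right (hM i a) (norm_nonneg _))
      _ = M ^ 2 * (∑ a, ‖f (src i a)‖) ^ 2 := by rw [← Finset.mul_sum, mul_pow]
      _ ≤ M ^ 2 * (Fintype.card (A i) * ∑ a, ‖f (src i a)‖ ^ 2) := by
          gcongr
          exact sq_sum_le_card_mul_sum_sq
      _ ≤ M ^ 2 * (n * ∑ a, ‖f (src i a)‖ ^ 2) := by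
          gcongr
          exact hrow i
      _ = _ := by ring
  have hsum : ∀ f : lp E 2, Summable fun a : Σ i, A i => ‖f (src a.1 a.2)‖ ^ 2 := fun f =>
    summable_of_sum_le (fun _ => by positivity) (hq f)
  have hsum' : ∀ f : lp E 2, Summable fun i => ‖∑ a, T i a (f (src i a))‖ ^ 2 := fun f =>
    Summable.of_nonneg_of_le (fun _ => by positivity) (hrow' f) ((hsum f).sigma.mul_left _)
  let L : lp E 2 →ₗ[ℂ] lp E 2 :=
    { toFun := fun f => ⟨fun i => ∑ a, T i a (f (src i a)), memℓp_two_iff.2 (hsum' f)⟩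
      map_add' := fun f g => by
        ext i : 2
        simp only [lp.coeFn_add, Pi.add_apply, map_add, Finset.sum_add_distrib]
      map_smul' := fun c f => by
        ext i : 2
        simp only [lp.coeFn_smul, Pi.smul_apply, map_smul, Finset.smul_sum, RingHom.id_apply] }
  have hL : ∀ f, ‖L f‖ ≤ n * M * ‖f‖ := by
    intro f
    refine le_of_sq_le_sq ?_ (by positivity)
    rw [lp_two_norm_sq]
    calc _ ≤ ∑' i, n * M ^ 2 * ∑' a, ‖f (src i a)‖ ^ 2 :=
          (hsum' f).tsum_le_tsum (hrow' f) ((hsum f).sigma.mul_left _)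
      _ = n * M ^ 2 * ∑' a : Σ i, A i, ‖f (src a.1 a.2)‖ ^ 2 := by
          rw [tsum_mul_left, (hsum f).tsum_sigma]
      _ ≤ n * M ^ 2 * (n * ‖f‖ ^ 2) := by
          gcongr
          exact (hsum f).tsum_le_of_sum_le (hq f)
      _ = _ := by ring
  exact ⟨L.mkContinuous _ hL, LinearMap.mkContinuous_norm_le _ (by positivity) _, fun f i => rfl⟩

/-- Composition with a measure preserving map followed by multiplication with a bounded function. -/
theorem exists_weighted_comp {α β : Type*} [MeasurableSpace α] [MeasurableSpace β] {μ : Measure α}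
    {ν : Measure β} {φ : β → α} (hφ : MeasurePreserving φ ν μ) {a : β → ℝ}
    (ha : AEStronglyMeasurable a ν) {M : ℝ} (hM0 : 0 ≤ M) (hM : ∀ᵐ x ∂ν, |a x| ≤ M) :
    ∃ T : Lp ℂ 2 μ →L[ℂ] Lp ℂ 2 ν, ‖T‖ ≤ M ∧ ∀ f, T f =ᵐ[ν] fun x => a x • f (φ x) := by
  have hle : ∀ f : Lp ℂ 2 μ, ∀ᵐ x ∂ν, ‖a x • f (φ x)‖ ≤ M * ‖Lp.compMeasurePreserving φ hφ f x‖ := by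
    intro f
    filter_upwards [hM, Lp.coeFn_compMeasurePreserving f hφ] with x hx h1
    rw [h1, norm_smul, Real.norm_eq_abs]
    exact mul_le_mul_of_nonneg_right hx (norm_nonneg _)
  have hmem : ∀ f : Lp ℂ 2 μ, MemLp (fun x => a x • f (φ x)) 2 ν := fun f =>
    MemLp.of_le_mul (Lp.memLp (Lp.compMeasurePreserving φ hφ f))
      (ha.smul ((Lp.aestronglyMeasurable f).comp_measurePreserving hφ)) (hle f)
  let L : Lp ℂ 2 μ →ₗ[ℂ] Lp ℂ 2 ν :=
    { toFun := fun f => (hmem f).toLp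
      map_add' := fun f g => by
        refine Lp.ext ?_
        filter_upwards [(hmem (f + g)).coeFn_toLp, Lp.coeFn_add ((hmem f).toLp) ((hmem g).toLp),
          (hmem f).coeFn_toLp, (hmem g).coeFn_toLp,
          hφ.quasiMeasurePreserving.ae (Lp.coeFn_add f g)] with x h1 h2 h3 h4 h5
        rw [h1, h2, Pi.add_apply, h3, h4, h5, Pi.add_apply, smul_add]
      map_smul' := fun c f => by
        refine Lp.ext ?_
        filter_upwards [(hmem (c • f)).coeFn_toLp, Lp.coeFn_smul c ((hmem f).toLp),
          (hmem f).coeFn_toLp, hφ.quasiMeasurePreserving.ae (Lp.coeFn_smul c f)] with x h1 h2 h3 h5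
        rw [RingHom.id_apply, h1, h2, Pi.smul_apply, h3, h5, Pi.smul_apply, smul_comm] }
  have hL : ∀ f, ‖L f‖ ≤ M * ‖f‖ := by
    intro f
    rw [← Lp.norm_compMeasurePreserving f hφ]
    refine Lp.norm_le_mul_norm_of_ae_le_mul ?_
    filter_upwards [hle f, (hmem f).coeFn_toLp] with x h1 h2
    exact (congrArg norm h2).trans_le h1
  exact ⟨L.mkContinuous M hL, LinearMap.mkContinuous_norm_le _ hM0 _, fun f => (hmem f).coeFn_toLp⟩

end Sparse

namespace CubeComplex

variable {V : Type*} {K : CubeComplex V}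

/-! ## Square integrable forms with continuous coefficients -/

/-- `ξ` has the coefficients `c`. -/
def HasCoeff (c : ∀ i : K.FormIndex, i.1.E → ℂ) (ξ : K.OmegaL2) : Prop :=
  ∀ i : K.FormIndex, (ξ i : i.1.E → ℂ) =ᵐ[i.1.measure] c i

theorem HasCoeff.unique {c : ∀ i : K.FormIndex, i.1.E → ℂ} {ξ η : K.OmegaL2} (h : HasCoeff c ξ)
    (h' : HasCoeff c η) : ξ = η := by
  ext i : 2
  exact Lp.ext ((h i).trans (h' i).symm)

theorem Represents.hasCoeff {σ : K.Form} {ξ : K.OmegaL2} (h : Represents σ ξ) :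
    HasCoeff (coeff σ) ξ := h

instance (C : K.Cube) : IsProbabilityMeasure C.measure :=
  inferInstanceAs (IsProbabilityMeasure ((volume : Measure C.E).restrict (Set.Icc 0 1)))

theorem Cube.memLp_of_continuous (C : K.Cube) {f : C.E → ℂ} (hf : Continuous f) :
    MemLp f 2 C.measure := by
  obtain ⟨M, hM⟩ := isCompact_Icc.exists_bound_of_continuousOn (s := C.box) hf.continuousOn
  refine MemLp.of_bound hf.aestronglyMeasurable M ?_
  exact (ae_restrict_iff' measurableSet_Icc).2 (Filter.Eventually.of_forall hM)

theorem Cube.integrable_of_continuous (C : K.Cube) {f : C.E → ℂ} (hf : Continuous f) :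
    Integrable f C.measure :=
  hf.continuousOn.integrableOn_compact isCompact_Icc

theorem exists_hasCoeff {c : ∀ i : K.FormIndex, i.1.E → ℂ} (hc : ∀ i, Continuous (c i))
    (hfin : {i | c i ≠ 0}.Finite) : ∃ ξ : K.OmegaL2, HasCoeff c ξ := by
  let f : ∀ i : K.FormIndex, Lp ℂ 2 i.1.measure := fun i => (i.1.memLp_of_continuous (hc i)).toLp
  have hf : ∀ i, f i =ᵐ[i.1.measure] c i := fun i => MemLp.coeFn_toLp _
  refine ⟨⟨f, memℓp_two_iff.2 ?_⟩, hf⟩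
  refine summable_of_ne_finset_zero (s := hfin.toFinset) fun i hi => ?_
  have h0 : c i = 0 := by simpa using hi
  have : f i = 0 := by
    refine Lp.ext ((hf i).trans ?_)
    rw [h0]
    exact (Lp.coeFn_zero ..).symm
  rw [this]; simp

theorem finite_coeff_ne_zero {σ : K.Form} (hσ : σ ∈ K.Omega) : {i | coeff σ i ≠ 0}.Finite := by
  refine (hσ.2.toFinset.sigma fun _ => Finset.univ).finite_toSet.subset fun i hi => ?_
  rw [Finset.mem_coe, Finset.mem_sigma, Set.Finite.mem_toFinset]
  exact ⟨fun h => hi (coeff_eq_zero h), Finset.mem_univ _⟩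

theorem exists_represents {σ : K.Form} (hσ : σ ∈ K.Omega) : ∃ ξ : K.OmegaL2, Represents σ ξ :=
  exists_hasCoeff (fun i => (contDiff_coeff hσ i).continuous) (finite_coeff_ne_zero hσ)

theorem HasCoeff.inner_eq {c d : ∀ i : K.FormIndex, i.1.E → ℂ} {ξ η : K.OmegaL2}
    (h : HasCoeff c ξ) (h' : HasCoeff d η) :
    inner ℂ ξ η = ∑' i, ∫ x, inner ℂ (c i x) (d i x) ∂i.1.measure := by
  rw [lp.inner_eq_tsum]
  refine tsum_congr fun i => ?_
  rw [L2.inner_def]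
  refine integral_congr_ae ?_
  filter_upwards [h i, h' i] with x h1 h2
  rw [h1, h2]

theorem HasCoeff.inner_eq_sum {c d : ∀ i : K.FormIndex, i.1.E → ℂ} {ξ η : K.OmegaL2}
    (h : HasCoeff c ξ) (h' : HasCoeff d η) (F : Finset K.Cube) (hF : ∀ i, i.1 ∉ F → d i = 0) :
    inner ℂ ξ η = ∑ C ∈ F, ∑ I : Finset C.Mid,
      ∫ x, inner ℂ (c ⟨C, I⟩ x) (d ⟨C, I⟩ x) ∂C.measure := by
  rw [h.inner_eq h', tsum_eq_sum (s := F.sigma fun _ => Finset.univ), Finset.sum_sigma]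
  intro i hi
  have : d i = 0 := hF i fun hi' => hi (Finset.mem_sigma.2 ⟨hi', Finset.mem_univ _⟩)
  simp [this]

theorem inner_eq_of_single {ξ η : K.OmegaL2} (i : K.FormIndex) (h : ∀ j, j ≠ i → η j = 0) :
    inner ℂ η ξ = inner ℂ (η i) (ξ i) := by
  rw [lp.inner_eq_tsum, tsum_eq_single i]
  intro j hj
  rw [h j hj, inner_zero_left]

theorem Cube.interior_of_mem_Ioo (C : K.Cube) {x : C.E} (hx : ∀ H, x H ∈ Set.Ioo (0 : ℝ) 1) :
    x ∈ interior C.box := by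
  refine interior_maximal (s := C.box) (t := Set.univ.pi fun _ => Set.Ioo (0 : ℝ) 1) ?_
    (isOpen_set_pi Set.finite_univ fun _ _ => isOpen_Ioo) fun H _ => hx H
  exact fun y hy => ⟨fun H => (hy H trivial).1.le, fun H => (hy H trivial).2.le⟩

theorem Cube.ae_mem_interior (C : K.Cube) : ∀ᵐ x ∂C.measure, x ∈ interior C.box := by
  filter_upwards [ae_box_mem_Ioo (ι := C.Mid)] with x hx using C.interior_of_mem_Ioo hx

/-- The compactly supported forms are dense. -/
theorem dense_l2Subspace_Omega00 : Dense (l2Subspace K.Omega00 : Set K.OmegaL2) := by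
  classical
  rw [Submodule.dense_iff_topologicalClosure_eq_top, Submodule.topologicalClosure_eq_top_iff,
    Submodule.eq_bot_iff]
  intro ξ hξ
  ext i : 2
  refine Lp.ext ?_
  have hint : Integrable (ξ i) i.1.measure := (Lp.memLp (ξ i)).integrable (by norm_num)
  have h1 := isOpen_interior.ae_eq_zero_of_integral_contDiff_smul_eq_zero (U := interior i.1.box)
    (f := (ξ i : i.1.E → ℂ)) (μ := i.1.measure) (hint.locallyIntegrable.locallyIntegrableOn _) ?_
  · filter_upwards [h1, i.1.ae_mem_interior, Lp.coeFn_zero ℂ 2 i.1.measure] with x hx hx' h0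
    rw [hx hx']
    exact h0.symm
  · intro g hg _ hsupp
    let c : ∀ j : K.FormIndex, j.1.E → ℂ := Pi.single i fun x => (g x : ℂ)
    have hci : c i = fun x => (g x : ℂ) := Pi.single_eq_same _ _
    have hcj : ∀ j, j ≠ i → c j = 0 := fun j hj => Pi.single_eq_of_ne hj _
    have hc : ∀ j, ContDiff ℝ ∞ (c j) := by
      intro j
      by_cases hj : j = i
      · subst hj
        rw [hci]
        exact Complex.ofRealCLM.contDiff.comp hg
      · rw [hcj j hj]; exact contDiff_const
    have hfin : {j | c j ≠ 0}.Finite := (Set.finite_singleton i).subset fun j hj => by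
      by_contra h; exact hj (hcj j h)
    obtain ⟨η, hη⟩ := exists_hasCoeff (fun j => (hc j).continuous) hfin
    have hmem : η ∈ l2Subspace K.Omega00 := by
      refine ⟨ofCoeff c, ofCoeff_mem_Omega00 hc hfin fun j => ?_, ?_⟩
      · by_cases hj : j = i
        · subst hj
          rw [hci]
          refine Set.Subset.trans (closure_mono fun x hx => ?_) hsupp
          simpa using hx
        · rw [hcj j hj]
          have : tsupport (0 : j.1.E → ℂ) = ∅ := tsupport_eq_empty_iff.2 rfl
          rw [this]; exact Set.empty_subset _
      · intro j
        rw [coeff_ofCoeff]; exact hη j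
    have h2 := (Submodule.mem_orthogonal _ _).1 hξ η hmem
    rw [inner_eq_of_single i fun j hj => ?_, L2.inner_def] at h2
    · rw [← h2]
      refine integral_congr_ae ?_
      filter_upwards [hη i] with x hx
      rw [hx, hci]
      simp [mul_comm]
    · refine Lp.ext ((hη j).trans ?_)
      rw [hcj j hj]
      exact (Lp.coeFn_zero ..).symm

/-! ## The formal adjoint of `d_w` -/

theorem inner_real_smul_left (r : ℝ) (a b : ℂ) : inner ℂ (r • a) b = r • inner ℂ a b := by
  simp only [RCLike.inner_apply, Complex.real_smul, map_mul, Complex.conj_ofReal]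
  ring

theorem inner_real_smul_right (r : ℝ) (a b : ℂ) : inner ℂ a (r • b) = r • inner ℂ a b := by
  simp only [RCLike.inner_apply, Complex.real_smul]
  ring

/-- The derivative of ⟨f, g⟩ in the direction H integrates to zero, because f vanishes on the two
faces transverse to that direction. -/
theorem Cube.integral_inner_fderiv (C : K.Cube) (H : C.Mid) {f g : C.E → ℂ} (hf : ContDiff ℝ ∞ f)
    (hg : ContDiff ℝ ∞ g) (h0 : ∀ x ∈ C.box, x H = 0 ∨ x H = 1 → f x = 0) (w : ℝ) :
    ∫ x, inner ℂ (fderiv ℝ f x (Pi.single H 1) + w • f x) (g x) ∂C.measure =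
      ∫ x, inner ℂ (f x) (-fderiv ℝ g x (Pi.single H 1) + w • g x) ∂C.measure := by
  have hf' : Continuous fun x => fderiv ℝ f x (Pi.single H 1) :=
    (hf.continuous_fderiv (by simp)).clm_apply continuous_const
  have hg' : Continuous fun x => fderiv ℝ g x (Pi.single H 1) :=
    (hg.continuous_fderiv (by simp)).clm_apply continuous_const
  have hfc := hf.continuous
  have hgc := hg.continuous
  have h1 := integral_box_fderiv_eq_zero H (F := fun x => inner ℂ (f x) (g x))
    ((hf.of_le (by simp)).inner ℂ (hg.of_le (by simp))) fun x hx hxH => by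
      rw [h0 x hx hxH, inner_zero_left]
  rw [← sub_eq_zero, ← integral_sub (C.integrable_of_continuous (by fun_prop))
    (C.integrable_of_continuous (by fun_prop))]
  refine Eq.trans (integral_congr_ae (Filter.Eventually.of_forall fun x => ?_)) h1
  have h2 := fderiv_inner_apply ℂ (hf.differentiable (by simp) x) (hg.differentiable (by simp) x)
    (Pi.single H 1)
  simp only
  rw [h2]
  simp only [inner_add_left, inner_add_right, inner_neg_right, inner_real_smul_left,
    inner_real_smul_right]
  ring

/-- Reindexing pairs (I, h ∈ I) as (I \ {h}, h): it turns the matrix of d_w into that of its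
transpose. -/
theorem sum_erase_eq_sum_insert {α M : Type*} [Fintype α] [DecidableEq α] [AddCommMonoid M]
    (G : α → Finset α → Finset α → M) :
    ∑ I : Finset α, ∑ h ∈ I, G h (I.erase h) I = ∑ J : Finset α, ∑ h ∈ Jᶜ, G h J (insert h J) := by
  rw [Finset.sum_sigma', Finset.sum_sigma']
  refine Finset.sum_bij' (fun a _ => ⟨a.1.erase a.2, a.2⟩) (fun a _ => ⟨insert a.2 a.1, a.2⟩)
    ?_ ?_ ?_ ?_ ?_
  · rintro ⟨I, h⟩ _; simp
  · rintro ⟨J, h⟩ _; simp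
  · rintro ⟨I, h⟩ hI
    simp only [Finset.mem_sigma, Finset.mem_univ, true_and] at hI
    simp [Finset.insert_erase hI]
  · rintro ⟨J, h⟩ hJ
    simp only [Finset.mem_sigma, Finset.mem_univ, true_and, Finset.mem_compl] at hJ
    simp [Finset.erase_insert hJ]
  · rintro ⟨I, h⟩ hI
    simp only [Finset.mem_sigma, Finset.mem_univ, true_and] at hI
    simp [Finset.insert_erase hI]

/-- The coefficients of the formal adjoint of `d_w`. -/
def dStarCoeff (w : K.Hyperplane → ℝ) (σ : K.Form) (i : K.FormIndex) (x : i.1.E) : ℂ :=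
  ∑ H ∈ i.2ᶜ, wedgeSign (insert H i.2) H •
    (-fderiv ℝ (coeff σ ⟨i.1, insert H i.2⟩) x (Pi.single H 1) +
      w H.1 • coeff σ ⟨i.1, insert H i.2⟩ x)

theorem continuous_fderiv_coeff {σ : K.Form} (hσ : σ ∈ K.Omega) (i : K.FormIndex) (v : i.1.E) :
    Continuous fun x => fderiv ℝ (coeff σ i) x v :=
  ((contDiff_coeff hσ i).continuous_fderiv (by simp)).clm_apply continuous_const

theorem continuous_dStarCoeff (w : K.Hyperplane → ℝ) {σ : K.Form} (hσ : σ ∈ K.Omega)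
    (i : K.FormIndex) : Continuous (dStarCoeff w σ i) := by
  unfold dStarCoeff
  refine continuous_finsetSum _ fun H _ => ?_
  have k1 := continuous_fderiv_coeff hσ ⟨i.1, insert H i.2⟩ (Pi.single H 1)
  have k2 := (contDiff_coeff hσ ⟨i.1, insert H i.2⟩).continuous
  fun_prop

theorem dStarCoeff_eq_zero (w : K.Hyperplane → ℝ) {σ : K.Form} {i : K.FormIndex} (h : σ i.1 = 0) :
    dStarCoeff w σ i = 0 := by
  funext x
  refine Finset.sum_eq_zero fun H _ => ?_
  have : coeff σ ⟨i.1, insert H i.2⟩ = 0 := coeff_eq_zero h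
  simp [this]

theorem exists_hasCoeff_dStar (w : K.Hyperplane → ℝ) {σ : K.Form} (hσ : σ ∈ K.Omega) :
    ∃ ξ : K.OmegaL2, HasCoeff (dStarCoeff w σ) ξ := by
  refine exists_hasCoeff (continuous_dStarCoeff w hσ) ?_
  refine (hσ.2.toFinset.sigma fun _ => Finset.univ).finite_toSet.subset fun i hi => ?_
  rw [Finset.mem_coe, Finset.mem_sigma, Set.Finite.mem_toFinset]
  exact ⟨fun h => hi (dStarCoeff_eq_zero w h), Finset.mem_univ _⟩

theorem exists_represents_dForm (w : K.Hyperplane → ℝ) {σ : K.Form} (hσ : σ ∈ K.Omega) :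
    ∃ ξ : K.OmegaL2, Represents (dForm w σ) ξ := by
  refine exists_hasCoeff (fun i => ?_) ?_
  · have : coeff (dForm w σ) i = _ := funext (coeff_dForm w hσ i.1 i.2)
    rw [this]
    refine continuous_finsetSum _ fun H _ => ?_
    have k1 := continuous_fderiv_coeff hσ ⟨i.1, i.2.erase H⟩ (Pi.single H 1)
    have k2 := (contDiff_coeff hσ ⟨i.1, i.2.erase H⟩).continuous
    fun_prop
  · refine (hσ.2.toFinset.sigma fun _ => Finset.univ).finite_toSet.subset fun i hi => ?_
    rw [Finset.mem_coe, Finset.mem_sigma, Set.Finite.mem_toFinset]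
    refine ⟨fun h => hi ?_, Finset.mem_univ _⟩
    funext x
    refine (coeff_dForm w hσ i.1 i.2 x).trans (Finset.sum_eq_zero fun H _ => ?_)
    have : coeff σ ⟨i.1, i.2.erase H⟩ = 0 := coeff_eq_zero h
    simp [this]

theorem coeff_eq_zero_of_mem_Omega0 {σ : K.Form} (hσ : σ ∈ K.Omega0) (i : K.FormIndex) {H : i.1.Mid}
    (hH : H ∉ i.2) {x : i.1.E} (hx : x ∈ i.1.box) (hxH : x H = 0 ∨ x H = 1) : coeff σ i x = 0 := by
  refine hσ.2 i.1 _ H x hx hxH _ fun k => Pi.single_eq_of_ne ?_ 1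
  exact fun e => hH (e ▸ Finset.orderEmbOfFin_mem _ _ _)

/-- Integration by parts: `d_w` on `Ω₀` is adjoint to its formal adjoint. -/
theorem inner_dForm (w : K.Hyperplane → ℝ) {σ τ : K.Form} (hσ : σ ∈ K.Omega0) (hτ : τ ∈ K.Omega)
    {σ₂ τ₂ ξ η : K.OmegaL2} (h1 : Represents σ σ₂) (h2 : Represents τ τ₂)
    (h3 : Represents (dForm w σ) ξ) (h4 : HasCoeff (dStarCoeff w τ) η) :
    inner ℂ ξ τ₂ = inner ℂ σ₂ η := by
  have e1 := h3.hasCoeff.inner_eq_sum h2.hasCoeff hτ.2.toFinset fun i hi => coeff_eq_zero (by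
    simpa using hi)
  have e2 := h1.hasCoeff.inner_eq_sum h4 hτ.2.toFinset fun i hi => dStarCoeff_eq_zero w (by
    simpa using hi)
  rw [e1, e2]
  refine Finset.sum_congr rfl fun C _ => ?_
  have key : ∀ I : Finset C.Mid, ∫ x, inner ℂ (coeff (dForm w σ) ⟨C, I⟩ x) (coeff τ ⟨C, I⟩ x) ∂C.measure =
      ∑ H ∈ I, wedgeSign I H • ∫ x, inner ℂ (coeff σ ⟨C, I.erase H⟩ x)
        (-fderiv ℝ (coeff τ ⟨C, I⟩) x (Pi.single H 1) + w H.1 • coeff τ ⟨C, I⟩ x) ∂C.measure := by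
    intro I
    simp only [coeff_dForm w hσ.1, sum_inner]
    rw [integral_finsetSum]
    · refine Finset.sum_congr rfl fun H hH => ?_
      simp only [inner_real_smul_left]
      rw [integral_smul]
      congr 1
      exact C.integral_inner_fderiv H (contDiff_coeff hσ.1 ⟨C, I.erase H⟩) (contDiff_coeff hτ ⟨C, I⟩)
        (fun x hx hxH => coeff_eq_zero_of_mem_Omega0 hσ ⟨C, I.erase H⟩ (by simp) hx hxH) (w H.1)
    · intro H _
      refine C.integrable_of_continuous ?_
      have k1 := continuous_fderiv_coeff hσ.1 ⟨C, I.erase H⟩ (Pi.single H 1)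
      have k2 := (contDiff_coeff hσ.1 ⟨C, I.erase H⟩).continuous
      have k3 := (contDiff_coeff hτ ⟨C, I⟩).continuous
      fun_prop
  have key' : ∀ J : Finset C.Mid, ∫ x, inner ℂ (coeff σ ⟨C, J⟩ x) (dStarCoeff w τ ⟨C, J⟩ x) ∂C.measure =
      ∑ H ∈ Jᶜ, wedgeSign (insert H J) H • ∫ x, inner ℂ (coeff σ ⟨C, J⟩ x)
        (-fderiv ℝ (coeff τ ⟨C, insert H J⟩) x (Pi.single H 1) +
          w H.1 • coeff τ ⟨C, insert H J⟩ x) ∂C.measure := by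
    intro J
    simp only [dStarCoeff, inner_sum]
    rw [integral_finsetSum]
    · refine Finset.sum_congr rfl fun H hH => ?_
      simp only [inner_real_smul_right]
      rw [integral_smul]
    · intro H _
      refine C.integrable_of_continuous ?_
      have k1 := continuous_fderiv_coeff hτ ⟨C, insert H J⟩ (Pi.single H 1)
      have k2 := (contDiff_coeff hτ ⟨C, insert H J⟩).continuous
      have k3 := (contDiff_coeff hσ.1 ⟨C, J⟩).continuous
      fun_prop
  simp only [key, key']
  exact sum_erase_eq_sum_insert fun H J I => wedgeSign I H • ∫ x, inner ℂ (coeff σ ⟨C, J⟩ x)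
        (-fderiv ℝ (coeff τ ⟨C, I⟩) x (Pi.single H 1) + w H.1 • coeff τ ⟨C, I⟩ x) ∂C.measure

end CubeComplex

end

noncomputable section

open MeasureTheory

namespace CubeComplex

variable {V : Type*} {K : CubeComplex V}

/-! ## Bounded operators of the type of `e_w` -/

theorem Cube.mem_midSet_face (hK : K.IsCAT0) (Q : V) (D : K.Cube) {H H' : K.Hyperplane} :
    H' ∈ K.midSet (D.face hK Q H).1 ↔ H' ∈ K.midSet D.1 ∧ H' ≠ H := by
  rw [D.midSet_face]; rfl

/-- The hyperplanes of a cube are those of a face and one more. -/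
def Cube.faceEquiv (hK : K.IsCAT0) (Q : V) (D : K.Cube) (H : D.Mid) :
    Option (D.face hK Q H.1).Mid ≃ D.Mid :=
  Equiv.ofBijective
    (fun o => o.elim H fun H' => ⟨H'.1, midSet_mono (D.face_subset hK Q H.1) H'.2⟩) (by
    constructor
    · rintro (_ | a) (_ | b) h
      · rfl
      · exact absurd (congrArg Subtype.val h).symm ((D.mem_midSet_face hK Q).1 b.2).2
      · exact absurd (congrArg Subtype.val h) ((D.mem_midSet_face hK Q).1 a.2).2
      · exact congrArg some (Subtype.ext (Subtype.mk.inj h))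
    · intro H'
      by_cases h : H' = H
      · exact ⟨none, h.symm⟩
      · exact ⟨some ⟨H'.1, (D.mem_midSet_face hK Q).2 ⟨H'.2, fun e => h (Subtype.ext e)⟩⟩, rfl⟩)

/-- The omitted coordinate runs over an interval of length 1, so the fibres of the projection have
mass 1. -/
theorem measurePreserving_faceProj (hK : K.IsCAT0) (Q : V) (D : K.Cube) (H : D.Mid) :
    MeasurePreserving (faceProj (D.face_subset hK Q H.1)) D.measure (D.face hK Q H.1).measure :=
  measurePreserving_comp_some (D.faceEquiv hK Q H)

theorem faceIndex_hyp (hK : K.IsCAT0) (Q : V) (i : K.FormIndex) (H : i.1.Mid) :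
    hyp (faceIndex hK Q i H).2 = (hyp i.2).erase H.1 := by
  rw [faceIndex, hyp_idx, hyp_erase]
  intro H' hH'
  rw [hyp_erase, Finset.mem_erase] at hH'
  exact (i.1.mem_midSet_face hK Q).2 ⟨(mem_hyp.1 hH'.2).1, hH'.1⟩

theorem encard_midSet_le {N : ℕ} (hK : K.IsCAT0)
    (hN : ∀ P v : V, (K.downSet P v).encard ≤ N) (Q : V) (D : K.Cube) :
    (K.midSet D.1).encard ≤ N :=
  (Set.encard_le_encard (D.midSet_subset_downSet hK Q)).trans (hN Q _)

theorem card_coe_le {N : ℕ} (hK : K.IsCAT0)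
    (hN : ∀ P v : V, (K.downSet P v).encard ≤ N) (Q : V) (i : K.FormIndex) :
    Fintype.card i.2 ≤ N := by
  have h1 : ((hyp i.2 : Finset K.Hyperplane) : Set K.Hyperplane).encard ≤ N :=
    (Set.encard_le_encard fun H hH => (mem_hyp.1 hH).1).trans (encard_midSet_le hK hN Q i.1)
  rw [Set.encard_coe_eq_coe_finsetCard, hyp, Finset.card_map] at h1
  rw [Fintype.card_coe]
  exact_mod_cast h1

/-- With bounded coefficient functions the operator passes the test of `exists_sparse_operator`. For
the columns: a target cube has the same top vertex as its face, and is recovered from the face and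
the added hyperplane, which lies in the `downSet` of that vertex. -/
theorem exists_eGen_operator (hK : K.IsCAT0) (hb : K.BoundedGeometry) (Q : V)
    {a : ∀ D : K.Cube, D.Mid → D.E → ℝ} (ha : ∀ D H, Continuous (a D H)) {M : ℝ}
    (hM : ∀ D H, ∀ x ∈ D.box, |a D H x| ≤ M) :
    ∃ T : K.OmegaL2 →L[ℂ] K.OmegaL2, ∀ σ ξ, Represents σ ξ → Represents (eGen Q a σ) (T ξ) := by
  obtain ⟨N, hN⟩ := hb.exists_encard_downSet_le
  have hM' : ∀ D H, ∀ x ∈ D.box, |a D H x| ≤ max M 0 := fun D H x hx =>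
    (hM D H x hx).trans (le_max_left _ _)
  have hblock : ∀ (i : K.FormIndex) (H : i.2), ∃ T : Lp ℂ 2 (faceIndex hK Q i H.1).1.measure →L[ℂ]
      Lp ℂ 2 i.1.measure, ‖T‖ ≤ max M 0 ∧ ∀ f, T f =ᵐ[i.1.measure] fun x =>
        (wedgeSign i.2 H.1 * a i.1 H.1 x) • f (faceProj (i.1.face_subset hK Q H.1.1) x) := by
    intro i H
    refine exists_weighted_comp (measurePreserving_faceProj hK Q i.1 H.1)
      (continuous_const.mul (ha i.1 H.1)).aestronglyMeasurable (le_max_right _ _) ?_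
    refine (ae_restrict_iff' measurableSet_Icc).2 (Filter.Eventually.of_forall fun x hx => ?_)
    change |wedgeSign i.2 H.1 * a i.1 H.1 x| ≤ _
    rw [abs_mul, abs_wedgeSign, one_mul]
    exact hM' i.1 H.1 x hx
  choose T hT hTf using hblock
  obtain ⟨S, -, hS⟩ := exists_sparse_operator (E := fun i : K.FormIndex => Lp ℂ 2 i.1.measure)
    (A := fun i : K.FormIndex => i.2)
    (fun i H => faceIndex hK Q i H.1) T (le_max_right _ _) hT (card_coe_le hK hN Q) (by
      intro j
      refine le_trans (Set.encard_le_encard_of_injOn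
        (t := K.downSet Q (j.1.top hK Q)) (f := fun a => a.2.1.1) ?_ ?_) (hN Q _)
      · rintro ⟨i, H⟩ rfl
        rw [faceIndex, i.1.top_face]
        exact i.1.midSet_subset_downSet hK Q H.1.2
      · rintro ⟨⟨D, I⟩, ⟨H, hH⟩⟩ h1 ⟨⟨D', I'⟩, ⟨H', hH'⟩⟩ h2 (e : H.1 = H'.1)
        have h3 : faceIndex hK Q ⟨D, I⟩ H = faceIndex hK Q ⟨D', I'⟩ H' := h1.trans h2.symm
        have h4 : D.face hK Q H.1 = D'.face hK Q H'.1 := congrArg Sigma.fst h3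
        have hD : D = D' := by
          refine Cube.ext_top hK (P := Q) ?_ ?_
          · rw [← D.top_face hK Q H.1, ← D'.top_face hK Q H'.1, h4]
          · ext H₀
            have k1 := D.mem_midSet_face hK Q (H := H.1) (H' := H₀)
            have k2 := D'.mem_midSet_face hK Q (H := H'.1) (H' := H₀)
            rw [h4, k2] at k1
            by_cases h0 : H₀ = H.1
            · exact ⟨fun _ => by rw [h0, e]; exact H'.2, fun _ => by rw [h0]; exact H.2⟩
            · have h0' : H₀ ≠ H'.1 := e ▸ h0
              simpa [h0, h0'] using k1.symm
        subst hD
        obtain rfl : H = H' := Subtype.ext e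
        have h5 : (hyp I).erase H.1 = (hyp I').erase H.1 := by
          rw [← faceIndex_hyp hK Q ⟨D, I⟩ H, ← faceIndex_hyp hK Q ⟨D, I'⟩ H, h3]
        have h6 : I = I' := by
          rw [← hyp_erase, ← hyp_erase] at h5
          rw [← Finset.insert_erase (show H ∈ I from hH),
            ← Finset.insert_erase (show H ∈ I' from hH'), hyp_injective h5]
        subst h6
        rfl)
  refine ⟨S, fun σ ξ h i => ?_⟩
  rw [hS]
  have h1 : ∀ H : i.2, (T i H (ξ (faceIndex hK Q i H.1)) : i.1.E → ℂ) =ᵐ[i.1.measure] fun x =>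
      wedgeSign i.2 H.1 • a i.1 H.1 x •
        coeff σ (faceIndex hK Q i H.1) (faceProj (i.1.face_subset hK Q H.1.1) x) := by
    intro H
    filter_upwards [hTf i H (ξ (faceIndex hK Q i H.1)),
      (measurePreserving_faceProj hK Q i.1 H.1).quasiMeasurePreserving.ae
        (h (faceIndex hK Q i H.1))] with x hx hx'
    rw [hx, hx', mul_smul]
  have h2 := Lp.coeFn_finsetSum Finset.univ fun H : i.2 => T i H (ξ (faceIndex hK Q i H.1))
  filter_upwards [h2, ae_all_iff.2 h1] with x hx hx'
  rw [hx, coeff_eGen hK, Finset.sum_apply, ← Finset.sum_coe_sort i.2]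
  exact Finset.sum_congr rfl fun H _ => hx' H

/-- Exterior multiplication with a combination of the coordinate forms. -/
def wedgeForm (c : ∀ D : K.Cube, D.Mid → ℝ) (σ : K.Form) : K.Form
  | _, 0, _ => 0
  | D, _ + 1, x => ∑ H : D.Mid, c D H • wedge (alpha H) (σ D _ x)

theorem coeff_wedgeForm (c : ∀ D : K.Cube, D.Mid → ℝ) (σ : K.Form) (i : K.FormIndex) (x : i.1.E) :
    coeff (wedgeForm c σ) i x = ∑ H ∈ i.2, wedgeSign i.2 H • c i.1 H •
      coeff σ ⟨i.1, i.2.erase H⟩ x := by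
  obtain ⟨D, I⟩ := i
  rcases hp : I.card with _ | p
  · rw [coeff_eq_altCoeff _ D hp]
    rw [Finset.card_eq_zero] at hp
    subst hp
    simp [wedgeForm, altCoeff_zero]
  · rw [coeff_eq_altCoeff _ D hp]
    simp only [wedgeForm]
    rw [altCoeff_sum, ← Finset.sum_subset (Finset.subset_univ I)]
    · refine Finset.sum_congr rfl fun H hH => ?_
      rw [altCoeff_smul, alpha, altCoeff_wedge _ _ hp, if_pos hH, smul_comm,
        coeff_eq_altCoeff σ D (p := p) (by rw [Finset.card_erase_of_mem hH, hp]; rfl)]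
      rfl
    · intro H _ hH
      rw [altCoeff_smul, alpha, altCoeff_wedge _ _ hp, if_neg hH, smul_zero]

theorem exists_wedgeForm_operator (hK : K.IsCAT0) (hb : K.BoundedGeometry) (Q : V)
    {c : ∀ D : K.Cube, D.Mid → ℝ} {M : ℝ} (hM : ∀ D H, |c D H| ≤ M) :
    ∃ T : K.OmegaL2 →L[ℂ] K.OmegaL2, ∀ σ ξ, Represents σ ξ → Represents (wedgeForm c σ) (T ξ) := by
  obtain ⟨N, hN⟩ := hb.exists_encard_downSet_le
  let T : ∀ (i : K.FormIndex) (H : i.2), Lp ℂ 2 i.1.measure →L[ℂ] Lp ℂ 2 i.1.measure := fun i H =>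
    ((wedgeSign i.2 H.1 * c i.1 H.1 : ℝ) : ℂ) • ContinuousLinearMap.id ℂ _
  have hT : ∀ i H, ‖T i H‖ ≤ max M 0 := by
    intro i H
    refine ContinuousLinearMap.opNorm_le_bound _ (le_max_right _ _) fun f => ?_
    change ‖((wedgeSign i.2 H.1 * c i.1 H.1 : ℝ) : ℂ) • f‖ ≤ _
    rw [norm_smul, Complex.norm_real, Real.norm_eq_abs, abs_mul, abs_wedgeSign, one_mul]
    exact mul_le_mul_of_nonneg_right ((hM _ _).trans (le_max_left _ _)) (norm_nonneg _)
  obtain ⟨S, -, hS⟩ := exists_sparse_operator (E := fun i : K.FormIndex => Lp ℂ 2 i.1.measure)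
    (A := fun i : K.FormIndex => i.2)
    (fun i H => ⟨i.1, i.2.erase H.1⟩) T (le_max_right _ _) hT (card_coe_le hK hN Q) (by
      intro j
      refine le_trans (Set.encard_le_encard_of_injOn
        (t := K.midSet j.1.1) (f := fun a => a.2.1.1) ?_ ?_) (encard_midSet_le hK hN Q j.1)
      · rintro ⟨i, H⟩ rfl
        exact H.1.2
      · rintro ⟨⟨D, I⟩, ⟨H, hH⟩⟩ h1 ⟨⟨D', I'⟩, ⟨H', hH'⟩⟩ h2 (e : H.1 = H'.1)
        have h3 : (⟨D, I.erase H⟩ : K.FormIndex) = ⟨D', I'.erase H'⟩ := h1.trans h2.symm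
        obtain rfl : D = D' := congrArg Sigma.fst h3
        obtain rfl : H = H' := Subtype.ext e
        have h4 : I.erase H = I'.erase H := eq_of_heq (Sigma.mk.inj_iff.1 h3).2
        have h6 : I = I' := by
          rw [← Finset.insert_erase (show H ∈ I from hH),
            ← Finset.insert_erase (show H ∈ I' from hH'), h4]
        subst h6
        rfl)
  refine ⟨S, fun σ ξ h i => ?_⟩
  rw [hS]
  have h1 : ∀ H : i.2, (T i H (ξ ⟨i.1, i.2.erase H.1⟩) : i.1.E → ℂ) =ᵐ[i.1.measure] fun x =>
      wedgeSign i.2 H.1 • c i.1 H.1 • coeff σ ⟨i.1, i.2.erase H.1⟩ x := by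
    intro H
    filter_upwards [Lp.coeFn_smul ((wedgeSign i.2 H.1 * c i.1 H.1 : ℝ) : ℂ)
      (ξ ⟨i.1, i.2.erase H.1⟩), h ⟨i.1, i.2.erase H.1⟩] with x hx hx'
    refine hx.trans ?_
    rw [Pi.smul_apply, hx', ← mul_smul, Complex.real_smul, smul_eq_mul]
  have h2 := Lp.coeFn_finsetSum Finset.univ fun H : i.2 => T i H (ξ ⟨i.1, i.2.erase H.1⟩)
  filter_upwards [h2, ae_all_iff.2 h1] with x hx hx'
  rw [hx, coeff_wedgeForm, Finset.sum_apply, ← Finset.sum_coe_sort i.2]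
  exact Finset.sum_congr rfl fun H _ => hx' H

/-! ## The formal adjoint of `e_w` -/

theorem finite_setOf_top_eq (hK : K.IsCAT0) (hb : K.BoundedGeometry) (Q v : V) :
    {D : K.Cube | D.top hK Q = v}.Finite := by
  refine Set.Finite.of_finite_image (f := fun D : K.Cube => K.midSet D.1)
    ((hb.finite_downSet Q v).finite_subsets.subset ?_) ?_
  · rintro _ ⟨D, rfl, rfl⟩
    exact D.midSet_subset_downSet hK Q
  · intro D hD D' hD' h
    exact Cube.ext_top hK (hD.trans (Eq.symm hD')) h

/-- Only cubes with the same top vertex as a cube in the support of σ receive a contribution, and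
bounded geometry leaves finitely many of them. -/
theorem exists_represents_eGen (hK : K.IsCAT0) (hb : K.BoundedGeometry) (Q : V)
    {a : ∀ D : K.Cube, D.Mid → D.E → ℝ} (ha : ∀ D H, Continuous (a D H)) {σ : K.Form}
    (hσ : σ ∈ K.Omega) : ∃ ξ : K.OmegaL2, Represents (eGen Q a σ) ξ := by
  refine exists_hasCoeff (fun i => ?_) ?_
  · have : coeff (eGen Q a σ) i = _ := funext (coeff_eGen hK Q a σ i)
    rw [this]
    refine continuous_finsetSum _ fun H _ => ?_
    have k1 := ha i.1 H
    have k2 := (contDiff_coeff hσ (faceIndex hK Q i H)).continuous.comp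
      (faceProj (i.1.face_subset hK Q H.1)).continuous
    exact ((k1.smul k2).const_smul (wedgeSign i.2 H))
  · have hfin : (⋃ C ∈ {C | σ C ≠ 0}, {D : K.Cube | D.top hK Q = C.top hK Q}).Finite :=
      hσ.2.biUnion fun C _ => finite_setOf_top_eq hK hb Q _
    refine (hfin.toFinset.sigma fun _ => Finset.univ).finite_toSet.subset fun i hi => ?_
    rw [Finset.mem_coe, Finset.mem_sigma, Set.Finite.mem_toFinset]
    refine ⟨?_, Finset.mem_univ _⟩
    by_contra hcon
    simp only [Set.mem_iUnion, not_exists] at hcon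
    refine hi (funext fun x => ?_)
    rw [coeff_eGen hK]
    refine Finset.sum_eq_zero fun H _ => ?_
    have : coeff σ (faceIndex hK Q i H) (faceProj (i.1.face_subset hK Q H.1) x) = 0 := by
      rw [coeff_eq_zero]
      · rfl
      · by_contra h
        exact hcon _ h (i.1.top_face hK Q H.1).symm
    rw [this, smul_zero, smul_zero]

theorem continuous_eWeight (w : K.Hyperplane → ℝ) (D : K.Cube) (H : D.Mid) :
    Continuous (eWeight w D H) := by
  unfold eWeight; fun_prop

theorem exists_represents_eForm (hK : K.IsCAT0) (hb : K.BoundedGeometry) (P : V)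
    (w : K.Hyperplane → ℝ) {σ : K.Form} (hσ : σ ∈ K.Omega) :
    ∃ ξ : K.OmegaL2, Represents (eForm P w σ) ξ := by
  rw [eForm_eq_eGen]
  exact exists_represents_eGen hK hb P (continuous_eWeight w) hσ

/-- `η` is the image of `τ` under the formal adjoint of `e_w`. -/
def IsEAdjoint (P : V) (w : K.Hyperplane → ℝ) (τ η : K.OmegaL2) : Prop :=
  ∀ ρ ∈ K.Omega, ∀ ξ ζ : K.OmegaL2, Represents ρ ξ → Represents (eForm P w ρ) ζ →
    inner ℂ ζ τ = inner ℂ ξ η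

/-- Although e_w is unbounded, pairing with τ only sees the finitely many cubes that support τ.
Cutting the weights off outside these cubes gives a bounded operator T, and the value is its adjoint
at τ. -/
theorem exists_isEAdjoint (hK : K.IsCAT0) (hb : K.BoundedGeometry) (P : V)
    (w : K.Hyperplane → ℝ) {τ : K.Form} (hτ : τ ∈ K.Omega) {τ₂ : K.OmegaL2}
    (h : Represents τ τ₂) : ∃ η, IsEAdjoint P w τ₂ η := by
  classical
  let F : Finset K.Cube := hτ.2.toFinset
  let a : ∀ D : K.Cube, D.Mid → D.E → ℝ := fun D H x => if D ∈ F then eWeight w D H x else 0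
  have ha : ∀ D H, Continuous (a D H) := by
    intro D H
    by_cases hD : D ∈ F
    · simpa only [a, hD, if_true] using continuous_eWeight w D H
    · simpa only [a, hD, if_false] using continuous_const
  have hM : ∀ D H, ∀ x ∈ D.box, |a D H x| ≤
      ∑ D ∈ F, ∑ H : D.Mid, |w H.1| * Real.exp |w H.1| := by
    intro D H x hx
    by_cases hD : D ∈ F
    · simp only [a, hD, if_true, eWeight]
      have h1 : |w H.1 * Real.exp (w H.1 * (x H - 1))| ≤ |w H.1| * Real.exp |w H.1| := by
        rw [abs_mul, Real.abs_exp]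
        gcongr
        refine (le_abs_self _).trans ?_
        rw [abs_mul]
        refine mul_le_of_le_one_right (abs_nonneg _) ?_
        rw [abs_le]
        have h2 := hx.1 H
        have h3 := hx.2 H
        simp only [Pi.zero_apply, Pi.one_apply] at h2 h3
        constructor <;> linarith
      refine h1.trans ?_
      refine (Finset.single_le_sum (f := fun H : D.Mid => |w H.1| * Real.exp |w H.1|)
        (fun _ _ => by positivity) (Finset.mem_univ H)).trans ?_
      exact Finset.single_le_sum (f := fun D : K.Cube => ∑ H : D.Mid, |w H.1| * Real.exp |w H.1|)
        (fun _ _ => Finset.sum_nonneg fun _ _ => by positivity) hD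
    · simp only [a, hD, if_false, abs_zero]
      exact Finset.sum_nonneg fun _ _ => Finset.sum_nonneg fun _ _ => by positivity
  obtain ⟨T, hT⟩ := exists_eGen_operator hK hb P ha hM
  refine ⟨ContinuousLinearMap.adjoint T τ₂, fun ρ hρ ξ ζ hξ hζ => ?_⟩
  rw [ContinuousLinearMap.adjoint_inner_right]
  have h0 : ∀ i : K.FormIndex, i.1 ∉ F → coeff τ i = 0 := fun i hi => coeff_eq_zero (by
    simpa [F] using hi)
  rw [hζ.hasCoeff.inner_eq_sum h.hasCoeff F h0, (hT ρ ξ hξ).hasCoeff.inner_eq_sum h.hasCoeff F h0]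
  refine Finset.sum_congr rfl fun C hC => Finset.sum_congr rfl fun I _ => ?_
  have : coeff (eForm P w ρ) ⟨C, I⟩ = coeff (eGen P a ρ) ⟨C, I⟩ := by
    funext x
    rw [eForm_eq_eGen, coeff_eGen hK, coeff_eGen hK]
    simp only [a, hC, if_true]
  rw [this]

end CubeComplex

end

noncomputable section

open MeasureTheory

/-! ## The graph of the de Rham operator -/

theorem LinearPMap.mem_graph_domRestrict {E F : Type*} [AddCommGroup E] [Module ℂ E]
    [AddCommGroup F] [Module ℂ F] {f : E →ₗ.[ℂ] F} {S : Submodule ℂ E} {x : E} {y : F} (hx : x ∈ S)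
    (h : (x, y) ∈ f.graph) : (x, y) ∈ (f.domRestrict S).graph := by
  obtain ⟨z, hz, hz'⟩ := (LinearPMap.mem_graph_iff f).1 h
  simp only at hz hz'
  subst hz
  refine (LinearPMap.mem_graph_iff _).2 ⟨⟨z, hx, z.2⟩, rfl, ?_⟩
  exact hz'

theorem LinearPMap.mem_graph_add {E F : Type*} [AddCommGroup E] [Module ℂ E]
    [AddCommGroup F] [Module ℂ F] {f g : E →ₗ.[ℂ] F} {x : E} {y y' : F}
    (h : (x, y) ∈ f.graph) (h' : (x, y') ∈ g.graph) : (x, y + y') ∈ (f + g).graph := by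
  obtain ⟨z, hz, hz'⟩ := (LinearPMap.mem_graph_iff f).1 h
  obtain ⟨t, ht, ht'⟩ := (LinearPMap.mem_graph_iff g).1 h'
  simp only at hz hz' ht ht'
  subst hz
  have e : (⟨z, ht ▸ t.2⟩ : g.domain) = t := Subtype.ext ht.symm
  refine (LinearPMap.mem_graph_iff _).2 ⟨⟨z, z.2, ht ▸ t.2⟩, rfl, ?_⟩
  refine (LinearPMap.add_apply f g _).trans ?_
  rw [e, ht', ← hz']

theorem LinearPMap.mem_graph_adjoint {H : Type*} [NormedAddCommGroup H] [InnerProductSpace ℂ H]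
    [CompleteSpace H] {f : H →ₗ.[ℂ] H} (hf : Dense (f.domain : Set H)) {x y : H}
    (h : ∀ a b, (a, b) ∈ f.graph → inner ℂ b x = inner ℂ a y) : (x, y) ∈ f.adjoint.graph := by
  rw [LinearPMap.adjoint_graph_eq_graph_adjoint hf, Submodule.mem_adjoint_iff]
  intro a b hab
  rw [h a b hab, sub_self]

namespace CubeComplex

variable {V : Type*} {K : CubeComplex V}

/-- `Submodule.toLinearPMap` has the prescribed graph only if the relation is single valued. This is
a real condition, since a form is determined by its L²-class only on the cube, not on the ambient
space. -/
theorem mem_graph_l2Operator {S : Submodule ℂ K.Form} {T : S →ₗ[ℂ] K.Form}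
    (hT : ∀ σ : S, Represents σ.1 0 → ∀ η, Represents (T σ) η → η = 0) {ξ η : K.OmegaL2} :
    (ξ, η) ∈ (l2Operator S T).graph ↔ ∃ σ : S, Represents σ.1 ξ ∧ Represents (T σ) η := by
  rw [l2Operator, Submodule.toLinearPMap_graph_eq]
  · rfl
  · rintro ⟨x, y⟩ ⟨σ, h1, h2⟩ h3
    simp only at h1 h2 h3
    subst h3
    exact hT σ h1 y h2

theorem domain_l2Operator_le (S : Submodule ℂ K.Form) (T : S →ₗ[ℂ] K.Form) :
    (l2Operator S T).domain ≤ l2Subspace S := by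
  rintro _ ⟨⟨x, y⟩, ⟨σ, h1, -⟩, rfl⟩
  exact ⟨σ, σ.2, h1⟩

theorem eq_zero_of_hasCoeff {c : ∀ i : K.FormIndex, i.1.E → ℂ} {ξ : K.OmegaL2} (h : HasCoeff c ξ)
    (h0 : ∀ i, c i =ᵐ[i.1.measure] 0) : ξ = 0 := by
  refine h.unique fun i => ?_
  rw [lp.coeFn_zero, Pi.zero_apply]
  exact (Lp.coeFn_zero ..).trans (h0 i).symm

/-- A continuous coefficient that vanishes almost everywhere vanishes on the open interior, so its
derivatives vanish there too and d_w is well defined on L²-classes. -/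
theorem coeff_eqOn_zero {σ : K.Form} (hσ : σ ∈ K.Omega) (h : Represents σ 0) (i : K.FormIndex) :
    Set.EqOn (coeff σ i) 0 (interior i.1.box) := by
  have h1 : coeff σ i =ᵐ[i.1.measure] 0 := by
    have h2 := h i
    rw [lp.coeFn_zero, Pi.zero_apply] at h2
    exact h2.symm.trans (Lp.coeFn_zero ..)
  have h3 : coeff σ i =ᵐ[volume.restrict (interior i.1.box)] 0 :=
    ae_mono (Measure.restrict_mono interior_subset le_rfl) h1
  exact Measure.eqOn_open_of_ae_eq h3 isOpen_interior (contDiff_coeff hσ i).continuous.continuousOn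
    continuousOn_const

theorem eq_zero_of_represents_dForm (w : K.Hyperplane → ℝ) {σ : K.Form} (hσ : σ ∈ K.Omega)
    (h : Represents σ 0) {η : K.OmegaL2} (hη : Represents (dForm w σ) η) : η = 0 := by
  refine eq_zero_of_hasCoeff hη.hasCoeff fun i => ?_
  filter_upwards [i.1.ae_mem_interior] with x hx
  refine (coeff_dForm w hσ i.1 i.2 x).trans (Finset.sum_eq_zero fun H _ => ?_)
  have h1 := coeff_eqOn_zero hσ h ⟨i.1, i.2.erase H⟩
  have h2 : coeff σ ⟨i.1, i.2.erase H⟩ =ᶠ[𝓝 x] fun _ => 0 :=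
    h1.eventuallyEq_of_mem (isOpen_interior.mem_nhds hx)
  have h3 : coeff σ ⟨i.1, i.2.erase H⟩ x = 0 := h1 hx
  rw [h2.fderiv_eq, h3]
  simp

theorem eq_zero_of_represents_eForm (hK : K.IsCAT0) (P : V) (w : K.Hyperplane → ℝ) {σ : K.Form}
    (h : Represents σ 0) {η : K.OmegaL2} (hη : Represents (eForm P w σ) η) : η = 0 := by
  rw [eForm_eq_eGen] at hη
  refine eq_zero_of_hasCoeff hη.hasCoeff fun i => ?_
  have h1 : ∀ H : i.1.Mid, ∀ᵐ x ∂i.1.measure,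
      coeff σ (faceIndex hK P i H) (faceProj (i.1.face_subset hK P H.1) x) = 0 := by
    intro H
    have h2 := h (faceIndex hK P i H)
    rw [lp.coeFn_zero, Pi.zero_apply] at h2
    exact (measurePreserving_faceProj hK P i.1 H).quasiMeasurePreserving.ae
      (h2.symm.trans (Lp.coeFn_zero ..))
  filter_upwards [ae_all_iff.2 h1] with x hx
  refine (coeff_eGen hK P _ σ i x).trans (Finset.sum_eq_zero fun H _ => ?_)
  rw [hx H, smul_zero, smul_zero]

theorem l2Subspace_mono {S T : Submodule ℂ K.Form} (h : S ≤ T) : l2Subspace S ≤ l2Subspace T :=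
  fun _ ⟨σ, hσ, hr⟩ => ⟨σ, h hσ, hr⟩

theorem dense_l2Subspace_Omega : Dense (l2Subspace K.Omega : Set K.OmegaL2) :=
  dense_l2Subspace_Omega00.mono
    (l2Subspace_mono (S := K.Omega00) (T := K.Omega) fun _ h => h.1)

theorem Omega00_le_Omega0 : K.Omega00 ≤ K.Omega0 := by
  intro σ hσ
  refine ⟨hσ.1, fun C p H x hx hxH v _ => ?_⟩
  have hx' : x ∉ interior C.box := by
    intro hxi
    have h1 : interior C.box ⊆ {y | 0 < y H ∧ y H < 1} := by
      intro y hy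
      have h2 : Set.MapsTo (fun z : C.E => z H) C.box (Set.Icc 0 1) := fun z hz =>
        ⟨hz.1 H, hz.2 H⟩
      have h3 : (fun z : C.E => z H) '' interior C.box ⊆ interior (Set.Icc (0 : ℝ) 1) :=
        interior_maximal (Set.image_subset_iff.2 fun z hz => h2 (interior_subset hz))
          (isOpenMap_eval H _ isOpen_interior)
      rw [interior_Icc] at h3
      exact h3 ⟨y, hy, rfl⟩
    have := h1 hxi
    simp only [Set.mem_ofPred_eq] at this
    rcases hxH with h | h <;> linarith [this.1, this.2]
  have : σ C p x = 0 := image_eq_zero_of_notMem_tsupport fun h => hx' (hσ.2 C p h)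
  rw [this]; rfl

theorem mem_graph_dDiamondOp (w : K.Hyperplane → ℝ) {σ : K.Form} (hσ : σ ∈ K.Omega)
    {ξ η : K.OmegaL2} (h : Represents σ ξ) (hη : HasCoeff (dStarCoeff w σ) η) :
    (ξ, η) ∈ (dDiamondOp w).graph := by
  have hT : ∀ σ : K.Omega00, Represents σ.1 0 → ∀ η,
      Represents (dLin K.Omega00 (fun _ h => h.1) w σ) η → η = 0 := fun σ h η h' =>
    eq_zero_of_represents_dForm w σ.2.1 h h'
  refine LinearPMap.mem_graph_domRestrict ⟨σ, hσ, h⟩ (LinearPMap.mem_graph_adjoint ?_ ?_)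
  · refine dense_l2Subspace_Omega00.mono ?_
    rintro x ⟨τ, hτ, hx⟩
    obtain ⟨y, hy⟩ := exists_represents_dForm w hτ.1
    exact LinearPMap.mem_domain_of_mem_graph ((mem_graph_l2Operator hT).2 ⟨⟨τ, hτ⟩, hx, hy⟩)
  · intro a b hab
    obtain ⟨τ, ha, hb⟩ := (mem_graph_l2Operator hT).1 hab
    exact inner_dForm w (Omega00_le_Omega0 τ.2) hσ ha h hb hη

theorem mem_graph_eOp (hK : K.IsCAT0) (P : V) (w : K.Hyperplane → ℝ) {ξ η : K.OmegaL2} :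
    (ξ, η) ∈ (eOp P w).graph ↔ ∃ σ : K.Omega, Represents σ.1 ξ ∧ Represents (eForm P w σ) η :=
  mem_graph_l2Operator fun _ h _ h' => eq_zero_of_represents_eForm hK P w h h'

theorem mem_graph_eDiamondOp (hK : K.IsCAT0) (hb : K.BoundedGeometry) (P : V)
    (w : K.Hyperplane → ℝ) {ξ η : K.OmegaL2} (h : ξ ∈ l2Subspace K.Omega)
    (hη : IsEAdjoint P w ξ η) : (ξ, η) ∈ (eDiamondOp P w).graph := by
  refine LinearPMap.mem_graph_domRestrict h (LinearPMap.mem_graph_adjoint ?_ ?_)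
  · refine dense_l2Subspace_Omega.mono ?_
    rintro x ⟨τ, hτ, hx⟩
    obtain ⟨y, hy⟩ := exists_represents_eForm hK hb P w hτ
    exact LinearPMap.mem_domain_of_mem_graph ((mem_graph_eOp hK P w).2 ⟨⟨τ, hτ⟩, hx, hy⟩)
  · intro a b hab
    obtain ⟨τ, ha, hb⟩ := (mem_graph_eOp hK P w).1 hab
    exact hη τ τ.2 a b ha hb

/-- The four parts of the value of the de Rham operator on a form. -/
structure DeRhamParts (P : V) (w : K.Hyperplane → ℝ) (σ : K.Form) (ξ η₁ η₂ η₃ η₄ : K.OmegaL2) :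
    Prop where
  mem : σ ∈ K.Omega0
  rep : Represents σ ξ
  d : Represents (dForm w σ) η₁
  e : Represents (eForm P w σ) η₂
  dStar : HasCoeff (dStarCoeff w σ) η₃
  eStar : IsEAdjoint P w ξ η₄

theorem exists_deRhamParts (hK : K.IsCAT0) (hb : K.BoundedGeometry) (P : V)
    (w : K.Hyperplane → ℝ) {σ : K.Form} (hσ : σ ∈ K.Omega0) {ξ : K.OmegaL2} (h : Represents σ ξ) :
    ∃ η₁ η₂ η₃ η₄, DeRhamParts P w σ ξ η₁ η₂ η₃ η₄ := by
  obtain ⟨η₁, h1⟩ := exists_represents_dForm w hσ.1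
  obtain ⟨η₂, h2⟩ := exists_represents_eForm hK hb P w hσ.1
  obtain ⟨η₃, h3⟩ := exists_hasCoeff_dStar w hσ.1
  obtain ⟨η₄, h4⟩ := exists_isEAdjoint hK hb P w hσ.1 h
  exact ⟨η₁, η₂, η₃, η₄, hσ, h, h1, h2, h3, h4⟩

theorem DeRhamParts.mem_graph (hK : K.IsCAT0) (hb : K.BoundedGeometry) {P : V}
    {w : K.Hyperplane → ℝ} {σ : K.Form} {ξ η₁ η₂ η₃ η₄ : K.OmegaL2}
    (h : DeRhamParts P w σ ξ η₁ η₂ η₃ η₄) :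
    (ξ, η₁ + η₂ + η₃ + η₄) ∈ (deRhamOp P w).graph := by
  refine LinearPMap.mem_graph_add (LinearPMap.mem_graph_add (LinearPMap.mem_graph_add ?_ ?_) ?_) ?_
  · have hT : ∀ σ : K.Omega0, Represents σ.1 0 → ∀ η,
        Represents (dLin K.Omega0 (fun _ h => h.1) w σ) η → η = 0 := fun σ h η h' =>
      eq_zero_of_represents_dForm w σ.2.1 h h'
    exact (mem_graph_l2Operator hT).2 ⟨⟨σ, h.mem⟩, h.rep, h.d⟩
  · exact (mem_graph_eOp hK P w).2 ⟨⟨σ, h.mem.1⟩, h.rep, h.e⟩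
  · exact mem_graph_dDiamondOp w h.mem.1 h.rep h.dStar
  · exact mem_graph_eDiamondOp hK hb P w ⟨σ, h.mem.1, h.rep⟩ h.eStar

/-- The other three summands are defined on all of Ω(X), so d_w alone decides the domain. -/
theorem domain_deRhamOp (hK : K.IsCAT0) (hb : K.BoundedGeometry) (P : V) (w : K.Hyperplane → ℝ) :
    (deRhamOp P w).domain = l2Subspace K.Omega0 := by
  refine le_antisymm ?_ ?_
  · intro ξ hξ
    exact domain_l2Operator_le _ _ hξ.1.1.1
  · rintro ξ ⟨σ, hσ, h⟩
    obtain ⟨η₁, η₂, η₃, η₄, hp⟩ := exists_deRhamParts hK hb P w hσ h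
    exact LinearPMap.mem_domain_of_mem_graph (hp.mem_graph hK hb)

theorem exists_deRhamParts_of_mem_graph (hK : K.IsCAT0) (hb : K.BoundedGeometry) {P : V}
    {w : K.Hyperplane → ℝ} {ξ ζ : K.OmegaL2} (h : (ξ, ζ) ∈ (deRhamOp P w).graph) :
    ∃ σ η₁ η₂ η₃ η₄, DeRhamParts P w σ ξ η₁ η₂ η₃ η₄ ∧ ζ = η₁ + η₂ + η₃ + η₄ := by
  have h1 := LinearPMap.mem_domain_of_mem_graph h
  rw [domain_deRhamOp hK hb] at h1
  obtain ⟨σ, hσ, hr⟩ := h1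
  obtain ⟨η₁, η₂, η₃, η₄, hp⟩ := exists_deRhamParts hK hb P w hσ hr
  exact ⟨σ, η₁, η₂, η₃, η₄, hp,
    LinearPMap.mem_graph_snd_inj _ h (hp.mem_graph hK hb) rfl⟩

/-- The d_w-part on one side pairs with the d_w^⋄-part on the other, and likewise for e_w. The
boundary condition holds on both sides, so integration by parts leaves no boundary terms. -/
theorem isFormalAdjoint_deRhamOp (hK : K.IsCAT0) (hb : K.BoundedGeometry) (P : V)
    (w : K.Hyperplane → ℝ) : (deRhamOp P w : K.OmegaL2 →ₗ.[ℂ] _).IsFormalAdjoint (deRhamOp P w) := by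
  intro x y
  obtain ⟨σ, η₁, η₂, η₃, η₄, h, e⟩ :=
    exists_deRhamParts_of_mem_graph hK hb (LinearPMap.mem_graph (deRhamOp P w) x)
  obtain ⟨τ, θ₁, θ₂, θ₃, θ₄, k, e'⟩ :=
    exists_deRhamParts_of_mem_graph hK hb (LinearPMap.mem_graph (deRhamOp P w) y)
  rw [e, e']
  have a1 := inner_dForm w h.mem k.mem.1 h.rep k.rep h.d k.dStar
  have a2 := inner_dForm w k.mem h.mem.1 k.rep h.rep k.d h.dStar
  have a3 := k.eStar σ h.mem.1 _ _ h.rep h.e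
  have a4 := h.eStar τ k.mem.1 _ _ k.rep k.e
  have a2' := congrArg (starRingEnd ℂ) a2
  have a4' := congrArg (starRingEnd ℂ) a4
  simp only [inner_conj_symm] at a2' a4'
  simp only [inner_add_left, inner_add_right, a1, a3, ← a2', ← a4']
  ring

end CubeComplex

end

noncomputable section

open MeasureTheory

/-! ## The eigenforms of the square of the de Rham operator -/

theorem fderiv_prod_apply_single {ι : Type*} [Fintype ι] [DecidableEq ι] (u : ι → ℝ → ℝ)
    (hu : ∀ i, ContDiff ℝ 1 (u i)) (h : ι) (x : ι → ℝ) :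
    fderiv ℝ (fun x : ι → ℝ => ((∏ i, u i (x i) : ℝ) : ℂ)) x (Pi.single h 1) =
      ((deriv (u h) (x h) * ∏ i ∈ Finset.univ.erase h, u i (x i) : ℝ) : ℂ) := by
  have hd : DifferentiableAt ℝ (fun x : ι → ℝ => ((∏ i, u i (x i) : ℝ) : ℂ)) x := by
    have h1 : ContDiff ℝ 1 fun x : ι → ℝ => ∏ i, u i (x i) :=
      contDiff_prod fun i _ => (hu i).comp (contDiff_apply ℝ ℝ i)
    exact Complex.ofRealCLM.differentiable.comp (h1.differentiable one_ne_zero) x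
  rw [← hd.lineDeriv_eq_fderiv, lineDeriv]
  have e : (fun t : ℝ => ((∏ i, u i ((x + t • Pi.single h 1 : ι → ℝ) i) : ℝ) : ℂ)) = fun t =>
      ((u h (x h + t) * ∏ i ∈ Finset.univ.erase h, u i (x i) : ℝ) : ℂ) := by
    funext t
    rw [← Finset.mul_prod_erase _ _ (Finset.mem_univ h)]
    congr 2
    · simp
    · refine Finset.prod_congr rfl fun i hi => ?_
      simp [Finset.ne_of_mem_erase hi]
  rw [e]
  have h2 : HasDerivAt (fun t => u h (x h + t)) (deriv (u h) (x h)) 0 := by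
    have h3 : HasDerivAt (u h) (deriv (u h) (x h)) (x h + 0) := by
      rw [add_zero]; exact ((hu h).differentiable one_ne_zero _).hasDerivAt
    exact h3.comp_const_add (x h) 0
  exact (h2.mul_const _).ofReal_comp.deriv

theorem deriv_sinMode_add (w : ℝ) {m : ℕ} (hm : m ≠ 0) (t : ℝ) :
    deriv (sinMode m) t + w * sinMode m t = cosMode w m t := by
  have h : HasDerivAt (sinMode m) (Real.cos (m * Real.pi * t) * (m * Real.pi * 1)) t :=
    ((hasDerivAt_id t).const_mul (m * Real.pi)).sin
  rw [h.deriv, cosMode, if_neg hm, sinMode]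
  ring

/-- For m ≠ 0 this is the factorization (-d/dx + w)(d/dx + w) = w² - d²/dx² applied to a sine; for m
= 0 the mode spans the kernel of -d/dx + w. -/
theorem neg_deriv_cosMode_add (w : ℝ) (m : ℕ) (t : ℝ) :
    -deriv (cosMode w m) t + w * cosMode w m t =
      if m = 0 then 0 else (w ^ 2 + m ^ 2 * Real.pi ^ 2) * sinMode m t := by
  split_ifs with hm
  · have e : cosMode w m = fun t => Real.exp (w * (t - 1)) := by
      funext t; rw [cosMode, if_pos hm]
    have h : HasDerivAt (cosMode w m) (Real.exp (w * (t - 1)) * (w * 1)) t := by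
      rw [e]; exact (((hasDerivAt_id t).sub_const 1).const_mul w).exp
    rw [h.deriv, e]
    ring
  · have e : cosMode w m = fun t =>
        m * Real.pi * Real.cos (m * Real.pi * t) + w * Real.sin (m * Real.pi * t) := by
      funext t; rw [cosMode, if_neg hm]
    have h : HasDerivAt (cosMode w m) (m * Real.pi * (-Real.sin (m * Real.pi * t) *
        (m * Real.pi * 1)) + w * (Real.cos (m * Real.pi * t) * (m * Real.pi * 1))) t := by
      rw [e]
      exact ((((hasDerivAt_id t).const_mul (m * Real.pi)).cos).const_mul _).add
        ((((hasDerivAt_id t).const_mul (m * Real.pi)).sin).const_mul _)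
    rw [h.deriv, e, sinMode]
    ring

/-- The square of the `L²`-norm of `e^{w (x - 1)}` on the unit interval. -/
def expNormSq (w : ℝ) : ℝ := ∫ t in (0 : ℝ)..1, Real.exp (2 * w * (t - 1))

theorem expNormSq_nonneg (w : ℝ) : 0 ≤ expNormSq w :=
  intervalIntegral.integral_nonneg zero_le_one fun _ _ => (Real.exp_pos _).le

theorem two_mul_expNormSq (w : ℝ) : 2 * w * expNormSq w = 1 - Real.exp (-(2 * w)) := by
  rw [expNormSq, ← intervalIntegral.integral_const_mul]
  have h : ∀ t ∈ Set.uIcc (0 : ℝ) 1, HasDerivAt (fun t => Real.exp (2 * w * (t - 1)))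
      (2 * w * Real.exp (2 * w * (t - 1))) t := by
    intro t _
    have := (((hasDerivAt_id t).sub_const 1).const_mul (2 * w)).exp
    simpa [mul_comm] using this
  rw [intervalIntegral.integral_eq_sub_of_hasDerivAt h (by
    apply Continuous.intervalIntegrable; fun_prop)]
  simp

/-- The product w² ∫ e^{2w(x-1)} dx equals w(1 - e^{-2w})/2, and e^{-2w} ≤ 1/2 for w ≥ 1. So the
contribution of a zero mode to the eigenvalue still tends to infinity with w. -/
theorem le_four_mul_expNormSq {w : ℝ} (hw : 1 ≤ w) : w ≤ 4 * (w * (w * expNormSq w)) := by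
  have h1 := two_mul_expNormSq w
  have h2 : Real.exp (-(2 * w)) ≤ 1 / 2 := by
    rw [Real.exp_neg, inv_eq_one_div]
    refine one_div_le_one_div_of_le (by norm_num) ?_
    linarith [Real.add_one_le_exp (2 * w)]
  nlinarith

/-- For m ≠ 0 the integrand is the derivative of w e^{w(t-1)} sin(mπt). Hence e_w^⋄ only sees the
modes with m = 0. -/
theorem integral_exp_mul_cosMode (w : ℝ) (m : ℕ) :
    ∫ t in Set.Icc (0 : ℝ) 1, ((w * Real.exp (w * (t - 1)) * cosMode w m t : ℝ) : ℂ) =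
      ((if m = 0 then w * expNormSq w else 0 : ℝ) : ℂ) := by
  rw [integral_complex_ofReal, integral_Icc_eq_integral_Ioc,
    ← intervalIntegral.integral_of_le zero_le_one]
  congr 1
  split_ifs with hm
  · rw [expNormSq, ← intervalIntegral.integral_const_mul]
    refine intervalIntegral.integral_congr fun t _ => ?_
    simp only [cosMode, if_pos hm]
    rw [mul_assoc, ← Real.exp_add]
    ring_nf
  · have h : ∀ t ∈ Set.uIcc (0 : ℝ) 1,
        HasDerivAt (fun t => w * (Real.exp (w * (t - 1)) * Real.sin (m * Real.pi * t)))
        (w * Real.exp (w * (t - 1)) * cosMode w m t) t := by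
      intro t _
      have h1 := (((hasDerivAt_id t).sub_const 1).const_mul w).exp
      have h2 := ((hasDerivAt_id t).const_mul (m * Real.pi)).sin
      refine ((h1.mul h2).const_mul w).congr_deriv ?_
      simp only [cosMode, if_neg hm, id]
      ring
    rw [intervalIntegral.integral_eq_sub_of_hasDerivAt h (by
      apply Continuous.intervalIntegrable
      have := (contDiff_cosMode w m (n := 0)).continuous
      fun_prop)]
    simp [Real.sin_nat_mul_pi]

theorem wedgeSign_insert {α : Type*} [LinearOrder α] (I : Finset α) (k : α) :
    wedgeSign (insert k I) k = wedgeSign I k := by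
  rw [wedgeSign, wedgeSign, Finset.filter_insert, if_neg (lt_irrefl k)]

namespace CubeComplex

variable {V : Type*} {K : CubeComplex V}

theorem HasCoeff.sum_smul {κ : Type*} (s : Finset κ) (r : κ → ℂ)
    {c : κ → ∀ i : K.FormIndex, i.1.E → ℂ} {ξ : κ → K.OmegaL2} (h : ∀ k, HasCoeff (c k) (ξ k)) :
    HasCoeff (fun i x => ∑ k ∈ s, r k * c k i x) (∑ k ∈ s, r k • ξ k) := by
  classical
  intro i
  induction s using Finset.induction_on with
  | empty =>
    rw [Finset.sum_empty, lp.coeFn_zero, Pi.zero_apply]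
    filter_upwards [Lp.coeFn_zero ℂ 2 i.1.measure] with x hx
    rw [hx, Finset.sum_empty, Pi.zero_apply]
  | insert a s ha ih =>
    rw [Finset.sum_insert ha, lp.coeFn_add, Pi.add_apply, lp.coeFn_smul, Pi.smul_apply]
    filter_upwards [ih, h a i, Lp.coeFn_add (r a • ξ a i) ((∑ k ∈ s, r k • ξ k : K.OmegaL2) i),
      Lp.coeFn_smul (r a) (ξ a i)] with x h1 h2 h3 h4
    rw [h3, Pi.add_apply, h4, Pi.smul_apply, h1, h2, Finset.sum_insert ha, smul_eq_mul]

/-! ### Product modes on the cubes and the action of d_w, e_w and d_w^⋄ on them -/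

/-- The product of the one-dimensional modes over the coordinates of a cube. -/
def modeFun (w : K.Hyperplane → ℝ) (m : K.Hyperplane →₀ ℕ) (I : Finset K.Hyperplane) (C : K.Cube)
    (x : C.E) : ℝ :=
  ∏ H : C.Mid, if H.1 ∈ I then cosMode (w H.1) (m H.1) (x H) else sinMode (m H.1) (x H)

/-- The multi-index of the eigenform with the given parameters. -/
def IsModeIndex (hK : K.IsCAT0) (P v : V) (m : K.Hyperplane →₀ ℕ) (I : Finset K.Hyperplane)
    (i : K.FormIndex) : Prop :=
  i.1.top hK P = v ∧ hyp i.2 = I ∧ ∀ H, H ∈ K.midSet i.1.1 ↔ H ∈ I ∨ m H ≠ 0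

open Classical in
/-- The coefficients of an eigenform. -/
def modeCoeff (hK : K.IsCAT0) (P : V) (w : K.Hyperplane → ℝ) (v : V) (m : K.Hyperplane →₀ ℕ)
    (I : Finset K.Hyperplane) (i : K.FormIndex) (x : i.1.E) : ℂ :=
  if IsModeIndex hK P v m I i then (modeFun w m I i.1 x : ℂ) else 0

variable (hK : K.IsCAT0) (P : V) (w : K.Hyperplane → ℝ) (v : V) (m : K.Hyperplane →₀ ℕ)
  (I : Finset K.Hyperplane)

/-- The mode with parameters v, m, I lives on one cube, whose hyperplanes are those in I and those
with m ≠ 0. A hyperplane outside I with m = 0 would contribute the factor sin 0 = 0, so it is not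
allowed to cut the cube. -/
theorem IsModeIndex.unique {hK : K.IsCAT0} {P v : V} {m : K.Hyperplane →₀ ℕ}
    {I : Finset K.Hyperplane} {i j : K.FormIndex} (h : IsModeIndex hK P v m I i)
    (h' : IsModeIndex hK P v m I j) : i = j := by
  obtain ⟨C, J⟩ := i
  obtain ⟨C', J'⟩ := j
  obtain rfl : C = C' := Cube.ext_top hK (P := P) (h.1.trans h'.1.symm)
    (Set.ext fun H => (h.2.2 H).trans (h'.2.2 H).symm)
  obtain rfl : J = J' := hyp_injective (h.2.1.trans h'.2.1.symm)
  rfl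

theorem contDiff_modeCoeff (i : K.FormIndex) : ContDiff ℝ ∞ (modeCoeff hK P w v m I i) := by
  unfold modeCoeff
  split_ifs
  · have h1 : ContDiff ℝ ∞ (modeFun w m I i.1) := by
      refine contDiff_prod fun H _ => ?_
      split_ifs
      · exact (contDiff_cosMode _ _).comp (contDiff_apply ℝ ℝ H)
      · exact (contDiff_sinMode _).comp (contDiff_apply ℝ ℝ H)
    exact Complex.ofRealCLM.contDiff.comp h1
  · exact contDiff_const

/-- For H ∉ I the factor in x_H is a sine mode and vanishes at both ends. -/
theorem modeCoeff_mem_Omega0 : ofCoeff (modeCoeff hK P w v m I) ∈ K.Omega0 := by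
  refine ofCoeff_mem_Omega0 (contDiff_modeCoeff hK P w v m I) ?_ ?_
  · refine Set.Subsingleton.finite fun i hi j hj => ?_
    have key : ∀ i, modeCoeff hK P w v m I i ≠ 0 → IsModeIndex hK P v m I i := by
      intro i hi
      by_contra h
      exact hi (funext fun x => if_neg h)
    exact (key i hi).unique (key j hj)
  · intro i H hH x hx
    unfold modeCoeff
    split_ifs with h
    · have : H.1 ∉ I := by rw [← h.2.1, val_mem_hyp]; exact hH
      rw [modeFun, Finset.prod_eq_zero (Finset.mem_univ H), Complex.ofReal_zero]
      rw [if_neg this, sinMode]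
      rcases hx with hx | hx <;> simp [hx, Real.sin_nat_mul_pi]
    · rfl

theorem exists_modeVec : ∃ ξ : K.OmegaL2, Represents (ofCoeff (modeCoeff hK P w v m I)) ξ :=
  exists_represents (modeCoeff_mem_Omega0 hK P w v m I).1

/-- The eigenforms as elements of the Hilbert space. -/
def modeVec : K.OmegaL2 := (exists_modeVec hK P w v m I).choose

theorem represents_modeVec :
    Represents (ofCoeff (modeCoeff hK P w v m I)) (modeVec hK P w v m I) :=
  (exists_modeVec hK P w v m I).choose_spec

theorem hasCoeff_modeVec : HasCoeff (modeCoeff hK P w v m I) (modeVec hK P w v m I) := by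
  have := (represents_modeVec hK P w v m I).hasCoeff
  rwa [coeff_ofCoeff] at this

variable {w m I}

theorem modeFun_eq_mul {C : K.Cube} (H : C.Mid) (x : C.E) [DecidableEq C.Mid] :
    modeFun w m I C x =
      (if H.1 ∈ I then cosMode (w H.1) (m H.1) (x H) else sinMode (m H.1) (x H)) *
      ∏ H' ∈ Finset.univ.erase H,
        if H'.1 ∈ I then cosMode (w H'.1) (m H'.1) (x H') else sinMode (m H'.1) (x H') :=
  (Finset.mul_prod_erase _ _ (Finset.mem_univ H)).symm

theorem fderiv_modeFun {C : K.Cube} [DecidableEq C.Mid] (H : C.Mid) (x : C.E) :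
    fderiv ℝ (fun x => (modeFun w m I C x : ℂ)) x (Pi.single H 1) =
      (((if H.1 ∈ I then deriv (cosMode (w H.1) (m H.1)) (x H) else deriv (sinMode (m H.1)) (x H)) *
      ∏ H' ∈ Finset.univ.erase H, if H'.1 ∈ I then cosMode (w H'.1) (m H'.1) (x H')
        else sinMode (m H'.1) (x H') : ℝ) : ℂ) := by
  have h := fderiv_prod_apply_single (fun H' : C.Mid => fun t =>
    if H'.1 ∈ I then cosMode (w H'.1) (m H'.1) t else sinMode (m H'.1) t) (fun H' => by
      split_ifs
      · exact contDiff_cosMode _ _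
      · exact contDiff_sinMode _) H x
  refine h.trans ?_
  congr 2
  split_ifs <;> rfl

theorem fderiv_modeFun_add {C : K.Cube} [DecidableEq C.Mid] {H : C.Mid} (hI : H.1 ∉ I)
    (hm : m H.1 ≠ 0) (x : C.E) :
    fderiv ℝ (fun x => (modeFun w m I C x : ℂ)) x (Pi.single H 1) + w H.1 • (modeFun w m I C x : ℂ) =
      (modeFun w m (insert H.1 I) C x : ℂ) := by
  rw [fderiv_modeFun, modeFun_eq_mul H x, modeFun_eq_mul H x, if_neg hI, if_neg hI,
    if_pos (Finset.mem_insert_self _ _), ← deriv_sinMode_add _ hm, Complex.real_smul]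
  have e : ∏ H' ∈ Finset.univ.erase H, (if H'.1 ∈ insert H.1 I then
      cosMode (w H'.1) (m H'.1) (x H') else sinMode (m H'.1) (x H')) =
      ∏ H' ∈ Finset.univ.erase H, (if H'.1 ∈ I then
      cosMode (w H'.1) (m H'.1) (x H') else sinMode (m H'.1) (x H')) := by
    refine Finset.prod_congr rfl fun H' hH' => ?_
    have : H'.1 ≠ H.1 := fun e => (Finset.mem_erase.1 hH').1 (Subtype.ext e)
    simp only [Finset.mem_insert, this, false_or]
  rw [e]
  push_cast
  ring

theorem neg_fderiv_modeFun_add {C : K.Cube} [DecidableEq C.Mid] {H : C.Mid} (hI : H.1 ∈ I)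
    (x : C.E) :
    -fderiv ℝ (fun x => (modeFun w m I C x : ℂ)) x (Pi.single H 1) +
      w H.1 • (modeFun w m I C x : ℂ) =
      ((if m H.1 = 0 then 0 else w H.1 ^ 2 + m H.1 ^ 2 * Real.pi ^ 2 : ℝ) : ℂ) *
        (modeFun w m (I.erase H.1) C x : ℂ) := by
  rw [fderiv_modeFun, modeFun_eq_mul H x, modeFun_eq_mul H x, if_pos hI, if_pos hI,
    if_neg (Finset.notMem_erase _ _), Complex.real_smul]
  have e : ∏ H' ∈ Finset.univ.erase H, (if H'.1 ∈ I.erase H.1 then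
      cosMode (w H'.1) (m H'.1) (x H') else sinMode (m H'.1) (x H')) =
      ∏ H' ∈ Finset.univ.erase H, (if H'.1 ∈ I then
      cosMode (w H'.1) (m H'.1) (x H') else sinMode (m H'.1) (x H')) := by
    refine Finset.prod_congr rfl fun H' hH' => ?_
    have : H'.1 ≠ H.1 := fun e => (Finset.mem_erase.1 hH').1 (Subtype.ext e)
    simp only [Finset.mem_erase, ne_eq, this, not_false_iff, true_and]
  rw [e]
  generalize (∏ H' ∈ Finset.univ.erase H, (if H'.1 ∈ I then
      cosMode (w H'.1) (m H'.1) (x H') else sinMode (m H'.1) (x H'))) = p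
  have h1 := neg_deriv_cosMode_add (w H.1) (m H.1) (x H)
  have h2 : ((if m H.1 = 0 then 0 else w H.1 ^ 2 + m H.1 ^ 2 * Real.pi ^ 2 : ℝ)) *
      (sinMode (m H.1) (x H) * p) =
      (-deriv (cosMode (w H.1) (m H.1)) (x H) + w H.1 * cosMode (w H.1) (m H.1) (x H)) * p := by
    rw [h1]
    split_ifs <;> ring
  have h3 := congrArg (fun t : ℝ => (t : ℂ)) h2
  push_cast at h3 ⊢
  linear_combination -h3

/-- Restriction of a product of modes to a face. -/
theorem modeFun_faceProj {C : K.Cube} (H : C.Mid) (x : C.E) :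
    modeFun w m I C x =
      (if H.1 ∈ I then cosMode (w H.1) (m H.1) (x H) else sinMode (m H.1) (x H)) *
      modeFun w m (I.erase H.1) (C.face hK P H.1) (faceProj (C.face_subset hK P H.1) x) := by
  unfold modeFun
  rw [← (C.faceEquiv hK P H).prod_comp, Fintype.prod_option]
  congr 1
  refine Finset.prod_congr rfl fun H' _ => ?_
  have h1 : H'.1 ≠ H.1 := ((C.mem_midSet_face hK P).1 H'.2).2
  have h2 : ((C.faceEquiv hK P H (some H')) : C.Mid).1 = H'.1 := rfl
  simp only [h2, Finset.mem_erase, ne_eq, h1, not_false_iff, true_and]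
  rfl

/-- The coefficient of the step from `I` to `I ∪ {H}`. -/
def raiseCoeff (w : K.Hyperplane → ℝ) (m : K.Hyperplane →₀ ℕ) (H : K.Hyperplane) : ℝ :=
  if m H = 0 then w H else 1

/-- The coefficient of the step from `I` to `I \ {H}`. -/
def lowerCoeff (w : K.Hyperplane → ℝ) (m : K.Hyperplane →₀ ℕ) (H : K.Hyperplane) : ℝ :=
  if m H = 0 then w H * expNormSq (w H) else w H ^ 2 + m H ^ 2 * Real.pi ^ 2

variable (w m I)

theorem modeCoeff_of_isModeIndex {i : K.FormIndex} (h : IsModeIndex hK P v m I i) :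
    modeCoeff hK P w v m I i = fun x => (modeFun w m I i.1 x : ℂ) :=
  funext fun _ => if_pos h

theorem modeCoeff_of_not_isModeIndex {i : K.FormIndex} (h : ¬IsModeIndex hK P v m I i) :
    modeCoeff hK P w v m I i = 0 := funext fun _ => if_neg h

theorem sum_eq_sum_hyp {C : K.Cube} {Q : Finset K.Hyperplane} {J : Finset C.Mid}
    {F : K.Hyperplane → ℂ} (hF : ∀ H, F H ≠ 0 → H ∈ Q ∧ H ∈ hyp J) :
    ∑ H ∈ Q, F H = ∑ H ∈ J, F H.1 := by
  classical
  have e : ∑ H ∈ Q, F H = ∑ H ∈ hyp J, F H := by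
    rw [← Finset.sum_filter_ne_zero, ← Finset.sum_filter_ne_zero (s := hyp J)]
    refine Finset.sum_congr (Finset.ext fun H => ?_) fun _ _ => rfl
    simp only [Finset.mem_filter]
    exact ⟨fun h => ⟨(hF H h.2).2, h.2⟩, fun h => ⟨(hF H h.2).1, h.2⟩⟩
  rw [e, hyp, Finset.sum_map]
  rfl

theorem isModeIndex_of_ne_zero {hK : K.IsCAT0} {P : V} {w : K.Hyperplane → ℝ} {v : V}
    {m : K.Hyperplane →₀ ℕ} {I : Finset K.Hyperplane} {i : K.FormIndex} {x : i.1.E}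
    (h : modeCoeff hK P w v m I i x ≠ 0) : IsModeIndex hK P v m I i := by
  by_contra h'
  exact h (if_neg h')

theorem IsModeIndex.mem_of_mem {hK : K.IsCAT0} {P v : V} {m : K.Hyperplane →₀ ℕ}
    {I : Finset K.Hyperplane} {i : K.FormIndex} (h : IsModeIndex hK P v m I i)
    {Q : Finset K.Hyperplane} (hQ : (Q : Set _) = K.downSet P v) {H : K.Hyperplane}
    (hH : H ∈ K.midSet i.1.1) : H ∈ Q := by
  have h3 := i.1.midSet_subset_downSet hK P hH
  rwa [h.1, ← hQ] at h3

/-- Here H ∉ I must have m(H) ≠ 0, since H already cuts the cube. The cube does not change and the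
sine factor becomes a cosine mode. -/
theorem represents_dForm_modeVec (Q : Finset K.Hyperplane) (hQ : (Q : Set _) = K.downSet P v) :
    Represents (dForm w (ofCoeff (modeCoeff hK P w v m I)))
      (∑ H ∈ Q, (if H ∉ I ∧ m H ≠ 0 then (wedgeSign I H : ℂ) else 0) •
        modeVec hK P w v m (insert H I)) := by
  classical
  intro i
  refine (HasCoeff.sum_smul Q _ (fun H => hasCoeff_modeVec hK P w v m (insert H I)) i).trans ?_
  refine Filter.Eventually.of_forall fun x => ?_
  simp only
  rw [coeff_dForm w (modeCoeff_mem_Omega0 hK P w v m I).1, coeff_ofCoeff]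
  let F : K.Hyperplane → ℂ := fun H => (if H ∉ I ∧ m H ≠ 0 then (wedgeSign I H : ℂ) else 0) *
    modeCoeff hK P w v m (insert H I) i x
  have hF : ∀ H, F H ≠ 0 → H ∈ Q ∧ H ∈ hyp i.2 := by
    intro H hH
    have h1 := isModeIndex_of_ne_zero (right_ne_zero_of_mul hH)
    have h2 : H ∈ hyp i.2 := h1.2.1 ▸ Finset.mem_insert_self H I
    exact ⟨h1.mem_of_mem hQ (mem_hyp.1 h2).1, h2⟩
  refine (sum_eq_sum_hyp hF).trans (Finset.sum_congr rfl fun H hH => ?_)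
  simp only [F]
  by_cases h : IsModeIndex hK P v m I ⟨i.1, i.2.erase H⟩
  · have hHI : H.1 ∉ I := by rw [← h.2.1, val_mem_hyp]; exact Finset.notMem_erase _ _
    have hm : m H.1 ≠ 0 := ((h.2.2 H.1).1 H.2).resolve_left hHI
    have h' : IsModeIndex hK P v m (insert H.1 I) i := by
      refine ⟨h.1, ?_, fun H' => (h.2.2 H').trans ?_⟩
      · rw [← h.2.1, hyp_erase, Finset.insert_erase (val_mem_hyp.2 hH)]
      · rw [Finset.mem_insert]
        constructor
        · rintro (h | h)
          exacts [.inl (.inr h), .inr h]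
        · rintro ((rfl | h) | h)
          exacts [.inr hm, .inl h, .inr h]
    rw [modeCoeff_of_isModeIndex hK P w v m _ h, modeCoeff_of_isModeIndex hK P w v m _ h',
      if_pos ⟨hHI, hm⟩, fderiv_modeFun_add hHI hm, ← wedgeSign_hyp, h'.2.1, wedgeSign_insert]
    rfl
  · rw [modeCoeff_of_not_isModeIndex hK P w v m _ h]
    have h0 : fderiv ℝ (0 : i.1.E → ℂ) x (Pi.single H 1) + w H.1 • (0 : i.1.E → ℂ) x = 0 := by
      rw [fderiv_zero]; simp
    refine Eq.trans ?_ (congrArg (wedgeSign i.2 H • ·) h0).symm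
    simp only [smul_zero]
    split_ifs with hc
    · rw [modeCoeff_of_not_isModeIndex hK P w v m _, Pi.zero_apply, mul_zero]
      intro h'
      refine h ⟨h'.1, ?_, fun H' => (h'.2.2 H').trans ?_⟩
      · rw [hyp_erase, h'.2.1, Finset.erase_insert hc.1]
      · rw [Finset.mem_insert]
        constructor
        · rintro ((rfl | h) | h)
          exacts [.inr hc.2, .inl h, .inr h]
        · rintro (h | h)
          exacts [.inl (.inr h), .inr h]
    · rw [zero_mul]

theorem isModeIndex_faceIndex {v : V} {m : K.Hyperplane →₀ ℕ} {I : Finset K.Hyperplane}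
    {i : K.FormIndex} {H : i.1.Mid} (hm : m H.1 = 0)
    (h : IsModeIndex hK P v m I i) :
    IsModeIndex hK P v m (I.erase H.1) (faceIndex hK P i H) := by
  refine ⟨(i.1.top_face hK P H.1).trans h.1, by rw [faceIndex_hyp, h.2.1], fun H' => ?_⟩
  refine (i.1.mem_midSet_face hK P).trans ?_
  rw [h.2.2, Finset.mem_erase]
  constructor
  · rintro ⟨h1 | h1, h2⟩
    exacts [.inl ⟨h2, h1⟩, .inr h1]
  · rintro (h1 | h1)
    exacts [⟨.inl h1.2, h1.1⟩, ⟨.inr h1, fun e => h1 (e ▸ hm)⟩]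

/-- Complementary to d_w: the new hyperplane H has m(H) = 0 and does not cut the old cube. The form
is constant in the new direction up to the factor w e^{w(x-1)}, which is w times the zero mode. -/
theorem represents_eForm_modeVec (Q : Finset K.Hyperplane) (hQ : (Q : Set _) = K.downSet P v) :
    Represents (eForm P w (ofCoeff (modeCoeff hK P w v m I)))
      (∑ H ∈ Q, (if H ∉ I ∧ m H = 0 then ((wedgeSign I H * w H : ℝ) : ℂ) else 0) •
        modeVec hK P w v m (insert H I)) := by
  classical
  intro i
  refine (HasCoeff.sum_smul Q _ (fun H => hasCoeff_modeVec hK P w v m (insert H I)) i).trans ?_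
  refine Filter.Eventually.of_forall fun x => ?_
  simp only
  rw [eForm_eq_eGen, coeff_eGen hK, coeff_ofCoeff]
  let F : K.Hyperplane → ℂ := fun H =>
    (if H ∉ I ∧ m H = 0 then ((wedgeSign I H * w H : ℝ) : ℂ) else 0) *
      modeCoeff hK P w v m (insert H I) i x
  have hF : ∀ H, F H ≠ 0 → H ∈ Q ∧ H ∈ hyp i.2 := by
    intro H hH
    have h1 := isModeIndex_of_ne_zero (right_ne_zero_of_mul hH)
    have h2 : H ∈ hyp i.2 := h1.2.1 ▸ Finset.mem_insert_self H I
    exact ⟨h1.mem_of_mem hQ (mem_hyp.1 h2).1, h2⟩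
  refine (sum_eq_sum_hyp hF).trans (Finset.sum_congr rfl fun H hH => ?_)
  simp only [F]
  by_cases h : IsModeIndex hK P v m I (faceIndex hK P i H)
  · have hI : I = (hyp i.2).erase H.1 := by rw [← h.2.1, faceIndex_hyp]
    have hHI : H.1 ∉ I := by rw [hI]; exact Finset.notMem_erase _ _
    have hm : m H.1 = 0 := by
      by_contra hm
      exact ((i.1.mem_midSet_face hK P).1 ((h.2.2 H.1).2 (.inr hm))).2 rfl
    have h' : IsModeIndex hK P v m (insert H.1 I) i := by
      refine ⟨(i.1.top_face hK P H.1).symm.trans h.1, ?_, fun H' => ?_⟩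
      · rw [hI, Finset.insert_erase (val_mem_hyp.2 hH)]
      · by_cases e : H' = H.1
        · subst e
          simp [H.2]
        · have := (i.1.mem_midSet_face hK P (H := H.1)).symm.trans (h.2.2 H')
          simp only [e, ne_eq, not_false_iff, and_true] at this
          rw [this]
          simp [e]
    rw [modeCoeff_of_isModeIndex hK P w v m _ h, modeCoeff_of_isModeIndex hK P w v m _ h',
      if_pos ⟨hHI, hm⟩, ← wedgeSign_hyp, h'.2.1, wedgeSign_insert]
    simp only
    rw [modeFun_faceProj hK P H x, if_pos (Finset.mem_insert_self _ _), Finset.erase_insert hHI,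
      eWeight, cosMode, if_pos hm]
    simp only [Complex.real_smul]
    push_cast
    simp only [faceIndex]
    ring
  · rw [modeCoeff_of_not_isModeIndex hK P w v m _ h]
    refine Eq.trans ?_
      (by rw [smul_zero, smul_zero] : wedgeSign i.2 H • eWeight w i.1 H x • (0 : ℂ) = 0).symm
    split_ifs with hc
    · rw [modeCoeff_of_not_isModeIndex hK P w v m _, Pi.zero_apply, mul_zero]
      intro h'
      refine h ?_
      have := isModeIndex_faceIndex hK P hc.2 h'
      rwa [Finset.erase_insert hc.1] at this
    · rw [zero_mul]

/-- A cosine factor with m ≠ 0 returns to a sine with the factor w² + m²π²; a zero mode is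
annihilated. -/
theorem hasCoeff_dStar_modeVec (Q : Finset K.Hyperplane) (hQ : (Q : Set _) = K.downSet P v) :
    HasCoeff (dStarCoeff w (ofCoeff (modeCoeff hK P w v m I)))
      (∑ H ∈ Q, (if H ∈ I ∧ m H ≠ 0 then
        ((wedgeSign I H * (w H ^ 2 + m H ^ 2 * Real.pi ^ 2) : ℝ) : ℂ) else 0) •
        modeVec hK P w v m (I.erase H)) := by
  classical
  intro i
  refine (HasCoeff.sum_smul Q _ (fun H => hasCoeff_modeVec hK P w v m (I.erase H)) i).trans ?_
  refine Filter.Eventually.of_forall fun x => ?_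
  simp only
  rw [dStarCoeff, coeff_ofCoeff]
  let F : K.Hyperplane → ℂ := fun H => (if H ∈ I ∧ m H ≠ 0 then
    ((wedgeSign I H * (w H ^ 2 + m H ^ 2 * Real.pi ^ 2) : ℝ) : ℂ) else 0) *
    modeCoeff hK P w v m (I.erase H) i x
  have hF : ∀ H, F H ≠ 0 → H ∈ Q ∧ H ∈ hyp i.2ᶜ := by
    intro H hH
    have h1 := isModeIndex_of_ne_zero (right_ne_zero_of_mul hH)
    have h2 : H ∈ I ∧ m H ≠ 0 := by
      by_contra h
      exact left_ne_zero_of_mul hH (if_neg h)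
    have h3 := (h1.2.2 H).2 (.inr h2.2)
    refine ⟨h1.mem_of_mem hQ h3, mem_hyp.2 ⟨h3, Finset.mem_compl.2 fun h => ?_⟩⟩
    have h4 := mem_hyp.2 ⟨h3, h⟩
    rw [h1.2.1] at h4
    exact Finset.notMem_erase _ _ h4
  refine (sum_eq_sum_hyp hF).trans (Finset.sum_congr rfl fun H hH => ?_)
  rw [Finset.mem_compl] at hH
  simp only [F]
  have hins : hyp (insert H i.2) = insert H.1 (hyp i.2) := by
    ext H'
    simp only [mem_hyp, Finset.mem_insert]
    constructor
    · rintro ⟨h1, rfl | h2⟩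
      exacts [.inl rfl, .inr ⟨h1, h2⟩]
    · rintro (rfl | ⟨h1, h2⟩)
      exacts [⟨H.2, .inl rfl⟩, ⟨h1, .inr h2⟩]
  by_cases h : IsModeIndex hK P v m I ⟨i.1, insert H i.2⟩
  · have hI : I = insert H.1 (hyp i.2) := by rw [← h.2.1, hins]
    have hHI : H.1 ∈ I := by rw [hI]; exact Finset.mem_insert_self _ _
    have hE : I.erase H.1 = hyp i.2 := by
      rw [hI, Finset.erase_insert (fun h => hH (val_mem_hyp.1 h))]
    rw [modeCoeff_of_isModeIndex hK P w v m _ h, neg_fderiv_modeFun_add hHI,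
      ← wedgeSign_hyp, h.2.1]
    by_cases hm : m H.1 = 0
    · simp only [hm, ne_eq, not_true, and_false, if_false, if_true, zero_mul, Complex.ofReal_zero,
        smul_zero]
    · have h' : IsModeIndex hK P v m (I.erase H.1) i := by
        refine ⟨h.1, hE.symm, fun H' => (h.2.2 H').trans ?_⟩
        rw [Finset.mem_erase]
        constructor
        · rintro (h1 | h1)
          · by_cases e : H' = H.1
            exacts [.inr (e ▸ hm), .inl ⟨e, h1⟩]
          · exact .inr h1
        · rintro (h1 | h1)
          exacts [.inl h1.2, .inr h1]
      rw [modeCoeff_of_isModeIndex hK P w v m _ h', if_pos ⟨hHI, hm⟩, if_neg hm]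
      simp only [Complex.real_smul]
      push_cast
      ring
  · rw [modeCoeff_of_not_isModeIndex hK P w v m _ h]
    have h0 : -fderiv ℝ (0 : i.1.E → ℂ) x (Pi.single H 1) + w H.1 • (0 : i.1.E → ℂ) x = 0 := by
      rw [fderiv_zero]; simp
    refine Eq.trans ?_ (congrArg (wedgeSign (insert H i.2) H • ·) h0).symm
    simp only [smul_zero]
    split_ifs with hc
    · rw [modeCoeff_of_not_isModeIndex hK P w v m _, Pi.zero_apply, mul_zero]
      intro h'
      refine h ⟨h'.1, ?_, fun H' => (h'.2.2 H').trans ?_⟩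
      · rw [hins, h'.2.1, Finset.insert_erase hc.1]
      · rw [Finset.mem_erase]
        constructor
        · rintro (h1 | h1)
          exacts [.inl h1.2, .inr h1]
        · rintro (h1 | h1)
          · by_cases e : H' = H.1
            exacts [.inr (e ▸ hc.2), .inl ⟨e, h1⟩]
          · exact .inr h1
    · rw [zero_mul]

end CubeComplex

end

noncomputable section

open MeasureTheory

namespace CubeComplex

variable {V : Type*} {K : CubeComplex V}

variable (hK : K.IsCAT0) (P : V) (w : K.Hyperplane → ℝ) (v : V) (m : K.Hyperplane →₀ ℕ)
  (I : Finset K.Hyperplane)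

/-! ### The action of e_w^⋄ on the modes, completeness, and the spectrum of the square -/

theorem continuous_modeFun (C : K.Cube) : Continuous (modeFun w m I C) := by
  refine continuous_finsetProd _ fun H _ => ?_
  split_ifs
  · exact (contDiff_cosMode _ _ (n := 0)).continuous.comp (continuous_apply H)
  · exact (contDiff_sinMode _ (n := 0)).continuous.comp (continuous_apply H)

theorem inner_modeVec {c : ∀ i : K.FormIndex, i.1.E → ℂ} {ξ : K.OmegaL2} (h : HasCoeff c ξ)
    {i : K.FormIndex} (hi : IsModeIndex hK P v m I i) :
    inner ℂ ξ (modeVec hK P w v m I) =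
      ∫ x, inner ℂ (c i x) (modeFun w m I i.1 x : ℂ) ∂i.1.measure := by
  rw [h.inner_eq (hasCoeff_modeVec hK P w v m I), tsum_eq_single i,
    modeCoeff_of_isModeIndex hK P w v m I hi]
  intro j hj
  rw [modeCoeff_of_not_isModeIndex hK P w v m I fun hj' => hj (hj'.unique hi)]
  simp

theorem modeVec_eq_zero (h : ∀ i, ¬IsModeIndex hK P v m I i) : modeVec hK P w v m I = 0 := by
  refine eq_zero_of_hasCoeff (hasCoeff_modeVec hK P w v m I) fun i => ?_
  rw [modeCoeff_of_not_isModeIndex hK P w v m I (h i)]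

theorem exists_isModeIndex_iff :
    (∃ i, IsModeIndex hK P v m I i) ↔ ∀ H, H ∈ I ∨ m H ≠ 0 → H ∈ K.downSet P v := by
  constructor
  · rintro ⟨i, hi⟩ H hH
    have := i.1.midSet_subset_downSet hK P ((hi.2.2 H).2 hH)
    rwa [hi.1] at this
  · intro h
    have hfin : {H | H ∈ I ∨ m H ≠ 0}.Finite := by
      refine (I.finite_toSet.union m.support.finite_toSet).subset ?_
      rintro H (hH | hH)
      exacts [.inl hH, .inr (Finsupp.mem_support_iff.2 hH)]
    obtain ⟨C, h1, h2⟩ := exists_cube_top_eq hK hfin h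
    refine ⟨⟨C, idx C I⟩, h1, hyp_idx fun H hH => ?_, fun H => ?_⟩
    · rw [h2]; exact .inl hH
    · rw [h2]; rfl

/-- Fubini: the integral over the direction H is that of `integral_exp_mul_cosMode`, and the rest is
an inner product on the face. -/
theorem integral_inner_eWeight {i : K.FormIndex} {H : i.1.Mid} (hH : H.1 ∈ I)
    (c : (i.1.face hK P H.1).E → ℂ) (s : ℝ) :
    ∫ x, inner ℂ (s • eWeight w i.1 H x • c (faceProj (i.1.face_subset hK P H.1) x))
      (modeFun w m I i.1 x : ℂ) ∂i.1.measure =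
      (s : ℂ) * ((if m H.1 = 0 then w H.1 * expNormSq (w H.1) else 0 : ℝ) : ℂ) *
        ∫ y, inner ℂ (c y) (modeFun w m (I.erase H.1) _ y : ℂ) ∂(i.1.face hK P H.1).measure := by
  have h1 := integral_box_mul (i.1.faceEquiv hK P H)
    (fun y => inner ℂ (c y) (modeFun w m (I.erase H.1) (i.1.face hK P H.1) y : ℂ))
    (fun t => ((w H.1 * Real.exp (w H.1 * (t - 1)) * cosMode (w H.1) (m H.1) t : ℝ) : ℂ))
  rw [integral_exp_mul_cosMode] at h1
  have h2 : ∀ x : i.1.E, inner ℂ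
      (s • eWeight w i.1 H x • c (faceProj (i.1.face_subset hK P H.1) x))
      (modeFun w m I i.1 x : ℂ) =
      (s : ℂ) * (inner ℂ (c fun k => x (i.1.faceEquiv hK P H (some k)))
        (modeFun w m (I.erase H.1) (i.1.face hK P H.1)
          fun k => x (i.1.faceEquiv hK P H (some k)) : ℂ) *
        ((w H.1 * Real.exp (w H.1 * (x (i.1.faceEquiv hK P H none) - 1)) *
          cosMode (w H.1) (m H.1) (x (i.1.faceEquiv hK P H none)) : ℝ) : ℂ)) := by
    intro x
    have e1 : faceProj (i.1.face_subset hK P H.1) x =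
        fun k => x (i.1.faceEquiv hK P H (some k)) := rfl
    have e2 : i.1.faceEquiv hK P H none = H := rfl
    rw [modeFun_faceProj hK P H x, if_pos hH, e1, e2, inner_real_smul_left, inner_real_smul_left,
      eWeight]
    simp only [RCLike.inner_apply, Complex.real_smul]
    push_cast
    ring
  simp only [h2]
  rw [integral_const_mul]
  refine (congrArg ((s : ℂ) * ·) h1).trans ?_
  simp only [Cube.measure, Cube.box]
  ring

/-- Transpose of `represents_eForm_modeVec`: a hyperplane of I with m = 0 is removed together with
its coordinate, and the factor w ∫ e^{2w(x-1)} dx comes from integrating it out. -/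
theorem isEAdjoint_modeVec (Q : Finset K.Hyperplane) (hQ : (Q : Set _) = K.downSet P v) :
    IsEAdjoint P w (modeVec hK P w v m I)
      (∑ H ∈ Q, (if H ∈ I ∧ m H = 0 then
        ((wedgeSign I H * (w H * expNormSq (w H)) : ℝ) : ℂ) else 0) •
        modeVec hK P w v m (I.erase H)) := by
  intro ρ hρ ξ ζ hξ hζ
  rw [inner_sum]
  simp only [inner_smul_right]
  by_cases hex : ∃ i, IsModeIndex hK P v m I i
  · obtain ⟨i, hi⟩ := hex
    rw [inner_modeVec hK P w v m I hζ.hasCoeff hi]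
    have hF : ∀ H, (if H ∈ I ∧ m H = 0 then
        ((wedgeSign I H * (w H * expNormSq (w H)) : ℝ) : ℂ) else 0) *
        inner ℂ ξ (modeVec hK P w v m (I.erase H)) ≠ 0 → H ∈ Q ∧ H ∈ hyp i.2 := by
      intro H hH
      have h2 : H ∈ I ∧ m H = 0 := by
        by_contra h
        exact left_ne_zero_of_mul hH (if_neg h)
      exact ⟨hi.mem_of_mem hQ ((hi.2.2 H).2 (.inl h2.1)), hi.2.1 ▸ h2.1⟩
    rw [sum_eq_sum_hyp hF]
    simp only [eForm_eq_eGen, coeff_eGen hK, sum_inner]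
    rw [integral_finsetSum]
    · refine Finset.sum_congr rfl fun H hH => ?_
      have hHI : H.1 ∈ I := hi.2.1 ▸ val_mem_hyp.2 hH
      refine (integral_inner_eWeight hK P w m I hHI (coeff ρ (faceIndex hK P i H)) _).trans ?_
      by_cases hm : m H.1 = 0
      · rw [if_pos hm, if_pos ⟨hHI, hm⟩, ← wedgeSign_hyp, hi.2.1,
          inner_modeVec hK P w v m _ hξ.hasCoeff (isModeIndex_faceIndex hK P hm hi),
          Complex.ofReal_mul (wedgeSign I H.1)]
        rfl
      · rw [if_neg hm, if_neg fun h => hm h.2]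
        simp
    · intro H _
      refine i.1.integrable_of_continuous ?_
      have k1 := continuous_eWeight w i.1 H
      have k2 : Continuous fun x =>
          coeff ρ (faceIndex hK P i H) (faceProj (i.1.face_subset hK P H.1) x) :=
        (contDiff_coeff hρ (faceIndex hK P i H)).continuous.comp
          (faceProj (i.1.face_subset hK P H.1)).continuous
      have k3 := continuous_modeFun w m I i.1
      have k4 : Continuous fun x => wedgeSign i.2 H • eWeight w i.1 H x •
          coeff ρ (faceIndex hK P i H) (faceProj (i.1.face_subset hK P H.1) x) :=
        (k1.fun_smul k2).fun_const_smul _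
      exact k4.inner (Complex.continuous_ofReal.comp k3)
  -- If no cube carries the mode for I, none carries the one for I \ {H} either, because H itself
  -- lies in `downSet P v`. So both sides vanish.
  · rw [modeVec_eq_zero hK P w v m I (not_exists.1 hex), inner_zero_right]
    refine (Finset.sum_eq_zero fun H hH => ?_).symm
    rw [modeVec_eq_zero hK P w v m (I.erase H), inner_zero_right, mul_zero]
    refine not_exists.1 fun h => hex ?_
    rw [exists_isModeIndex_iff] at h ⊢
    intro H' hH'
    by_cases e : H' = H
    · subst e
      rw [← hQ]; exact hH
    · exact h H' (hH'.imp_left fun h => Finset.mem_erase.2 ⟨e, h⟩)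

/-- For each H exactly one of the four operators moves I to I ∆ {H}: d_w or e_w if H ∉ I, d_w^⋄ or
e_w^⋄ if H ∈ I, according to whether m(H) ≠ 0 or m(H) = 0. The sum over all of `downSet P v` has the
form required by `koszul_sq`. -/
theorem mem_graph_modeVec (hb : K.BoundedGeometry) (Q : Finset K.Hyperplane)
    (hQ : (Q : Set _) = K.downSet P v) :
    (modeVec hK P w v m I, ∑ H ∈ Q, (koszulCoeff (raiseCoeff w m) (lowerCoeff w m) H I : ℂ) •
      modeVec hK P w v m (symmDiff I {H})) ∈ (deRhamOp P w).graph := by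
  have h : DeRhamParts P w _ _ _ _ _ _ := ⟨modeCoeff_mem_Omega0 hK P w v m I,
    represents_modeVec hK P w v m I, represents_dForm_modeVec hK P w v m I Q hQ,
    represents_eForm_modeVec hK P w v m I Q hQ, hasCoeff_dStar_modeVec hK P w v m I Q hQ,
    isEAdjoint_modeVec hK P w v m I Q hQ⟩
  have h1 := h.mem_graph hK hb
  simp only [← Finset.sum_add_distrib] at h1
  convert h1 using 2
  refine Finset.sum_congr rfl fun H _ => ?_
  by_cases hH : H ∈ I
  · have e : symmDiff I {H} = I.erase H := by
      ext H'
      simp only [Finset.mem_symmDiff, Finset.mem_singleton, Finset.mem_erase]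
      constructor
      · rintro (h | h)
        exacts [⟨h.2, h.1⟩, absurd (h.1 ▸ hH) h.2]
      · exact fun h => .inl ⟨h.2, h.1⟩
    by_cases hm : m H = 0 <;>
      simp [e, hH, hm, koszulCoeff, wedgeSign, lowerCoeff]
  · have e : symmDiff I {H} = insert H I := by
      ext H'
      simp only [Finset.mem_symmDiff, Finset.mem_singleton, Finset.mem_insert]
      constructor
      · rintro (h | h)
        exacts [.inr h.1, .inl h.1]
      · rintro (rfl | h)
        exacts [.inr ⟨rfl, hH⟩, .inl ⟨h, fun e => hH (e ▸ h)⟩]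
    by_cases hm : m H = 0 <;>
      simp [e, hH, hm, koszulCoeff, wedgeSign, raiseCoeff]

theorem mem_graph_sum_modeVec (hb : K.BoundedGeometry) (Q : Finset K.Hyperplane)
    (hQ : (Q : Set _) = K.downSet P v) :
    (∑ H ∈ Q, (koszulCoeff (raiseCoeff w m) (lowerCoeff w m) H I : ℂ) •
      modeVec hK P w v m (symmDiff I {H}),
      ((∑ H ∈ Q, raiseCoeff w m H * lowerCoeff w m H : ℝ) : ℂ) • modeVec hK P w v m I) ∈
      (deRhamOp P w).graph := by
  rw [← koszul_sq (raiseCoeff w m) (lowerCoeff w m) Q (modeVec hK P w v m) I]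
  exact LinearPMap.mem_graph_sum Q _ fun H _ => mem_graph_modeVec hK P w v m _ hb Q hQ

/-- An element orthogonal to all modes has, on each cube and for each multi-index, a coefficient
orthogonal to all products of sine and cosine modes, and `ae_eq_zero_of_integral_modes` applies. -/
theorem span_modeVec :
    (Submodule.span ℂ (Set.range fun t : V × (K.Hyperplane →₀ ℕ) × Finset K.Hyperplane =>
      modeVec hK P w t.1 t.2.1 t.2.2)).topologicalClosure = ⊤ := by
  classical
  rw [Submodule.topologicalClosure_eq_top_iff, Submodule.eq_bot_iff]
  intro ξ hξ
  have hξ' : ∀ v m I, inner ℂ ξ (modeVec hK P w v m I) = 0 := fun v m I =>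
    (Submodule.mem_orthogonal' _ _).1 hξ _ (Submodule.subset_span ⟨(v, m, I), rfl⟩)
  ext i : 2
  refine Lp.ext (Filter.EventuallyEq.trans ?_ (Lp.coeFn_zero ..).symm)
  have hint : Integrable (ξ i) i.1.measure := (Lp.memLp (ξ i)).integrable (by norm_num)
  have key := ae_eq_zero_of_integral_modes (fun H : i.1.Mid => w H.1) (fun H => H ∈ i.2)
    (fun x => starRingEnd ℂ (ξ i x)) (Complex.conjCLE.integrable_comp_iff.2 hint) ?_
  · filter_upwards [key] with x hx
    exact (map_eq_zero _).1 hx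
  · intro n
    -- A mode number 0 in a sine coordinate makes the product vanish; otherwise n, extended by zero
    -- to all hyperplanes, is an admissible choice of m for this cube.
    by_cases hn : ∃ H : i.1.Mid, H ∉ i.2 ∧ n H = 0
    · obtain ⟨H, h1, h2⟩ := hn
      have : ∀ x : i.1.Mid → ℝ, (∏ H, if H ∈ i.2 then cosMode (w H.1) (n H) (x H)
          else sinMode (n H) (x H)) = 0 := fun x =>
        Finset.prod_eq_zero (Finset.mem_univ H) (by simp [h1, h2, sinMode])
      simp [this]
    · push Not at hn
      let e : i.1.Mid ↪ K.Hyperplane := Function.Embedding.subtype _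
      let m : K.Hyperplane →₀ ℕ := (Finsupp.equivFunOnFinite.symm n).embDomain e
      have hm : ∀ H : i.1.Mid, m H.1 = n H := fun H =>
        Finsupp.embDomain_apply_self e (Finsupp.equivFunOnFinite.symm n) H
      have hm' : ∀ H, m H ≠ 0 → H ∈ K.midSet i.1.1 := by
        intro H hH
        by_contra h
        exact hH (Finsupp.embDomain_of_notMem_range e _ H (by rintro ⟨H', rfl⟩; exact h H'.2))
      have hi : IsModeIndex hK P (i.1.top hK P) m (hyp i.2) i := by
        refine ⟨rfl, rfl, fun H => ⟨fun h => ?_, ?_⟩⟩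
        · by_cases h' : (⟨H, h⟩ : i.1.Mid) ∈ i.2
          · exact .inl (mem_hyp.2 ⟨h, h'⟩)
          · right
            have := hm ⟨H, h⟩
            simp only at this
            rw [this]
            exact hn _ h'
        · rintro (h | h)
          exacts [(mem_hyp.1 h).1, hm' H h]
      have h0 := hξ' (i.1.top hK P) m (hyp i.2)
      rw [inner_modeVec hK P w _ m _ (c := fun i => ξ i) (fun i => Filter.EventuallyEq.rfl) hi]
        at h0
      refine Eq.trans (integral_congr_ae (Filter.Eventually.of_forall fun x => ?_)) h0
      simp only [RCLike.inner_apply, modeFun, hm, val_mem_hyp, Complex.real_smul]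

/-- The eigenvalue of the square of the de Rham operator. -/
def modeEigenvalue (hb : K.BoundedGeometry) : ℝ :=
  ∑ H ∈ (hb.finite_downSet P v).toFinset, raiseCoeff w m H * lowerCoeff w m H

variable {w m}

theorem raiseCoeff_mul_lowerCoeff_nonneg (hw : ∀ H, 0 ≤ w H) (H : K.Hyperplane) :
    0 ≤ raiseCoeff w m H * lowerCoeff w m H := by
  have h1 := hw H
  have h2 := expNormSq_nonneg (w H)
  unfold raiseCoeff lowerCoeff
  split_ifs <;> positivity

/-- If m(H) = 0 the product is w² ∫ e^{2w(x-1)} dx, at least w/4 once w ≥ 1; otherwise it is w² +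
m²π². The constants only need to be uniform. -/
theorem le_of_raiseCoeff_mul_lowerCoeff_le (H : K.Hyperplane) {R : ℝ} (hR : 1 ≤ R)
    (h : raiseCoeff w m H * lowerCoeff w m H ≤ R) : w H ≤ 4 * R ∧ (m H : ℝ) ≤ R := by
  unfold raiseCoeff lowerCoeff at h
  split_ifs at h with hm
  · refine ⟨?_, by rw [hm]; norm_num; linarith⟩
    rcases le_total 1 (w H) with h1 | h1
    · linarith [le_four_mul_expNormSq h1]
    · linarith
  · have h1 : (1 : ℝ) ≤ m H := by exact_mod_cast Nat.one_le_iff_ne_zero.2 hm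
    have hpi : 1 ≤ Real.pi := by linarith [Real.pi_gt_three]
    have h2 : (m H : ℝ) ≤ m H ^ 2 * Real.pi ^ 2 := by
      have h3 : 1 ≤ Real.pi ^ 2 := one_le_pow₀ hpi
      nlinarith [mul_nonneg (sq_nonneg (m H : ℝ)) (sub_nonneg.2 h3)]
    constructor
    · nlinarith [sq_nonneg (w H - 1), sq_nonneg ((m H : ℝ) * Real.pi)]
    · nlinarith [sq_nonneg (w H)]

/-- All summands of the eigenvalue are nonnegative, so a bound R confines `downSet P v` to a finite
set F of hyperplanes. By `downSet_injective` finitely many v remain. For a nonzero mode, I and the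
support of m lie in `downSet P v`, and m is bounded there. -/
theorem finite_modes (hb : K.BoundedGeometry) (hw : ∀ H, 0 ≤ w H)
    (hfin : ∀ R : ℝ, {H : K.Hyperplane | w H ≤ R}.Finite) (R : ℝ) :
    {t : V × (K.Hyperplane →₀ ℕ) × Finset K.Hyperplane |
      modeEigenvalue P w t.1 t.2.1 hb ≤ R ∧ modeVec hK P w t.1 t.2.1 t.2.2 ≠ 0}.Finite := by
  classical
  set R' := max R 1
  let F : Finset K.Hyperplane := (hfin (4 * R')).toFinset
  have hV : {v : V | K.downSet P v ⊆ F}.Finite :=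
    Set.Finite.of_finite_image (F.finite_toSet.finite_subsets.subset (by
      rintro _ ⟨v, hv, rfl⟩; exact hv)) (downSet_injective hK P).injOn
  have hM : (F.finsupp fun _ => Finset.range (⌊R'⌋₊ + 1) : Set (K.Hyperplane →₀ ℕ)).Finite :=
    Finset.finite_toSet _
  refine (hV.prod (hM.prod (F.powerset.finite_toSet))).subset ?_
  rintro ⟨v, m, I⟩ ⟨h1, h2⟩
  simp only at h1 h2
  have hQ : ∀ H ∈ K.downSet P v, raiseCoeff w m H * lowerCoeff w m H ≤ R' := by
    intro H hH
    refine (Finset.single_le_sum (f := fun H => raiseCoeff w m H * lowerCoeff w m H)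
      (fun H _ => raiseCoeff_mul_lowerCoeff_nonneg hw H) ?_).trans
      (h1.trans (le_max_left R 1))
    exact (Set.Finite.mem_toFinset _).2 hH
  have hQ' := fun H hH => le_of_raiseCoeff_mul_lowerCoeff_le H (le_max_right R 1) (hQ H hH)
  have hF : K.downSet P v ⊆ F := fun H hH => (Set.Finite.mem_toFinset _).2 (hQ' H hH).1
  have hex : ∃ i, IsModeIndex hK P v m I i := by
    by_contra h
    exact h2 (modeVec_eq_zero hK P w v m I (not_exists.1 h))
  rw [exists_isModeIndex_iff] at hex
  refine ⟨hF, ?_, ?_⟩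
  · refine Finset.mem_coe.2 (Finset.mem_finsupp_iff.2 ⟨fun H hH => ?_, fun H _ => ?_⟩)
    · exact hF (hex H (.inr (Finsupp.mem_support_iff.1 hH)))
    · rw [Finset.mem_range, Nat.lt_succ_iff]
      by_cases hH : m H = 0
      · rw [hH]; exact Nat.zero_le _
      · exact Nat.le_floor (hQ' H (hex H (.inr hH))).2
  · exact Finset.mem_coe.2 (Finset.mem_powerset.2 fun H hH => hF (hex H (.inl hH)))

/-- Essential self-adjointness and compactness of the resolvent for proper nonnegative weights. -/
theorem essentiallySelfAdjoint_deRhamOp (hK : K.IsCAT0) (P : V) (hb : K.BoundedGeometry) (hw : ∀ H, 0 ≤ w H)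
    (hfin : ∀ R : ℝ, {H : K.Hyperplane | w H ≤ R}.Finite) :
    IsEssentiallySelfAdjoint (deRhamOp P w) ∧ HasCompactResolvent (deRhamOp P w).closure := by
  refine essentiallySelfAdjoint_of_sq _ (isFormalAdjoint_deRhamOp hK hb P w)
    (fun t : V × (K.Hyperplane →₀ ℕ) × Finset K.Hyperplane => modeVec hK P w t.1 t.2.1 t.2.2) _
    (fun t => modeEigenvalue P w t.1 t.2.1 hb) (fun t => ?_)
    (fun t => mem_graph_modeVec hK P w t.1 t.2.1 t.2.2 hb _ (Set.Finite.coe_toFinset _))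
    (fun t => mem_graph_sum_modeVec hK P w t.1 t.2.1 t.2.2 hb _ (Set.Finite.coe_toFinset _))
    (span_modeVec hK P w) (finite_modes hK P hb hw hfin)
  exact Finset.sum_nonneg fun H _ => raiseCoeff_mul_lowerCoeff_nonneg hw H

/-- There are countably many nonzero modes, by `finite_modes` for R = 0, 1, 2, …, and they span a
dense subspace. -/
theorem separableSpace_OmegaL2 (hK : K.IsCAT0) (P : V) (hb : K.BoundedGeometry) (hw : ∀ H, 0 ≤ w H)
    (hfin : ∀ R : ℝ, {H : K.Hyperplane | w H ≤ R}.Finite) :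
    TopologicalSpace.SeparableSpace K.OmegaL2 := by
  let φ := fun t : V × (K.Hyperplane →₀ ℕ) × Finset K.Hyperplane =>
    modeVec hK P w t.1 t.2.1 t.2.2
  have hc : (Set.range φ).Countable := by
    have h1 : {t | φ t ≠ 0}.Countable := by
      refine (Set.countable_iUnion fun n : ℕ => (finite_modes hK P hb hw hfin n).countable).mono ?_
      intro t ht
      obtain ⟨n, hn⟩ := exists_nat_ge (modeEigenvalue P w t.1 t.2.1 hb)
      exact Set.mem_iUnion.2 ⟨n, hn, ht⟩
    refine ((h1.image φ).insert 0).mono ?_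
    rintro _ ⟨t, rfl⟩
    by_cases h : φ t = 0
    exacts [.inl h, .inr ⟨t, h, rfl⟩]
  have h2 : TopologicalSpace.IsSeparable (Submodule.span ℂ (Set.range φ) : Set K.OmegaL2) :=
    hc.isSeparable.span
  have h3 := h2.closure
  rw [← Submodule.topologicalClosure_coe, span_modeVec hK P w, Submodule.top_coe] at h3
  exact TopologicalSpace.isSeparable_univ_iff.1 h3

end CubeComplex

end

noncomputable section

open MeasureTheory

namespace CubeComplex

variable {V : Type*} {K : CubeComplex V}

/-! ## The grading -/

/-- The grading operator of the Hilbert space of square-integrable forms. -/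
def gradingOp (K : CubeComplex V) : K.OmegaL2 →L[ℂ] K.OmegaL2 :=
  lpDiag (fun i : K.FormIndex => ((-1 : ℂ) ^ i.2.card) • ContinuousLinearMap.id ℂ _) 1
    (fun i => by
      rw [norm_smul, norm_pow, norm_neg, norm_one, one_pow, one_mul]
      exact ContinuousLinearMap.norm_id_le) zero_le_one

theorem isDegreeGrading_gradingOp : IsDegreeGrading K.gradingOp := fun _ _ => rfl

theorem neg_one_pow_mul_self (n : ℕ) : (-1 : ℂ) ^ n * (-1 : ℂ) ^ n = 1 := by
  rw [← mul_pow]; norm_num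

theorem IsDegreeGrading.sq {γ : K.OmegaL2 →L[ℂ] K.OmegaL2} (h : IsDegreeGrading γ) : γ * γ = 1 := by
  ext ξ i : 3
  rw [mul_apply_eq_comp, h, h, smul_smul, neg_one_pow_mul_self, one_smul]
  rfl

theorem IsDegreeGrading.inner_left {γ : K.OmegaL2 →L[ℂ] K.OmegaL2} (h : IsDegreeGrading γ)
    (ξ η : K.OmegaL2) : inner ℂ (γ ξ) η = inner ℂ ξ (γ η) := by
  rw [lp.inner_eq_tsum, lp.inner_eq_tsum]
  refine tsum_congr fun i => ?_
  rw [h, h, inner_smul_left, inner_smul_right]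
  simp

theorem IsDegreeGrading.isSelfAdjoint {γ : K.OmegaL2 →L[ℂ] K.OmegaL2} (h : IsDegreeGrading γ) :
    IsSelfAdjoint γ :=
  ContinuousLinearMap.isSelfAdjoint_iff_isSymmetric.2 h.inner_left

/-- The grading on forms. -/
def gradeForm (σ : K.Form) : K.Form := fun C p => (-1 : ℂ) ^ p • σ C p

theorem coeff_gradeForm (σ : K.Form) (i : K.FormIndex) :
    coeff (gradeForm σ) i = (-1 : ℂ) ^ i.2.card • coeff σ i := rfl

theorem gradeForm_mem_Omega {σ : K.Form} (h : σ ∈ K.Omega) : gradeForm σ ∈ K.Omega := by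
  refine ⟨fun C p => show ContDiff ℝ ∞ fun y => (-1 : ℂ) ^ p • σ C p y from (h.1 C p).const_smul _,
    h.2.subset fun C hC h0 => hC ?_⟩
  funext p x
  ext v
  simp [gradeForm, h0]

theorem gradeForm_mem_Omega0 {σ : K.Form} (h : σ ∈ K.Omega0) : gradeForm σ ∈ K.Omega0 := by
  refine ⟨gradeForm_mem_Omega h.1, fun C p H x hx hH v hv => ?_⟩
  show (-1 : ℂ) ^ p • σ C p x v = 0
  rw [h.2 C p H x hx hH v hv, smul_zero]

theorem represents_gradeForm {γ : K.OmegaL2 →L[ℂ] K.OmegaL2} (hγ : IsDegreeGrading γ)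
    {σ : K.Form} {ξ : K.OmegaL2} (h : Represents σ ξ) : Represents (gradeForm σ) (γ ξ) := by
  intro i
  rw [hγ, coeff_gradeForm]
  filter_upwards [h i, Lp.coeFn_smul ((-1 : ℂ) ^ i.2.card) (ξ i)] with x h1 h2
  rw [h2, Pi.smul_apply, h1, Pi.smul_apply]

theorem hasCoeff_neg_grading {γ : K.OmegaL2 →L[ℂ] K.OmegaL2} (hγ : IsDegreeGrading γ)
    {c c' : ∀ i : K.FormIndex, i.1.E → ℂ} {ξ : K.OmegaL2} (h : HasCoeff c ξ)
    (hc : ∀ i, c' i = -((-1 : ℂ) ^ i.2.card • c i)) : HasCoeff c' (-γ ξ) := by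
  intro i
  rw [hc, lp.coeFn_neg, Pi.neg_apply, hγ]
  filter_upwards [h i, Lp.coeFn_smul ((-1 : ℂ) ^ i.2.card) (ξ i),
    Lp.coeFn_neg ((-1 : ℂ) ^ i.2.card • ξ i)] with x h1 h2 h3
  rw [h3, Pi.neg_apply, h2, Pi.smul_apply, h1, Pi.neg_apply, Pi.smul_apply]

theorem dForm_gradeForm (w : K.Hyperplane → ℝ) {σ : K.Form} (h : σ ∈ K.Omega) :
    dForm w (gradeForm σ) = -gradeForm (dForm w σ) := by
  funext C p x
  cases p with
  | zero => simp [dForm, gradeForm]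
  | succ p =>
    have h1 := (dLin K.Omega le_rfl w).map_smul ((-1 : ℂ) ^ p) ⟨σ, h⟩
    have h2 := congrFun (congrFun (congrFun h1 C) (p + 1)) x
    refine Eq.trans (show _ = _ from h2) ?_
    show (-1 : ℂ) ^ p • dForm w σ C (p + 1) x = -((-1 : ℂ) ^ (p + 1) • dForm w σ C (p + 1) x)
    ext v
    simp [pow_succ]

theorem eForm_gradeForm (P : V) (w : K.Hyperplane → ℝ) (σ : K.Form) :
    eForm P w (gradeForm σ) = -gradeForm (eForm P w σ) := by
  funext C p x
  cases p with
  | zero => simp [eForm, gradeForm]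
  | succ p =>
    have h1 := (eLin ⊤ P w).map_smul ((-1 : ℂ) ^ p) ⟨σ, trivial⟩
    have h2 := congrFun (congrFun (congrFun h1 C) (p + 1)) x
    refine Eq.trans (show _ = _ from h2) ?_
    show (-1 : ℂ) ^ p • eForm P w σ C (p + 1) x = -((-1 : ℂ) ^ (p + 1) • eForm P w σ C (p + 1) x)
    ext v
    simp [pow_succ]

theorem dStarCoeff_gradeForm (w : K.Hyperplane → ℝ) {σ : K.Form} (h : σ ∈ K.Omega)
    (i : K.FormIndex) :
    dStarCoeff w (gradeForm σ) i = -((-1 : ℂ) ^ i.2.card • dStarCoeff w σ i) := by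
  funext x
  simp only [Pi.neg_apply, Pi.smul_apply, dStarCoeff, Finset.smul_sum, ← Finset.sum_neg_distrib]
  refine Finset.sum_congr rfl fun H hH => ?_
  have hd := (contDiff_coeff h ⟨i.1, insert H i.2⟩).differentiable (by simp) x
  rw [coeff_gradeForm, fderiv_const_smul hd]
  simp only [Finset.card_insert_of_notMem (Finset.mem_compl.1 hH), pow_succ]
  simp only [smul_apply, Pi.smul_apply, smul_eq_mul, Complex.real_smul]
  ring

theorem DeRhamParts.grade {γ : K.OmegaL2 →L[ℂ] K.OmegaL2} (hγ : IsDegreeGrading γ)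
    {P : V} {w : K.Hyperplane → ℝ} {σ : K.Form} {ξ η₁ η₂ η₃ η₄ : K.OmegaL2}
    (h : DeRhamParts P w σ ξ η₁ η₂ η₃ η₄) :
    DeRhamParts P w (gradeForm σ) (γ ξ) (-γ η₁) (-γ η₂) (-γ η₃) (-γ η₄) where
  mem := gradeForm_mem_Omega0 h.mem
  rep := represents_gradeForm hγ h.rep
  d := hasCoeff_neg_grading hγ h.d.hasCoeff fun i => by rw [dForm_gradeForm w h.mem.1]; rfl
  e := hasCoeff_neg_grading hγ h.e.hasCoeff fun i => by rw [eForm_gradeForm P w]; rfl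
  dStar := hasCoeff_neg_grading hγ h.dStar fun i => dStarCoeff_gradeForm w h.mem.1 i
  eStar := by
    intro ρ hρ θ ζ hθ hζ
    have h1 : Represents (eForm P w (gradeForm ρ)) (-γ ζ) :=
      hasCoeff_neg_grading hγ hζ.hasCoeff fun i => by rw [eForm_gradeForm P w]; rfl
    have h2 := h.eStar _ (gradeForm_mem_Omega hρ) _ _ (represents_gradeForm hγ hθ) h1
    rw [inner_neg_left, hγ.inner_left, hγ.inner_left] at h2
    rw [inner_neg_right, ← h2, neg_neg]

theorem closure_deRhamOp_odd (hK : K.IsCAT0) (hb : K.BoundedGeometry) {P : V}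
    {w : K.Hyperplane → ℝ} (hc : (deRhamOp P w).IsClosable) {γ : K.OmegaL2 →L[ℂ] K.OmegaL2}
    (hγ : IsDegreeGrading γ) {ξ ζ : K.OmegaL2} (h : (ξ, ζ) ∈ (deRhamOp P w).closure.graph) :
    (γ ξ, -γ ζ) ∈ (deRhamOp P w).closure.graph := by
  let S : K.OmegaL2 × K.OmegaL2 →L[ℂ] K.OmegaL2 := -(γ.comp (ContinuousLinearMap.snd ℂ _ _))
  have hS : ∀ p, S p = -γ p.2 := fun _ => rfl
  have key := LinearPMap.closure_graph_of_graph hc γ S ?_ h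
  · rwa [hS] at key
  intro ξ ζ h
  rw [hS]
  obtain ⟨σ, η₁, η₂, η₃, η₄, hp, rfl⟩ := exists_deRhamParts_of_mem_graph hK hb h
  have e : -γ (η₁ + η₂ + η₃ + η₄) = -γ η₁ + -γ η₂ + -γ η₃ + -γ η₄ := by
    simp only [map_add, neg_add]
  exact e ▸ (hp.grade hγ).mem_graph hK hb

end CubeComplex

end

noncomputable section

open MeasureTheory

namespace CubeComplex

variable {V : Type*} {K : CubeComplex V}

/-! ## The group action on forms -/

open Classical in
/-- The sign by which `g⁻¹` changes the orientation of the coordinate of `H`. -/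
def moveSign (P : V) {G : Type*} [Group G] [MulAction G V] (g : G) (H : K.Hyperplane) : ℝ := if H.Separates P (g • P) then -1 else 1

theorem abs_moveSign (P : V) {G : Type*} [Group G] [MulAction G V] (g : G) (H : K.Hyperplane) : |moveSign P g H| = 1 := by
  unfold moveSign; split_ifs <;> simp

section Action

variable {G : Type*} [Group G] [MulAction G V] [K.CubicalAction G]

/-- The bijection between the hyperplanes of `g⁻¹C` and of `C`. -/
def Cube.midEquiv (g : G) (C : K.Cube) : (C.translate g⁻¹).Mid ≃ C.Mid where
  toFun H := ⟨H.1.translate g, C.translate_mid g H⟩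
  invFun H := ⟨H.1.translate g⁻¹, (mem_midSet_smul g⁻¹ C.1 _).2 (by
    rw [inv_inv, Hyperplane.translate_translate_inv]; exact H.2)⟩
  left_inv H := Subtype.ext (Hyperplane.translate_inv_translate g H.1)
  right_inv H := Subtype.ext (Hyperplane.translate_translate_inv g H.1)

theorem moveLin_apply (P : V) (g : G) (C : K.Cube) (x : C.E) (H : (C.translate g⁻¹).Mid) :
    moveLin P g C x H = moveSign P g (H.1.translate g) * x (C.midEquiv g H) := rfl

open Classical in
theorem move_apply (P : V) (g : G) (C : K.Cube) (x : C.E) (H : (C.translate g⁻¹).Mid) :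
    move P g C x H = if (H.1.translate g).Separates P (g • P) then 1 - x (C.midEquiv g H)
      else x (C.midEquiv g H) := by
  rw [move, moveLin_apply, moveSign]
  split_ifs <;> ring

theorem moveLin_single (P : V) (g : G) (C : K.Cube) [DecidableEq C.Mid]
    [DecidableEq (C.translate g⁻¹).Mid] (H : C.Mid) :
    moveLin P g C (Pi.single H 1) =
      moveSign P g H.1 • Pi.single ((C.midEquiv g).symm H) (1 : ℝ) := by
  funext H'
  rw [moveLin_apply, Pi.smul_apply, smul_eq_mul]
  by_cases h : H' = (C.midEquiv g).symm H
  · subst h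
    rw [Equiv.apply_symm_apply, Pi.single_eq_same, Pi.single_eq_same]
    congr 2
    exact Hyperplane.translate_translate_inv g H.1
  · rw [Pi.single_eq_of_ne h, Pi.single_eq_of_ne fun e => h (by rw [← e, Equiv.symm_apply_apply]),
      mul_zero, mul_zero]

theorem measurePreserving_move (P : V) (g : G) (C : K.Cube) :
    MeasurePreserving (move P g C) C.measure (C.translate g⁻¹).measure := by
  classical
  have h := measurePreserving_box_signed (C.midEquiv g)
    fun H => (H.1.translate g).Separates P (g • P)
  have e : move P g C = fun x H => if (H.1.translate g).Separates P (g • P) then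
      1 - x (C.midEquiv g H) else x (C.midEquiv g H) := by
    funext x H
    exact move_apply P g C x H
  rw [e]
  exact h

theorem move_mem_box (P : V) (g : G) (C : K.Cube) {x : C.E} (hx : x ∈ C.box) :
    move P g C x ∈ (C.translate g⁻¹).box := by
  classical
  have h : ∀ H, move P g C x H ∈ Set.Icc (0 : ℝ) 1 := by
    intro H
    have h1 := hx.1 (C.midEquiv g H)
    have h2 := hx.2 (C.midEquiv g H)
    simp only [Pi.zero_apply, Pi.one_apply] at h1 h2
    rw [move_apply]
    split_ifs <;> constructor <;> linarith
  exact ⟨fun H => (h H).1, fun H => (h H).2⟩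

theorem hasFDerivAt_move (P : V) (g : G) (C : K.Cube) (x : C.E) :
    HasFDerivAt (move P g C) (moveLin P g C) x := by
  classical
  exact (moveLin P g C).hasFDerivAt.const_add
    (fun H => if (H.1.translate g).Separates P (g • P) then 1 else 0)

theorem contDiff_move (P : V) (g : G) (C : K.Cube) {n : WithTop ℕ∞} : ContDiff ℝ n (move P g C) := by
  classical
  exact contDiff_const.add (moveLin P g C).contDiff

/-- The index of the coefficient that `g` moves to the `i`-th coefficient. -/
def moveIndex (g : G) (i : K.FormIndex) : K.FormIndex :=
  ⟨i.1.translate g⁻¹, i.2.map (i.1.midEquiv g).symm.toEmbedding⟩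

theorem moveIndex_injective (g : G) : Function.Injective (moveIndex (K := K) g) := by
  rintro ⟨C, I⟩ ⟨C', I'⟩ h
  have h1 : C.translate g⁻¹ = C'.translate g⁻¹ := congrArg Sigma.fst h
  obtain rfl : C = C' := by
    have := congrArg (Cube.translate g) h1
    rwa [Cube.translate_translate_inv, Cube.translate_translate_inv] at this
  obtain rfl : I = I' := Finset.map_injective _ (eq_of_heq (Sigma.mk.inj h).2)
  rfl

/-- The action permutes coefficients up to sign. Signs come from the coordinates reflected by g⁻¹
and from reordering, since the auxiliary order of the hyperplanes is not invariant under the group.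
-/
theorem exists_sign_coeff_smulForm (P : V) (g : G) (i : K.FormIndex) :
    ∃ ε : ℝ, |ε| = 1 ∧ ∀ σ : K.Form, ∀ x,
      coeff (smulForm P g σ) i x = ε • coeff σ (moveIndex g i) (move P g i.1 x) := by
  classical
  let f : Fin i.2.card → (i.1.translate g⁻¹).Mid := fun k =>
    (i.1.midEquiv g).symm (i.2.orderEmbOfFin rfl k)
  have hf : Function.Injective f := (i.1.midEquiv g).symm.injective.comp
    (i.2.orderEmbOfFin rfl).injective
  have hI : ∀ H, H ∈ (moveIndex g i).2 ↔ ∃ k, f k = H := by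
    intro H
    refine Finset.mem_map.trans ⟨?_, ?_⟩
    · rintro ⟨H', h1, rfl⟩
      have : H' ∈ Set.range (i.2.orderEmbOfFin rfl) := by
        rw [Finset.range_orderEmbOfFin]; exact h1
      obtain ⟨k, rfl⟩ := this
      exact ⟨k, rfl⟩
    · rintro ⟨k, rfl⟩
      exact ⟨_, Finset.orderEmbOfFin_mem i.2 rfl k, rfl⟩
  obtain ⟨ε, h1, h2⟩ := exists_sign_altCoeff hf hI
  refine ⟨(∏ k, moveSign P g (i.2.orderEmbOfFin rfl k).1) * ε, ?_, fun σ x => ?_⟩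
  · rw [abs_mul, h1, mul_one, Finset.abs_prod]
    exact Finset.prod_eq_one fun k _ => abs_moveSign P g _
  · have h3 : (moveIndex g i).2.card = i.2.card := Finset.card_map _
    refine Eq.trans ?_ (congrArg _ (coeff_eq_altCoeff σ (i.1.translate g⁻¹) h3 _).symm)
    rw [mul_smul]
    refine Eq.trans ?_ (congrArg _ (h2 _))
    show σ (i.1.translate g⁻¹) _ (move P g i.1 x)
      (fun k => moveLin P g i.1 (Pi.single (i.2.orderEmbOfFin rfl k) 1)) = _
    refine Eq.trans ?_ (ContinuousAlternatingMap.map_smul_univ _ _ _)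
    congr 1
    funext k
    convert moveLin_single P g i.1 (i.2.orderEmbOfFin rfl k) using 3

theorem exists_smulForm_operator (P : V) (g : G) :
    ∃ T : K.OmegaL2 →L[ℂ] K.OmegaL2, ‖T‖ ≤ 1 ∧
      ∀ σ ξ, Represents σ ξ → Represents (smulForm P g σ) (T ξ) := by
  choose ε hε h using exists_sign_coeff_smulForm (K := K) P g
  have hblock : ∀ i : K.FormIndex, ∃ T : Lp ℂ 2 (moveIndex g i).1.measure →L[ℂ]
      Lp ℂ 2 i.1.measure, ‖T‖ ≤ 1 ∧ ∀ f, T f =ᵐ[i.1.measure] fun x => ε i • f (move P g i.1 x) :=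
    fun i => exists_weighted_comp (measurePreserving_move P g i.1) (a := fun _ => ε i)
      aestronglyMeasurable_const zero_le_one (Filter.Eventually.of_forall fun _ => (hε i).le)
  choose T hT1 hT2 using hblock
  obtain ⟨S, hS1, hS2⟩ := exists_sparse_operator
    (E := fun i : K.FormIndex => Lp ℂ 2 i.1.measure) (A := fun _ => Unit) (fun i _ => moveIndex g i)
    (fun i _ => T i) zero_le_one (fun i _ => hT1 i) (n := 1) (fun i => by simp) (fun j => by
      rw [Nat.cast_one, Set.encard_le_one_iff]
      rintro ⟨a, _⟩ ⟨b, _⟩ ha hb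
      have : a = b := moveIndex_injective g (Eq.trans ha (Eq.symm hb))
      subst this
      rfl)
  refine ⟨S, by simpa using hS1, fun σ ξ hξ i => ?_⟩
  rw [hS2]
  simp only [Finset.univ_unique, Finset.sum_singleton]
  have h1 := (measurePreserving_move P g i.1).quasiMeasurePreserving.ae (hξ (moveIndex g i))
  filter_upwards [hT2 i (ξ (moveIndex g i)), h1] with x hx1 hx2
  rw [hx1, hx2, h]

/-- The unitary operator of `g`. -/
def smulOp (P : V) (g : G) : K.OmegaL2 →L[ℂ] K.OmegaL2 := (exists_smulForm_operator P g).choose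

theorem norm_smulOp_le (P : V) (g : G) : ‖smulOp (K := K) P g‖ ≤ 1 :=
  (exists_smulForm_operator P g).choose_spec.1

theorem represents_smulForm (P : V) (g : G) {σ : K.Form} {ξ : K.OmegaL2} (h : Represents σ ξ) :
    Represents (smulForm P g σ) (smulOp P g ξ) :=
  (exists_smulForm_operator P g).choose_spec.2 σ ξ h

/-- Used to compare forms on cubes that are equal but not definitionally so: points and linear maps
are compared coordinate by coordinate through their hyperplanes. -/
theorem comp_congr (σ : K.Form) {C₁ C₂ : K.Cube} (h : C₁ = C₂) (p : ℕ) {F : Type*}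
    [NormedAddCommGroup F] [NormedSpace ℝ F] {x₁ : C₁.E} {x₂ : C₂.E} {L₁ : F →L[ℝ] C₁.E}
    {L₂ : F →L[ℝ] C₂.E}
    (hx : ∀ (H : K.Hyperplane) (h₁ : H ∈ K.midSet C₁.1) (h₂ : H ∈ K.midSet C₂.1),
      x₁ ⟨H, h₁⟩ = x₂ ⟨H, h₂⟩)
    (hL : ∀ (y : F) (H : K.Hyperplane) (h₁ : H ∈ K.midSet C₁.1) (h₂ : H ∈ K.midSet C₂.1),
      L₁ y ⟨H, h₁⟩ = L₂ y ⟨H, h₂⟩) :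
    (σ C₁ p x₁).compContinuousLinearMap L₁ = (σ C₂ p x₂).compContinuousLinearMap L₂ := by
  subst h
  obtain rfl : x₁ = x₂ := funext fun H => hx H.1 H.2 H.2
  obtain rfl : L₁ = L₂ := by
    ext y H
    exact hL y H.1 H.2 H.2
  rfl

theorem smulForm_mul (hK : K.IsCAT0) (P : V) (g h : G) (σ : K.Form) :
    smulForm P (g * h) σ = smulForm P g (smulForm P h σ) := by
  classical
  funext C p x
  have e : C.translate (g * h)⁻¹ = (C.translate g⁻¹).translate h⁻¹ := by
    refine Subtype.ext ?_
    show (g * h)⁻¹ • C.1 = h⁻¹ • g⁻¹ • C.1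
    rw [mul_inv_rev, mul_smul]
  -- The cocycle identity for the reflections: passing from P to gP to ghP, the two flips of a
  -- coordinate cancel if both occur.
  have hs : ∀ H : K.Hyperplane, ((H.translate h).translate g).Separates P ((g * h) • P) ↔
      ¬(((H.translate h).translate g).Separates P (g • P) ↔ (H.translate h).Separates P (h • P)) := by
    intro H
    rw [separates_trans_iff hK _ P (g • P), mul_smul, Hyperplane.translate_separates]
  refine (comp_congr σ e p (L₁ := moveLin P (g * h) C)
    (x₂ := move P h (C.translate g⁻¹) (move P g C x))
    (L₂ := (moveLin P h (C.translate g⁻¹)).comp (moveLin P g C)) ?_ ?_).trans ?_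
  · intro H h₁ h₂
    have e1 : C.midEquiv (g * h) ⟨H, h₁⟩ =
        C.midEquiv g ((C.translate g⁻¹).midEquiv h ⟨H, h₂⟩) :=
      Subtype.ext (Hyperplane.translate_mul g h H)
    have e2 : ((C.translate g⁻¹).midEquiv h ⟨H, h₂⟩).1 = H.translate h := rfl
    rw [move_apply, move_apply, move_apply, e1, e2]
    simp only [Hyperplane.translate_mul, hs]
    by_cases a : ((H.translate h).translate g).Separates P (g • P) <;>
      by_cases b : (H.translate h).Separates P (h • P) <;> simp [a, b]
  · intro y H h₁ h₂
    have e1 : C.midEquiv (g * h) ⟨H, h₁⟩ =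
        C.midEquiv g ((C.translate g⁻¹).midEquiv h ⟨H, h₂⟩) :=
      Subtype.ext (Hyperplane.translate_mul g h H)
    have e2 : ((C.translate g⁻¹).midEquiv h ⟨H, h₂⟩).1 = H.translate h := rfl
    rw [ContinuousLinearMap.comp_apply, moveLin_apply, moveLin_apply, moveLin_apply, e1, e2]
    simp only [Hyperplane.translate_mul, hs, moveSign]
    by_cases a : ((H.translate h).translate g).Separates P (g • P) <;>
      by_cases b : (H.translate h).Separates P (h • P) <;> simp [a, b]
  · rfl

/-- An element that fixes the base vertex and the vertices of the cube `C` acts trivially on the forms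
on `C`. -/
theorem smulForm_apply_of_fixed (P : V) {g : G} (hP : g • P = P) {C : K.Cube}
    (hC : ∀ v ∈ C.1, g • v = v) (σ : K.Form) : smulForm P g σ C = σ C := by
  have hC' : ∀ v ∈ C.1, g⁻¹ • v = v := fun v hv => inv_smul_eq_iff.2 (hC v hv).symm
  have e : C.translate g⁻¹ = C := by
    refine Subtype.ext ?_
    show (fun v => g⁻¹ • v) '' C.1 = C.1
    rw [Set.image_congr hC', Set.image_id']
  have hH : ∀ H ∈ K.midSet C.1, H.translate g = H := by
    rintro H ⟨u, hu, v, hv, h⟩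
    have h1 := h.translate g
    rw [hC u hu, hC v hv] at h1
    exact h1.eq h
  funext p x
  refine (comp_congr σ e p (x₂ := x) (L₂ := ContinuousLinearMap.id ℝ C.E) ?_ ?_).trans ?_
  · intro H h₁ h₂
    rw [move_apply, hP, if_neg (not_separates_self _ _)]
    congr 1
    exact Subtype.ext (hH H h₂)
  · intro y H h₁ h₂
    rw [moveLin_apply, moveSign, hP, if_neg (not_separates_self _ _), one_mul]
    exact congrArg y (Subtype.ext (hH H h₂))
  · ext v; rfl

theorem smulForm_eq_self (P : V) {g : G} (hP : g • P = P) {σ : K.Form}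
    (h : ∀ C : K.Cube, σ C ≠ 0 → ∀ v ∈ C.1, g • v = v) : smulForm P g σ = σ := by
  funext C
  by_cases hC : σ C = 0
  · by_cases hC' : σ (C.translate g⁻¹) = 0
    · rw [hC]
      funext p x
      ext v
      simp [smulForm, hC']
    · have h1 := h _ hC'
      have e : C.translate g⁻¹ = C := by
        have h2 : (C.translate g⁻¹).translate g = C.translate g⁻¹ := by
          refine Subtype.ext ?_
          show (fun v => g • v) '' (C.translate g⁻¹).1 = (C.translate g⁻¹).1
          rw [Set.image_congr h1, Set.image_id']
        rw [← h2, Cube.translate_translate_inv]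
      exact absurd (e.symm ▸ hC) hC'
  · exact smulForm_apply_of_fixed P hP (h C hC) σ

theorem smulForm_mem_Omega (P : V) (g : G) {σ : K.Form} (h : σ ∈ K.Omega) :
    smulForm P g σ ∈ K.Omega := by
  refine ⟨fun C p => ?_, ?_⟩
  · exact (ContinuousAlternatingMap.compContinuousLinearMapCLM (moveLin P g C)).contDiff.comp
      ((h.1 (C.translate g⁻¹) p).comp (contDiff_move P g C))
  · refine (h.2.preimage (f := Cube.translate g⁻¹) ?_).subset fun C hC h0 => hC ?_
    · intro C _ C' _ e
      have := congrArg (Cube.translate g) e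
      rwa [Cube.translate_translate_inv, Cube.translate_translate_inv] at this
    · funext p x
      ext v
      simp [smulForm, h0]

theorem smulForm_mem_Omega0 (P : V) (g : G) {σ : K.Form} (h : σ ∈ K.Omega0) :
    smulForm P g σ ∈ K.Omega0 := by
  classical
  refine ⟨smulForm_mem_Omega P g h.1, fun C p H x hx hxH v hv => ?_⟩
  refine h.2 _ p ((C.midEquiv g).symm H) _ (move_mem_box P g C hx) ?_ _ fun k => ?_
  · rw [move_apply, Equiv.apply_symm_apply]
    split_ifs
    · rcases hxH with e | e <;> simp [e]
    · exact hxH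
  · show moveLin P g C (v k) _ = 0
    rw [moveLin_apply, Equiv.apply_symm_apply, hv, mul_zero]

end Action

/-! ### The unitary representation of the group -/

theorem ext_of_represents {S T : K.OmegaL2 →L[ℂ] K.OmegaL2}
    (h : ∀ σ ∈ K.Omega, ∀ ξ, Represents σ ξ → S ξ = T ξ) : S = T := by
  refine ContinuousLinearMap.coeFn_injective (Continuous.ext_on dense_l2Subspace_Omega S.continuous
    T.continuous ?_)
  rintro ξ ⟨σ, hσ, hr⟩
  exact h σ hσ ξ hr

section Action

variable {G : Type*} [Group G] [MulAction G V] [K.CubicalAction G]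

theorem smulOp_mul (hK : K.IsCAT0) (P : V) (g h : G) :
    smulOp (K := K) P (g * h) = (smulOp P g).comp (smulOp P h) := by
  refine ext_of_represents fun σ _ ξ hr => ?_
  have h1 := represents_smulForm P (g * h) hr
  rw [smulForm_mul hK] at h1
  exact h1.hasCoeff.unique (represents_smulForm P g (represents_smulForm P h hr)).hasCoeff

theorem smulOp_one (P : V) : smulOp (K := K) P (1 : G) = ContinuousLinearMap.id ℂ _ := by
  refine ext_of_represents fun σ _ ξ hr => ?_
  have h1 := represents_smulForm P (1 : G) hr
  rw [smulForm_eq_self P (one_smul G P) fun _ _ v _ => one_smul G v] at h1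
  exact h1.hasCoeff.unique hr.hasCoeff

theorem smulOp_inv_apply (hK : K.IsCAT0) (P : V) (g : G) (ξ : K.OmegaL2) :
    smulOp P g⁻¹ (smulOp P g ξ) = ξ := by
  have := smulOp_mul hK P g⁻¹ g
  rw [inv_mul_cancel, smulOp_one] at this
  exact (DFunLike.congr_fun this ξ).symm

theorem smulOp_apply_inv (hK : K.IsCAT0) (P : V) (g : G) (ξ : K.OmegaL2) :
    smulOp P g (smulOp P g⁻¹ ξ) = ξ := by
  have := smulOp_inv_apply hK P g⁻¹ ξ
  rwa [inv_inv] at this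

theorem norm_smulOp_apply (hK : K.IsCAT0) (P : V) (g : G) (ξ : K.OmegaL2) :
    ‖smulOp P g ξ‖ = ‖ξ‖ := by
  have h1 : ∀ (g : G) (ξ : K.OmegaL2), ‖smulOp P g ξ‖ ≤ ‖ξ‖ := fun g ξ => by
    simpa using (smulOp P g).le_of_opNorm_le (norm_smulOp_le P g) ξ
  refine le_antisymm (h1 g ξ) ?_
  simpa only [smulOp_inv_apply hK] using h1 g⁻¹ (smulOp P g ξ)

/-- The unitary representation of the group. -/
def unitaryRep (hK : K.IsCAT0) (P : V) (G : Type*) [Group G] [MulAction G V] [K.CubicalAction G] :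
    G →* (K.OmegaL2 ≃ₗᵢ[ℂ] K.OmegaL2) where
  toFun g :=
    { toFun := smulOp P g
      map_add' := map_add _
      map_smul' := map_smul _
      invFun := smulOp P g⁻¹
      left_inv := smulOp_inv_apply hK P g
      right_inv := smulOp_apply_inv hK P g
      norm_map' := norm_smulOp_apply hK P g }
  map_one' := by
    ext1 ξ
    exact DFunLike.congr_fun (smulOp_one P) ξ
  map_mul' g h := by
    ext1 ξ
    exact DFunLike.congr_fun (smulOp_mul hK P g h) ξ

theorem unitaryRep_apply (hK : K.IsCAT0) (P : V) (g : G) (ξ : K.OmegaL2) :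
    unitaryRep hK P G g ξ = smulOp P g ξ := rfl

theorem inner_smulOp_left (hK : K.IsCAT0) (P : V) (g : G) (ξ η : K.OmegaL2) :
    inner ℂ (smulOp P g ξ) η = inner ℂ ξ (smulOp P g⁻¹ η) := by
  have := (unitaryRep hK P G g).inner_map_map ξ (smulOp P g⁻¹ η)
  rwa [unitaryRep_apply, unitaryRep_apply, smulOp_apply_inv hK] at this

theorem smulOp_grading {γ : K.OmegaL2 →L[ℂ] K.OmegaL2} (hγ : IsDegreeGrading γ) (P : V) (g : G)
    (ξ : K.OmegaL2) : smulOp P g (γ ξ) = γ (smulOp P g ξ) := by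
  refine DFunLike.congr_fun (f := (smulOp P g).comp γ) (g := γ.comp (smulOp P g))
    (ext_of_represents fun σ _ ξ hr => ?_) ξ
  have h1 := represents_smulForm P g (represents_gradeForm hγ hr)
  have h2 := represents_gradeForm hγ (represents_smulForm P g hr)
  exact h1.hasCoeff.unique h2.hasCoeff

/-- For a form supported on finitely many cubes, the elements fixing P and all vertices of these
cubes act trivially and form an open subgroup, so the orbit map is locally constant. Density and
unitarity carry continuity over to all vectors as a uniform limit. -/
theorem continuous_smulOp_apply [TopologicalSpace G] [IsTopologicalGroup G] (hK : K.IsCAT0) (P : V)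
    (hcont : ∀ v : V, IsOpen (MulAction.stabilizer G v : Set G)) (ξ : K.OmegaL2) :
    Continuous fun g : G => smulOp P g ξ := by
  have hΩ : ∀ σ ∈ K.Omega, ∀ ξ, Represents σ ξ → Continuous fun g : G => smulOp P g ξ := by
    intro σ hσ ξ hr
    let U : Set G := {g | g • P = P ∧ ∀ C ∈ hσ.2.toFinset, ∀ v ∈ C.finite.toFinset, g • v = v}
    have hU : IsOpen U := by
      have e : U = (MulAction.stabilizer G P : Set G) ∩ ⋂ C ∈ hσ.2.toFinset,
          ⋂ v ∈ C.finite.toFinset, (MulAction.stabilizer G v : Set G) := by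
        ext g; simp [U]
      rw [e]
      exact (hcont P).inter (isOpen_biInter_finset fun C _ => isOpen_biInter_finset fun v _ =>
        hcont v)
    have h1 : (1 : G) ∈ U := ⟨one_smul G P, fun _ _ v _ => one_smul G v⟩
    have h2 : ∀ k ∈ U, smulOp P k ξ = ξ := by
      intro k hk
      have h3 := represents_smulForm P k hr
      rw [smulForm_eq_self P hk.1 fun C hC v hv => hk.2 C (by simpa using hC) v (by simpa using hv)]
        at h3
      exact h3.hasCoeff.unique hr.hasCoeff
    refine IsLocallyConstant.continuous ((IsLocallyConstant.iff_eventually_eq _).2 fun g => ?_)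
    have h4 : ∀ᶠ k in 𝓝 g, g⁻¹ * k ∈ U := by
      have h5 : Filter.Tendsto (fun k => g⁻¹ * k) (𝓝 g) (𝓝 (g⁻¹ * g)) :=
        (continuous_const_mul g⁻¹).tendsto g
      rw [inv_mul_cancel] at h5
      exact h5 (hU.mem_nhds h1)
    filter_upwards [h4] with k hk
    have h6 := DFunLike.congr_fun (smulOp_mul hK P g (g⁻¹ * k)) ξ
    rw [mul_inv_cancel_left, ContinuousLinearMap.comp_apply, h2 _ hk] at h6
    exact h6
  refine continuous_of_uniform_approx_of_continuous fun u hu => ?_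
  obtain ⟨ε, hε, hu⟩ := Metric.mem_uniformity_dist.1 hu
  obtain ⟨η, ⟨σ, hσ, hr⟩, hη⟩ := Metric.mem_closure_iff.1 (dense_l2Subspace_Omega ξ) ε hε
  refine ⟨fun g => smulOp P g η, hΩ σ hσ η hr, fun g => hu ?_⟩
  rwa [dist_eq_norm, ← map_sub, norm_smulOp_apply hK, ← dist_eq_norm]

end Action

end CubeComplex

end

noncomputable section

open MeasureTheory

/-! ## Commutators with the group action -/

/-- Mean value inequality: the derivative of t e^{ty} in t is (1 + ty) e^{ty}, of modulus at most 1
for t ≥ 0 and y ≤ 0. -/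
theorem abs_mul_exp_sub_le {w w' y : ℝ} (hw : 0 ≤ w) (hw' : 0 ≤ w') (hy : y ≤ 0) :
    |w * Real.exp (w * y) - w' * Real.exp (w' * y)| ≤ |w - w'| := by
  have hd : ∀ t ∈ Set.Ici (0 : ℝ), HasDerivWithinAt (fun t => t * Real.exp (t * y))
      ((1 + t * y) * Real.exp (t * y)) (Set.Ici 0) t := by
    intro t _
    have h1 : HasDerivAt (fun t => t * Real.exp (t * y))
        (1 * Real.exp (t * y) + t * (Real.exp (t * y) * (1 * y))) t :=
      (hasDerivAt_id t).mul ((hasDerivAt_id t).mul_const y).exp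
    exact (h1.congr_deriv (by ring)).hasDerivWithinAt
  have hb : ∀ t ∈ Set.Ici (0 : ℝ), ‖(1 + t * y) * Real.exp (t * y)‖ ≤ 1 := by
    intro t ht
    have hz : t * y ≤ 0 := mul_nonpos_of_nonneg_of_nonpos ht hy
    have h1 : Real.exp (t * y) ≤ 1 := Real.exp_le_one_iff.2 hz
    have h2 := Real.exp_pos (t * y)
    have h3 := Real.add_one_le_exp (-(t * y))
    have h4 : Real.exp (-(t * y)) * Real.exp (t * y) = 1 := by
      rw [← Real.exp_add]; simp
    rw [Real.norm_eq_abs, abs_le]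
    constructor <;> nlinarith
  have := (convex_Ici (0 : ℝ)).norm_image_sub_le_of_norm_hasDerivWithin_le hd hb hw' hw
  simpa using this

namespace CubeComplex

variable {V : Type*} {K : CubeComplex V}

theorem wedge_compContinuousLinearMap {E F : Type*} [NormedAddCommGroup E] [NormedSpace ℝ E]
    [NormedAddCommGroup F] [NormedSpace ℝ F] {p : ℕ} (α : F →L[ℝ] ℝ) (β : F [⋀^Fin p]→L[ℝ] ℂ)
    (L : E →L[ℝ] F) : (wedge α β).compContinuousLinearMap L =
      wedge (α.comp L) (β.compContinuousLinearMap L) := by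
  ext v
  simp only [wedge, ContinuousAlternatingMap.compContinuousLinearMap_apply,
    ContinuousAlternatingMap.alternatizeUncurryFin_apply]
  rfl

theorem add_smul_form {F : Type*} [NormedAddCommGroup F] [NormedSpace ℝ F] {p : ℕ} (a b : ℝ)
    (β : F [⋀^Fin p]→L[ℝ] ℂ) : (a + b) • β = a • β + b • β := by
  ext v
  simp [add_mul]

theorem zero_smul_form {F : Type*} [NormedAddCommGroup F] [NormedSpace ℝ F] {p : ℕ}
    (β : F [⋀^Fin p]→L[ℝ] ℂ) : (0 : ℝ) • β = 0 := by
  ext v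
  simp

theorem wedge_smul_left {F : Type*} [NormedAddCommGroup F] [NormedSpace ℝ F] {p : ℕ} (c : ℝ)
    (α : F →L[ℝ] ℝ) (β : F [⋀^Fin p]→L[ℝ] ℂ) : wedge (c • α) β = c • wedge α β := by
  ext v
  simp only [wedge, ContinuousAlternatingMap.alternatizeUncurryFin_apply,
    ContinuousLinearMap.smulRight_apply, ContinuousAlternatingMap.smul_apply, smul_apply,
    Finset.smul_sum, smul_eq_mul, mul_smul]
  exact Finset.sum_congr rfl fun i _ => smul_comm _ _ _

theorem Represents.sub {σ τ : K.Form} {ξ η : K.OmegaL2} (h : Represents σ ξ)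
    (h' : Represents τ η) : Represents (σ - τ) (ξ - η) := by
  have e1 : σ - τ = σ + (-1 : ℂ) • τ := (sub_eq_add_neg σ τ).trans
    (congrArg (σ + ·) (neg_one_smul ℂ τ).symm)
  have e2 : ξ - η = ξ + (-1 : ℂ) • η := (sub_eq_add_neg ξ η).trans
    (congrArg (ξ + ·) (neg_one_smul ℂ η).symm)
  rw [e1, e2]
  exact h.add (h'.smul (-1))

theorem eGen_add (Q : V) (a b : ∀ D : K.Cube, D.Mid → D.E → ℝ) (σ : K.Form) :
    eGen Q (fun D H x => a D H x + b D H x) σ = eGen Q a σ + eGen Q b σ := by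
  funext D p x
  cases p with
  | zero => exact (add_zero _).symm
  | succ p =>
    simp only [eGen, Pi.add_apply, ← Finset.sum_add_distrib]
    refine Finset.sum_congr rfl fun C _ => Finset.sum_congr rfl fun H _ => ?_
    split_ifs
    · exact add_smul_form _ _ _
    · rw [add_zero]

/-- A hyperplane that does not separate P from Q has them on the same side, so the faces it
contributes are the same for both base vertices. -/
theorem eGen_congr_base (hK : K.IsCAT0) {P Q : V} {a : ∀ D : K.Cube, D.Mid → D.E → ℝ}
    (ha : ∀ D (H : D.Mid) x, H.1.Separates P Q → a D H x = 0) (σ : K.Form) :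
    eGen P a σ = eGen Q a σ := by
  classical
  funext D p x
  cases p with
  | zero => rfl
  | succ p =>
    simp only [eGen]
    refine Finset.sum_congr rfl fun C _ => Finset.sum_congr rfl fun H _ => ?_
    by_cases h : H.1.Separates P Q
    · rw [ha D H x h, zero_smul_form, ite_self, ite_self]
    · have e : H.1 ∈ C.1.SAH P ↔ H.1 ∈ C.1.SAH Q := by
        refine and_congr_right fun _ => forall₂_congr fun v _ => ?_
        have := separates_trans_iff hK H.1 v P Q
        tauto
      simp only [e]

theorem moveSign_of_fixed {G : Type*} [Group G] [MulAction G V] {P : V} {g : G} (hP : g • P = P) (H : K.Hyperplane) :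
    moveSign P g H = 1 := by
  rw [moveSign, hP, if_neg (not_separates_self H P)]

section Action

variable {G : Type*} [Group G] [MulAction G V] [K.CubicalAction G]

theorem alpha_comp_moveLin (P : V) (g : G) (C : K.Cube) (H : (C.translate g⁻¹).Mid) :
    (alpha H).comp (moveLin P g C) =
      moveSign P g (C.midEquiv g H).1 • alpha (C.midEquiv g H) := by
  ext y
  rfl

/-- The coefficients of the commutator of `d_w` and `g`. -/
def dDefect (w : K.Hyperplane → ℝ) (P : V) (g : G) (H : K.Hyperplane) : ℝ :=
  w H - moveSign P g H * w (H.translate g⁻¹)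

/-- Exterior derivatives commute with pullbacks, so only the zeroth order term of d_w produces a
defect; there dx_H on g⁻¹C is pulled back to ±dx_{gH} on C. -/
theorem dForm_smulForm (w : K.Hyperplane → ℝ) (P : V) (g : G) {σ : K.Form} (hσ : σ ∈ K.Omega) :
    dForm w (smulForm P g σ) = smulForm P g (dForm w σ) +
      wedgeForm (fun _ H => dDefect w P g H.1) (smulForm P g σ) := by
  funext C p x
  cases p with
  | zero =>
    refine ContinuousAlternatingMap.ext fun v => ?_
    simp [dForm, smulForm, wedgeForm]
  | succ p =>
    have h1 := extDeriv_pullback (r := 2) (f := move P g C) (x := x)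
      ((hσ.1 (C.translate g⁻¹) p).differentiable (by simp) (move P g C x))
      (contDiff_move P g C).contDiffAt (by rw [minSmoothness_of_isRCLikeNormedField])
    simp only [(hasFDerivAt_move P g C _).fderiv] at h1
    have h2 : ∀ H : (C.translate g⁻¹).Mid,
        ContinuousAlternatingMap.compContinuousLinearMapCLM (moveLin P g C)
          (w H.1 • wedge (alpha H) (σ (C.translate g⁻¹) p (move P g C x))) =
        (fun H : C.Mid => (moveSign P g H.1 * w (H.1.translate g⁻¹)) •
          wedge (alpha H) (smulForm P g σ C p x)) (C.midEquiv g H) := by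
      intro H
      rw [map_smul]
      refine (congrArg (w H.1 • ·) (wedge_compContinuousLinearMap _ _ _)).trans ?_
      rw [alpha_comp_moveLin, wedge_smul_left, smul_smul, mul_comm]
      have e : (C.midEquiv g H).1.translate g⁻¹ = H.1 :=
        Hyperplane.translate_inv_translate g H.1
      simp only [e]
      rfl
    have h3 : smulForm P g (dForm w σ) C (p + 1) x = extDeriv (smulForm P g σ C p) x +
        ∑ H : C.Mid, (moveSign P g H.1 * w (H.1.translate g⁻¹)) •
          wedge (alpha H) (smulForm P g σ C p x) := by
      have h4 : smulForm P g (dForm w σ) C (p + 1) x =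
          ContinuousAlternatingMap.compContinuousLinearMapCLM (moveLin P g C)
            (dForm w σ (C.translate g⁻¹) (p + 1) (move P g C x)) := rfl
      rw [h4, dForm, map_add, map_sum, Finset.sum_congr rfl fun H _ => h2 H]
      exact congrArg₂ (· + ·) h1.symm ((C.midEquiv g).sum_comp fun H : C.Mid =>
        (moveSign P g H.1 * w (H.1.translate g⁻¹)) • wedge (alpha H) (smulForm P g σ C p x))
    rw [Pi.add_apply, Pi.add_apply, Pi.add_apply, h3, dForm, wedgeForm, add_assoc,
      ← Finset.sum_add_distrib]
    congr 1
    refine Finset.sum_congr rfl fun H _ => ?_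
    refine Eq.trans ?_ (add_smul_form _ _ _)
    congr 1
    rw [dDefect]
    ring

/-- The faces of `D` and of `g⁻¹D`. -/
def Cube.facesEquiv (g : G) (D : K.Cube) :
    {C : K.Cube // C.1 ⊆ D.1} ≃ {C : K.Cube // C.1 ⊆ (D.translate g⁻¹).1} where
  toFun C := ⟨C.1.translate g⁻¹, Set.smul_set_mono C.2⟩
  invFun C := ⟨C.1.translate g, by
    have h : g • C.1.1 ⊆ g • (D.translate g⁻¹).1 := Set.smul_set_mono C.2
    have e : g • (D.translate g⁻¹).1 = D.1 := smul_inv_smul g D.1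
    rwa [e] at h⟩
  left_inv C := Subtype.ext (Cube.translate_translate_inv g C.1)
  right_inv C := Subtype.ext (Cube.translate_inv_translate g C.1)

/-- The coefficient functions of the conjugate of `eGen` by `g`. -/
def moveWeight (P : V) (g : G) (a : ∀ D : K.Cube, D.Mid → D.E → ℝ) (D : K.Cube) (H : D.Mid)
    (x : D.E) : ℝ :=
  moveSign P g H.1 * a (D.translate g⁻¹) ((D.midEquiv g).symm H) (move P g D x)

/-- The faces away from Q are carried by g to the faces away from gQ, so conjugation moves the base
vertex and transports the coefficient functions. -/
theorem smulForm_eGen (P Q : V) (g : G) (a : ∀ D : K.Cube, D.Mid → D.E → ℝ) (σ : K.Form) :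
    smulForm P g (eGen Q a σ) = eGen (g • Q) (moveWeight P g a) (smulForm P g σ) := by
  classical
  funext D p x
  cases p with
  | zero =>
    refine ContinuousAlternatingMap.ext fun v => ?_
    simp [eGen, smulForm]
  | succ p =>
    have h4 : smulForm P g (eGen Q a σ) D (p + 1) x =
        ContinuousAlternatingMap.compContinuousLinearMapCLM (moveLin P g D)
          (eGen Q a σ (D.translate g⁻¹) (p + 1) (move P g D x)) := rfl
    rw [h4, eGen, eGen, map_sum, ← (D.facesEquiv g).sum_comp]
    refine Finset.sum_congr rfl fun C _ => ?_
    rw [map_sum, ← (D.midEquiv g).sum_comp]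
    refine Finset.sum_congr rfl fun H _ => ?_
    have hc : ((D.facesEquiv g C).1.IsFacet (D.translate g⁻¹) ∧ H.1 ∈ (D.facesEquiv g C).1.SAH Q) ↔
        (C.1.IsFacet D ∧ (D.midEquiv g H).1 ∈ C.1.SAH (g • Q)) := by
      refine and_congr (Cube.isFacet_translate g⁻¹) ?_
      have := Cube.mem_SAH_translate g Q (C := C.1.translate g⁻¹) (H := H.1)
      rw [Cube.translate_translate_inv] at this
      exact this.symm
    by_cases h : C.1.IsFacet D ∧ (D.midEquiv g H).1 ∈ C.1.SAH (g • Q)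
    · rw [if_pos (hc.2 h), if_pos h, map_smul]
      refine (congrArg (_ • ·) (wedge_compContinuousLinearMap _ _ _)).trans ?_
      rw [alpha_comp_moveLin, wedge_smul_left, smul_smul, moveWeight, Equiv.symm_apply_apply,
        mul_comm]
      rfl
    · rw [if_neg (fun h' => h (hc.1 h')), if_neg h, map_zero]

/-- The weight of g⁻¹H is the distance from gP to H. If H does not separate P from gP, the defect is
a difference of the two distances, bounded uniformly by M. For the finitely many other hyperplanes
it is the sum of the distances, bounded by M'. -/
theorem exists_dForm_commutator (hK : K.IsCAT0) (hb : K.BoundedGeometry) (P : V) (g : G) :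
    ∃ T : K.OmegaL2 →L[ℂ] K.OmegaL2, ∀ σ ∈ K.Omega, ∀ ξ η, Represents σ ξ →
      Represents (dForm (distWeight P) σ) η →
      Represents (dForm (distWeight P) (smulForm P g σ)) (smulOp P g η + T (smulOp P g ξ)) := by
  classical
  obtain ⟨M, hM⟩ := exists_abs_distWeight_sub_le hK P (g • P)
  let F := (finite_separates hK P (g • P)).toFinset
  let M' := ∑ H ∈ F, (distWeight P H + distWeight (g • P) H)
  have h0 : ∀ H : K.Hyperplane, 0 ≤ distWeight P H + distWeight (g • P) H := fun H =>
    add_nonneg (distWeight_nonneg _ _) (distWeight_nonneg _ _)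
  have hb' : ∀ (D : K.Cube) (H : D.Mid), |dDefect (distWeight P) P g H.1| ≤ max M M' := by
    intro D H
    rw [dDefect, distWeight_translate_inv, moveSign]
    split_ifs with h
    · refine le_trans ?_ (le_max_right _ _)
      rw [neg_one_mul, sub_neg_eq_add, abs_of_nonneg (h0 _)]
      exact Finset.single_le_sum (f := fun H => distWeight P H + distWeight (g • P) H)
        (fun H _ => h0 H) ((Set.Finite.mem_toFinset _).2 h)
    · rw [one_mul]
      exact (hM H.1).trans (le_max_left _ _)
  obtain ⟨T, hT⟩ := exists_wedgeForm_operator hK hb P hb'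
  refine ⟨T, fun σ hσ ξ η hξ hη => ?_⟩
  rw [dForm_smulForm _ P g hσ]
  exact (represents_smulForm P g hη).add (hT _ _ (represents_smulForm P g hξ))

theorem continuous_moveWeight (w : K.Hyperplane → ℝ) (P : V) (g : G) (D : K.Cube) (H : D.Mid) :
    Continuous (moveWeight P g (eWeight w) D H) := by
  have h1 := continuous_eWeight w (D.translate g⁻¹) ((D.midEquiv g).symm H)
  exact continuous_const.mul (h1.comp (contDiff_move P g D (n := 0)).continuous)

theorem abs_eWeight_le {w : K.Hyperplane → ℝ} (hw : ∀ H, 0 ≤ w H) {D : K.Cube} (H : D.Mid) {x : D.E}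
    (hx : x ∈ D.box) : |eWeight w D H x| ≤ w H.1 := by
  have h1 : x H ≤ 1 := hx.2 H
  have h2 := hw H.1
  rw [eWeight, abs_of_nonneg (mul_nonneg h2 (Real.exp_pos _).le)]
  refine mul_le_of_le_one_right h2 (Real.exp_le_one_iff.2 ?_)
  exact mul_nonpos_of_nonneg_of_nonpos h2 (by linarith)

-- The coefficient functions of e_w and of its conjugate by g are split according to whether H
-- separates P from gP. On the nonseparating part the base vertices are interchangeable and the
-- difference is bounded by `abs_mul_exp_sub_le`; on the separating part only finitely many
-- hyperplanes occur and each operator is bounded by itself.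
open Classical in
theorem exists_eForm_commutator (hK : K.IsCAT0) (hb : K.BoundedGeometry) (P : V) (g : G) :
    ∃ T : K.OmegaL2 →L[ℂ] K.OmegaL2, ∀ (σ : K.Form) (ξ η), Represents σ ξ →
      Represents (eForm P (distWeight P) σ) η →
      Represents (eForm P (distWeight P) (smulForm P g σ)) (smulOp P g η + T (smulOp P g ξ)) := by
  obtain ⟨M, hM⟩ := exists_abs_distWeight_sub_le hK P (g • P)
  set Q := g • P with hQ
  let F := (finite_separates hK P Q).toFinset
  let w : K.Hyperplane → ℝ := distWeight P
  let k : ∀ D : K.Cube, D.Mid → D.E → ℝ := eWeight w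
  let b : ∀ D : K.Cube, D.Mid → D.E → ℝ := moveWeight P g (eWeight w)
  let sep : ∀ D : K.Cube, D.Mid → Prop := fun D H => H.1.Separates P Q
  let a₁ : ∀ D : K.Cube, D.Mid → D.E → ℝ := fun D H x => if sep D H then 0 else k D H x - b D H x
  let a₂ : ∀ D : K.Cube, D.Mid → D.E → ℝ := fun D H x => if sep D H then k D H x else 0
  let b₁ : ∀ D : K.Cube, D.Mid → D.E → ℝ := fun D H x => if sep D H then 0 else b D H x
  let b₂ : ∀ D : K.Cube, D.Mid → D.E → ℝ := fun D H x => if sep D H then b D H x else 0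
  have hk : ∀ D H, Continuous (k D H) := continuous_eWeight w
  have hbc : ∀ D H, Continuous (b D H) := continuous_moveWeight w P g
  have hw : ∀ H, 0 ≤ w H := distWeight_nonneg P
  have hmem : ∀ {D : K.Cube} {H : D.Mid}, sep D H → H.1 ∈ F := fun h =>
    (Set.Finite.mem_toFinset _).2 h
  have hbb : ∀ (D : K.Cube) (H : D.Mid), ∀ x ∈ D.box, |b D H x| ≤ distWeight Q H.1 := by
    intro D H x hx
    simp only [b, moveWeight]
    rw [abs_mul, abs_moveSign, one_mul, hQ, ← distWeight_translate_inv]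
    exact abs_eWeight_le hw _ (move_mem_box P g D hx)
  obtain ⟨T₁, h₁⟩ := exists_eGen_operator hK hb P (a := a₁) (M := max M 0) (fun D H => by
      by_cases h : sep D H
      · simp only [a₁, h, if_true]; exact continuous_const
      · simp only [a₁, h, if_false]; exact (hk D H).sub (hbc D H)) (fun D H x hx => by
      by_cases h : sep D H
      · simp only [a₁, h, if_true, abs_zero]; exact le_max_right _ _
      · simp only [a₁, h, if_false]
        refine le_trans ?_ ((hM H.1).trans (le_max_left _ _))
        have e : b D H x = distWeight Q H.1 * Real.exp (distWeight Q H.1 * (x H - 1)) := by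
          simp only [b, moveWeight, eWeight]
          have e1 : ((D.midEquiv g).symm H).1.translate g = H.1 :=
            Hyperplane.translate_translate_inv g H.1
          have e2 : w ((D.midEquiv g).symm H).1 = distWeight Q H.1 :=
            distWeight_translate_inv g P H.1
          rw [move_apply, e1, if_neg h, Equiv.apply_symm_apply, e2, moveSign, if_neg h, one_mul]
        rw [e]
        have h1 : x H ≤ 1 := hx.2 H
        exact abs_mul_exp_sub_le (hw _) (distWeight_nonneg _ _) (by linarith))
  obtain ⟨T₂, h₂⟩ := exists_eGen_operator hK hb P (a := a₂) (M := ∑ H ∈ F, w H) (fun D H => by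
      by_cases h : sep D H
      · simp only [a₂, h, if_true]; exact hk D H
      · simp only [a₂, h, if_false]; exact continuous_const) (fun D H x hx => by
      by_cases h : sep D H
      · simp only [a₂, h, if_true]
        exact (abs_eWeight_le hw H hx).trans
          (Finset.single_le_sum (f := w) (fun H _ => hw H) (hmem h))
      · simp only [a₂, h, if_false, abs_zero]; exact Finset.sum_nonneg fun H _ => hw H)
  obtain ⟨T₃, h₃⟩ := exists_eGen_operator hK hb Q (a := b₂) (M := ∑ H ∈ F, distWeight Q H)
    (fun D H => by
      by_cases h : sep D H
      · simp only [b₂, h, if_true]; exact hbc D H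
      · simp only [b₂, h, if_false]; exact continuous_const) (fun D H x hx => by
      by_cases h : sep D H
      · simp only [b₂, h, if_true]
        exact (hbb D H x hx).trans (Finset.single_le_sum (f := fun H => distWeight Q H)
          (fun H _ => distWeight_nonneg _ _) (hmem h))
      · simp only [b₂, h, if_false, abs_zero]
        exact Finset.sum_nonneg fun H _ => distWeight_nonneg _ _)
  refine ⟨T₁ + T₂ - T₃, fun σ ξ η hξ hη => ?_⟩
  have hτ := represents_smulForm P g hξ
  set τ := smulForm P g σ
  have e1 : eForm P w τ = eGen P a₁ τ + eGen P a₂ τ + eGen P b₁ τ := by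
    rw [eForm_eq_eGen, ← eGen_add, ← eGen_add]
    congr 1
    funext D H x
    simp only [a₁, a₂, b₁, k]
    split_ifs <;> ring
  have e2 : smulForm P g (eForm P w σ) = eGen Q b₁ τ + eGen Q b₂ τ := by
    rw [eForm_eq_eGen, smulForm_eGen, ← eGen_add]
    congr 1
    funext D H x
    simp only [b₁, b₂, b]
    split_ifs <;> ring
  have e3 : eGen P b₁ τ = eGen Q b₁ τ :=
    eGen_congr_base hK (fun D H x h => if_pos h) τ
  have e4 : eForm P w τ = smulForm P g (eForm P w σ) +
      (eGen P a₁ τ + eGen P a₂ τ - eGen Q b₂ τ) := by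
    rw [e1, e2, e3]; abel
  rw [show eForm P (distWeight P) τ = _ from e4]
  exact (represents_smulForm P g hη).add (((h₁ _ _ hτ).add (h₂ _ _ hτ)).sub (h₃ _ _ hτ))

/-- When gP = P no coordinate is reflected and the weights are g-invariant, so the defect is zero.
-/
theorem dForm_smulForm_of_fixed {P : V} {g : G} (hP : g • P = P) {σ : K.Form} (hσ : σ ∈ K.Omega) :
    dForm (distWeight P) (smulForm P g σ) = smulForm P g (dForm (distWeight P) σ) := by
  have h : wedgeForm (fun (D : K.Cube) H => dDefect (distWeight P) P g H.1) (smulForm P g σ) = 0 := by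
    funext D p x
    cases p with
    | zero => rfl
    | succ p =>
      refine Finset.sum_eq_zero fun H _ => ?_
      have e : dDefect (distWeight P) P g H.1 = 0 := by
        rw [dDefect, moveSign_of_fixed hP, distWeight_translate_inv, hP, one_mul, sub_self]
      simp only [e]
      exact zero_smul_form _
  rw [dForm_smulForm _ P g hσ, h, add_zero]

theorem eForm_smulForm_of_fixed {P : V} {g : G} (hP : g • P = P) (σ : K.Form) :
    eForm P (distWeight P) (smulForm P g σ) = smulForm P g (eForm P (distWeight P) σ) := by
  rw [eForm_eq_eGen, eForm_eq_eGen, smulForm_eGen, hP]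
  congr 1
  funext D H x
  have e1 : ((D.midEquiv g).symm H).1.translate g = H.1 :=
    Hyperplane.translate_translate_inv g H.1
  have e2 : distWeight P ((D.midEquiv g).symm H).1 = distWeight P H.1 := by
    refine (distWeight_translate_inv g P H.1).trans ?_
    rw [hP]
  rw [moveWeight, moveSign_of_fixed hP, one_mul, eWeight, eWeight, move_apply, e1, hP,
    if_neg (not_separates_self _ _), Equiv.apply_symm_apply, e2]

end Action

end CubeComplex

end

noncomputable section

open MeasureTheory

namespace CubeComplex

variable {V : Type*} {K : CubeComplex V}

section Action

variable {G : Type*} [Group G] [MulAction G V] [K.CubicalAction G]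

/-! ### The commutator of the de Rham operator with the group -/

/-- `T` is the defect of the equivariance of `d_w`. -/
def IsDCommutator (P : V) (w : K.Hyperplane → ℝ) (g : G) (T : K.OmegaL2 →L[ℂ] K.OmegaL2) : Prop :=
  ∀ σ ∈ K.Omega, ∀ ξ η, Represents σ ξ → Represents (dForm w σ) η →
    Represents (dForm w (smulForm P g σ)) (smulOp P g η + T (smulOp P g ξ))

/-- `T` is the defect of the equivariance of `e_w`. -/
def IsECommutator (P : V) (w : K.Hyperplane → ℝ) (g : G) (T : K.OmegaL2 →L[ℂ] K.OmegaL2) : Prop :=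
  ∀ (σ : K.Form) (ξ η), Represents σ ξ → Represents (eForm P w σ) η →
    Represents (eForm P w (smulForm P g σ)) (smulOp P g η + T (smulOp P g ξ))

theorem inner_smulOp_right (hK : K.IsCAT0) (P : V) (g : G) (ξ η : K.OmegaL2) :
    inner ℂ ξ (smulOp P g η) = inner ℂ (smulOp P g⁻¹ ξ) η := by
  rw [inner_smulOp_left hK, inv_inv]

/-- The two formal adjoints are handled by duality: their commutator with g is obtained from the
commutator of d_w and e_w with g⁻¹, which is why `Td'` and `Te'` enter through their adjoints. -/
theorem DeRhamParts.smul (hK : K.IsCAT0) {P : V} {w : K.Hyperplane → ℝ} {g : G}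
    {Td Te Td' Te' : K.OmegaL2 →L[ℂ] K.OmegaL2} (hd : IsDCommutator P w g Td)
    (he : IsECommutator P w g Te) (hd' : IsDCommutator P w g⁻¹ Td')
    (he' : IsECommutator P w g⁻¹ Te') {σ : K.Form} {ξ η₁ η₂ η₃ η₄ : K.OmegaL2}
    (h : DeRhamParts P w σ ξ η₁ η₂ η₃ η₄) :
    DeRhamParts P w (smulForm P g σ) (smulOp P g ξ) (smulOp P g η₁ + Td (smulOp P g ξ))
      (smulOp P g η₂ + Te (smulOp P g ξ)) (smulOp P g (η₃ - ContinuousLinearMap.adjoint Td' ξ))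
      (smulOp P g (η₄ - ContinuousLinearMap.adjoint Te' ξ)) where
  mem := smulForm_mem_Omega0 P g h.mem
  rep := represents_smulForm P g h.rep
  d := hd σ h.mem.1 ξ η₁ h.rep h.d
  e := he σ ξ η₂ h.rep h.e
  dStar := by
    obtain ⟨η', hη'⟩ := exists_hasCoeff_dStar w (smulForm_mem_Omega P g h.mem.1)
    have e : η' = smulOp P g (η₃ - ContinuousLinearMap.adjoint Td' ξ) := by
      refine dense_l2Subspace_Omega00.eq_of_inner_right ℂ fun θ hθ => ?_
      obtain ⟨τ, hτ, hr⟩ := hθ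
      have hτ0 := Omega00_le_Omega0 hτ
      obtain ⟨dθ, hdθ⟩ := exists_represents_dForm w hτ.1
      have h1 := inner_dForm w hτ0 (smulForm_mem_Omega P g h.mem.1) hr
        (represents_smulForm P g h.rep) hdθ hη'
      have h2 := inner_dForm w (smulForm_mem_Omega0 P g⁻¹ hτ0) h.mem.1
        (represents_smulForm P g⁻¹ hr) h.rep (hd' τ hτ.1 θ dθ hr hdθ) h.dStar
      rw [inner_smulOp_right hK] at h1
      rw [inner_add_left] at h2
      rw [inner_smulOp_right hK, inner_sub_right, ContinuousLinearMap.adjoint_inner_right, ← h1,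
        ← h2]
      ring
    exact e ▸ hη'
  eStar := by
    intro ρ hρ θ ζ hθ hζ
    have h2 := h.eStar _ (smulForm_mem_Omega P g⁻¹ hρ) _ _ (represents_smulForm P g⁻¹ hθ)
      (he' ρ θ ζ hθ hζ)
    rw [inner_add_left] at h2
    rw [inner_smulOp_right hK, inner_smulOp_right hK, inner_sub_right,
      ContinuousLinearMap.adjoint_inner_right, ← h2]
    ring

/-- `R` is the defect of the equivariance of the operator `D`. -/
def IsCommutator (P : V) (D : K.OmegaL2 →ₗ.[ℂ] K.OmegaL2) (g : G)
    (R : K.OmegaL2 →L[ℂ] K.OmegaL2) : Prop :=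
  ∀ ξ ζ, (ξ, ζ) ∈ D.graph → (smulOp P g ξ, smulOp P g ζ + R ξ) ∈ D.graph

theorem isCommutator_deRhamOp (hK : K.IsCAT0) (hb : K.BoundedGeometry) {P : V}
    {w : K.Hyperplane → ℝ} {g : G} {Td Te Td' Te' : K.OmegaL2 →L[ℂ] K.OmegaL2}
    (hd : IsDCommutator P w g Td) (he : IsECommutator P w g Te) (hd' : IsDCommutator P w g⁻¹ Td')
    (he' : IsECommutator P w g⁻¹ Te') :
    IsCommutator P (deRhamOp P w) g ((Td + Te).comp (smulOp P g) -
      (smulOp P g).comp (ContinuousLinearMap.adjoint Td' + ContinuousLinearMap.adjoint Te')) := by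
  intro ξ ζ h
  obtain ⟨σ, η₁, η₂, η₃, η₄, hp, rfl⟩ := exists_deRhamParts_of_mem_graph hK hb h
  have key := (hp.smul hK hd he hd' he').mem_graph hK hb
  have e : smulOp P g (η₁ + η₂ + η₃ + η₄) + ((Td + Te).comp (smulOp P g) - (smulOp P g).comp
      (ContinuousLinearMap.adjoint Td' + ContinuousLinearMap.adjoint Te')) ξ =
      smulOp P g η₁ + Td (smulOp P g ξ) + (smulOp P g η₂ + Te (smulOp P g ξ)) +
      smulOp P g (η₃ - ContinuousLinearMap.adjoint Td' ξ) +
      smulOp P g (η₄ - ContinuousLinearMap.adjoint Te' ξ) := by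
    have e1 : ((Td + Te).comp (smulOp P g) - (smulOp P g).comp
        (ContinuousLinearMap.adjoint Td' + ContinuousLinearMap.adjoint Te')) ξ =
        Td (smulOp P g ξ) + Te (smulOp P g ξ) - smulOp P g (ContinuousLinearMap.adjoint Td' ξ +
          ContinuousLinearMap.adjoint Te' ξ) := rfl
    rw [e1]
    simp only [map_add, map_sub]
    abel
  rw [e]
  exact key

theorem IsCommutator.closure {P : V} {D : K.OmegaL2 →ₗ.[ℂ] K.OmegaL2} (hc : D.IsClosable) {g : G}
    {R : K.OmegaL2 →L[ℂ] K.OmegaL2} (h : IsCommutator P D g R) : IsCommutator P D.closure g R := by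
  intro ξ ζ hξ
  let S : K.OmegaL2 × K.OmegaL2 →L[ℂ] K.OmegaL2 :=
    (smulOp P g).comp (ContinuousLinearMap.snd ℂ _ _) + R.comp (ContinuousLinearMap.fst ℂ _ _)
  exact LinearPMap.closure_graph_of_graph hc (smulOp P g) S (fun x y hxy => h x y hxy) hξ

theorem exists_isCommutator (hK : K.IsCAT0) (hb : K.BoundedGeometry) (P : V) (g : G) :
    ∃ R, IsCommutator P (deRhamOp (K := K) P (distWeight P)) g R := by
  obtain ⟨Td, hd⟩ := exists_dForm_commutator hK hb P g
  obtain ⟨Te, he⟩ := exists_eForm_commutator hK hb P g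
  obtain ⟨Td', hd'⟩ := exists_dForm_commutator hK hb P g⁻¹
  obtain ⟨Te', he'⟩ := exists_eForm_commutator hK hb P g⁻¹
  exact ⟨_, isCommutator_deRhamOp hK hb hd he hd' he'⟩

theorem isCommutator_of_fixed (hK : K.IsCAT0) (hb : K.BoundedGeometry) {P : V} {g : G}
    (hP : g • P = P) : IsCommutator P (deRhamOp (K := K) P (distWeight P)) g 0 := by
  have hd : ∀ {g : G}, g • P = P → IsDCommutator P (distWeight (K := K) P) g 0 := by
    intro g hP σ hσ ξ η _ hη
    rw [dForm_smulForm_of_fixed hP hσ, zero_apply, add_zero]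
    exact represents_smulForm P g hη
  have he : ∀ {g : G}, g • P = P → IsECommutator P (distWeight (K := K) P) g 0 := by
    intro g hP σ ξ η _ hη
    rw [eForm_smulForm_of_fixed hP, zero_apply, add_zero]
    exact represents_smulForm P g hη
  have hP' : g⁻¹ • P = P := inv_smul_eq_iff.2 hP.symm
  have h := isCommutator_deRhamOp hK hb (hd hP) (he hP) (hd hP') (he hP')
  rw [map_zero, add_zero, ContinuousLinearMap.comp_zero, ContinuousLinearMap.zero_comp, sub_zero] at h
  exact h

theorem IsCommutator.conj (hK : K.IsCAT0) {P : V} {D : K.OmegaL2 →ₗ.[ℂ] K.OmegaL2} {g : G}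
    {R : K.OmegaL2 →L[ℂ] K.OmegaL2} (h : IsCommutator P D g R) {ξ ζ : K.OmegaL2}
    (hξ : (smulOp P g⁻¹ ξ, ζ) ∈ D.graph) :
    (ξ, smulOp P g ζ + R (smulOp P g⁻¹ ξ)) ∈ D.graph := by
  have := h _ _ hξ
  rwa [smulOp_apply_inv hK] at this

/-- Both sides are the bounded extension of D minus its conjugate, by gk and by g respectively. As
k⁻¹ commutes with D, the two conjugates agree on the dense domain. -/
theorem IsCommutator.unique (hK : K.IsCAT0) {P : V} {D : K.OmegaL2 →ₗ.[ℂ] K.OmegaL2}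
    (hD : Dense (D.domain : Set K.OmegaL2)) {g k : G} {R R' S : K.OmegaL2 →L[ℂ] K.OmegaL2}
    (h : IsCommutator P D g R) (h' : IsCommutator P D (g * k) R') (hg : IsCommutator P D g⁻¹ S)
    (hk : IsCommutator P D k⁻¹ 0) :
    R'.comp (smulOp P (g * k)⁻¹) = R.comp (smulOp P g⁻¹) := by
  refine ContinuousLinearMap.coeFn_injective (Continuous.ext_on hD
    (ContinuousLinearMap.continuous _) (ContinuousLinearMap.continuous _) fun ξ hξ => ?_)
  have h1 := hg _ _ (D.mem_graph ⟨ξ, hξ⟩)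
  set ζ := smulOp P g⁻¹ (D ⟨ξ, hξ⟩) + S ξ
  have h2 := hk _ _ h1
  have e : smulOp P k⁻¹ (smulOp P g⁻¹ ξ) = smulOp P (g * k)⁻¹ ξ := by
    rw [mul_inv_rev, smulOp_mul hK]
    rfl
  have e' : smulOp P (g * k) (smulOp P k⁻¹ ζ) = smulOp P g ζ := by
    have := DFunLike.congr_fun (smulOp_mul hK P (g * k) k⁻¹) ζ
    rw [mul_inv_cancel_right] at this
    exact this.symm
  rw [zero_apply, add_zero] at h2
  simp only at h2
  rw [e] at h2
  have h3 := h'.conj hK h2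
  rw [e'] at h3
  exact add_left_cancel (LinearPMap.mem_graph_snd_inj _ h3 (h.conj hK h1) rfl)

end Action

end CubeComplex

end

/-! ### Assembly of the unbounded cycle -/

theorem mainTheorem5 {V : Type*} (K : CubeComplex V) (hcat : K.IsCAT0) (hbg : K.BoundedGeometry)
    (P : V) {G : Type*} [Group G] [TopologicalSpace G] [IsTopologicalGroup G]
    [LocallyCompactSpace G] [SecondCountableTopology G] [MulAction G V] [K.CubicalAction G]
    (hcont : ∀ v : V, IsOpen (MulAction.stabilizer G v : Set G)) :
    (CubeComplex.deRhamOp P (K := K) (CubeComplex.distWeight P)).domain =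
        CubeComplex.l2Subspace K.Omega0 ∧
      IsEssentiallySelfAdjoint (CubeComplex.deRhamOp P (K := K) (CubeComplex.distWeight P)) ∧
      ∃ (γ : K.OmegaL2 →L[ℂ] K.OmegaL2) (u : G →* (K.OmegaL2 ≃ₗᵢ[ℂ] K.OmegaL2)),
        CubeComplex.IsDegreeGrading γ ∧
        (∀ (g : G), ∀ σ ∈ K.Omega, ∀ ξ : K.OmegaL2, CubeComplex.Represents σ ξ →
          CubeComplex.Represents (CubeComplex.smulForm P g σ) (u g ξ)) ∧
        IsUnboundedCycle γ u
          (CubeComplex.deRhamOp P (K := K) (CubeComplex.distWeight P)).closure := by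
  have hw : ∀ H : K.Hyperplane, 0 ≤ CubeComplex.distWeight P H := CubeComplex.distWeight_nonneg P
  have hfin : ∀ R : ℝ, {H : K.Hyperplane | CubeComplex.distWeight P H ≤ R}.Finite :=
    CubeComplex.finite_distWeight_le hcat hbg P
  obtain ⟨hesa, hres⟩ := CubeComplex.essentiallySelfAdjoint_deRhamOp hcat P hbg hw hfin
  refine ⟨CubeComplex.domain_deRhamOp hcat hbg P _, hesa, K.gradingOp,
    CubeComplex.unitaryRep hcat P G, CubeComplex.isDegreeGrading_gradingOp,
    fun g σ _ ξ h => CubeComplex.represents_smulForm P g h, ?_⟩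
  set D₀ := CubeComplex.deRhamOp P (K := K) (CubeComplex.distWeight P)
  set D := D₀.closure
  have hγ := CubeComplex.isDegreeGrading_gradingOp (K := K)
  choose R hR using fun g : G => CubeComplex.exists_isCommutator hcat hbg P g
  have hR' : ∀ g, CubeComplex.IsCommutator P D g (R g) := fun g => (hR g).closure hesa.2.1
  have hdense : Dense (D.domain : Set K.OmegaL2) := hesa.1.mono D₀.le_closure.1
  have hinv : ∀ (g : G), ∀ ξ ∈ D.domain, CubeComplex.unitaryRep hcat P G g ξ ∈ D.domain :=
    fun g ξ hξ => LinearPMap.mem_domain_of_mem_graph (hR' g _ _ (D.mem_graph ⟨ξ, hξ⟩))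
  -- From D u(g) = u(g) D + R(g), substituting u(g)⁻¹ξ for the argument gives D - u(g) D u(g)⁻¹ =
  -- R(g) u(g)⁻¹.
  let B : G → K.OmegaL2 →L[ℂ] K.OmegaL2 := fun g => (R g).comp (CubeComplex.smulOp P g⁻¹)
  have hB : ∀ g k : G, k • P = P → B (g * k) = B g := by
    intro g k hk
    have hk' : k⁻¹ • P = P := inv_smul_eq_iff.2 hk.symm
    exact (hR' g).unique hcat hdense (hR' (g * k)) (hR' g⁻¹)
      ((CubeComplex.isCommutator_of_fixed hcat hbg hk').closure hesa.2.1)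
  -- B is constant on the left cosets of the stabilizer of P, which is open. Local constancy in
  -- operator norm gives both strong continuity and local boundedness.
  have hloc : ∀ g₀ : G, ∀ᶠ g in 𝓝 g₀, B g = B g₀ := by
    intro g₀
    have h1 : Filter.Tendsto (fun k => g₀⁻¹ * k) (𝓝 g₀) (𝓝 (g₀⁻¹ * g₀)) :=
      (continuous_const_mul g₀⁻¹).tendsto g₀
    rw [inv_mul_cancel] at h1
    filter_upwards [h1 ((hcont P).mem_nhds (one_mem _))] with g hg
    have := hB g₀ (g₀⁻¹ * g) hg
    rwa [mul_inv_cancel_left] at this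
  exact
    { separable := CubeComplex.separableSpace_OmegaL2 hcat P hbg hw hfin
      grading_selfAdjoint := hγ.isSelfAdjoint
      grading_sq := hγ.sq
      rep_even := CubeComplex.smulOp_grading hγ P
      rep_continuous := CubeComplex.continuous_smulOp_apply hcat P hcont
      selfAdjoint := hesa.2.2
      odd := fun ξ => by
        have h := CubeComplex.closure_deRhamOp_odd hcat hbg hesa.2.1 hγ (D.mem_graph ξ)
        have h1 := LinearPMap.mem_domain_of_mem_graph h
        exact ⟨h1, LinearPMap.mem_graph_snd_inj _ (D.mem_graph ⟨_, h1⟩) h rfl⟩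
      compactResolvent := hres
      domain_invariant := hinv
      bounded_difference := by
        refine ⟨B, fun g ξ => ?_, fun ξ => ?_, fun g₀ => ?_⟩
        · have h1 := (hR' g).conj hcat (ξ := ξ) (D.mem_graph ⟨_, hinv g⁻¹ ξ ξ.2⟩)
          have h2 := LinearPMap.mem_graph_snd_inj _ (D.mem_graph ξ) h1 rfl
          exact eq_sub_of_add_eq' h2.symm
        · exact IsLocallyConstant.continuous ((IsLocallyConstant.iff_eventually_eq _).2 fun g₀ =>
            (hloc g₀).mono fun g hg => by rw [hg])
        · exact ⟨_, hloc g₀, ‖B g₀‖, fun g hg => (congrArg norm hg).le⟩ }
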